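/- **Setting.** Let $\mathfrak g$ be a (finite-dimensional) complex simple Lie algebra with Killing form $\langle\cdot,\cdot\rangle$ and let $\mathsf G$ be its adjoint group (a complex simple Lie group acts on everything below through its adjoint group). Fix a Hitchin–Kostant quadruple $(\mathfrak h,\Delta^+,\rho,\lambda)$: $\mathfrak h$ is a Cartan subalgebra with root set $\Delta$, $\Delta^+$ is a system of positive roots, $\rho$ is an antilinear involutive automorphism of $\mathfrak g$ preserving $\mathfrak h$ with $-\langle u,\rho(u)\rangle>0$ for $u\neq0$, $\lambda$ is an antilinear involutive automorphism preserving $\mathfrak h$, commuting with $\rho$, whose fixed points form a split real form, and $\rho,\lambda$ preserve a common principal subalgebra $\mathfrak s\cong\mathfrak{sl}_2$ containing the half sum of the positive coroots, with $\rho=(-1)^{m+1}\lambda$ on $\mathfrak h\cap V$ for every irreducible $\mathfrak s$-submodule $V\subset\mathfrak g$ of dimension $2m+1$. Let $\mathsf T\subset\mathsf G$ be the group of elements that fix $\mathfrak h$ pointwise and commute with $\rho$ and $\lambda$, $\mathfrak t=\{u\in\mathfrak h:\rho(u)=\lambda(u)=u\}$ its Lie algebra, and $\mathsf X=\mathsf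 G/\mathsf T$, identified with the space of Hitchin–Kostant quadruples; at each $x\in\mathsf X$ we have conjugated objects $\mathfrak h,\mathfrak g_\alpha,\mathfrak t,\rho,\lambda$, and $T_x\mathsf X=\mathfrak g/\mathfrak t$. The Maurer–Cartan form $\omega$ is the $\mathfrak g$-valued one-form on $\mathsf X$ which at $x$ is the inverse of the projection $\mathfrak t^\perp\to\mathfrak g/\mathfrak t$, where $\mathfrak t^\perp$ is the orthogonal for the real part of the Killing form. On the trivial bundle $\mathcal G=\mathfrak g\times\mathsf X$ with trivial connection $\mathsf D$ put $\nabla=\mathsf D-\operatorname{ad}\omega$. Let $\Pi$ be the set of simple roots, $\eta$ the longest root, $Z^\dagger=\Pi\cup\{-\eta\}$, $Z=-Z^\dagger$, and decompose $\omega=\omega_0+\sum_{\alpha\in\Delta}\omega_\alpha$ along $\mathfrak h\oplus\bigoplus_\alpha\mathfrak g_\alpha$; let $\phi,\phi^\dagger,\omega_1$ be the sums of the $\omega_\alpha$ over $\alpha\in Z$, $\alpha\in Z^\dagger$, $\alpha\in\Delta\setminus(Z\cup Z^\dagger)$. The wedge product of $\mathfrak g$-valued forms uses the Lie bracket. A smooth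 map $f$ from a surface to $\mathsf X$ is *cyclic* if $f^*\omega_1=0$, $f^*\omega_0=0$, $f^*(\phi\wedge\phi)=0$, $f^*(\rho(\phi))=-f^*\phi^\dagger$, $f^*(\lambda(\omega))=f^*\omega$, and for every simple root $\beta$ and every nonzero tangent vector $u$, $(f^*\omega_\beta)(u)\neq0$. A smooth vector field $\xi$ along $f$ (a section of $f^*T\mathsf X$) is an *infinitesimal deformation of cyclic surfaces* if it is real, i.e. $\lambda(\omega(\xi))=\omega(\xi)$, and if for each $\Omega$ in the cyclic Pfaffian system $(\omega_0,\omega_1,\phi\wedge\phi,\phi+\rho(\phi^\dagger))$ one has, on the surface, $i_\xi d^\nabla\Omega=-d^\nabla(i_\xi\Omega)$. A *closed cyclic surface* is given by a closed surface $\Sigma$ of genus greater than $1$, with universal cover $\widetilde\Sigma$, a homomorphism $\delta:\pi_1(\Sigma)\to\mathsf G$ and a $\delta$-equivariant cyclic map $f:\widetilde\Sigma\to\mathsf X$. An *infinitesimal deformation of the closed cyclic surface* is an infinitesimal deformation $\xi$ of the cyclic surface $f$ which is $\delta$-equivariant: $\xi(\gamma s)=\delta(\gamma)_*\,\xi(s)$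 for all $\gamma\in\pi_1(\Sigma)$, $s\in\widetilde\Sigma$. **Proposition.** Let $\xi$ be an infinitesimal deformation of a closed cyclic surface. If there is a simple root $\alpha$ such that $\omega_\alpha(\xi)=0$ identically, then $\xi=0$. -/

import Mathlib

open scoped Manifold ContDiff Topology

namespace CyclicSurface

/-! ### The canonical topology of a finite-dimensional complex Lie algebra

All norms on a finite-dimensional space are equivalent; the coordinate norm of a basis is used. -/

section Norm

variable {L : Type*} [LieRing L] [LieAlgebra ℂ L] [Module.Finite ℂ L]

noncomputable instance (priority := 50) instNormedAddCommGroup : NormedAddCommGroup L :=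
  NormedAddCommGroup.induced L (Fin (Module.finrank ℂ L) → ℂ)
    (Module.finBasis ℂ L).equivFun (Module.finBasis ℂ L).equivFun.injective

noncomputable instance (priority := 50) instNormedSpace : NormedSpace ℂ L :=
  NormedSpace.induced ℂ L (Fin (Module.finrank ℂ L) → ℂ) (Module.finBasis ℂ L).equivFun

instance (priority := 50) instCompleteSpace : CompleteSpace L := FiniteDimensional.complete ℂ L

/-- `ad u` as a continuous linear map. -/
noncomputable def adL (u : L) : L →L[ℂ] L :=
  LinearMap.toContinuousLinearMap (LieAlgebra.ad ℂ L u : L →ₗ[ℂ] L)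

theorem exp_neg_exp (D : L →L[ℂ] L) (x : L) :
    NormedSpace.exp (-D) (NormedSpace.exp D x) = x := by
  let _ : NormedAlgebra ℚ (L →L[ℂ] L) := NormedAlgebra.restrictScalars ℚ ℂ (L →L[ℂ] L)
  have h : NormedSpace.exp (-D) * NormedSpace.exp D = 1 := by
    rw [← NormedSpace.exp_add_of_commute (Commute.refl D).neg_left]; simp
  exact DFunLike.congr_fun h x

/-- The linear automorphism `exp (ad u)` of `L`. -/
noncomputable def expAd (u : L) : L ≃ₗ[ℂ] L :=
  { ((NormedSpace.exp (adL u) : L →L[ℂ] L) : L →ₗ[ℂ] L) with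
    invFun := (NormedSpace.exp (-adL u) : L →L[ℂ] L)
    left_inv := fun x => exp_neg_exp (adL u) x
    right_inv := fun x => by simpa using exp_neg_exp (-adL u) x }

variable (L) in
/-- The adjoint group `G` of `L` (the connected group of inner automorphisms): the subgroup of
`GL(L)` generated by all `exp (ad u)`. -/
noncomputable def adjointGroup : Subgroup (L ≃ₗ[ℂ] L) := Subgroup.closure (Set.range expAd)

/-- `exp (ad u)` as an element of the adjoint group. -/
noncomputable def expG (u : L) : adjointGroup L :=
  ⟨expAd u, Subgroup.subset_closure ⟨u, rfl⟩⟩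

end Norm

/-! ### Cartan subalgebras with positive roots -/

section Roots

variable {L : Type*} [LieRing L] [LieAlgebra ℂ L]

/-- The roots of a Cartan subalgebra `h`, as functions on `h`. -/
def roots (h : LieSubalgebra ℂ L) [LieRing.IsNilpotent h] : Set (h → ℂ) :=
  {χ | χ ≠ 0 ∧ LieAlgebra.rootSpace h χ ≠ ⊥}

variable (L) in
/-- A Cartan subalgebra together with a system of positive roots. -/
structure PositiveSystem where
  /-- the Cartan subalgebra -/
  h : LieSubalgebra ℂ L
  cartan : h.IsCartanSubalgebra
  /-- the set of positive roots -/
  pos : Set (h → ℂ)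
  pos_subset : pos ⊆ roots h
  pos_or_neg : ∀ α ∈ roots h, α ∈ pos ∨ -α ∈ pos
  not_both : ∀ α ∈ pos, -α ∉ pos
  add_mem : ∀ α ∈ pos, ∀ β ∈ pos, α + β ∈ roots h → α + β ∈ pos

namespace PositiveSystem

instance instCartan (P : PositiveSystem L) : P.h.IsCartanSubalgebra := P.cartan

variable (P : PositiveSystem L)

/-- A simple root: a positive root which is not the sum of two positive roots. -/
def IsSimpleRoot (α : P.h → ℂ) : Prop :=
  α ∈ P.pos ∧ ∀ β ∈ P.pos, ∀ γ ∈ P.pos, α ≠ β + γ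

/-- The longest root: the positive root `η` such that `β + η` is not a root for any positive
root `β`. -/
def IsLongestRoot (η : P.h → ℂ) : Prop :=
  η ∈ P.pos ∧ ∀ β ∈ P.pos, β + η ∉ roots P.h

/-- The conjugate cyclic root set: the simple roots and the opposite of the longest root. -/
def Zdag : Set (P.h → ℂ) := {α | P.IsSimpleRoot α ∨ P.IsLongestRoot (-α)}

/-- The cyclic root set. -/
def Z : Set (P.h → ℂ) := {α | -α ∈ P.Zdag}

/-- The sum of the weight spaces of `L` with weights in `S`; the weight space of `0` is `h`. -/
def weightSum (S : Set (P.h → ℂ)) : Submodule ℂ L :=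
  ⨆ χ ∈ S, (LieAlgebra.rootSpace P.h χ).toSubmodule

theorem isCompl_weightSum [Module.Finite ℂ L] (S : Set (P.h → ℂ)) :
    IsCompl (P.weightSum S) (P.weightSum Sᶜ) := by
  have hi : iSupIndep fun χ : P.h → ℂ => (LieAlgebra.rootSpace P.h χ).toSubmodule :=
    LieSubmodule.iSupIndep_toSubmodule.mpr (LieModule.iSupIndep_genWeightSpace ℂ P.h L)
  have ht : ⨆ χ : P.h → ℂ, (LieAlgebra.rootSpace P.h χ).toSubmodule = ⊤ := by
    rw [← LieSubmodule.iSup_toSubmodule, LieModule.iSup_genWeightSpace_eq_top,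
      LieSubmodule.top_toSubmodule]
  refine ⟨hi.disjoint_biSup_biSup disjoint_compl_right, codisjoint_iff.mpr ?_⟩
  rw [eq_top_iff, ← ht, iSup_le_iff]
  intro χ
  by_cases hχ : χ ∈ S
  · exact le_sup_of_le_left (le_iSup₂_of_le χ hχ le_rfl)
  · exact le_sup_of_le_right (le_iSup₂_of_le χ hχ le_rfl)

/-- The projection of `L` onto the sum of the weight spaces with weights in `S`, along the sum of
the other ones. -/
noncomputable def proj [Module.Finite ℂ L] (S : Set (P.h → ℂ)) : L →ₗ[ℂ] L :=
  (P.weightSum S).projection (P.weightSum Sᶜ) (P.isCompl_weightSum S)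

/-- The vector of `h` which represents `α` with respect to the Killing form. -/
noncomputable def dualVec (α : P.h → ℂ) : L :=
  Classical.epsilon fun t : L => t ∈ P.h ∧ ∀ u : P.h, killingForm ℂ L t (u : L) = α u

/-- The coroot `h_α` of `α`: `⟨h_α, u⟩ = (2 / ⟨α, α⟩) α(u)`. -/
noncomputable def coroot (α : P.h → ℂ) : L :=
  (2 / killingForm ℂ L (P.dualVec α) (P.dualVec α)) • P.dualVec α

/-- The half sum `a` of the positive coroots. -/
noncomputable def halfSum : L := (1 / 2 : ℂ) • ∑ᶠ α ∈ P.pos, P.coroot α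

/-- `s` is an `h`-principal three-dimensional subalgebra: it is spanned by the half sum `a` of the
positive coroots and two vectors `X`, `Y` with `[a,X] = X`, `[a,Y] = -Y`, `[X,Y] = -a`. -/
def IsPrincipal (s : LieSubalgebra ℂ L) : Prop :=
  ∃ X Y : L, ⁅P.halfSum, X⁆ = X ∧ ⁅P.halfSum, Y⁆ = -Y ∧ ⁅X, Y⁆ = -P.halfSum ∧
    s.toSubmodule = Submodule.span ℂ {P.halfSum, X, Y}

end PositiveSystem

/-! ### Hitchin–Kostant quadruples -/

/-- An antilinear involutive automorphism of the Lie algebra `L`. -/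
structure IsConjugation (τ : L →ₗ⋆[ℂ] L) : Prop where
  involutive : ∀ u, τ (τ u) = u
  map_lie : ∀ u v, τ ⁅u, v⁆ = ⁅τ u, τ v⁆

/-- The fixed points of the conjugation `τ` form a split real form: some Cartan subalgebra `c` is
stable under `τ` and all its roots are real on the fixed points of `τ` in `c`. -/
def IsSplit (τ : L →ₗ⋆[ℂ] L) : Prop :=
  ∃ (c : LieSubalgebra ℂ L) (_ : c.IsCartanSubalgebra), (∀ v ∈ c, τ v ∈ c) ∧
    ∀ v : c, τ v = v → ∀ χ ∈ roots c, (χ v).im = 0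

variable (L) in
/-- A Hitchin–Kostant quadruple `(h, Δ⁺, ρ, lam)`. -/
structure HKQuadruple extends PositiveSystem L where
  /-- the compact conjugation -/
  ρ : L →ₗ⋆[ℂ] L
  /-- the split conjugation -/
  lam : L →ₗ⋆[ℂ] L
  ρ_conj : IsConjugation ρ
  lam_conj : IsConjugation lam
  ρ_h : ∀ u ∈ h, ρ u ∈ h
  lam_h : ∀ u ∈ h, lam u ∈ h
  /-- `ρ` is a Cartan involution: `-⟨u, ρ u⟩ > 0` for `u ≠ 0`. -/
  ρ_cartan : ∀ u, u ≠ 0 → (killingForm ℂ L u (ρ u)).re < 0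
  lam_split : IsSplit lam
  comm : ∀ u, ρ (lam u) = lam (ρ u)
  /-- Both conjugations preserve the same principal subalgebra `s`, and
  `ρ = (-1) ^ (m + 1) lam` on the intersection of `h` with any irreducible `s`-submodule
  of dimension `2 m + 1`. -/
  principal : ∃ s : LieSubalgebra ℂ L, toPositiveSystem.IsPrincipal s ∧
    (∀ u ∈ s, ρ u ∈ s) ∧ (∀ u ∈ s, lam u ∈ s) ∧
    ∀ V : LieSubmodule ℂ s L, LieModule.IsIrreducible ℂ s V →
      ∀ m : ℕ, Module.finrank ℂ V = 2 * m + 1 →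
        ∀ v ∈ V, v ∈ h → ρ v = (-1 : ℂ) ^ (m + 1) • lam v

end Roots

namespace HKQuadruple

variable {L : Type*} [LieRing L] [LieAlgebra ℂ L] [Module.Finite ℂ L] (Q : HKQuadruple L)

/-- The real subalgebra `t` of the vectors of `h` fixed by `ρ` and `lam`. -/
def t : Submodule ℝ L where
  carrier := {u | u ∈ Q.h ∧ Q.ρ u = u ∧ Q.lam u = u}
  zero_mem' := ⟨Q.h.zero_mem, map_zero _, map_zero _⟩
  add_mem' := fun {u v} hu hv => ⟨Q.h.add_mem hu.1 hv.1,
    by rw [map_add, hu.2.1, hv.2.1], by rw [map_add, hu.2.2, hv.2.2]⟩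
  smul_mem' := fun r u hu => by
    refine ⟨?_, ?_, ?_⟩
    · rw [← Complex.coe_smul r u]; exact Q.h.smul_mem _ hu.1
    · rw [← Complex.coe_smul r u, map_smulₛₗ, hu.2.1, Complex.conj_ofReal]
    · rw [← Complex.coe_smul r u, map_smulₛₗ, hu.2.2, Complex.conj_ofReal]

variable (L) in
/-- The real part of the Killing form. -/
noncomputable def reKilling : LinearMap.BilinForm ℝ L :=
  LinearMap.mk₂ ℝ (fun u v => (killingForm ℂ L u v).re)
    (fun u v w => by rw [map_add, LinearMap.add_apply, Complex.add_re])
    (fun r u v => by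
      rw [← Complex.coe_smul r u, map_smul, LinearMap.smul_apply, smul_eq_mul,
        Complex.re_ofReal_mul, smul_eq_mul])
    (fun u v w => by rw [map_add, Complex.add_re])
    (fun r u v => by
      rw [← Complex.coe_smul r v, map_smul, smul_eq_mul, Complex.re_ofReal_mul, smul_eq_mul])

/-- The orthogonal of `t` for the (real part of the) Killing form. -/
noncomputable def tPerp : Submodule ℝ L := LinearMap.BilinForm.orthogonal (reKilling L) Q.t

theorem isCompl_tPerp : IsCompl Q.t Q.tPerp := by
  have hs : (reKilling L).IsRefl := fun u v huv => by
    have h : killingForm ℂ L v u = killingForm ℂ L u v := LieModule.traceForm_comm ℂ L L v u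
    change (killingForm ℂ L v u).re = 0
    rw [h]; exact huv
  refine (LinearMap.BilinForm.isCompl_orthogonal_iff_disjoint hs).mpr ?_
  rw [Submodule.disjoint_def]
  intro u hu hu'
  by_contra h0
  have h1 := Q.ρ_cartan u h0
  rw [hu.2.1] at h1
  exact absurd (hu' u hu) (ne_of_lt h1)

/-- The torus `T`: the elements of `G` which fix `h` pointwise and commute with `ρ` and `lam`.
It is the stabiliser of the quadruple in the adjoint group `G`. -/
def T : Subgroup (adjointGroup L) where
  carrier := {g | (∀ u ∈ Q.h, g.1 u = u) ∧ (∀ u, g.1 (Q.ρ u) = Q.ρ (g.1 u)) ∧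
    ∀ u, g.1 (Q.lam u) = Q.lam (g.1 u)}
  one_mem' := ⟨fun _ _ => rfl, fun _ => rfl, fun _ => rfl⟩
  mul_mem' := fun {a b} ha hb =>
    ⟨fun u hu => by
        change a.1 (b.1 u) = u
        rw [hb.1 u hu, ha.1 u hu],
      fun u => by
        change a.1 (b.1 (Q.ρ u)) = Q.ρ (a.1 (b.1 u))
        rw [hb.2.1, ha.2.1],
      fun u => by
        change a.1 (b.1 (Q.lam u)) = Q.lam (a.1 (b.1 u))
        rw [hb.2.2, ha.2.2]⟩
  inv_mem' := fun {a} ha =>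
    ⟨fun u hu => by
        change a.1.symm u = u
        rw [LinearEquiv.symm_apply_eq, ha.1 u hu],
      fun u => by
        change a.1.symm (Q.ρ u) = Q.ρ (a.1.symm u)
        rw [LinearEquiv.symm_apply_eq, ha.2.1, LinearEquiv.apply_symm_apply],
      fun u => by
        change a.1.symm (Q.lam u) = Q.lam (a.1.symm u)
        rw [LinearEquiv.symm_apply_eq, ha.2.2, LinearEquiv.apply_symm_apply]⟩

/-- The space `X = G / T` of Hitchin–Kostant quadruples; `g T` stands for the conjugate by `g` of
the base quadruple `Q`. -/
abbrev X : Type _ := adjointGroup L ⧸ Q.T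

variable {Q}

/-- An element `g` of `G` which takes the base quadruple to `x`. -/
noncomputable def frame (x : Q.X) : L ≃ₗ[ℂ] L := (Quotient.out x : adjointGroup L).1

/-- The conjugate `g P g⁻¹` at `x = g T` of an operator `P` attached to the base quadruple. It is
used for operators `P` which commute with `T`, for which it does not depend on `g`. -/
noncomputable def at' (P : L → L) (x : Q.X) (v : L) : L := frame x (P ((frame x).symm v))

/-- The subspace `t` of the quadruple `x`. -/
noncomputable def tAt (x : Q.X) : Submodule ℝ L :=
  Q.t.map ((frame x).restrictScalars ℝ : L →ₗ[ℝ] L)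

/-- The tangent space `T_x X = L / t_x`. The class of `v` is the velocity at `s = 0` of the curve
`exp (s ad v) x`. -/
abbrev Tan (x : Q.X) : Type _ := L ⧸ tAt x

/-- The value at `x` of the vector field on `X` generated by `v`. -/
noncomputable def fund (v : L) (x : Q.X) : Tan x := (tAt x).mkQ v

/-- The isomorphism `L / t_x → L / t` induced by the inverse of the frame. -/
noncomputable def tanEquiv (x : Q.X) : Tan x ≃ₗ[ℝ] (L ⧸ Q.t) :=
  (Submodule.Quotient.equiv Q.t (tAt x) ((frame x).restrictScalars ℝ) rfl).symm

/-- The Maurer–Cartan form: the inverse of the projection of the orthogonal of `t_x` onto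
`T_x X = L / t_x`. -/
noncomputable def mc (x : Q.X) (p : Tan x) : L :=
  frame x (Submodule.quotientEquivOfIsCompl Q.t Q.tPerp Q.isCompl_tPerp (tanEquiv x p) : L)

/-- The conjugation `ρ` of the quadruple `x`. -/
noncomputable def rhoAt (x : Q.X) (v : L) : L := at' Q.ρ x v

/-- The conjugation `lam` of the quadruple `x`. -/
noncomputable def lamAt (x : Q.X) (v : L) : L := at' Q.lam x v

/-- The component of the Maurer–Cartan form with weights in `S`. -/
noncomputable def mcPart (S : Set (Q.h → ℂ)) (x : Q.X) (p : Tan x) : L :=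
  at' (Q.proj S) x (mc x p)

variable (Q)

/-- The component `ω_α` of the Maurer–Cartan form along the root space of `α`. -/
noncomputable def omegaRoot (α : Q.h → ℂ) (x : Q.X) (p : Tan x) : L := mcPart {α} x p

/-- The component `ω₀` along the Cartan subalgebra. -/
noncomputable def omega0 (x : Q.X) (p : Tan x) : L := mcPart (Q := Q) {0} x p

/-- The component `φ` along the roots in `Z`. -/
noncomputable def phi (x : Q.X) (p : Tan x) : L := mcPart Q.Z x p

/-- The component `φ†` along the roots in `Z†`. -/
noncomputable def phiDag (x : Q.X) (p : Tan x) : L := mcPart Q.Zdag x p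

/-- The component `ω₁` along the roots neither in `Z` nor in `Z†`. -/
noncomputable def omega1 (x : Q.X) (p : Tan x) : L := mcPart ({0} ∪ Q.Z ∪ Q.Zdag)ᶜ x p

/-- The two-form `φ ∧ φ`, for the wedge product of `L`-valued forms induced by the bracket. -/
noncomputable def phiPhi (x : Q.X) (p q : Tan x) : L :=
  ⁅Q.phi x p, Q.phi x q⁆ - ⁅Q.phi x q, Q.phi x p⁆

/-- The one-form `φ + ρ(φ†)`. -/
noncomputable def phiRho (x : Q.X) (p : Tan x) : L := Q.phi x p + rhoAt x (Q.phiDag x p)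

/-! ### Exterior covariant derivatives on `X`

Forms on `X` have values in the trivial bundle with fibre `L`; the connection is `∇ = D - ω`, where
`D` is the trivial connection. The exterior derivative is given by Cartan's formula on the vector
fields `fund v`, whose flows are `exp (s ad v)` and for which
`[fund u, fund v] = - fund [u, v]`. -/

variable {Q}

/-- The derivative of `H` at `x` along the vector field generated by `u`. -/
noncomputable def lieDer (u : L) (H : Q.X → L) (x : Q.X) : L :=
  deriv (fun s : ℝ => H (expG (s • u) • x)) 0

/-- `d^∇ Ω` for a one-form `Ω` on `X`. -/
noncomputable def dNabla₁ (Ω : ∀ x : Q.X, Tan x → L) (x : Q.X) (p q : Tan x) : L :=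
  let u := mc x p
  let v := mc x q
  lieDer u (fun y => Ω y (fund v y)) x - lieDer v (fun y => Ω y (fund u y)) x
    + Ω x (fund ⁅u, v⁆ x) - (⁅u, Ω x q⁆ - ⁅v, Ω x p⁆)

/-- `d^∇ Ω` for a two-form `Ω` on `X`. -/
noncomputable def dNabla₂ (Ω : ∀ x : Q.X, Tan x → Tan x → L) (x : Q.X) (p q r : Tan x) : L :=
  let u := mc x p
  let v := mc x q
  let w := mc x r
  lieDer u (fun y => Ω y (fund v y) (fund w y)) x
    - lieDer v (fun y => Ω y (fund u y) (fund w y)) x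
    + lieDer w (fun y => Ω y (fund u y) (fund v y)) x
    + Ω x (fund ⁅u, v⁆ x) r - Ω x (fund ⁅u, w⁆ x) q + Ω x (fund ⁅v, w⁆ x) p
    - (⁅u, Ω x q r⁆ - ⁅v, Ω x p r⁆ + ⁅w, Ω x p q⁆)

/-! ### Maps from a surface to `X` -/

variable {M : Type*} [TopologicalSpace M] [ChartedSpace (EuclideanSpace ℝ (Fin 2)) M]

/-- `g` is a lift of `f : M → G / T` to `G`, smooth near the point `m`. -/
def IsLift (f : M → Q.X) (m : M) (g : M → adjointGroup L) : Prop :=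
  (∀ᶠ m' in 𝓝 m, (QuotientGroup.mk (g m') : Q.X) = f m') ∧
    ∀ v : L, ContMDiffAt (𝓡 2) 𝓘(ℝ, L) ∞ (fun m' => (g m').1 v) m

/-- `f` is smooth: it has smooth local lifts to `G`. -/
def SmoothMap (f : M → Q.X) : Prop := ∀ m, ∃ g, IsLift f m g

/-- `p` is the image of `u` under the tangent map of `f`: if `g` is a smooth lift of `f` near `m`
and `dg(u) g⁻¹ = ad w`, then `p` is the class of `w`. -/
def IsTangent (f : M → Q.X) (m : M) (u : TangentSpace (𝓡 2) m) (p : Tan (f m)) : Prop :=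
  ∃ g, IsLift f m g ∧ ∃ w : L, p = fund w (f m) ∧
    ∀ v : L, mfderiv (𝓡 2) 𝓘(ℝ, L) (fun m' => (g m').1 v) m u = (⁅w, (g m).1 v⁆ : L)

/-- The tangent map of `f`. -/
noncomputable def tmap (f : M → Q.X) (m : M) (u : TangentSpace (𝓡 2) m) : Tan (f m) :=
  Classical.epsilon (IsTangent f m u)

/-- The covariant derivative, for the pull-back by `f` of `∇`, of an `L`-valued function. -/
noncomputable def nablaM (f : M → Q.X) (s : M → L) (m : M) (u : TangentSpace (𝓡 2) m) : L :=
  let du : L := mfderiv (𝓡 2) 𝓘(ℝ, L) s m u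
  du - ⁅mc (f m) (tmap f m u), s m⁆

/-- The exterior derivative of an `L`-valued one-form on `M`, computed in the chart at `m`. -/
noncomputable def dM (θ : ∀ m : M, TangentSpace (𝓡 2) m → L) (m : M)
    (u v : TangentSpace (𝓡 2) m) : L :=
  let c := extChartAt (𝓡 2) m
  let coeff := fun (w y : EuclideanSpace ℝ (Fin 2)) =>
    θ (c.symm y) (mfderiv 𝓘(ℝ, EuclideanSpace ℝ (Fin 2)) (𝓡 2) c.symm y w)
  let u' : EuclideanSpace ℝ (Fin 2) := mfderiv (𝓡 2) 𝓘(ℝ, EuclideanSpace ℝ (Fin 2)) c m u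
  let v' : EuclideanSpace ℝ (Fin 2) := mfderiv (𝓡 2) 𝓘(ℝ, EuclideanSpace ℝ (Fin 2)) c m v
  fderiv ℝ (coeff v') (c m) u' - fderiv ℝ (coeff u') (c m) v'

/-- The exterior covariant derivative, for the pull-back by `f` of `∇`, of a one-form on `M`. -/
noncomputable def dNablaM (f : M → Q.X) (θ : ∀ m : M, TangentSpace (𝓡 2) m → L) (m : M)
    (u v : TangentSpace (𝓡 2) m) : L :=
  dM θ m u v - (⁅mc (f m) (tmap f m u), θ m v⁆ - ⁅mc (f m) (tmap f m v), θ m u⁆)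

/-- Cyclic maps from a surface to `X`. That `ω_β` never vanishes for a simple root `β` means that
its pull-back is injective on each tangent plane. -/
structure IsCyclic (f : M → Q.X) : Prop where
  smooth : SmoothMap f
  omega1_eq : ∀ m u, Q.omega1 (f m) (tmap f m u) = 0
  omega0_eq : ∀ m u, Q.omega0 (f m) (tmap f m u) = 0
  phiPhi_eq : ∀ m u v, Q.phiPhi (f m) (tmap f m u) (tmap f m v) = 0
  rho_phi : ∀ m u, rhoAt (f m) (Q.phi (f m) (tmap f m u)) = -Q.phiDag (f m) (tmap f m u)
  omegaRoot_ne : ∀ β, Q.IsSimpleRoot β → ∀ m, ∀ u : TangentSpace (𝓡 2) m, u ≠ 0 →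
    Q.omegaRoot β (f m) (tmap f m u) ≠ 0
  real : ∀ m u, lamAt (f m) (mc (f m) (tmap f m u)) = mc (f m) (tmap f m u)

/-- `ξ` satisfies the equation `i_ξ d^∇ Ω = - d^∇ (i_ξ Ω)` along `f`, for a one-form `Ω`. -/
def IsVariation₁ (f : M → Q.X) (ξ : ∀ m, Tan (f m)) (Ω : ∀ x : Q.X, Tan x → L) : Prop :=
  ∀ m u, dNabla₁ Ω (f m) (ξ m) (tmap f m u) = -nablaM f (fun m' => Ω (f m') (ξ m')) m u

/-- `ξ` satisfies the equation `i_ξ d^∇ Ω = - d^∇ (i_ξ Ω)` along `f`, for a two-form `Ω`. -/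
def IsVariation₂ (f : M → Q.X) (ξ : ∀ m, Tan (f m)) (Ω : ∀ x : Q.X, Tan x → Tan x → L) : Prop :=
  ∀ m u v, dNabla₂ Ω (f m) (ξ m) (tmap f m u) (tmap f m v) =
    -dNablaM f (fun m' u' => Ω (f m') (ξ m') (tmap f m' u')) m u v

/-- The vector field `ξ` along `f` is an infinitesimal deformation of cyclic surfaces: it is
smooth, real, and an infinitesimal variation of the cyclic Pfaffian system
`(ω₀, ω₁, φ ∧ φ, φ + ρ(φ†))`. -/
structure IsInfDeformation (f : M → Q.X) (ξ : ∀ m, Tan (f m)) : Prop where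
  smooth : ContMDiff (𝓡 2) 𝓘(ℝ, L) ∞ fun m => mc (f m) (ξ m)
  real : ∀ m, lamAt (f m) (mc (f m) (ξ m)) = mc (f m) (ξ m)
  omega0_var : IsVariation₁ f ξ Q.omega0
  omega1_var : IsVariation₁ f ξ Q.omega1
  phiPhi_var : IsVariation₂ f ξ Q.phiPhi
  phiRho_var : IsVariation₁ f ξ Q.phiRho

end HKQuadruple

/-! ### Closed surfaces -/

/-- `Γ` acts on the surface `M` smoothly, freely, properly discontinuously and cocompactly: when `M`
is connected and simply connected, it is the universal cover of the closed surface `Γ \ M`, whose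
fundamental group is `Γ`. -/
structure IsDeckGroup (Γ M : Type*) [Group Γ] [TopologicalSpace M]
    [ChartedSpace (EuclideanSpace ℝ (Fin 2)) M] [MulAction Γ M] : Prop where
  smooth : ∀ γ : Γ, ContMDiff (𝓡 2) (𝓡 2) ∞ fun m : M => γ • m
  free : ∀ (γ : Γ) (m : M), γ • m = m → γ = 1
  proper : ProperlyDiscontinuousSMul Γ M
  cocompact : ∃ K : Set M, IsCompact K ∧ ∀ m : M, ∃ γ : Γ, γ • m ∈ K

/-- The genus of a closed oriented surface with fundamental group `Γ`: half the rank of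
`H₁ = Γ / [Γ, Γ]`. -/
noncomputable def genus (Γ : Type*) [Group Γ] : ℕ :=
  Module.finrank ℤ (Additive (Abelianization Γ)) / 2

end CyclicSurface

/-!
In a local frame `G : M → adjointGroup L` along a cyclic surface `f`, the derivative of `f` becomes
`φ - ρ φ`, where `φ` takes values in the sum of the root spaces of `Z`. These values commute, and
lie on a complex line. This line gives the surface a complex structure. The deformation `ξ` becomes
a function `ζ` whose covariant derivative is `η - ρ η` modulo `t`, with `η` valued in the same root
spaces and subject to the linearization of `⁅φ u, φ v⁆ = 0` (`exists_localModel`).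

The vanishing of `ζ` is proved for its parts in turn.

* The part `ζ + ρ ζ`, fixed by the compact involution. Its norm, the energy, satisfies a Bochner
  inequality (`curl_conjDeriv_le`), by which it is subharmonic. Since it is invariant under the deck
  group, which acts cocompactly, the strong maximum principle makes it constant
  (`exists_energy_eq`), and equality in the Bochner inequality then says that `ζ + ρ ζ` commutes
  with `φ` and `ρ φ`. Suppose that the component of the surface along the longest root vanishes at
  some point `p`. There `φ` is a principal nilpotent element, and a vector which commutes with it
  and with its conjugate, and has no component along `h`, is zero. Hence the energy vanishes at `p`,
  and so everywhere.
* The part outside `Z` and `Zdag`. As now `ρ ζ = -ζ`, the bracket of `ζ` with `φ - ρ φ` lies in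
  `h`, and the components of `ζ` outside `Z` and `Zdag` are parallel, so that their norm is
  constant. It vanishes at `p`, again because `φ` is principal nilpotent there.
* The part along `Z` and `Zdag`. It is `x - ρ x` with `x` valued in the root spaces of `Z` and
  commuting with `φ`. As the extended Dynkin diagram is connected, the commutant of `φ` in these
  root spaces is the line spanned by `φ` (`exists_eq_smul_of_lie_eq_zero`), so that `x = c φ`. The
  hypothesis `ω_α(ξ) = 0` gives `c = 0`.

These steps are assembled in `eq_zero_of_exists_zero`. There remains the existence of the point `p`
(`exists_longest_eq_zero`), where the genus matters. The longest root is a sum of simple roots, and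
this relation between the roots makes the product of the corresponding components of `φ` insensitive
to the connection: it is a holomorphic differential, of degree the Coxeter number. If the component
along the longest root never vanished, nor would this product, and a root of it would give local
flat coordinates, defined up to rotations and translations, hence a flat structure preserved by the
deck group (`exists_isFlatAt`, `isFlatStructure_of_atlas`). In place of the Gauss–Bonnet theorem, a
count of points excludes this. By cocompactness the flat charts develop to a map from the whole
plane onto the surface, and the points over an orbit of the deck group are separated. A disc of
radius `r` contains at most a multiple of `r ^ 2` of them, while three independent classes in the
first homology would give of the order of `r ^ 3`. So the first Betti number is at most two
(`finrank_abelianization_le`), against the assumption that the genus exceeds one.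
-/

set_option linter.unusedSectionVars false

namespace CyclicSurface

/-! ### Positive systems and bases of root systems -/

section Base

open Module IsAddIndecomposable

variable {ι M N : Type*} [Finite ι] [AddCommGroup M] [AddCommGroup N] [Module ℂ M] [Module ℂ N]
  (P : RootPairing ι ℂ M N) [P.IsCrystallographic]

/-- Reflecting a positive root in a positive root with which it makes an obtuse angle gives a
positive root, since the root string joining the two consists of positive roots. -/
theorem reflectionPerm_mem_pos {pos : Set ι}
    (hneg : ∀ i ∈ pos, P.reflectionPerm i i ∉ pos)
    (hadd : ∀ i ∈ pos, ∀ j ∈ pos, ∀ k, P.root k = P.root i + P.root j → k ∈ pos)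
    {i : ι} (hi : i ∈ pos) (n : ℕ) :
    ∀ j ∈ pos, P.pairingIn ℤ j i = -(n : ℤ) → P.reflectionPerm i j ∈ pos := by
  induction n using Nat.strong_induction_on with
  | _ n ih =>
    intro j hj hji
    have hp : P.pairing j i = ((-(n : ℤ) : ℤ) : ℂ) := by
      rw [← hji, ← P.algebraMap_pairingIn ℤ]; simp
    have hr : P.root (P.reflectionPerm i j) = P.root j + (n : ℂ) • P.root i := by
      rw [P.root_reflectionPerm, P.reflection_apply_root, hp]; push_cast; module
    rcases Nat.eq_zero_or_pos n with rfl | hn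
    · have : P.root (P.reflectionPerm i j) = P.root j := by simp [hr]
      rwa [P.root.injective this]
    have hne : P.root j ≠ -P.root i := by
      intro h
      have : j = P.reflectionPerm i i := P.root.injective (by
        rw [h, P.root_reflectionPerm, P.reflection_apply_self])
      exact hneg i hi (this ▸ hj)
    obtain ⟨k, hk⟩ := P.root_add_root_mem_of_pairingIn_neg (i := j) (j := i) (by omega) hne
    have hkpos := hadd j hj i hi k hk
    rcases Nat.lt_or_ge n 2 with h2 | h2
    · obtain rfl : n = 1 := by omega
      have : P.root (P.reflectionPerm i j) = P.root k := by rw [hr, hk]; simp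
      rwa [P.root.injective this]
    · have hki : P.pairingIn ℤ k i = -((n - 2 : ℕ) : ℤ) := by
        have h1 : P.pairing k i = P.pairing j i + 2 := by
          rw [← P.root_coroot_eq_pairing, hk, map_add, LinearMap.add_apply,
            P.root_coroot_eq_pairing, P.root_coroot_eq_pairing, P.pairing_same]
        have h2' : (algebraMap ℤ ℂ) (P.pairingIn ℤ k i) = algebraMap ℤ ℂ (-(n : ℤ) + 2) := by
          rw [P.algebraMap_pairingIn, h1, hp]; simp
        have := (algebraMap ℤ ℂ).injective_int h2'
        push_cast [h2]; omega
      have h3 := ih (n - 2) (by omega) k hkpos hki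
      refine hadd _ h3 i hi _ ?_
      rw [hr, P.root_reflectionPerm, hk, map_add, ← P.root_reflectionPerm, hr,
        P.reflection_apply_self]
      module

/-- A positive root has positive pairing with the sum of the positive coroots. -/
theorem sum_pairing_pos {pos : Set ι} [Fintype ι] [DecidablePred (· ∈ pos)]
    (hneg : ∀ i ∈ pos, P.reflectionPerm i i ∉ pos)
    (hadd : ∀ i ∈ pos, ∀ j ∈ pos, ∀ k, P.root k = P.root i + P.root j → k ∈ pos)
    {i : ι} (hi : i ∈ pos) :
    0 < ∑ j with j ∈ pos, P.pairingIn ℤ i j := by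
  classical
  set s := P.reflectionPerm i with hs
  have hss : ∀ j, s (s j) = j := fun j => P.reflectionPerm_self i j
  have hanti : ∀ j, P.pairingIn ℤ i (s j) = -P.pairingIn ℤ i j := by
    intro j
    apply (algebraMap ℤ ℂ).injective_int
    rw [map_neg, P.algebraMap_pairingIn, P.algebraMap_pairingIn]
    have := P.pairing_reflectionPerm i i j
    rw [← hs] at this
    rw [this, hs, P.pairing_reflectionPerm_self_left]
  rw [← Finset.sum_filter_add_sum_filter_not _ (fun j => s j ∈ pos)]
  have h0 : ∑ j ∈ Finset.univ.filter (· ∈ pos) with s j ∈ pos, P.pairingIn ℤ i j = 0 := by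
    have : ∑ j ∈ Finset.univ.filter (· ∈ pos) with s j ∈ pos, P.pairingIn ℤ i j =
        ∑ j ∈ Finset.univ.filter (· ∈ pos) with s j ∈ pos, -P.pairingIn ℤ i j := by
      refine Finset.sum_nbij' s s ?_ ?_ ?_ ?_ ?_
      · simp +contextual [hss]
      · simp +contextual [hss]
      · simp [hss]
      · simp [hss]
      · simp [hanti]
    rw [Finset.sum_neg_distrib] at this
    omega
  rw [h0, zero_add]
  refine Finset.sum_pos ?_ ⟨i, ?_⟩
  · intro j hj
    simp only [Finset.mem_filter, Finset.mem_univ, true_and] at hj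
    by_contra hle
    apply hj.2
    have hle' : P.pairingIn ℤ j i ≤ 0 := by
      by_contra h
      exact hle ((P.zero_lt_pairingIn_iff' (S := ℤ) (i := i) (j := j)).mpr (not_le.mp h))
    refine reflectionPerm_mem_pos P hneg hadd hi (-P.pairingIn ℤ j i).toNat j hj.1 ?_
    omega
  · simp only [Finset.mem_filter, Finset.mem_univ, true_and]
    exact ⟨hi, hneg i hi⟩

/-- A system of positive roots which is closed under addition comes from a base, which consists of
the indecomposable positive roots. -/
theorem exists_base_of_positive [P.IsRootSystem] [P.IsReduced] {pos : Set ι}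
    (hor : ∀ i, i ∈ pos ∨ P.reflectionPerm i i ∈ pos)
    (hneg : ∀ i ∈ pos, P.reflectionPerm i i ∉ pos)
    (hadd : ∀ i ∈ pos, ∀ j ∈ pos, ∀ k, P.root k = P.root i + P.root j → k ∈ pos) :
    ∃ b : P.Base, (∀ i, i ∈ b.support ↔
        i ∈ pos ∧ ∀ j ∈ pos, ∀ k ∈ pos, P.root i ≠ P.root j + P.root k) ∧
      ∀ i ∈ pos, P.root i ∈ AddSubmonoid.closure (P.root '' b.support) := by
  classical
  let _ := P.indexNeg
  have : Fintype ι := Fintype.ofFinite ι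
  -- the sum of the positive coroots, made rational by a `ℚ`-linear retraction `ℂ → ℚ`
  obtain ⟨π, hπ⟩ := LinearMap.exists_leftInverse_of_injective (Algebra.linearMap ℚ ℂ)
    (LinearMap.ker_eq_bot.mpr (algebraMap ℚ ℂ).injective)
  let T : N := ∑ j with j ∈ pos, P.coroot j
  let f : M →+ ℚ := π.toAddMonoidHom.comp (P.toLinearMap.flip T).toAddMonoidHom
  have hf : ∀ i, f (P.root i) = ((∑ j with j ∈ pos, P.pairingIn ℤ i j : ℤ) : ℚ) := by
    intro i
    have h1 : P.toLinearMap.flip T (P.root i) =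
        Algebra.linearMap ℚ ℂ ((∑ j with j ∈ pos, P.pairingIn ℤ i j : ℤ) : ℚ) := by
      have h2 : ∀ j, ((P.pairingIn ℤ i j : ℤ) : ℂ) = P.pairing i j := fun j => by
        simpa using P.algebraMap_pairingIn ℤ i j
      simp [T, h2]
    change π (P.toLinearMap.flip T (P.root i)) = _
    rw [h1, ← LinearMap.comp_apply, hπ, LinearMap.id_apply]
  have hfpos : ∀ i ∈ pos, 0 < f (P.root i) := by
    intro i hi
    rw [hf]; exact_mod_cast sum_pairing_pos P hneg hadd hi
  have hfiff : ∀ i, 0 < f (P.root i) ↔ i ∈ pos := by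
    refine fun i => ⟨fun h => ?_, hfpos i⟩
    by_contra hi
    have h1 := hfpos _ ((hor i).resolve_left hi)
    rw [P.root_reflectionPerm, P.reflection_apply_self, map_neg] at h1
    linarith
  have hf0 : ∀ i, f (P.root i) ≠ 0 := by
    intro i h
    rcases hor i with hi | hi
    · exact (hfpos i hi).ne' h
    · have h1 := hfpos _ hi
      rw [P.root_reflectionPerm, P.reflection_apply_self, map_neg, h] at h1
      simp at h1
  refine ⟨RootPairing.Base.mk' P (baseOf P.root f) (P.linearIndepOn_root_baseOf f hf0)
    (fun i ↦ mem_or_neg_mem_closure_baseOf P.root f i (hf0 i) (by simp)), ?_, ?_⟩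
  · intro i
    have : {i | 0 < f (P.root i)} = pos := Set.ext hfiff
    simp [RootPairing.Base.mk', baseOf, this, P.ne_zero]
  · intro i hi
    have h1 := AddSubmonoid.closure_image_isAddIndecomposable_baseOf P.root f
    have h2 : ((RootPairing.Base.mk' P (baseOf P.root f) (P.linearIndepOn_root_baseOf f hf0)
      (fun i ↦ mem_or_neg_mem_closure_baseOf P.root f i (hf0 i) (by simp))).support : Set ι) =
        baseOf P.root f := by simp [RootPairing.Base.mk']
    rw [h2, h1]
    exact AddSubmonoid.subset_closure ⟨i, hfpos i hi, rfl⟩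

end Base

/-! ### Projections onto sums of weight spaces -/

namespace PositiveSystem

open LieAlgebra

section Proj

variable {L : Type*} [LieRing L] [LieAlgebra ℂ L] (P : PositiveSystem L)

theorem rootSpace_le_weightSum {S : Set (P.h → ℂ)} {χ : P.h → ℂ}
    (h : (rootSpace P.h χ).toSubmodule ≠ ⊥ → χ ∈ S) :
    (rootSpace P.h χ).toSubmodule ≤ P.weightSum S := by
  by_cases h0 : (rootSpace P.h χ).toSubmodule = ⊥
  · rw [h0]; exact bot_le
  · exact le_iSup₂_of_le χ (h h0) le_rfl

theorem mem_weightSum_of_mem {S : Set (P.h → ℂ)} {χ : P.h → ℂ} {x : L} (hx : x ∈ rootSpace P.h χ)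
    (h : χ ∈ S) : x ∈ P.weightSum S :=
  P.rootSpace_le_weightSum (fun _ => h) hx

theorem weightSum_mono {S T : Set (P.h → ℂ)} (h : S ⊆ T) : P.weightSum S ≤ P.weightSum T :=
  biSup_mono fun _ hχ => h hχ

theorem weightSum_singleton (χ : P.h → ℂ) :
    P.weightSum {χ} = (rootSpace P.h χ).toSubmodule := by
  simp [weightSum]

theorem mem_weightSum_singleton {χ : P.h → ℂ} {x : L} :
    x ∈ P.weightSum {χ} ↔ x ∈ rootSpace P.h χ := by
  rw [weightSum_singleton]; rfl

/-- To prove that an additive condition holds on a sum of weight spaces it is enough to consider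
each weight space. -/
theorem weightSum_induction {S : Set (P.h → ℂ)} {p : L → Prop} {x : L} (hx : x ∈ P.weightSum S)
    (h0 : p 0) (hadd : ∀ x y, p x → p y → p (x + y))
    (h : ∀ χ ∈ S, ∀ x ∈ rootSpace P.h χ, p x) : p x := by
  rw [weightSum, iSup_subtype'] at hx
  refine Submodule.iSup_induction _ (motive := p) hx ?_ h0 hadd
  rintro ⟨χ, hχ⟩ x hx
  exact h χ hχ x hx

theorem lie_mem_weightSum {A B C : Set (P.h → ℂ)}
    (hC : ∀ a ∈ A, ∀ b ∈ B, (rootSpace P.h (a + b)).toSubmodule ≠ ⊥ → a + b ∈ C) {x y : L}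
    (hx : x ∈ P.weightSum A) (hy : y ∈ P.weightSum B) : ⁅x, y⁆ ∈ P.weightSum C := by
  refine P.weightSum_induction (p := fun x => ⁅x, y⁆ ∈ P.weightSum C) hx (by simp)
    (fun x x' h h' => by rw [add_lie]; exact Submodule.add_mem _ h h') fun a ha x hxa => ?_
  refine P.weightSum_induction (p := fun y => ⁅x, y⁆ ∈ P.weightSum C) hy (by simp)
    (fun y y' h h' => by rw [lie_add]; exact Submodule.add_mem _ h h') fun b hb y hyb => ?_
  exact P.rootSpace_le_weightSum (hC a ha b hb) (lie_mem_genWeightSpace_of_mem_genWeightSpace hxa hyb)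

variable [Module.Finite ℂ L]

theorem mem_h_iff {x : L} : x ∈ P.h ↔ x ∈ rootSpace P.h (0 : P.h → ℂ) := by
  rw [rootSpace_zero_eq]; rfl

theorem mem_h_iff_weightSum {x : L} : x ∈ P.h ↔ x ∈ P.weightSum {0} := by
  rw [mem_weightSum_singleton, mem_h_iff]

theorem proj_mem (S : Set (P.h → ℂ)) (x : L) : P.proj S x ∈ P.weightSum S :=
  Submodule.projection_apply_mem _ x

theorem proj_of_mem {S : Set (P.h → ℂ)} {x : L} (hx : x ∈ P.weightSum S) : P.proj S x = x :=
  Submodule.projection_apply_left (P.isCompl_weightSum S) ⟨x, hx⟩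

theorem proj_of_disjoint {S T : Set (P.h → ℂ)} (h : Disjoint S T) {x : L}
    (hx : x ∈ P.weightSum T) : P.proj S x = 0 :=
  (Submodule.projection_apply_eq_zero_iff (P.isCompl_weightSum S)).mpr
    (P.weightSum_mono (Set.subset_compl_iff_disjoint_left.mpr h) hx)

theorem proj_add_compl (S : Set (P.h → ℂ)) (x : L) : P.proj S x + P.proj Sᶜ x = x := by
  obtain ⟨y, hy, z, hz, rfl⟩ : ∃ y ∈ P.weightSum S, ∃ z ∈ P.weightSum Sᶜ, y + z = x :=
    Submodule.mem_sup.mp ((P.isCompl_weightSum S).sup_eq_top ▸ Submodule.mem_top)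
  rw [map_add, map_add, P.proj_of_mem hy, P.proj_of_mem hz,
    P.proj_of_disjoint disjoint_compl_right hz, P.proj_of_disjoint disjoint_compl_left hy]
  simp

theorem mem_weightSum_of_proj_compl {S : Set (P.h → ℂ)} {x : L} (h : P.proj Sᶜ x = 0) :
    x ∈ P.weightSum S := by
  rw [← P.proj_add_compl S x, h, add_zero]; exact P.proj_mem S x

/-- To compare two additive maps it is enough to do so on each weight space. -/
theorem eq_of_forall_rootSpace {V : Type*} [AddCommGroup V] {f g : L →+ V}
    (h : ∀ χ, ∀ x ∈ rootSpace P.h χ, f x = g x) (x : L) : f x = g x := by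
  have hx : x ∈ P.weightSum Set.univ := by
    rw [← P.proj_add_compl Set.univ x]
    refine Submodule.add_mem _ (P.proj_mem _ x) ?_
    have := P.proj_mem Set.univᶜ x
    rw [Set.compl_univ] at this ⊢
    exact P.weightSum_mono (Set.empty_subset _) this
  exact P.weightSum_induction (p := fun x => f x = g x) hx (by simp)
    (fun x y hx hy => by rw [map_add, map_add, hx, hy]) fun χ _ x hx => h χ x hx

open Classical in
theorem proj_of_mem_rootSpace (S : Set (P.h → ℂ)) {χ : P.h → ℂ} {x : L}
    (hx : x ∈ rootSpace P.h χ) : P.proj S x = if χ ∈ S then x else 0 := by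
  split_ifs with h
  · exact P.proj_of_mem (P.mem_weightSum_of_mem hx h)
  · exact P.proj_of_disjoint (T := {χ}) (by simpa using h) (P.mem_weightSum_singleton.mpr hx)

/-- An additive map which permutes the weight spaces intertwines the projections. -/
theorem map_proj_of_forall {f : L →+ L} {S T : Set (P.h → ℂ)} (σ : (P.h → ℂ) → (P.h → ℂ))
    (hf : ∀ χ, ∀ x ∈ rootSpace P.h χ, f x ∈ rootSpace P.h (σ χ)) (hσ : ∀ χ, σ χ ∈ T ↔ χ ∈ S)
    (x : L) : f (P.proj S x) = P.proj T (f x) := by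
  refine P.eq_of_forall_rootSpace (f := f.comp (P.proj S).toAddMonoidHom)
    (g := (P.proj T).toAddMonoidHom.comp f) (fun χ x hx => ?_) x
  change f (P.proj S x) = P.proj T (f x)
  rw [P.proj_of_mem_rootSpace S hx, P.proj_of_mem_rootSpace T (hf χ x hx)]
  by_cases h : χ ∈ S <;> simp [h, hσ]

theorem proj_proj (S T : Set (P.h → ℂ)) (x : L) : P.proj S (P.proj T x) = P.proj (S ∩ T) x := by
  refine P.eq_of_forall_rootSpace (f := ((P.proj S).comp (P.proj T)).toAddMonoidHom)
    (g := (P.proj (S ∩ T)).toAddMonoidHom) (fun χ x hx => ?_) x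
  change P.proj S (P.proj T x) = P.proj (S ∩ T) x
  rw [P.proj_of_mem_rootSpace T hx, P.proj_of_mem_rootSpace (S ∩ T) hx]
  by_cases h : χ ∈ T <;> by_cases h' : χ ∈ S <;> simp [h, h', P.proj_of_mem_rootSpace S hx]

theorem proj_union {S T : Set (P.h → ℂ)} (h : Disjoint S T) (x : L) :
    P.proj (S ∪ T) x = P.proj S x + P.proj T x := by
  refine P.eq_of_forall_rootSpace (f := (P.proj (S ∪ T)).toAddMonoidHom)
    (g := (P.proj S + P.proj T).toAddMonoidHom) (fun χ x hx => ?_) x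
  change P.proj (S ∪ T) x = P.proj S x + P.proj T x
  simp only [P.proj_of_mem_rootSpace _ hx]
  have h3 : χ ∈ S → χ ∉ T := fun h' => Set.disjoint_left.mp h h'
  by_cases h1 : χ ∈ S <;> by_cases h2 : χ ∈ T <;> simp_all

open Classical in
theorem eq_zero_of_forall_proj {x : L} (h : ∀ χ, P.proj {χ} x = 0) : x = 0 := by
  by_contra hx
  obtain ⟨χ, hχ⟩ : ∃ χ, P.proj {χ} x ≠ 0 := by
    by_contra! h'
    have hfin : {χ : P.h → ℂ | (rootSpace P.h χ) ≠ ⊥}.Finite :=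
      LieModule.finite_genWeightSpace_ne_bot ℂ P.h L
    have key : ∀ s : Finset (P.h → ℂ), ∀ S : Set (P.h → ℂ), S ⊆ s → P.proj S x = 0 := by
      intro s
      induction s using Finset.induction_on with
      | empty =>
        intro S hS
        obtain rfl : S = ∅ := by simpa using hS
        simpa [weightSum] using P.proj_mem ∅ x
      | insert a s _ ih =>
        intro S hS
        have h1 : S = (S ∩ {a}) ∪ (S \ {a}) := by simp
        rw [h1, P.proj_union (Set.disjoint_sdiff_right.mono_left Set.inter_subset_right),
          ← P.proj_proj, h, map_zero, zero_add]
        refine ih _ fun y hy => ?_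
        have := hS hy.1
        simp only [Finset.coe_insert, Set.mem_insert_iff] at this
        exact this.resolve_left hy.2
    have h1 := key hfin.toFinset {χ | (rootSpace P.h χ) ≠ ⊥} (by simp)
    apply hx
    rw [← P.proj_add_compl {χ | (rootSpace P.h χ) ≠ ⊥} x, h1, zero_add]
    have h2 := P.proj_mem {χ | (rootSpace P.h χ) ≠ ⊥}ᶜ x
    have h3 : P.weightSum {χ | (rootSpace P.h χ) ≠ ⊥}ᶜ = ⊥ := by
      rw [weightSum, eq_bot_iff]
      refine iSup₂_le fun χ hχ => ?_
      have : rootSpace P.h χ = ⊥ := by simpa using hχ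
      rw [this]; simp
    rw [h3] at h2
    simpa using h2
  exact hχ (h χ)

/-- The bracket with an element whose weights shift the set `S` into `T` and its complement into
the complement of `T` intertwines the projections. -/
theorem proj_lie {A S T : Set (P.h → ℂ)} (hS : ∀ a ∈ A, ∀ b, a + b ∈ T ↔ b ∈ S) {x : L}
    (hx : x ∈ P.weightSum A) (y : L) : P.proj T ⁅x, y⁆ = ⁅x, P.proj S y⁆ := by
  conv_lhs => rw [← P.proj_add_compl S y, lie_add, map_add]
  rw [P.proj_of_mem (P.lie_mem_weightSum (fun a ha b hb _ => (hS a ha b).mpr hb) hx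
    (P.proj_mem S y)), P.proj_of_disjoint (T := Tᶜ) disjoint_compl_right
    (P.lie_mem_weightSum (fun a ha b hb _ => ?_) hx (P.proj_mem Sᶜ y)), add_zero]
  exact fun h => hb ((hS a ha b).mp h)

theorem proj_lie_h {x : L} (hx : x ∈ P.h) (S : Set (P.h → ℂ)) (y : L) :
    P.proj S ⁅x, y⁆ = ⁅x, P.proj S y⁆ :=
  P.proj_lie (A := {0}) (by simp) (P.mem_h_iff_weightSum.mp hx) y

end Proj

end PositiveSystem

/-! ### Simple roots and longest roots -/

namespace PositiveSystem

open LieAlgebra LieAlgebra.IsKilling LieModule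

variable {L : Type*} [LieRing L] [LieAlgebra ℂ L] [Module.Finite ℂ L] [IsKilling ℂ L]
  (P : PositiveSystem L)

omit [IsKilling ℂ L] in
theorem mem_roots_iff {χ : P.h → ℂ} :
    χ ∈ roots P.h ↔ ∃ i : P.h.root, ((i : Weight ℂ P.h L) : P.h → ℂ) = χ := by
  constructor
  · rintro ⟨h0, h1⟩
    refine ⟨⟨⟨χ, h1⟩, ?_⟩, rfl⟩
    simp only [Finset.mem_filter, Finset.mem_univ, true_and]
    intro h
    exact h0 h
  · rintro ⟨i, rfl⟩
    have hi := i.2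
    simp only [Finset.mem_filter, Finset.mem_univ, true_and] at hi
    exact ⟨fun h => hi h, i.1.genWeightSpace_ne_bot⟩

omit [IsKilling ℂ L] in
theorem coe_mem_roots (i : P.h.root) : ((i : Weight ℂ P.h L) : P.h → ℂ) ∈ roots P.h :=
  P.mem_roots_iff.mpr ⟨i, rfl⟩

theorem neg_mem_roots {χ : P.h → ℂ} (h : χ ∈ roots P.h) : -χ ∈ roots P.h := by
  obtain ⟨i, rfl⟩ := P.mem_roots_iff.mp h
  have hi := i.2
  simp only [Finset.mem_filter, Finset.mem_univ, true_and] at hi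
  refine P.mem_roots_iff.mpr ⟨⟨-i.1, ?_⟩, by simp⟩
  simpa using hi

theorem root_eq_add_iff {i j k : P.h.root} :
    (rootSystem P.h).root k = (rootSystem P.h).root i + (rootSystem P.h).root j ↔
      ((k : Weight ℂ P.h L) : P.h → ℂ) = ⇑(i : Weight ℂ P.h L) + ⇑(j : Weight ℂ P.h L) := by
  constructor
  · intro h; ext x; exact LinearMap.congr_fun h x
  · intro h; ext x; exact congrFun h x

theorem coe_reflectionPerm_self (i : P.h.root) :
    ((((rootSystem P.h).reflectionPerm i i : P.h.root) : Weight ℂ P.h L) : P.h → ℂ) =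
      -⇑(i : Weight ℂ P.h L) := by
  have h : (rootSystem P.h).root ((rootSystem P.h).reflectionPerm i i) =
      -(rootSystem P.h).root i := by
    rw [RootPairing.root_reflectionPerm, RootPairing.reflection_apply_self]
  ext x; exact LinearMap.congr_fun h x

theorem exists_base : ∃ b : (rootSystem P.h).Base,
    (∀ i : P.h.root, i ∈ b.support ↔ P.IsSimpleRoot ⇑(i : Weight ℂ P.h L)) ∧
    ∀ i : P.h.root, ⇑(i : Weight ℂ P.h L) ∈ P.pos →
      (rootSystem P.h).root i ∈ AddSubmonoid.closure ((rootSystem P.h).root '' b.support) := by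
  obtain ⟨b, hb, hb'⟩ := exists_base_of_positive (rootSystem P.h)
    (pos := {i : P.h.root | ⇑(i : Weight ℂ P.h L) ∈ P.pos})
    (fun i => by
      have := P.pos_or_neg _ (P.coe_mem_roots i)
      simpa only [Set.mem_ofPred_eq, P.coe_reflectionPerm_self] using this)
    (fun i hi => by
      have := P.not_both _ hi
      simpa only [Set.mem_ofPred_eq, P.coe_reflectionPerm_self] using this)
    (fun i hi j hj k hk => by
      have hk' := P.root_eq_add_iff.mp hk
      have := P.add_mem _ hi _ hj (hk' ▸ P.coe_mem_roots k)
      rwa [← hk'] at this)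
  refine ⟨b, fun i => (hb i).trans ⟨fun h => ⟨h.1, ?_⟩, fun h => ⟨h.1, ?_⟩⟩, hb'⟩
  · intro β hβ γ hγ hi
    obtain ⟨j, rfl⟩ := P.mem_roots_iff.mp (P.pos_subset hβ)
    obtain ⟨k, rfl⟩ := P.mem_roots_iff.mp (P.pos_subset hγ)
    exact h.2 j hβ k hγ (P.root_eq_add_iff.mpr hi)
  · intro j hj k hk hi
    exact h.2 _ hj _ hk (P.root_eq_add_iff.mp hi)

/-- The base of the root system formed by the simple roots. -/
noncomputable def base : (rootSystem P.h).Base := P.exists_base.choose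

theorem mem_base_iff {i : P.h.root} :
    i ∈ P.base.support ↔ P.IsSimpleRoot ⇑(i : Weight ℂ P.h L) :=
  P.exists_base.choose_spec.1 i

theorem exists_mem_base {β : P.h → ℂ} (hβ : P.IsSimpleRoot β) :
    ∃ i ∈ P.base.support, ⇑(i : Weight ℂ P.h L) = β := by
  obtain ⟨i, rfl⟩ := P.mem_roots_iff.mp (P.pos_subset hβ.1)
  exact ⟨i, P.mem_base_iff.mpr hβ, rfl⟩

/-- A positive root is a combination of simple roots with natural coefficients. -/
theorem exists_eq_sum_nat {γ : P.h → ℂ} (hγ : γ ∈ P.pos) :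
    ∃ n : P.base.support → ℕ, γ = ∑ i, n i • ⇑((i : P.h.root) : Weight ℂ P.h L) := by
  classical
  obtain ⟨i, rfl⟩ := P.mem_roots_iff.mp (P.pos_subset hγ)
  have h := P.exists_base.choose_spec.2 i hγ
  change _ ∈ AddSubmonoid.closure ((rootSystem P.h).root '' P.base.support) at h
  suffices ∀ x ∈ AddSubmonoid.closure ((rootSystem P.h).root '' P.base.support),
      ∃ n : P.base.support → ℕ, x = ∑ i, n i • (rootSystem P.h).root i by
    obtain ⟨n, hn⟩ := this _ h
    refine ⟨n, ?_⟩
    ext x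
    have := LinearMap.congr_fun hn x
    simpa using this
  intro x hx
  induction hx using AddSubmonoid.closure_induction with
  | mem x hx =>
    obtain ⟨j, hj, rfl⟩ := hx
    refine ⟨Pi.single ⟨j, hj⟩ 1, ?_⟩
    rw [Finset.sum_eq_single ⟨j, hj⟩ (fun k _ hk => by simp [Pi.single_eq_of_ne hk]) (by simp)]
    simp
  | zero => exact ⟨0, by simp⟩
  | add x y _ _ hx hy =>
    obtain ⟨n, rfl⟩ := hx
    obtain ⟨m, rfl⟩ := hy
    exact ⟨n + m, by simp [add_smul, Finset.sum_add_distrib]⟩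

/-- The simple roots can be given arbitrary values at a vector of the Cartan subalgebra. -/
theorem exists_forall_simple_apply_eq (c : (P.h → ℂ) → ℂ) :
    ∃ d : P.h, ∀ β, P.IsSimpleRoot β → β d = c β := by
  obtain ⟨d, hd⟩ := (Module.evalEquiv ℂ P.h).surjective
    (P.base.toWeightBasis.constr ℂ fun i => c ⇑((i : P.h.root) : Weight ℂ P.h L))
  refine ⟨d, fun β hβ => ?_⟩
  obtain ⟨i, hi, rfl⟩ := P.exists_mem_base hβ
  have h := P.base.toWeightBasis.constr_basis ℂ
    (fun i => c ⇑((i : P.h.root) : Weight ℂ P.h L)) ⟨i, hi⟩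
  rw [← hd] at h
  simpa using h

/-- There is a vector of the Cartan subalgebra on which each positive root takes its height as
value; the simple roots are the roots of height one. -/
theorem exists_height : ∃ d : P.h, (∀ β, P.IsSimpleRoot β → β d = 1) ∧
    ∀ γ ∈ P.pos, ∃ n : ℕ, 1 ≤ n ∧ γ d = n ∧ (n = 1 → P.IsSimpleRoot γ) := by
  classical
  obtain ⟨d, h1⟩ := P.exists_forall_simple_apply_eq fun _ => 1
  refine ⟨d, h1, fun γ hγ => ?_⟩
  obtain ⟨n, hn⟩ := P.exists_eq_sum_nat hγ
  have hγd : γ d = ((∑ i, n i : ℕ) : ℂ) := by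
    rw [hn]
    simp only [Finset.sum_apply, Nat.cast_sum]
    refine Finset.sum_congr rfl fun i _ => ?_
    rw [Pi.smul_apply, h1 _ (P.mem_base_iff.mp i.2), nsmul_eq_mul, mul_one]
  refine ⟨∑ i, n i, ?_, hγd, fun hsum => ?_⟩
  · by_contra h0
    have h0' : ∀ i, n i = 0 := by
      have : ∑ i, n i = 0 := by omega
      simpa using this
    have : γ = 0 := by rw [hn]; simp [h0']
    exact (P.pos_subset hγ).1 this
  · obtain ⟨i, hi⟩ : ∃ i, n i ≠ 0 := by
      by_contra! h0
      simp [h0] at hsum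
    have h2 : n i + ∑ j ∈ Finset.univ.erase i, n j = 1 := by
      rw [Finset.add_sum_erase _ _ (Finset.mem_univ i)]; exact hsum
    have h3 : ∑ j ∈ Finset.univ.erase i, n j = 0 := by omega
    have h4 : n i = 1 := by omega
    have h5 : γ = ⇑((i : P.h.root) : Weight ℂ P.h L) := by
      rw [hn, Finset.sum_eq_single i]
      · simp [h4]
      · intro j _ hj
        rw [Finset.sum_eq_zero_iff.mp h3 j (by simp [hj]), zero_smul]
      · simp
    rw [h5]; exact P.mem_base_iff.mp i.2

end PositiveSystem

namespace PositiveSystem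

open LieAlgebra LieAlgebra.IsKilling LieModule

variable {L : Type*} [LieRing L] [LieAlgebra ℂ L] [Module.Finite ℂ L]
  (P : PositiveSystem L)

section

omit [Module.Finite ℂ L]
variable {P}

theorem IsSimpleRoot.sub_notMem {α β : P.h → ℂ} (hα : P.IsSimpleRoot α) (hβ : P.IsSimpleRoot β) :
    α - β ∉ roots P.h := by
  intro h
  rcases P.pos_or_neg _ h with h1 | h1
  · exact hα.2 _ h1 _ hβ.1 (by abel)
  · exact hβ.2 _ h1 _ hα.1 (by abel)

theorem IsLongestRoot.sub_notMem {α β : P.h → ℂ} (hα : P.IsLongestRoot α)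
    (hβ : P.IsLongestRoot β) : α - β ∉ roots P.h := by
  intro h
  rcases P.pos_or_neg _ h with h1 | h1
  · refine hβ.2 _ h1 ?_
    rw [sub_add_cancel]; exact P.pos_subset hα.1
  · refine hα.2 _ h1 ?_
    rw [neg_sub, sub_add_cancel]; exact P.pos_subset hβ.1

theorem rootSpace_eq_bot {χ : P.h → ℂ} (h : χ ∉ roots P.h) (h0 : χ ≠ 0) :
    (rootSpace P.h χ).toSubmodule = ⊥ := by
  by_contra h'
  exact h ⟨h0, fun h2 => h' (by rw [h2]; rfl)⟩

end

variable [IsKilling ℂ L]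

theorem zdag_subset_roots : P.Zdag ⊆ roots P.h := by
  rintro χ (h | h)
  · exact P.pos_subset h.1
  · have := P.neg_mem_roots (P.pos_subset h.1)
    rwa [neg_neg] at this

theorem z_subset_roots : P.Z ⊆ roots P.h := by
  intro χ h
  have := P.neg_mem_roots (P.zdag_subset_roots h)
  rwa [neg_neg] at this

omit [IsKilling ℂ L] [Module.Finite ℂ L] in
/-- The cyclic root set and its conjugate are disjoint as soon as no simple root is a longest
root. -/
theorem disjoint_Z_Zdag (hs : ∀ β, P.IsSimpleRoot β → ¬P.IsLongestRoot β) :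
    Disjoint P.Z P.Zdag := by
  rw [Set.disjoint_left]
  rintro χ (h1 | h1) (h2 | h2)
  · exact P.not_both _ h2.1 h1.1
  · exact hs _ h1 h2
  · rw [neg_neg] at h1
    exact hs _ h2 h1
  · rw [neg_neg] at h1
    exact P.not_both _ h1.1 h2.1

/-- The bracket of the root spaces of `Z` with those of `Z†` lies in the Cartan subalgebra. -/
theorem lie_mem_h_of_mem_Z_of_mem_Zdag {x y : L} (hx : x ∈ P.weightSum P.Z)
    (hy : y ∈ P.weightSum P.Zdag) : ⁅x, y⁆ ∈ P.h := by
  rw [mem_h_iff_weightSum]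
  refine P.lie_mem_weightSum (fun a ha b hb h => ?_) hx hy
  by_contra h0
  have h0' : a + b ≠ 0 := h0
  apply h
  refine rootSpace_eq_bot ?_ h0'
  intro hr
  rcases ha with ha | ha <;> rcases hb with hb | hb
  · exact hb.sub_notMem ha (by simpa [sub_eq_add_neg, add_comm] using hr)
  · have := P.neg_mem_roots hr
    exact hb.2 _ ha.1 (by simpa [add_comm] using this)
  · rw [neg_neg] at ha
    exact ha.2 _ hb.1 (by simpa [add_comm] using hr)
  · rw [neg_neg] at ha
    exact ha.sub_notMem hb (by simpa [sub_eq_add_neg] using hr)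

/-- If the root vector `x` of `α` commutes with the weight vector `y` of `χ` and `χ - α` is not a
weight, then `χ` is orthogonal to `α`. -/
theorem apply_coroot_eq_zero_of_lie_eq_zero {i : P.h.root} {χ : P.h → ℂ} {x y : L}
    (hx : x ∈ rootSpace P.h ⇑(i : Weight ℂ P.h L)) (hx0 : x ≠ 0) (hy : y ∈ rootSpace P.h χ)
    (hy0 : y ≠ 0) (hb : (rootSpace P.h (χ - ⇑(i : Weight ℂ P.h L))).toSubmodule = ⊥)
    (hxy : ⁅x, y⁆ = 0) : χ (IsKilling.coroot (i : Weight ℂ P.h L)) = 0 := by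
  have hi : (i : Weight ℂ P.h L).IsNonZero := LieSubalgebra.isNonZero_coe_root i
  obtain ⟨h, e, f, t, he, hf⟩ := exists_isSl2Triple_of_weight_isNonZero hi
  have hc := t.h_eq_coroot hi he hf
  obtain ⟨c, hc'⟩ := (finrank_eq_one_iff_of_nonzero' (⟨x, hx⟩ : rootSpace P.h _)
    (by simpa using hx0)).mp (finrank_rootSpace_eq_one _ hi) ⟨e, he⟩
  replace hc' : c • x = e := congrArg Subtype.val hc'
  have hey : ⁅e, y⁆ = 0 := by rw [← hc', smul_lie, hxy, smul_zero]
  have hfy : ⁅f, y⁆ = 0 := by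
    have := lie_mem_genWeightSpace_of_mem_genWeightSpace hf hy
    rw [neg_add_eq_sub] at this
    have h2 : ⁅f, y⁆ ∈ (rootSpace P.h (χ - ⇑(i : Weight ℂ P.h L))).toSubmodule := this
    rw [hb] at h2
    simpa using h2
  have h1 : ⁅h, y⁆ = 0 := by rw [← t.lie_e_f, lie_lie, hey, hfy]; simp
  have h2 := lie_eq_smul_of_mem_rootSpace hy (IsKilling.coroot (i : Weight ℂ P.h L))
  rw [LieSubalgebra.coe_bracket_of_module, ← hc, h1] at h2
  exact (smul_eq_zero.mp h2.symm).resolve_right hy0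

section Simple

variable [IsSimple ℂ L]

/-- Induction along the edges of the Dynkin diagram, which is connected. -/
theorem simple_induction {p : (P.h → ℂ) → Prop}
    (hp : ∀ i j : P.h.root, i ∈ P.base.support → j ∈ P.base.support →
      p ⇑(i : Weight ℂ P.h L) → (j : Weight ℂ P.h L) (IsKilling.coroot (i : Weight ℂ P.h L)) ≠ 0 →
      p ⇑(j : Weight ℂ P.h L))
    {β₀ : P.h → ℂ} (hβ₀ : P.IsSimpleRoot β₀) (h₀ : p β₀) {β : P.h → ℂ} (hβ : P.IsSimpleRoot β) :
    p β := by
  obtain ⟨i, hi, rfl⟩ := P.exists_mem_base hβ₀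
  obtain ⟨j, hj, rfl⟩ := P.exists_mem_base hβ
  refine P.base.induction_on_cartanMatrix
    (p := fun k : P.base.support => p ⇑((k : P.h.root) : Weight ℂ P.h L))
    (i := ⟨i, hi⟩) (j := ⟨j, hj⟩) h₀ fun k l hk hkl => ?_
  refine hp k l k.2 l.2 hk fun h => hkl ?_
  rw [P.base.cartanMatrix_apply_eq_zero_iff_pairing]
  exact h

omit [IsSimple ℂ L] in
theorem pairingIn_simple_nonneg {e k : P.h.root}
    (he : P.IsLongestRoot ⇑(e : Weight ℂ P.h L)) (hk : k ∈ P.base.support) :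
    0 ≤ (rootSystem P.h).pairingIn ℤ e k := by
  by_contra! h
  have hk' := P.mem_base_iff.mp hk
  obtain ⟨l, hl⟩ := (rootSystem P.h).root_add_root_mem_of_pairingIn_neg h (by
    intro h'
    have h2 : ⇑(e : Weight ℂ P.h L) = -⇑(k : Weight ℂ P.h L) := by
      ext x; exact LinearMap.congr_fun h' x
    exact P.not_both _ hk'.1 (h2 ▸ he.1))
  apply he.2 _ hk'.1
  rw [add_comm, ← P.root_eq_add_iff.mp hl]
  exact P.coe_mem_roots l

/-- The longest root is unique: two dominant roots with full support make an acute angle, so that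
their difference would be a root. -/
theorem IsLongestRoot.unique {η η' : P.h → ℂ} (h : P.IsLongestRoot η) (h' : P.IsLongestRoot η') :
    η = η' := by
  classical
  obtain ⟨e, rfl⟩ := P.mem_roots_iff.mp (P.pos_subset h.1)
  obtain ⟨e', rfl⟩ := P.mem_roots_iff.mp (P.pos_subset h'.1)
  by_contra hne
  have hne' : e ≠ e' := fun h => hne (by rw [h])
  obtain ⟨n, hn⟩ := P.exists_eq_sum_nat h.1
  have hsum : ∀ k : P.h.root, (rootSystem P.h).pairingIn ℤ e k =
      ∑ i, n i * (rootSystem P.h).pairingIn ℤ i k := by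
    intro k
    apply (algebraMap ℤ ℂ).injective_int
    have : (rootSystem P.h).pairing e k = ∑ i, n i * (rootSystem P.h).pairing i k := by
      simp only [rootSystem_pairing_apply]
      have := congrFun hn (IsKilling.coroot (k : Weight ℂ P.h L))
      simpa using this
    rw [RootPairing.algebraMap_pairingIn, this]
    simp only [map_sum, map_mul, RootPairing.algebraMap_pairingIn]
    simp
  have hn0 : ∃ i, n i ≠ 0 := by
    by_contra! h0
    apply (P.pos_subset h.1).1
    rw [hn]; simp [h0]
  obtain ⟨i₀, hi₀⟩ := hn0
  have hfull : ∀ i, n i ≠ 0 := by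
    intro j
    refine P.base.induction_on_cartanMatrix (p := fun k => n k ≠ 0) hi₀ fun k l hk hkl hl => ?_
    have hkl' : k ≠ l := by rintro rfl; exact hk hl
    have h1 := P.pairingIn_simple_nonneg h l.2
    rw [hsum] at h1
    have h2 : ∀ i ∈ Finset.univ, (n i : ℤ) * (rootSystem P.h).pairingIn ℤ i l ≤ 0 := by
      intro i _
      by_cases hil : i = l
      · simp [hil, hl]
      · have := P.base.pairingIn_le_zero_of_ne (fun h => hil (Subtype.ext h)) i.2 l.2
        exact mul_nonpos_of_nonneg_of_nonpos (by positivity) this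
    have h3 := (Finset.sum_eq_zero_iff_of_nonpos h2).mp
      (le_antisymm (Finset.sum_nonpos h2) h1) k (Finset.mem_univ k)
    have h4 : (rootSystem P.h).pairingIn ℤ k l = 0 := by
      rcases mul_eq_zero.mp h3 with h4 | h4
      · exact absurd (by exact_mod_cast h4) hk
      · exact h4
    apply hkl
    rw [P.base.cartanMatrix_apply_eq_zero_iff_symm, P.base.cartanMatrix_apply_eq_zero_iff_pairing,
      ← (rootSystem P.h).algebraMap_pairingIn ℤ, h4, map_zero]
  have hnn : ∀ k ∈ P.base.support, 0 ≤ (rootSystem P.h).pairingIn ℤ k e' := by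
    intro k hk
    by_contra! hlt
    have := P.pairingIn_simple_nonneg h' hk
    have h2 := ((rootSystem P.h).pairingIn_lt_zero_iff (S := ℤ)).mp hlt
    omega
  obtain ⟨j, hj, hj0⟩ := P.base.exists_mem_support_pos_pairingIn_ne_zero e'
  have hpos : 0 < (rootSystem P.h).pairingIn ℤ e e' := by
    rw [hsum]
    refine Finset.sum_pos' (fun i _ => mul_nonneg (by positivity) (hnn i i.2))
      ⟨⟨j, hj⟩, Finset.mem_univ _, ?_⟩
    have h1 := hnn j hj
    have h2 := hfull ⟨j, hj⟩
    have h3 : 0 < (rootSystem P.h).pairingIn ℤ j e' := lt_of_le_of_ne h1 (Ne.symm hj0)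
    positivity
  obtain ⟨l, hl⟩ := (rootSystem P.h).root_sub_root_mem_of_pairingIn_pos hpos hne'
  apply h.sub_notMem h'
  have : ⇑(e : Weight ℂ P.h L) - ⇑(e' : Weight ℂ P.h L) = ⇑(l : Weight ℂ P.h L) := by
    ext x; exact (LinearMap.congr_fun hl x).symm
  rw [this]
  exact P.coe_mem_roots l

/-- If a simple root is a longest root, it is the only simple root. -/
theorem IsSimpleRoot.eq_of_isLongestRoot {β β' : P.h → ℂ} (hβ : P.IsSimpleRoot β)
    (hl : P.IsLongestRoot β) (hβ' : P.IsSimpleRoot β') : β' = β := by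
  refine P.simple_induction (p := fun χ => χ = β) (fun i j hi hj hiβ hij => ?_) hβ rfl hβ'
  by_contra hne
  have hji : j ≠ i := by rintro rfl; exact hne hiβ
  have hb := P.base.pairingIn_le_zero_of_ne hji.symm hi hj
  have hn := P.pairingIn_simple_nonneg (e := i) (k := j) (hiβ ▸ hl) hj
  have h0 : (rootSystem P.h).pairingIn ℤ i j = 0 := le_antisymm hb hn
  apply hij
  have : (rootSystem P.h).pairing i j = 0 := by
    rw [← (rootSystem P.h).algebraMap_pairingIn ℤ, h0, map_zero]
  rw [RootPairing.pairing_eq_zero_iff] at this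
  exact this

end Simple

end PositiveSystem

/-! ### Commutants of cyclic elements -/

namespace PositiveSystem

open LieAlgebra LieAlgebra.IsKilling LieModule

variable {L : Type*} [LieRing L] [LieAlgebra ℂ L] [Module.Finite ℂ L]
  (P : PositiveSystem L)

theorem proj_mem_inter (T : Set (P.h → ℂ)) {S : Set (P.h → ℂ)} {x : L}
    (hx : x ∈ P.weightSum S) : P.proj T x ∈ P.weightSum (T ∩ S) := by
  have h := P.proj_mem (T ∩ S) x
  rwa [← P.proj_proj, P.proj_of_mem hx] at h

/-- The component of weight `α + α'` of a bracket, when `α + α'` has only one decomposition as a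
sum of two elements of `S`. -/
theorem proj_lie_pair {S : Set (P.h → ℂ)} {α α' : P.h → ℂ} (hne : α ≠ α')
    (huniq : ∀ a ∈ S, ∀ a' ∈ S, a + a' = α + α' → a = α ∨ a = α')
    {x y : L} (hx : x ∈ P.weightSum S) (hy : y ∈ P.weightSum S) :
    P.proj {α + α'} ⁅x, y⁆ = ⁅P.proj {α} x, P.proj {α'} y⁆ + ⁅P.proj {α'} x, P.proj {α} y⁆ := by
  have hdis : Disjoint ({α} : Set (P.h → ℂ)) {α'} := by simpa using hne
  have hx' : x = P.proj {α} x + P.proj {α'} x + P.proj ({α} ∪ {α'})ᶜ x := by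
    rw [← P.proj_union hdis, P.proj_add_compl]
  have hrest : P.proj ({α} ∪ {α'})ᶜ x ∈ P.weightSum (({α} ∪ {α'})ᶜ ∩ S) := by
    exact P.proj_mem_inter _ hx
  have h0 : P.proj {α + α'} ⁅P.proj ({α} ∪ {α'})ᶜ x, y⁆ = 0 := by
    refine P.proj_of_disjoint (T := {α + α'}ᶜ) disjoint_compl_right
      (P.lie_mem_weightSum (C := {α + α'}ᶜ) (fun a ha b hb _ h => ?_) hrest hy)
    have := huniq a ha.2 b hb h
    exact ha.1 (by simpa [or_comm] using this)
  conv_lhs => rw [hx', add_lie, add_lie, map_add, map_add, h0, add_zero]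
  rw [P.proj_lie (A := {α}) (S := {α'}) (by simp) (P.proj_mem _ _),
    P.proj_lie (A := {α'}) (S := {α}) ?_ (P.proj_mem _ _)]
  rintro a rfl b
  rw [Set.mem_singleton_iff, Set.mem_singleton_iff, add_comm α, add_right_inj]

theorem lie_eq_smul_of_mem_weightSum [IsKilling ℂ L] {S : Set (P.h → ℂ)} {d : P.h} {c : ℂ}
    (hc : ∀ χ ∈ S, χ d = c) {x : L} (hx : x ∈ P.weightSum S) : ⁅(d : L), x⁆ = c • x := by
  refine P.weightSum_induction (p := fun x => ⁅(d : L), x⁆ = c • x) hx (by simp)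
    (fun x y hx hy => by rw [lie_add, hx, hy, smul_add]) fun χ hχ x hx => ?_
  rw [← hc χ hχ]
  exact lie_eq_smul_of_mem_rootSpace hx d

variable [IsKilling ℂ L]

/-- A root space is one-dimensional. -/
theorem exists_smul_eq {χ : P.h → ℂ} (hχ : χ ∈ roots P.h) {x y : L} (hx : x ∈ rootSpace P.h χ)
    (hx0 : x ≠ 0) (hy : y ∈ rootSpace P.h χ) : ∃ c : ℂ, c • x = y := by
  obtain ⟨i, rfl⟩ := P.mem_roots_iff.mp hχ
  obtain ⟨c, hc⟩ := (finrank_eq_one_iff_of_nonzero' (⟨x, hx⟩ : rootSpace P.h _)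
    (by simpa using hx0)).mp
    (finrank_rootSpace_eq_one _ (LieSubalgebra.isNonZero_coe_root i)) ⟨y, hy⟩
  exact ⟨c, congrArg Subtype.val hc⟩

/-- A decomposition of the opposite of a sum of two simple roots as a sum of elements of `Z` is
unique. -/
theorem eq_or_eq_of_add_eq_neg_simple {β β' a a' : P.h → ℂ} (hβ : P.IsSimpleRoot β)
    (hβ' : P.IsSimpleRoot β') (ha : a ∈ P.Z) (ha' : a' ∈ P.Z)
    (h : a + a' = -β + -β') : a = -β ∨ a = -β' := by
  classical
  obtain ⟨d, hd, hd'⟩ := P.exists_height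
  have hsum := congrFun h d
  simp only [Pi.add_apply, Pi.neg_apply, hd β hβ, hd β' hβ'] at hsum
  have key : ∀ a ∈ P.Z, (P.IsSimpleRoot (-a) ∧ a d = -1) ∨ ∃ n : ℕ, 1 ≤ n ∧ a d = n := by
    rintro a (ha | ha)
    · left
      refine ⟨ha, ?_⟩
      have := hd _ ha
      simp only [Pi.neg_apply] at this
      rw [← neg_eq_iff_eq_neg]; exact this
    · right
      rw [neg_neg] at ha
      obtain ⟨n, h1, h2, -⟩ := hd' _ ha.1
      exact ⟨n, h1, h2⟩
  have hsim : P.IsSimpleRoot (-a) ∧ P.IsSimpleRoot (-a') := by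
    rcases key a ha with ⟨h1, h2⟩ | ⟨n, h1, h2⟩ <;> rcases key a' ha' with ⟨h3, h4⟩ | ⟨m, h3, h4⟩
    · exact ⟨h1, h3⟩
    all_goals
      exfalso
      rw [h2, h4] at hsum
      have hre := congrArg Complex.re hsum
      simp only [Complex.add_re, Complex.neg_re, Complex.one_re, Complex.natCast_re] at hre
    · have : (1 : ℝ) ≤ m := by exact_mod_cast h3
      linarith
    · have : (1 : ℝ) ≤ n := by exact_mod_cast h1
      linarith
    · have : (1 : ℝ) ≤ n := by exact_mod_cast h1
      have : (1 : ℝ) ≤ m := by exact_mod_cast h3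
      linarith
  by_contra! hcon
  obtain ⟨c, hc⟩ := P.exists_forall_simple_apply_eq fun χ => if χ = -a then 1 else 0
  have h1 := congrFun h c
  have e1 : a c = -1 := by
    have := hc _ hsim.1
    simp only [Pi.neg_apply, if_true] at this
    rw [← neg_eq_iff_eq_neg]; exact this
  have e2 : a' c = -(if -a' = -a then 1 else 0) := by
    have := hc _ hsim.2
    simp only [Pi.neg_apply] at this
    rw [← neg_eq_iff_eq_neg]; exact this
  have e3 : β c = 0 := by
    rw [hc _ hβ, if_neg]
    intro h; exact hcon.1 (by rw [h, neg_neg])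
  have e4 : β' c = 0 := by
    rw [hc _ hβ', if_neg]
    intro h; exact hcon.2 (by rw [h, neg_neg])
  simp only [Pi.add_apply, Pi.neg_apply, e1, e2, e3, e4] at h1
  have hre := congrArg Complex.re h1
  split_ifs at hre <;> norm_num at hre

section Simple

variable [IsSimple ℂ L]

/-- A decomposition of the difference of a longest root and a simple root as a sum of elements of
`Z` is unique. -/
theorem eq_or_eq_of_add_eq_longest {η β a a' : P.h → ℂ} (hη : P.IsLongestRoot η)
    (hβ : P.IsSimpleRoot β) (ha : a ∈ P.Z) (ha' : a' ∈ P.Z)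
    (h : a + a' = η + -β) : a = η ∨ a = -β := by
  rcases ha with ha | ha
  · right
    rcases ha' with ha' | ha'
    · exfalso
      obtain ⟨d, hd, hd'⟩ := P.exists_height
      obtain ⟨n, h1, h2, -⟩ := hd' _ hη.1
      have hsum := congrFun h d
      have e1 := hd _ ha
      have e2 := hd _ ha'
      simp only [Pi.add_apply, Pi.neg_apply, hd β hβ] at hsum e1 e2
      have hre := congrArg Complex.re hsum
      have e1' := congrArg Complex.re e1
      have e2' := congrArg Complex.re e2
      rw [h2] at hre
      simp only [Complex.add_re, Complex.neg_re, Complex.one_re, Complex.natCast_re] at hre e1' e2'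
      have : (1 : ℝ) ≤ n := by exact_mod_cast h1
      linarith
    · rw [neg_neg] at ha'
      rw [ha'.unique P hη, add_comm η] at h
      exact add_right_cancel h
  · left
    rw [neg_neg] at ha
    exact ha.unique P hη

/-- An element of `g_Z` which commutes with a cyclic element of `g_Z`, all of whose components
along the opposites of the simple roots are nonzero, vanishes as soon as one of its components
along these roots does: this is the connectedness of the extended Dynkin diagram. -/
theorem eq_zero_of_lie_eq_zero {Φ x : L} (hΦ : Φ ∈ P.weightSum P.Z) (hx : x ∈ P.weightSum P.Z)
    (hΦ0 : ∀ β, P.IsSimpleRoot β → P.proj {-β} Φ ≠ 0) (hΦx : ⁅Φ, x⁆ = 0)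
    {β₀ : P.h → ℂ} (hβ₀ : P.IsSimpleRoot β₀)
    (hx₀ : P.proj {-β₀} x = 0) : x = 0 := by
  have hsimple : ∀ β, P.IsSimpleRoot β → P.proj {-β} x = 0 := by
    intro β hβ
    refine P.simple_induction (p := fun χ => P.proj {-χ} x = 0) (fun i j hi hj hxi hij => ?_)
      hβ₀ hx₀ hβ
    by_contra hxj
    set χ : P.h → ℂ := ⇑(i : Weight ℂ P.h L) with hχ
    set χ' : P.h → ℂ := ⇑(j : Weight ℂ P.h L) with hχ'
    have hsi := P.mem_base_iff.mp hi
    have hsj := P.mem_base_iff.mp hj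
    have hne : χ ≠ χ' := by intro h; rw [h] at hxi; exact hxj hxi
    have h1 := P.proj_lie_pair (S := P.Z) (α := -χ) (α' := -χ') (by simpa using hne)
      (fun a ha a' ha' h => P.eq_or_eq_of_add_eq_neg_simple hsi hsj ha ha' h) hΦ hx
    rw [hΦx, map_zero, hxi, lie_zero, add_zero] at h1
    obtain ⟨k, hk⟩ := P.mem_roots_iff.mp (P.neg_mem_roots (P.coe_mem_roots i))
    have h2 := P.apply_coroot_eq_zero_of_lie_eq_zero (i := k) (χ := -χ')
      (x := P.proj {-χ} Φ) (y := P.proj {-χ'} x)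
      (by rw [hk]; exact P.mem_weightSum_singleton.mp (P.proj_mem _ _)) (hΦ0 _ hsi)
      (P.mem_weightSum_singleton.mp (P.proj_mem _ _)) hxj
      (by
        rw [hk]
        refine rootSpace_eq_bot ?_ ?_
        · intro h; apply hsi.sub_notMem hsj
          simpa [add_comm, sub_eq_add_neg] using h
        · intro h; apply hne
          have : χ - χ' = 0 := by rw [← h, ← hχ]; abel
          exact sub_eq_zero.mp this) h1.symm
    have h3 : (k : Weight ℂ P.h L) = -(i : Weight ℂ P.h L) := by
      ext z; exact congrFun hk z
    rw [h3, IsKilling.coroot_neg] at h2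
    apply hij
    have h4 : Weight.toLinear ℂ P.h L (j : Weight ℂ P.h L) (-IsKilling.coroot (i : Weight ℂ P.h L)) = 0 := by
      have := neg_eq_zero.mp h2
      exact this
    rw [map_neg, neg_eq_zero] at h4
    exact h4
  refine P.eq_zero_of_forall_proj fun χ => ?_
  by_cases hχ : χ ∈ P.Z
  swap
  · exact P.proj_of_disjoint (T := P.Z) (by simpa using hχ) hx
  rcases hχ with hχ | hχ
  · have := hsimple _ hχ
    rwa [neg_neg] at this
  · rw [neg_neg] at hχ
    by_contra hxη
    obtain ⟨e, he⟩ := P.mem_roots_iff.mp (P.pos_subset hχ.1)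
    obtain ⟨j, hj, hj0⟩ := P.base.exists_mem_support_pos_pairingIn_ne_zero e
    have hsj := P.mem_base_iff.mp hj
    set β : P.h → ℂ := ⇑(j : Weight ℂ P.h L) with hβ
    have hne : -β ≠ χ := by
      intro h
      exact P.not_both _ hsj.1 (h ▸ hχ.1)
    have h1 := P.proj_lie_pair (S := P.Z) (α := χ) (α' := -β) hne.symm
      (fun a ha a' ha' h => P.eq_or_eq_of_add_eq_longest hχ hsj ha ha' h) hΦ hx
    rw [hΦx, map_zero, hsimple _ hsj, lie_zero, zero_add] at h1
    obtain ⟨k, hk⟩ := P.mem_roots_iff.mp (P.neg_mem_roots (P.coe_mem_roots j))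
    have h2 := P.apply_coroot_eq_zero_of_lie_eq_zero (i := k) (χ := χ)
      (x := P.proj {-β} Φ) (y := P.proj {χ} x)
      (by rw [hk]; exact P.mem_weightSum_singleton.mp (P.proj_mem _ _)) (hΦ0 _ hsj)
      (P.mem_weightSum_singleton.mp (P.proj_mem _ _)) hxη
      (by
        rw [hk, sub_neg_eq_add]
        refine rootSpace_eq_bot ?_ ?_
        · intro h; apply hχ.2 _ hsj.1
          rwa [add_comm]
        · intro h
          exact hne (eq_neg_of_add_eq_zero_left h).symm) h1.symm
    have h3 : (k : Weight ℂ P.h L) = -(j : Weight ℂ P.h L) := by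
      ext z; exact congrFun hk z
    rw [h3, IsKilling.coroot_neg, ← he] at h2
    have h4 : Weight.toLinear ℂ P.h L (e : Weight ℂ P.h L) (-IsKilling.coroot (j : Weight ℂ P.h L)) = 0 := by
      simpa using h2
    rw [map_neg, neg_eq_zero] at h4
    apply hj0
    have h5 : (rootSystem P.h).pairing e j = 0 := h4
    apply (algebraMap ℤ ℂ).injective_int
    rw [RootPairing.algebraMap_pairingIn, map_zero, RootPairing.pairing_eq_zero_iff]
    exact h5

/-- The commutant in `g_Z` of a cyclic element is the line which it spans. -/
theorem exists_eq_smul_of_lie_eq_zero {Φ x : L} (hΦ : Φ ∈ P.weightSum P.Z)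
    (hx : x ∈ P.weightSum P.Z) (hΦ0 : ∀ β, P.IsSimpleRoot β → P.proj {-β} Φ ≠ 0)
    (hΦx : ⁅Φ, x⁆ = 0) {β₀ : P.h → ℂ}
    (hβ₀ : P.IsSimpleRoot β₀) : ∃ c : ℂ, x = c • Φ := by
  obtain ⟨c, hc⟩ := P.exists_smul_eq (P.neg_mem_roots (P.pos_subset hβ₀.1))
    (P.mem_weightSum_singleton.mp (P.proj_mem {-β₀} Φ)) (hΦ0 _ hβ₀)
    (P.mem_weightSum_singleton.mp (P.proj_mem {-β₀} x))
  refine ⟨c, sub_eq_zero.mp ?_⟩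
  refine P.eq_zero_of_lie_eq_zero hΦ (Submodule.sub_mem _ hx (Submodule.smul_mem _ _ hΦ)) hΦ0 ?_
    hβ₀ ?_
  · rw [lie_sub, hΦx, lie_smul, lie_self]; simp
  · rw [map_sub, map_smul, hc, sub_self]

end Simple

/-- A vector killed by a principal nilpotent element which is an eigenvector of the height element
has a nonnegative half-integral eigenvalue: the principal nilpotent element and the height element
belong to a three-dimensional simple subalgebra. -/
theorem exists_nat_of_lie_eq_zero {e : L} (he : e ∈ P.weightSum {χ | P.IsSimpleRoot χ})
    (he0 : ∀ β, P.IsSimpleRoot β → P.proj {β} e ≠ 0) {d : P.h}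
    (hd : ∀ β, P.IsSimpleRoot β → β d = 1) {β₀ : P.h → ℂ} (hβ₀ : P.IsSimpleRoot β₀)
    {s : L} (hs0 : s ≠ 0) {μ : ℂ} (hμ : ⁅(d : L), s⁆ = μ • s) (hes : ⁅e, s⁆ = 0) :
    ∃ n : ℕ, 2 * μ = n := by
  classical
  have hy : ∀ i : P.base.support, ∃ y ∈ rootSpace P.h (-⇑((i : P.h.root) : Weight ℂ P.h L)),
      ⁅e, y⁆ = IsKilling.coroot ((i : P.h.root) : Weight ℂ P.h L) := by
    intro i
    have hi := P.mem_base_iff.mp i.2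
    have hnz := LieSubalgebra.isNonZero_coe_root (i : P.h.root)
    obtain ⟨h, x, y, t, hx, hy⟩ := exists_isSl2Triple_of_weight_isNonZero hnz
    have hc := t.h_eq_coroot hnz hx hy
    obtain ⟨c, hc'⟩ := P.exists_smul_eq (P.coe_mem_roots i)
      (P.mem_weightSum_singleton.mp (P.proj_mem {⇑((i : P.h.root) : Weight ℂ P.h L)} e))
      (he0 _ hi) hx
    refine ⟨c • y, Submodule.smul_mem _ _ hy, ?_⟩
    have hsplit := P.proj_add_compl {⇑((i : P.h.root) : Weight ℂ P.h L)} e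
    have hrest : ⁅P.proj {⇑((i : P.h.root) : Weight ℂ P.h L)}ᶜ e, y⁆ = 0 := by
      have hmem : P.proj {⇑((i : P.h.root) : Weight ℂ P.h L)}ᶜ e ∈
          P.weightSum ({⇑((i : P.h.root) : Weight ℂ P.h L)}ᶜ ∩ {χ | P.IsSimpleRoot χ}) := by
        exact P.proj_mem_inter _ he
      have := P.lie_mem_weightSum (C := ∅) (fun a ha b hb hab => ?_) hmem
        (P.mem_weightSum_singleton.mpr hy)
      · simpa [weightSum] using this
      · exfalso
        rw [Set.mem_singleton_iff] at hb
        rw [hb, ← sub_eq_add_neg] at hab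
        refine hab (rootSpace_eq_bot (ha.2.sub_notMem hi) ?_)
        rw [sub_ne_zero]; exact ha.1
    rw [← hsplit, add_lie, lie_smul, lie_smul, hrest, smul_zero, add_zero, ← smul_lie, hc',
      t.lie_e_f, hc]
  choose y hy hey using hy
  let b := P.base.toCoweightBasis
  let f : L := ∑ i, b.repr d i • y i
  have hef : ⁅e, f⁆ = d := by
    simp only [f, lie_sum, lie_smul, hey]
    have := congrArg (P.h.subtype) (b.sum_repr d)
    simpa [b] using this
  have hde : ⁅(d : L), e⁆ = (1 : ℂ) • e := P.lie_eq_smul_of_mem_weightSum (fun χ hχ => hd χ hχ) he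
  have hdf : ⁅(d : L), f⁆ = (-1 : ℂ) • f := by
    simp only [f, lie_sum, lie_smul, Finset.smul_sum]
    refine Finset.sum_congr rfl fun i _ => ?_
    have := lie_eq_smul_of_mem_rootSpace (hy i) d
    rw [Pi.neg_apply, hd _ (P.mem_base_iff.mp i.2), LieSubalgebra.coe_bracket_of_module] at this
    rw [this, smul_comm]
  have t : IsSl2Triple ((2 : ℂ) • (d : L)) e ((2 : ℂ) • f) := by
    refine ⟨?_, ?_, ?_, ?_⟩
    · intro h
      have hd0 : d = 0 := by
        have := (smul_eq_zero.mp h).resolve_left two_ne_zero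
        exact_mod_cast this
      obtain ⟨i, hi, rfl⟩ := P.exists_mem_base hβ₀
      have := hd _ hβ₀
      rw [hd0] at this
      have h0 : Weight.toLinear ℂ P.h L (i : Weight ℂ P.h L) 0 = 0 := map_zero _
      rw [Weight.toLinear_apply, this] at h0
      exact one_ne_zero h0
    · rw [lie_smul, hef]
    · rw [smul_lie, hde, one_smul, two_smul, two_smul]
    · rw [smul_lie, lie_smul, hdf]
      module
  have hprim : t.HasPrimitiveVectorWith s (2 * μ) :=
    ⟨hs0, by rw [smul_lie, hμ, smul_smul], hes⟩
  exact hprim.exists_nat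

end PositiveSystem

/-! ### Algebra of Hitchin–Kostant quadruples -/

namespace HKQuadruple

open LieAlgebra LieAlgebra.IsKilling LieModule

variable {L : Type*} [LieRing L] [LieAlgebra ℂ L] [Module.Finite ℂ L] (Q : HKQuadruple L)

theorem killingForm_conj {τ : L →ₗ⋆[ℂ] L} (hτ : IsConjugation τ) (x y : L) :
    killingForm ℂ L (τ x) (τ y) = star (killingForm ℂ L x y) := by
  let b := Module.finBasis ℂ L
  let e : L ≃ₗ⋆[ℂ] L := LinearEquiv.ofInvolutive τ hτ.involutive
  let e' : L ≃ₗ[ℂ] (Fin (Module.finrank ℂ L) → ℂ) := (e.trans b.equivFun).trans (starLinearEquiv ℂ)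
  let b' := Module.Basis.ofEquivFun e'
  have hb' : ∀ i, b' i = τ (b i) := by
    intro i
    apply e'.injective
    have h1 : e' (b' i) = Pi.single i 1 := by
      simp [b']
    have h2 : e' (τ (b i)) = star (b.equivFun (τ (τ (b i)))) := rfl
    rw [h1, h2, hτ.involutive]
    ext j
    rw [Pi.star_apply, Module.Basis.equivFun_self, Pi.single_apply]
    by_cases h : j = i
    · simp [h]
    · rw [if_neg h, if_neg (Ne.symm h), star_zero]
  rw [killingForm_apply_apply, killingForm_apply_apply, LinearMap.trace_eq_matrix_trace ℂ b',
    LinearMap.trace_eq_matrix_trace ℂ b, Matrix.trace, Matrix.trace, star_sum]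
  refine Finset.sum_congr rfl fun i _ => ?_
  rw [Matrix.diag_apply, Matrix.diag_apply, LinearMap.toMatrix_apply, LinearMap.toMatrix_apply, hb']
  have h3 : (ad ℂ L (τ x) ∘ₗ ad ℂ L (τ y)) (τ (b i)) = τ ((ad ℂ L x ∘ₗ ad ℂ L y) (b i)) := by
    simp [hτ.map_lie]
  rw [h3]
  have h4 : ∀ z, b'.repr (τ z) i = star (b.repr z i) := by
    intro z
    have : b'.repr (τ z) i = star (b.equivFun (τ (τ z)) i) := rfl
    rw [this, hτ.involutive]; rfl
  exact h4 _


theorem reKilling_apply (x y : L) : reKilling L x y = (killingForm ℂ L x y).re := rfl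

theorem reKilling_comm (x y : L) : reKilling L x y = reKilling L y x := by
  rw [reKilling_apply, reKilling_apply, killingForm, LieModule.traceForm_comm]

theorem reKilling_lie (x y z : L) : reKilling L ⁅x, y⁆ z = reKilling L x ⁅y, z⁆ :=
  congrArg Complex.re (LieModule.traceForm_apply_lie_apply ℂ L L x y z)

theorem reKilling_lie' (x y z : L) : reKilling L ⁅x, y⁆ z = -reKilling L y ⁅x, z⁆ := by
  rw [← lie_skew, map_neg, LinearMap.neg_apply, reKilling_lie]

theorem reKilling_rho (x y : L) : reKilling L (Q.ρ x) (Q.ρ y) = reKilling L x y := by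
  rw [reKilling_apply, killingForm_conj Q.ρ_conj, reKilling_apply, Complex.star_def,
    Complex.conj_re]

theorem rho_rho (x : L) : Q.ρ (Q.ρ x) = x := Q.ρ_conj.involutive x

theorem rho_real_smul (r : ℝ) (x : L) : Q.ρ (r • x) = r • Q.ρ x := by
  rw [← Complex.coe_smul, map_smulₛₗ, Complex.conj_ofReal, Complex.coe_smul]

theorem reKilling_self_neg {x : L} (hx : Q.ρ x = x) (h0 : x ≠ 0) : reKilling L x x < 0 := by
  have := Q.ρ_cartan x h0
  rwa [hx] at this

theorem reKilling_self_nonpos {x : L} (hx : Q.ρ x = x) : reKilling L x x ≤ 0 := by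
  by_cases h0 : x = 0
  · simp [h0]
  · exact (Q.reKilling_self_neg hx h0).le

theorem reKilling_self_pos {x : L} (hx : Q.ρ x = -x) (h0 : x ≠ 0) : 0 < reKilling L x x := by
  have := Q.ρ_cartan x h0
  rw [hx, map_neg, Complex.neg_re] at this
  rw [reKilling_apply]; linarith

theorem reKilling_self_nonneg {x : L} (hx : Q.ρ x = -x) : 0 ≤ reKilling L x x := by
  by_cases h0 : x = 0
  · simp [h0]
  · exact (Q.reKilling_self_pos hx h0).le

theorem reKilling_eq_zero_of_forall (Q : HKQuadruple L) {x : L}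
    (h : ∀ y, reKilling L x y = 0) : x = 0 := by
  by_contra h0
  exact absurd (h (Q.ρ x)) (ne_of_lt (Q.ρ_cartan x h0))

variable [IsSimple ℂ L]

theorem lie_eq_smul {χ : Q.h → ℂ} {x : L} (hx : x ∈ rootSpace Q.h χ) (u : Q.h) :
    ⁅(u : L), x⁆ = χ u • x := lie_eq_smul_of_mem_rootSpace hx u

theorem mem_rootSpace_of_forall {χ : Q.h → ℂ} {x : L} (hx : ∀ u : Q.h, ⁅(u : L), x⁆ = χ u • x) :
    x ∈ rootSpace Q.h χ := by
  refine LieModule.weightSpace_le_genWeightSpace L χ ?_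
  rw [LieModule.mem_weightSpace]
  exact hx

/-- The roots are imaginary on the vectors of `h` which are fixed by `ρ`. -/
theorem apply_re_eq_zero {χ : Q.h → ℂ} {x : L} (hx : x ∈ rootSpace Q.h χ) (h0 : x ≠ 0) {u : Q.h}
    (hu : Q.ρ u = u) : (χ u).re = 0 := by
  have h1 := Q.ρ_cartan x h0
  have h2 : killingForm ℂ L ⁅(u : L), x⁆ (Q.ρ x) = -killingForm ℂ L x (Q.ρ ⁅(u : L), x⁆) := by
    rw [Q.ρ_conj.map_lie, hu, ← lie_skew, map_neg, LinearMap.neg_apply]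
    congr 1
    exact LieModule.traceForm_apply_lie_apply ℂ L L x _ _
  rw [Q.lie_eq_smul hx, map_smulₛₗ Q.ρ, map_smul, map_smul, LinearMap.smul_apply, smul_eq_mul,
    smul_eq_mul, ← add_eq_zero_iff_eq_neg, ← add_mul] at h2
  have h3 : killingForm ℂ L x (Q.ρ x) ≠ 0 := by
    intro h; rw [h] at h1; simp at h1
  have h4 := congrArg Complex.re ((mul_eq_zero.mp h2).resolve_right h3)
  simp at h4
  exact h4

theorem rho_mem_rootSpace (χ : Q.h → ℂ) {x : L} (hx : x ∈ rootSpace Q.h χ) :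
    Q.ρ x ∈ rootSpace Q.h (-χ) := by
  by_cases h0 : x = 0
  · rw [h0, map_zero]; exact zero_mem _
  refine Q.mem_rootSpace_of_forall fun u => ?_
  -- `u = a + i b` with `a` and `b` fixed by `ρ`, where the root is imaginary
  let v : Q.h := ⟨Q.ρ u, Q.ρ_h _ u.2⟩
  have key : (starRingEnd ℂ) (χ v) = -χ u := by
    have e1 : χ (u + v) = χ u + χ v := by
      have h := Q.lie_eq_smul hx (u + v)
      rw [AddMemClass.coe_add, add_lie, Q.lie_eq_smul hx, Q.lie_eq_smul hx, ← add_smul] at h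
      exact (smul_left_injective ℂ h0 h).symm
    have e2 : χ (Complex.I • (u - v)) = Complex.I * (χ u - χ v) := by
      have h := Q.lie_eq_smul hx (Complex.I • (u - v))
      rw [SetLike.val_smul, AddSubgroupClass.coe_sub, smul_lie, sub_lie, Q.lie_eq_smul hx,
        Q.lie_eq_smul hx, ← sub_smul, smul_smul] at h
      exact (smul_left_injective ℂ h0 h).symm
    have f1 := Q.apply_re_eq_zero hx h0 (u := u + v) (by
      change Q.ρ (u + Q.ρ u) = u + Q.ρ u
      rw [map_add, Q.rho_rho, add_comm])
    have f2 := Q.apply_re_eq_zero hx h0 (u := Complex.I • (u - v)) (by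
      change Q.ρ (Complex.I • (u - Q.ρ u)) = Complex.I • (u - Q.ρ u)
      rw [map_smulₛₗ, map_sub, Q.rho_rho, Complex.conj_I, neg_smul, ← smul_neg, neg_sub])
    rw [e1] at f1
    rw [e2] at f2
    apply Complex.ext
    · simp at f1 ⊢; linarith
    · simp at f2 ⊢; linarith
  have h := congrArg Q.ρ (Q.lie_eq_smul hx v)
  rw [Q.ρ_conj.map_lie, map_smulₛₗ, key] at h
  change ⁅Q.ρ (Q.ρ u), _⁆ = _ at h
  rw [Q.rho_rho] at h
  exact h

theorem rho_proj {S T : Set (Q.h → ℂ)} (h : ∀ χ, -χ ∈ T ↔ χ ∈ S) (x : L) :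
    Q.ρ (Q.proj S x) = Q.proj T (Q.ρ x) :=
  Q.map_proj_of_forall (f := Q.ρ.toAddMonoidHom) (fun χ => -χ)
    (fun χ _ hx => Q.rho_mem_rootSpace χ hx) h x

theorem rho_mem_weightSum {S T : Set (Q.h → ℂ)} (h : ∀ χ ∈ S, -χ ∈ T) {x : L}
    (hx : x ∈ Q.weightSum S) : Q.ρ x ∈ Q.weightSum T := by
  refine Q.weightSum_induction (p := fun x => Q.ρ x ∈ Q.weightSum T) hx ?_ ?_ ?_
  · rw [map_zero]; exact Submodule.zero_mem _
  · intro x y hx hy; rw [map_add]; exact Submodule.add_mem _ hx hy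
  · intro χ hχ x hx
    exact Q.mem_weightSum_of_mem (Q.rho_mem_rootSpace χ hx) (h χ hχ)

theorem lam_proj_zero (x : L) : Q.lam (Q.proj {0} x) = Q.proj {0} (Q.lam x) := by
  refine Q.map_proj_of_forall (f := Q.lam.toAddMonoidHom)
    (fun χ u => (starRingEnd ℂ) (χ ⟨Q.lam u, Q.lam_h _ u.2⟩)) (fun χ x hx => ?_) (fun χ => ?_) x
  · refine Q.mem_rootSpace_of_forall fun u => ?_
    have h := congrArg Q.lam (Q.lie_eq_smul hx ⟨Q.lam u, Q.lam_h _ u.2⟩)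
    rw [Q.lam_conj.map_lie, map_smulₛₗ, Q.lam_conj.involutive] at h
    exact h
  · rw [Set.mem_singleton_iff, Set.mem_singleton_iff]
    constructor
    · intro h
      ext u
      have := congrFun h ⟨Q.lam u, Q.lam_h _ u.2⟩
      have e : (⟨Q.lam (Q.lam u), Q.lam_h _ (Q.lam_h _ u.2)⟩ : Q.h) = u :=
        Subtype.ext (Q.lam_conj.involutive u)
      simp only [e, Pi.zero_apply, map_eq_zero] at this
      exact this
    · rintro rfl
      ext u; simp

theorem killingForm_eq_zero_of_mem_h {x y : L} (hx : x ∈ Q.h) (hy : Q.proj {0} y = 0) :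
    killingForm ℂ L x y = 0 := by
  have hy' : y ∈ Q.weightSum {0}ᶜ :=
    Q.mem_weightSum_of_proj_compl (by rw [compl_compl]; exact hy)
  refine Q.weightSum_induction (p := fun y => killingForm ℂ L x y = 0) hy' (map_zero _)
    (fun y z h h' => by rw [map_add, h, h', add_zero]) fun χ hχ y hy => ?_
  exact killingForm_apply_eq_zero_of_mem_rootSpace_of_add_ne_zero ℂ L Q.h (Q.mem_h_iff.mp hx) hy
    (by rw [zero_add]; exact hχ)

theorem reKilling_eq_zero_of_mem_h {x y : L} (hx : x ∈ Q.h) (hy : Q.proj {0} y = 0) :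
    reKilling L x y = 0 := by
  rw [reKilling_apply, Q.killingForm_eq_zero_of_mem_h hx hy, Complex.zero_re]

theorem proj_zero_mem_h (x : L) : Q.proj {0} x ∈ Q.h :=
  Q.mem_h_iff_weightSum.mpr (Q.proj_mem _ _)

theorem reKilling_proj_zero {x : L} (hx : x ∈ Q.h) (y : L) :
    reKilling L x (Q.proj {0} y) = reKilling L x y := by
  have h := Q.proj_add_compl {0} y
  conv_rhs => rw [← h, map_add]
  rw [Q.reKilling_eq_zero_of_mem_h hx (y := Q.proj {0}ᶜ y), add_zero]
  exact Q.proj_of_disjoint (T := {0}ᶜ) disjoint_compl_right (Q.proj_mem _ _)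

/-- The `ρ`-invariant part of a real vector orthogonal to `t` has no component in `h`. -/
theorem proj_zero_add_rho {ζ : L} (hζ : ζ ∈ Q.tPerp) (hl : Q.lam ζ = ζ) :
    Q.proj {0} (ζ + Q.ρ ζ) = 0 := by
  set w := Q.proj {0} (ζ + Q.ρ ζ) with hw
  have hwh : w ∈ Q.h := Q.proj_zero_mem_h _
  have hρ : Q.ρ w = w := by
    rw [hw, Q.rho_proj (T := {0}) (by simp), map_add, Q.rho_rho, add_comm]
  have hlw : Q.lam w = w := by
    rw [hw, Q.lam_proj_zero, map_add, ← Q.comm, hl]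
  have h1 : reKilling L w ζ = 0 :=
    (LinearMap.BilinForm.mem_orthogonal_iff.mp hζ) w ⟨hwh, hρ, hlw⟩
  have h2 : reKilling L w w = 0 := by
    conv_lhs => rw [hw]
    rw [reKilling_comm, Q.reKilling_proj_zero hwh, map_add, h1, zero_add]
    rw [← hρ, reKilling_rho, h1]
  by_contra h0
  exact absurd h2 (ne_of_lt (Q.reKilling_self_neg hρ h0))

end HKQuadruple

namespace PositiveSystem

open LieAlgebra LieAlgebra.IsKilling LieModule

variable {L : Type*} [LieRing L] [LieAlgebra ℂ L] [Module.Finite ℂ L] [IsSimple ℂ L]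
  (P : PositiveSystem L)

theorem eq_zero_of_forall_lie {u : L} (h : ∀ x : L, ⁅u, x⁆ = 0) : u = 0 := by
  have hc : u ∈ LieAlgebra.center ℂ L := by
    rw [LieModule.mem_maxTrivSubmodule]
    intro x
    rw [← lie_skew, h, neg_zero]
  rwa [LieAlgebra.center_eq_bot, LieSubmodule.mem_bot] at hc

/-- A vector of `h` on which all simple roots vanish is zero. -/
theorem eq_zero_of_forall_simple {u : L} (hu : u ∈ P.h)
    (h : ∀ β, P.IsSimpleRoot β → β ⟨u, hu⟩ = 0) : u = 0 := by
  classical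
  have hpos : ∀ γ ∈ P.pos, γ ⟨u, hu⟩ = 0 := by
    intro γ hγ
    obtain ⟨n, hn⟩ := P.exists_eq_sum_nat hγ
    rw [hn, Finset.sum_apply]
    refine Finset.sum_eq_zero fun i _ => ?_
    rw [Pi.smul_apply, h _ (P.mem_base_iff.mp i.2), smul_zero]
  refine eq_zero_of_forall_lie fun x => ?_
  · refine P.eq_of_forall_rootSpace (f := (ad ℂ L u).toAddMonoidHom) (g := 0) (fun χ x hx => ?_) x
    change ⁅u, x⁆ = 0
    have h1 : ⁅u, x⁆ = χ ⟨u, hu⟩ • x := lie_eq_smul_of_mem_rootSpace hx ⟨u, hu⟩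
    by_cases hx0 : x = 0
    · rw [hx0, lie_zero]
    suffices χ ⟨u, hu⟩ = 0 by rw [h1, this, zero_smul]
    by_cases hχ : χ = 0
    · rw [hχ]; rfl
    have hr : χ ∈ roots P.h := ⟨hχ, fun hb => hx0 (by rw [hb] at hx; simpa using hx)⟩
    rcases P.pos_or_neg χ hr with hp | hp
    · exact hpos _ hp
    · have := hpos _ hp
      rwa [Pi.neg_apply, neg_eq_zero] at this

end PositiveSystem

namespace HKQuadruple

open LieAlgebra LieAlgebra.IsKilling LieModule

variable {L : Type*} [LieRing L] [LieAlgebra ℂ L] [Module.Finite ℂ L] [IsSimple ℂ L]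
  (Q : HKQuadruple L)

/-- A vector homogeneous for the height which commutes with a principal nilpotent element and its
conjugate vanishes. -/
theorem eq_zero_of_lie_eq_zero {Φ s : L} (hΦ : Φ ∈ Q.weightSum {χ | Q.IsSimpleRoot (-χ)})
    (hΦ0 : ∀ β, Q.IsSimpleRoot β → Q.proj {-β} Φ ≠ 0) {d : Q.h}
    (hd : ∀ β, Q.IsSimpleRoot β → β d = 1)
    (hpos : ∀ χ ∈ Q.pos, χ d ≠ 0) {β₀ : Q.h → ℂ} (hβ₀ : Q.IsSimpleRoot β₀) {j : ℂ}
    (hs : s ∈ Q.weightSum {χ | χ d = j}) (h1 : ⁅Φ, s⁆ = 0) (h2 : ⁅Q.ρ Φ, s⁆ = 0) : s = 0 := by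
  by_contra hs0
  have he : Q.ρ Φ ∈ Q.weightSum {χ | Q.IsSimpleRoot χ} := by
    exact Q.rho_mem_weightSum (fun χ hχ => hχ) hΦ
  have he0 : ∀ β, Q.IsSimpleRoot β → Q.proj {β} (Q.ρ Φ) ≠ 0 := by
    intro β hβ h
    apply hΦ0 β hβ
    have := Q.rho_proj (S := {-β}) (T := {β}) (fun χ => by simp [neg_eq_iff_eq_neg]) Φ
    rw [h] at this
    rw [← Q.rho_rho (Q.proj {-β} Φ), this, map_zero]
  obtain ⟨n, hn⟩ := Q.exists_nat_of_lie_eq_zero he he0 hd hβ₀ hs0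
    (Q.lie_eq_smul_of_mem_weightSum (fun χ hχ => hχ) hs) h2
  have hρs : Q.ρ s ∈ Q.weightSum {χ | χ d = -j} := by
    exact Q.rho_mem_weightSum (fun χ (hχ : χ d = j) => show -χ d = -j by rw [hχ]) hs
  have hρs0 : Q.ρ s ≠ 0 := by
    intro h; apply hs0; rw [← Q.rho_rho s, h, map_zero]
  obtain ⟨m, hm⟩ := Q.exists_nat_of_lie_eq_zero he he0 hd hβ₀ hρs0
    (Q.lie_eq_smul_of_mem_weightSum (fun χ hχ => hχ) hρs)
    (by rw [← Q.ρ_conj.map_lie, h1, map_zero])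
  have hj : j = 0 := by
    have h3 : (n : ℂ) + m = 0 := by rw [← hn, ← hm]; ring
    have h4 : n + m = 0 := by exact_mod_cast h3
    have h5 : n = 0 := by omega
    rw [h5, Nat.cast_zero] at hn
    exact (mul_eq_zero.mp hn).resolve_left two_ne_zero
  have hsh : s ∈ Q.h := by
    rw [Q.mem_h_iff_weightSum]
    refine Q.mem_weightSum_of_proj_compl (Q.eq_zero_of_forall_proj fun χ => ?_)
    rw [Q.proj_proj]
    by_cases hχ : χ = 0
    · rw [hχ, Set.inter_compl_self]
      exact Q.proj_of_disjoint (T := {χ | χ d = j}) (by simp) hs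
    by_cases hr : χ ∈ roots Q.h
    · refine Q.proj_of_disjoint (T := {χ | χ d = j}) ?_ hs
      rw [Set.disjoint_left]
      rintro χ' ⟨rfl, -⟩ h4
      have h4 : χ' d = j := h4
      rw [hj] at h4
      rcases Q.pos_or_neg _ hr with hp | hp
      · exact hpos _ hp h4
      · exact hpos _ hp (by rw [Pi.neg_apply, h4, neg_zero])
    · have := Q.weightSum_mono Set.inter_subset_left (Q.proj_mem ({χ} ∩ {0}ᶜ) s)
      rw [Q.weightSum_singleton, PositiveSystem.rootSpace_eq_bot hr hχ] at this
      simpa using this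
  refine hs0 (Q.eq_zero_of_forall_simple hsh fun β hβ => ?_)
  have h3 : ⁅s, Q.proj {-β} Φ⁆ = 0 := by
    rw [← Q.proj_lie_h hsh, ← lie_skew, h1, neg_zero, map_zero]
  have h4 : ⁅s, Q.proj {-β} Φ⁆ = (-β) ⟨s, hsh⟩ • Q.proj {-β} Φ :=
    Q.lie_eq_smul (Q.mem_weightSum_singleton.mp (Q.proj_mem _ _)) ⟨s, hsh⟩
  rw [h3] at h4
  have := (smul_eq_zero.mp h4.symm).resolve_right (hΦ0 β hβ)
  rwa [Pi.neg_apply, neg_eq_zero] at this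

/-- The components of a vector outside the simple roots and their opposites vanish, when the
brackets of the vector with a principal nilpotent element and its conjugate belong to `h`. -/
theorem proj_eq_zero_of_lie_mem_h {Φ s : L} (hΦ : Φ ∈ Q.weightSum {χ | Q.IsSimpleRoot (-χ)})
    (hΦ0 : ∀ β, Q.IsSimpleRoot β → Q.proj {-β} Φ ≠ 0) {β₀ : Q.h → ℂ} (hβ₀ : Q.IsSimpleRoot β₀)
    (h1 : ⁅Φ, s⁆ ∈ Q.h) (h2 : ⁅Q.ρ Φ, s⁆ ∈ Q.h) {χ : Q.h → ℂ} (hχ : ¬Q.IsSimpleRoot χ)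
    (hχ' : ¬Q.IsSimpleRoot (-χ)) : Q.proj {χ} s = 0 := by
  obtain ⟨d, hd, hd'⟩ := Q.exists_height
  have hpos : ∀ χ ∈ Q.pos, χ d ≠ 0 := by
    intro χ hχ
    obtain ⟨n, hn, h, -⟩ := hd' χ hχ
    rw [h]; exact_mod_cast (by omega : n ≠ 0)
  by_cases hχ0 : χ ∈ roots Q.h ∨ χ = 0
  swap
  · push Not at hχ0
    have := Q.proj_mem {χ} s
    rw [Q.weightSum_singleton, PositiveSystem.rootSpace_eq_bot hχ0.1 hχ0.2] at this
    simpa using this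
  have hj : χ d ≠ 1 ∧ χ d ≠ -1 := by
    rcases hχ0 with hr | h0
    · rcases Q.pos_or_neg χ hr with hp | hp
      · obtain ⟨n, hn, h, hn'⟩ := hd' χ hp
        rw [h]
        constructor
        · intro h; exact hχ (hn' (by exact_mod_cast h))
        · intro h; have := congrArg Complex.re h
          simp at this
          have h' : (0:ℝ) ≤ n := n.cast_nonneg
          linarith
      · obtain ⟨n, hn, h, hn'⟩ := hd' _ hp
        rw [Pi.neg_apply, neg_eq_iff_eq_neg] at h
        rw [h]
        constructor
        · intro h; have := congrArg Complex.re h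
          simp at this
          have h' : (0:ℝ) ≤ n := n.cast_nonneg
          linarith
        · intro h; rw [neg_inj] at h; exact hχ' (hn' (by exact_mod_cast h))
    · rw [h0]; simp
  have hdis : ∀ k : ℂ, k ≠ 0 → ∀ x ∈ Q.h, Q.proj {χ | χ d = k} x = 0 := by
    intro k hk x hx
    refine Q.proj_of_disjoint (T := {0}) ?_ (Q.mem_h_iff_weightSum.mp hx)
    rw [Set.disjoint_singleton_right]
    intro h; exact hk (Eq.symm h)
  have he : Q.ρ Φ ∈ Q.weightSum {χ | Q.IsSimpleRoot χ} := by
    exact Q.rho_mem_weightSum (fun χ hχ => hχ) hΦ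
  have hz : Q.proj {χ' | χ' d = χ d} s = 0 := by
    refine Q.eq_zero_of_lie_eq_zero hΦ hΦ0 hd hpos hβ₀ (j := χ d) (Q.proj_mem _ _) ?_ ?_
    · rw [← Q.proj_lie (A := {χ | Q.IsSimpleRoot (-χ)}) (T := {χ' | χ' d = χ d - 1}) ?_ hΦ]
      · exact hdis _ (sub_ne_zero.mpr hj.1) _ h1
      · intro a ha b
        have := hd _ ha
        rw [Pi.neg_apply, neg_eq_iff_eq_neg] at this
        simp only [Set.mem_ofPred_eq, Pi.add_apply, this]
        constructor
        · intro h; linear_combination h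
        · intro h; linear_combination h
    · rw [← Q.proj_lie (A := {χ | Q.IsSimpleRoot χ}) (T := {χ' | χ' d = χ d + 1}) ?_ he]
      · exact hdis _ (fun h => hj.2 (by linear_combination h)) _ h2
      · intro a ha b
        have := hd _ ha
        simp only [Set.mem_ofPred_eq, Pi.add_apply, this]
        constructor
        · intro h; linear_combination h
        · intro h; linear_combination h
  have : Q.proj {χ} (Q.proj {χ' | χ' d = χ d} s) = Q.proj {χ} s := by
    rw [Q.proj_proj, Set.inter_eq_left.mpr (by simp)]
  rw [← this, hz, map_zero]

/-- A vector which commutes with a principal nilpotent element and its conjugate vanishes. -/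
theorem eq_zero_of_commute {Φ s : L} (hΦ : Φ ∈ Q.weightSum {χ | Q.IsSimpleRoot (-χ)})
    (hΦ0 : ∀ β, Q.IsSimpleRoot β → Q.proj {-β} Φ ≠ 0) {β₀ : Q.h → ℂ} (hβ₀ : Q.IsSimpleRoot β₀)
    (h1 : ⁅Φ, s⁆ = 0) (h2 : ⁅Q.ρ Φ, s⁆ = 0) : s = 0 := by
  obtain ⟨d, hd, hd'⟩ := Q.exists_height
  have hpos : ∀ χ ∈ Q.pos, χ d ≠ 0 := by
    intro χ hχ
    obtain ⟨n, hn, h, -⟩ := hd' χ hχ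
    rw [h]; exact_mod_cast (by omega : n ≠ 0)
  have he : Q.ρ Φ ∈ Q.weightSum {χ | Q.IsSimpleRoot χ} := by
    exact Q.rho_mem_weightSum (fun χ hχ => hχ) hΦ
  refine Q.eq_zero_of_forall_proj fun χ => ?_
  have hz : Q.proj {χ' | χ' d = χ d} s = 0 := by
    refine Q.eq_zero_of_lie_eq_zero hΦ hΦ0 hd hpos hβ₀ (j := χ d) (Q.proj_mem _ _) ?_ ?_
    · rw [← Q.proj_lie (A := {χ | Q.IsSimpleRoot (-χ)}) (T := {χ' | χ' d = χ d - 1}) ?_ hΦ, h1,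
        map_zero]
      intro a ha b
      have := hd _ ha
      rw [Pi.neg_apply, neg_eq_iff_eq_neg] at this
      simp only [Set.mem_ofPred_eq, Pi.add_apply, this]
      constructor
      · intro h; linear_combination h
      · intro h; linear_combination h
    · rw [← Q.proj_lie (A := {χ | Q.IsSimpleRoot χ}) (T := {χ' | χ' d = χ d + 1}) ?_ he, h2,
        map_zero]
      intro a ha b
      have := hd _ ha
      simp only [Set.mem_ofPred_eq, Pi.add_apply, this]
      constructor
      · intro h; linear_combination h
      · intro h; linear_combination h
  have : Q.proj {χ} (Q.proj {χ' | χ' d = χ d} s) = Q.proj {χ} s := by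
    rw [Q.proj_proj, Set.inter_eq_left.mpr (by simp)]
  rw [← this, hz, map_zero]

end HKQuadruple
/-! ### The adjoint group and its torus -/

section Group

open LieAlgebra

variable {L : Type*} [LieRing L] [LieAlgebra ℂ L] [Module.Finite ℂ L]

theorem real_smul_lie (r : ℝ) (x y : L) : ⁅r • x, y⁆ = r • ⁅x, y⁆ := by
  rw [← Complex.coe_smul, smul_lie, Complex.coe_smul]

theorem real_lie_smul (r : ℝ) (x y : L) : ⁅x, r • y⁆ = r • ⁅x, y⁆ := by
  rw [← Complex.coe_smul, lie_smul, Complex.coe_smul]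

variable (L) in
/-- The Lie bracket as a continuous real bilinear map. -/
noncomputable def lieB : L →L[ℝ] L →L[ℝ] L :=
  (LinearMap.mk₂ ℝ (fun x y : L => ⁅x, y⁆) add_lie real_smul_lie lie_add
    fun r x y => real_lie_smul r x y).toContinuousBilinearMap

@[simp] theorem lieB_apply (x y : L) : lieB L x y = ⁅x, y⁆ := rfl

theorem hasDerivAt_exp_apply (D : L →L[ℂ] L) {v : ℝ → L} {v' : L} {t : ℝ}
    (hv : HasDerivAt v v' t) :
    HasDerivAt (fun s : ℝ => NormedSpace.exp (s • D) (v s))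
      (NormedSpace.exp (t • D) (D (v t) + v')) t := by
  have h1 : HasDerivAt (fun s : ℝ => NormedSpace.exp (s • D))
      (NormedSpace.exp (t • D) * D) t := hasDerivAt_exp_smul_const (𝕂 := ℝ) D t
  have h2 := (ContinuousLinearMap.restrictScalarsL ℂ L L ℝ ℝ).hasFDerivAt.comp_hasDerivAt t h1
  have h3 := h2.clm_apply hv
  rw [map_add]
  exact h3

theorem expAd_apply (u x : L) : expAd u x = NormedSpace.exp (adL u) x := rfl

theorem adL_real_smul (s : ℝ) (u : L) : adL (s • u) = s • adL u := by
  ext x; exact real_smul_lie s u x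

theorem exp_adL_lie (u x y : L) :
    NormedSpace.exp (adL u) ⁅x, y⁆ = ⁅NormedSpace.exp (adL u) x, NormedSpace.exp (adL u) y⁆ := by
  -- the curve `s ↦ e^{-sD} [e^{sD} x, e^{sD} y]`, with `D = ad u`, has derivative zero
  have hd : ∀ x (s : ℝ), HasDerivAt (fun s : ℝ => NormedSpace.exp (s • adL u) x)
      (NormedSpace.exp (s • adL u) ⁅u, x⁆) s := by
    intro x s
    have := hasDerivAt_exp_apply (adL u) (hasDerivAt_const s x)
    rw [add_zero] at this
    exact this
  have hcomm : ∀ x (s : ℝ), NormedSpace.exp (s • adL u) ⁅u, x⁆ =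
      ⁅u, NormedSpace.exp (s • adL u) x⁆ := by
    intro x s
    have h : Commute (NormedSpace.exp (s • adL u)) (adL u) :=
      ((Commute.refl (adL u)).smul_left s).exp_left
    exact DFunLike.congr_fun h.eq x
  let F : ℝ → L := fun s => NormedSpace.exp (s • -adL u)
    ⁅NormedSpace.exp (s • adL u) x, NormedSpace.exp (s • adL u) y⁆
  have hF : ∀ s, HasDerivAt F 0 s := by
    intro s
    have h1 := hasDerivAt_exp_apply (-adL u)
      (((lieB L).hasFDerivAt.comp_hasDerivAt s (hd x s)).clm_apply (hd y s))
    have h0 : (-adL u) ((lieB L) ((NormedSpace.exp (s • adL u)) x) ((NormedSpace.exp (s • adL u)) y))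
        + ((lieB L) ((NormedSpace.exp (s • adL u)) ⁅u, x⁆) ((NormedSpace.exp (s • adL u)) y)
        + (lieB L) ((NormedSpace.exp (s • adL u)) x) ((NormedSpace.exp (s • adL u)) ⁅u, y⁆)) = 0 := by
      simp only [lieB_apply, hcomm]
      change -⁅u, _⁆ + _ = (0 : L)
      rw [leibniz_lie]
      abel
    have h2 := h1.congr_deriv (congrArg (fun z => NormedSpace.exp (s • -adL u) z) h0)
    rwa [map_zero] at h2
  have hc : F 1 = F 0 := is_const_of_deriv_eq_zero (fun s => (hF s).differentiableAt)
    (fun s => (hF s).deriv) 1 0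
  simp only [F, one_smul, zero_smul, NormedSpace.exp_zero] at hc
  have h3 := congrArg (fun z => NormedSpace.exp (adL u) z) hc
  have h4 := exp_neg_exp (-adL u) ⁅NormedSpace.exp (adL u) x, NormedSpace.exp (adL u) y⁆
  rw [neg_neg] at h4
  rw [h4] at h3
  exact h3.symm

theorem map_lie_adjointGroup (g : adjointGroup L) (x y : L) : g.1 ⁅x, y⁆ = ⁅g.1 x, g.1 y⁆ := by
  obtain ⟨g, hg⟩ := g
  induction hg using Subgroup.closure_induction generalizing x y with
  | mem g hg => obtain ⟨u, rfl⟩ := hg; exact exp_adL_lie u x y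
  | one => rfl
  | mul a b _ _ ha hb =>
    change a (b ⁅x, y⁆) = ⁅a (b x), a (b y)⁆
    rw [hb, ha]
  | inv a _ ha =>
    change a.symm ⁅x, y⁆ = ⁅a.symm x, a.symm y⁆
    rw [LinearEquiv.symm_apply_eq]
    have := ha (a.symm x) (a.symm y)
    change a _ = ⁅a _, a _⁆ at this
    rw [this, LinearEquiv.apply_symm_apply, LinearEquiv.apply_symm_apply]

/-- An element of the adjoint group as an automorphism of the Lie algebra. -/
noncomputable def toLieEquiv (g : adjointGroup L) : L ≃ₗ⁅ℂ⁆ L :=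
  { g.1 with map_lie' := fun {x y} => map_lie_adjointGroup g x y }

theorem symm_lie (g : adjointGroup L) (x y : L) : g.1.symm ⁅x, y⁆ = ⁅g.1.symm x, g.1.symm y⁆ :=
  map_lie_adjointGroup g⁻¹ x y

theorem killingForm_adjointGroup (g : adjointGroup L) (x y : L) :
    killingForm ℂ L (g.1 x) (g.1 y) = killingForm ℂ L x y :=
  killingForm_of_equiv_apply (toLieEquiv g) x y

end Group

namespace HKQuadruple

open LieAlgebra

variable {L : Type*} [LieRing L] [LieAlgebra ℂ L] [Module.Finite ℂ L] (Q : HKQuadruple L)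

theorem reKilling_adjointGroup (g : adjointGroup L) (x y : L) :
    reKilling L (g.1 x) (g.1 y) = reKilling L x y := by
  rw [reKilling_apply, killingForm_adjointGroup, reKilling_apply]

/-- The orthogonal projection onto `tPerp`. -/
noncomputable def perp : L →ₗ[ℝ] L := Q.tPerp.projection Q.t Q.isCompl_tPerp.symm

theorem mem_tPerp {x : L} : x ∈ Q.tPerp ↔ ∀ u ∈ Q.t, reKilling L u x = 0 :=
  LinearMap.BilinForm.mem_orthogonal_iff

theorem perp_mem (x : L) : Q.perp x ∈ Q.tPerp := Submodule.projection_apply_mem _ x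

theorem perp_of_mem {x : L} (hx : x ∈ Q.tPerp) : Q.perp x = x :=
  Submodule.projection_apply_left Q.isCompl_tPerp.symm ⟨x, hx⟩

theorem perp_of_mem_t {x : L} (hx : x ∈ Q.t) : Q.perp x = 0 :=
  (Submodule.projection_apply_eq_zero_iff Q.isCompl_tPerp.symm).mpr hx

theorem sub_perp_mem (x : L) : x - Q.perp x ∈ Q.t := by
  rw [← Submodule.projection_apply_eq_zero_iff Q.isCompl_tPerp.symm]
  change Q.perp (x - Q.perp x) = 0
  rw [map_sub, Q.perp_of_mem (Q.perp_mem x), sub_self]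

/-- A linear map which preserves `t` and `tPerp` commutes with the projection. -/
theorem map_perp_of_forall {A : L →ₗ[ℝ] L} (h : ∀ u ∈ Q.t, A u ∈ Q.t)
    (h' : ∀ u ∈ Q.tPerp, A u ∈ Q.tPerp) (x : L) : A (Q.perp x) = Q.perp (A x) := by
  have e : A x = A (Q.perp x) + A (x - Q.perp x) := by rw [← map_add]; congr 1; abel
  rw [e, map_add, Q.perp_of_mem (h' _ (Q.perp_mem x)), Q.perp_of_mem_t (h _ (Q.sub_perp_mem x)),
    add_zero]

variable {Q}

theorem mem_T_perp {g : adjointGroup L} (hg : g ∈ Q.T) (x : L) :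
    g.1 (Q.perp x) = Q.perp (g.1 x) := by
  refine Q.map_perp_of_forall (A := (g.1 : L →ₗ[ℂ] L).restrictScalars ℝ) (fun u hu => ?_)
    (fun u hu => ?_) x
  · change g.1 u ∈ Q.t
    rw [hg.1 u hu.1]; exact hu
  · rw [mem_tPerp] at hu ⊢
    intro v hv
    change reKilling L v (g.1 u) = 0
    rw [← hg.1 v hv.1, reKilling_adjointGroup]
    exact hu v hv

/-- The projection onto `tPerp` commutes with the adjoint action of `t`. -/
theorem lie_perp [IsSimple ℂ L] {τ : L} (hτ : τ ∈ Q.t) (x : L) :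
    ⁅τ, Q.perp x⁆ = Q.perp ⁅τ, x⁆ := by
  have h0 : ∀ u ∈ Q.h, ⁅τ, u⁆ = 0 := by
    intro u hu
    have := Q.lie_eq_smul (Q.mem_h_iff.mp hu) ⟨τ, hτ.1⟩
    simpa using this
  refine Q.map_perp_of_forall (A := (lieB L τ : L →ₗ[ℝ] L)) (fun u hu => ?_) (fun u hu => ?_) x
  · change ⁅τ, u⁆ ∈ Q.t
    rw [h0 u hu.1]; exact Submodule.zero_mem _
  · rw [mem_tPerp]
    intro v hv
    change reKilling L v ⁅τ, u⁆ = 0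
    rw [← reKilling_lie, ← lie_skew, h0 v hv.1, neg_zero, map_zero, LinearMap.zero_apply]

theorem mem_T_proj [IsSimple ℂ L] {g : adjointGroup L} (hg : g ∈ Q.T)
    (S : Set (Q.h → ℂ)) (x : L) :
    g.1 (Q.proj S x) = Q.proj S (g.1 x) := by
  refine Q.map_proj_of_forall (f := (g.1 : L →ₗ[ℂ] L).toAddMonoidHom) (fun χ => χ) (fun χ x hx => ?_)
    (fun χ => Iff.rfl) x
  refine Q.mem_rootSpace_of_forall fun u => ?_
  change ⁅(u : L), g.1 x⁆ = χ u • g.1 x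
  conv_lhs => rw [← hg.1 u u.2]
  rw [← map_lie_adjointGroup, Q.lie_eq_smul hx, map_smul]

/-! ### The Maurer–Cartan form in a frame -/

/-- Two elements of the group which take the base quadruple to the same point differ by an element
of the torus. -/
theorem exists_mem_T {g g' : adjointGroup L} (h : (g : Q.X) = (g' : Q.X)) :
    ∃ t ∈ Q.T, g' = g * t :=
  ⟨g⁻¹ * g', QuotientGroup.eq.mp h, by group⟩

theorem frame_spec (x : Q.X) : ∃ g : adjointGroup L, (g : Q.X) = x ∧ frame x = g.1 :=
  ⟨Quotient.out x, QuotientGroup.out_eq' x, rfl⟩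

/-- An operator which commutes with the torus can be transported to `x` by any frame. -/
theorem at'_eq {P : L → L} (hP : ∀ t ∈ Q.T, ∀ v, t.1 (P v) = P (t.1 v)) {g : adjointGroup L}
    {x : Q.X} (hg : (g : Q.X) = x) (v : L) : at' P x v = g.1 (P (g.1.symm v)) := by
  obtain ⟨g', hg', hf⟩ := frame_spec x
  obtain ⟨t, ht, rfl⟩ := exists_mem_T (hg.trans hg'.symm)
  rw [at', hf]
  change g.1 (t.1 (P (t.1.symm (g.1.symm v)))) = _
  rw [hP t ht, LinearEquiv.apply_symm_apply]

theorem mc_fund {g : adjointGroup L} {x : Q.X} (hg : (g : Q.X) = x) (v : L) :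
    mc x (fund v x) = g.1 (Q.perp (g.1.symm v)) :=
  at'_eq (P := Q.perp) (fun _ ht v => mem_T_perp ht v) hg v

theorem fund_surjective (x : Q.X) (p : Tan x) : ∃ v, p = fund v x := by
  obtain ⟨v, rfl⟩ := Submodule.mkQ_surjective _ p
  exact ⟨v, rfl⟩

theorem mem_tAt {g : adjointGroup L} {x : Q.X} (hg : (g : Q.X) = x) {v : L} :
    v ∈ tAt x ↔ g.1.symm v ∈ Q.t := by
  obtain ⟨g', hg', hf⟩ := frame_spec x
  obtain ⟨t, ht, rfl⟩ := exists_mem_T (hg.trans hg'.symm)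
  rw [tAt, hf]
  constructor
  · rintro ⟨u, hu, rfl⟩
    change g.1.symm (g.1 (t.1 u)) ∈ Q.t
    rw [LinearEquiv.symm_apply_apply, ht.1 u hu.1]; exact hu
  · intro h
    refine ⟨_, h, ?_⟩
    change g.1 (t.1 _) = v
    rw [ht.1 _ h.1, LinearEquiv.apply_symm_apply]

theorem fund_eq_fund_iff {g : adjointGroup L} {x : Q.X} (hg : (g : Q.X) = x) {v w : L} :
    fund v x = fund w x ↔ g.1.symm (v - w) ∈ Q.t := by
  rw [← mem_tAt hg]
  exact Submodule.Quotient.eq _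

theorem fund_mc (x : Q.X) (p : Tan x) : fund (mc x p) x = p := by
  obtain ⟨v, rfl⟩ := fund_surjective x p
  obtain ⟨g, hg, hf⟩ := frame_spec x
  rw [fund_eq_fund_iff hg, mc_fund hg, map_sub, LinearEquiv.symm_apply_apply, ← neg_sub]
  exact Submodule.neg_mem _ (Q.sub_perp_mem _)

theorem symm_mc_mem {g : adjointGroup L} {x : Q.X} (hg : (g : Q.X) = x) (p : Tan x) :
    g.1.symm (mc x p) ∈ Q.tPerp := by
  obtain ⟨v, rfl⟩ := fund_surjective x p
  rw [mc_fund hg, LinearEquiv.symm_apply_apply]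
  exact Q.perp_mem _

theorem eq_zero_of_mc_eq_zero {x : Q.X} {p : Tan x} (h : mc x p = 0) : p = 0 := by
  rw [← fund_mc x p, h]
  exact map_zero _

theorem mcPart_eq [IsSimple ℂ L] {g : adjointGroup L} {x : Q.X} (hg : (g : Q.X) = x)
    (S : Set (Q.h → ℂ)) (p : Tan x) : mcPart S x p = g.1 (Q.proj S (g.1.symm (mc x p))) :=
  at'_eq (fun _ ht v => mem_T_proj ht S v) hg _

theorem rhoAt_eq {g : adjointGroup L} {x : Q.X} (hg : (g : Q.X) = x) (v : L) :
    rhoAt x v = g.1 (Q.ρ (g.1.symm v)) :=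
  at'_eq (fun _ ht v => ht.2.1 v) hg _

theorem lamAt_eq {g : adjointGroup L} {x : Q.X} (hg : (g : Q.X) = x) (v : L) :
    lamAt x v = g.1 (Q.lam (g.1.symm v)) :=
  at'_eq (fun _ ht v => ht.2.2 v) hg _

end HKQuadruple

/-! ### Moving frames -/

section Frames

open LieAlgebra

variable {L : Type*} [LieRing L] [LieAlgebra ℂ L] [Module.Finite ℂ L]
  {E : Type*} [NormedAddCommGroup E] [NormedSpace ℝ E]

/-- An element of the adjoint group as a continuous real linear map. -/
noncomputable def gop (g : adjointGroup L) : L →L[ℝ] L :=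
  (LinearMap.toContinuousLinearMap (g.1 : L →ₗ[ℂ] L)).restrictScalars ℝ

@[simp] theorem gop_apply (g : adjointGroup L) (v : L) : gop g v = g.1 v := rfl

/-- An element of the adjoint group as a continuous real linear equivalence. -/
noncomputable def gopEquiv (g : adjointGroup L) : L ≃L[ℝ] L :=
  ContinuousLinearEquiv.equivOfInverse (gop g) (gop g⁻¹) (fun x => g.1.symm_apply_apply x)
    (fun x => g.1.apply_symm_apply x)

theorem contDiffAt_gop_inv {G : E → adjointGroup L} {y : E} {n : ℕ∞ω}
    (h : ContDiffAt ℝ n (fun y => gop (G y)) y) : ContDiffAt ℝ n (fun y => gop (G y)⁻¹) y := by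
  have h1 : (fun y => gop (G y)⁻¹) = fun y => ContinuousLinearMap.inverse (gop (G y)) := by
    funext y
    exact (ContinuousLinearMap.inverse_equiv (gopEquiv (G y))).symm
  rw [h1]
  exact (contDiffAt_map_inverse (gopEquiv (G y))).comp y h

variable [IsSimple ℂ L]

variable (L) in
theorem exists_adInv : ∃ J : (L →L[ℝ] L) →L[ℝ] L, ∀ a, J (lieB L a) = a := by
  have hinj : LinearMap.ker (lieB L : L →ₗ[ℝ] L →L[ℝ] L) = ⊥ := by
    rw [LinearMap.ker_eq_bot']
    intro a ha
    exact PositiveSystem.eq_zero_of_forall_lie fun x => DFunLike.congr_fun ha x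
  obtain ⟨J, hJ⟩ := LinearMap.exists_leftInverse_of_injective _ hinj
  exact ⟨LinearMap.toContinuousLinearMap J, fun a => DFunLike.congr_fun hJ a⟩

variable (L) in
/-- A left inverse of the adjoint representation. -/
noncomputable def adInv : (L →L[ℝ] L) →L[ℝ] L := (exists_adInv L).choose

@[simp] theorem adInv_lieB (a : L) : adInv L (lieB L a) = a := (exists_adInv L).choose_spec a

/-- The logarithmic derivative `G⁻¹ dG` of a moving frame, which belongs to `ad L ≃ L`. -/
noncomputable def logDer (G : E → adjointGroup L) (y : E) : E →L[ℝ] L :=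
  adInv L ∘L (ContinuousLinearMap.compL ℝ L L L (gop (G y)⁻¹) ∘L fderiv ℝ (fun y => gop (G y)) y)

theorem logDer_eq {G : E → adjointGroup L} {y w : E} {a : L}
    (h : ∀ v, fderiv ℝ (fun y => gop (G y)) y w v = (G y).1 ⁅a, v⁆) : logDer G y w = a := by
  have h1 : gop (G y)⁻¹ ∘L fderiv ℝ (fun y => gop (G y)) y w = lieB L a := by
    ext v
    change (G y).1.symm (fderiv ℝ (fun y => gop (G y)) y w v) = _
    rw [h, LinearEquiv.symm_apply_apply, lieB_apply]
  change adInv L (gop (G y)⁻¹ ∘L fderiv ℝ (fun y => gop (G y)) y w) = a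
  rw [h1, adInv_lieB]

theorem fderiv_gop_apply {G : E → adjointGroup L} {y : E}
    (h : DifferentiableAt ℝ (fun y => gop (G y)) y) (w : E) (v : L) :
    fderiv ℝ (fun y => gop (G y)) y w v = fderiv ℝ (fun y => (G y).1 v) y w := by
  have h1 := (h.hasFDerivAt.clm_apply (hasFDerivAt_const v y)).fderiv
  simp only [gop_apply] at h1
  rw [h1]; simp

/-- All derivations of `L` are inner. -/
theorem logDer_spec {G : E → adjointGroup L} {y : E}
    (h : DifferentiableAt ℝ (fun y => gop (G y)) y) (w : E) (v : L) :
    fderiv ℝ (fun y => gop (G y)) y w v = (G y).1 ⁅logDer G y w, v⁆ := by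
  set B := fderiv ℝ (fun y => gop (G y)) y w with hB
  have hd : ∀ v, HasFDerivAt (fun y => (G y).1 v)
      ((fderiv ℝ (fun y => gop (G y)) y).flip v) y := by
    intro v
    exact (h.hasFDerivAt.clm_apply (hasFDerivAt_const v y)).congr_fderiv (by ext; simp)
  have hBv : ∀ v, B v = fderiv ℝ (fun y => (G y).1 v) y w := fun v => by
    rw [(hd v).fderiv]; rfl
  have hsmul : ∀ (c : ℂ) v, B (c • v) = c • B v := by
    intro c v
    have h1 : (fun y => (G y).1 (c • v)) = fun y => c • (G y).1 v := by
      funext y; rw [map_smul]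
    rw [hBv, h1, fderiv_fun_const_smul (hd v).differentiableAt, hBv]; rfl
  have hlie : ∀ x z, B ⁅x, z⁆ = ⁅B x, (G y).1 z⁆ + ⁅(G y).1 x, B z⁆ := by
    intro x z
    have h1 : (fun y => (G y).1 ⁅x, z⁆) = fun y => lieB L ((G y).1 x) ((G y).1 z) := by
      funext y; rw [map_lie_adjointGroup]; rfl
    have h2 : HasFDerivAt (fun y => lieB L ((G y).1 x) ((G y).1 z)) _ y :=
      ((lieB L).hasFDerivAt.comp y (hd x)).clm_apply (hd z)
    rw [hBv, h1, h2.fderiv]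
    simp [hB, add_comm]
  let D : LieDerivation ℂ L L :=
    { toFun := fun v => (G y).1.symm (B v)
      map_add' := fun x z => by rw [map_add, map_add]
      map_smul' := fun c x => by rw [hsmul, map_smul]; rfl
      leibniz' := fun x z => by
        change (G y).1.symm (B ⁅x, z⁆) = ⁅x, (G y).1.symm (B z)⁆ - ⁅z, (G y).1.symm (B x)⁆
        rw [hlie, map_add, symm_lie, symm_lie, LinearEquiv.symm_apply_apply,
          LinearEquiv.symm_apply_apply, ← lie_skew z]
        abel }
  obtain ⟨a, ha⟩ := LieDerivation.IsKilling.exists_eq_ad D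
  have key : ∀ v, B v = (G y).1 ⁅a, v⁆ := by
    intro v
    have : ⁅a, v⁆ = (G y).1.symm (B v) := by
      change _ = D v
      rw [← ha, LieDerivation.ad_apply_apply]
    rw [this, LinearEquiv.apply_symm_apply]
  rw [key, logDer_eq key]

theorem contDiffAt_logDer {G : E → adjointGroup L} {y : E} {n : ℕ}
    (h : ContDiffAt ℝ (n + 1) (fun y => gop (G y)) y) : ContDiffAt ℝ n (logDer G) y := by
  have h1 : ContDiffAt ℝ n (fderiv ℝ (fun y => gop (G y))) y :=
    h.fderiv_right le_rfl
  have h2 := contDiffAt_gop_inv (h.of_le (by exact_mod_cast Nat.le_succ n : (n : ℕ∞ω) ≤ n + 1))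
  exact contDiffAt_const.clm_comp
    (((ContinuousLinearMap.compL ℝ L L L).contDiff.contDiffAt.comp y h2).clm_comp h1)

theorem hasFDerivAt_frame_apply {G : E → adjointGroup L} {y : E}
    (h : DifferentiableAt ℝ (fun y => gop (G y)) y) {F : E → L} {F' : E →L[ℝ] L}
    (hF : HasFDerivAt F F' y) :
    HasFDerivAt (fun y => (G y).1 (F y))
      (gop (G y) ∘L ((lieB L).flip (F y) ∘L logDer G y + F')) y := by
  refine (h.hasFDerivAt.clm_apply hF).congr_fderiv ?_
  ext w
  simp [logDer_spec h, add_comm]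

theorem hasFDerivAt_frame_symm_apply {G : E → adjointGroup L} {y : E}
    (h : ContDiffAt ℝ 1 (fun y => gop (G y)) y) {F : E → L} {F' : E →L[ℝ] L}
    (hF : HasFDerivAt F F' y) :
    HasFDerivAt (fun y => (G y).1.symm (F y))
      (gop (G y)⁻¹ ∘L F' - (lieB L).flip ((G y).1.symm (F y)) ∘L logDer G y) y := by
  have h0 := ((contDiffAt_gop_inv h).differentiableAt one_ne_zero).hasFDerivAt.clm_apply hF
  change HasFDerivAt (fun y => (G y).1.symm (F y)) _ y at h0
  obtain ⟨K, hK⟩ : ∃ K, HasFDerivAt (fun y => (G y).1.symm (F y)) K y := ⟨_, h0⟩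
  have h1 := hasFDerivAt_frame_apply (h.differentiableAt one_ne_zero) hK
  simp only [LinearEquiv.apply_symm_apply] at h1
  have h2 := hF.unique h1
  refine hK.congr_fderiv ?_
  ext w
  have h3 := congrArg (fun z => (G y).1.symm z) (DFunLike.congr_fun h2 w)
  simp only [ContinuousLinearMap.comp_apply, gop_apply, LinearEquiv.symm_apply_apply,
    add_apply] at h3
  change K w = (G y).1.symm (F' w) - _
  rw [h3]
  simp

/-- The Maurer–Cartan structure equation. -/
theorem structure_equation {G : E → adjointGroup L} {y : E}
    (h : ContDiffAt ℝ 2 (fun y => gop (G y)) y) (v w : E) :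
    fderiv ℝ (logDer G) y v w - fderiv ℝ (logDer G) y w v + ⁅logDer G y v, logDer G y w⁆ = 0 := by
  have hev : ∀ᶠ y' in 𝓝 y, DifferentiableAt ℝ (fun y => gop (G y)) y' := by
    filter_upwards [h.eventually (by simp)] with y' hy'
    exact hy'.differentiableAt two_ne_zero
  have hA : DifferentiableAt ℝ (logDer G) y :=
    (contDiffAt_logDer (n := 1) (by exact_mod_cast h)).differentiableAt one_ne_zero
  have hB : DifferentiableAt ℝ (fderiv ℝ (fun y => gop (G y))) y :=
    (h.fderiv_right (m := 1) (by norm_num)).differentiableAt one_ne_zero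
  have hsymm : IsSymmSndFDerivAt ℝ (fun y => gop (G y)) y :=
    h.isSymmSndFDerivAt (by simp)
  have key : ∀ (v w : E) (u : L), fderiv ℝ (fderiv ℝ (fun y => gop (G y))) y v w u =
      (G y).1 (⁅logDer G y v, ⁅logDer G y w, u⁆⁆ + ⁅fderiv ℝ (logDer G) y v w, u⁆) := by
    intro v w u
    have h1 := (hB.hasFDerivAt.clm_apply (hasFDerivAt_const w y)).clm_apply (hasFDerivAt_const u y)
    have h2 : HasFDerivAt (fun y => ⁅logDer G y w, u⁆) _ y :=
      ((lieB L).hasFDerivAt.comp y (hA.hasFDerivAt.clm_apply (hasFDerivAt_const w y))).clm_apply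
        (hasFDerivAt_const u y)
    have h3 := hasFDerivAt_frame_apply (h.differentiableAt two_ne_zero) h2
    have h4 : (fun y => fderiv ℝ (fun y => gop (G y)) y w u) =ᶠ[𝓝 y]
        fun y => (G y).1 ⁅logDer G y w, u⁆ := by
      filter_upwards [hev] with y' hy'
      exact logDer_spec hy' w u
    have h5 := (h1.congr_of_eventuallyEq h4.symm).unique h3
    have h6 := DFunLike.congr_fun h5 v
    simpa using h6
  refine PositiveSystem.eq_zero_of_forall_lie fun u => ?_
  have h1 := key v w u
  rw [hsymm.eq v w, key w v u] at h1
  have h2 := (G y).1.injective h1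
  rw [add_lie, sub_lie, lie_lie]
  rw [← sub_eq_zero] at h2
  rw [← neg_eq_zero, ← h2]
  abel

end Frames

/-! ### Covariant derivatives of invariant forms -/

namespace HKQuadruple

open LieAlgebra

variable {L : Type*} [LieRing L] [LieAlgebra ℂ L] [Module.Finite ℂ L] {Q : HKQuadruple L}

theorem lieDer_eq {u : L} {H : Q.X → L} {x : Q.X} {c : ℝ → L} {c' : L}
    (hH : ∀ s : ℝ, H (expG (s • u) • x) = expAd (s • u) (c s)) (hc : HasDerivAt c c' 0) :
    lieDer u H x = ⁅u, c 0⁆ + c' := by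
  have h1 := hasDerivAt_exp_apply (adL u) hc
  rw [zero_smul, NormedSpace.exp_zero] at h1
  rw [lieDer]
  have h2 : (fun s : ℝ => H (expG (s • u) • x)) = fun s => NormedSpace.exp (s • adL u) (c s) := by
    funext s; rw [hH, expAd_apply, adL_real_smul]
  rw [h2, h1.deriv]; rfl

theorem hasDerivAt_expAd_symm (u v : L) :
    HasDerivAt (fun s : ℝ => (expAd (s • u)).symm v) (-⁅u, v⁆) 0 := by
  have h1 := hasDerivAt_exp_apply (-adL u) (hasDerivAt_const (0 : ℝ) v)
  rw [zero_smul, NormedSpace.exp_zero, add_zero] at h1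
  have h2 : (fun s : ℝ => (expAd (s • u)).symm v) =
      fun s => NormedSpace.exp (s • -adL u) v := by
    funext s
    change NormedSpace.exp (-adL (s • u)) v = _
    rw [adL_real_smul, smul_neg]
  rw [h2]; exact h1

theorem expAd_zero_symm (u v : L) : (expAd ((0 : ℝ) • u)).symm v = v := by
  change NormedSpace.exp (-adL ((0 : ℝ) • u)) v = _
  rw [adL_real_smul, zero_smul, neg_zero, NormedSpace.exp_zero]; rfl

/-- The derivative of an invariant one-form along the infinitesimal action of `G`. -/
theorem lieDer_oneForm {Ω : ∀ x : Q.X, Tan x → L} {W : L →L[ℝ] L}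
    (hΩ : ∀ (g : adjointGroup L) v, Ω (g : Q.X) (fund v (g : Q.X)) = g.1 (W (g.1.symm v)))
    (g : adjointGroup L) (u v : L) :
    lieDer u (fun y => Ω y (fund v y)) (g : Q.X) =
      ⁅u, g.1 (W (g.1.symm v))⁆ - g.1 (W (g.1.symm ⁅u, v⁆)) := by
  let W' : L →L[ℝ] L := gop g ∘L W ∘L gop g⁻¹
  rw [lieDer_eq (c := fun s => W' ((expAd (s • u)).symm v)) (fun s => ?_)
    (W'.hasFDerivAt.comp_hasDerivAt 0 (hasDerivAt_expAd_symm u v)), expAd_zero_symm, map_neg,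
    ← sub_eq_add_neg]
  · rfl
  · exact hΩ (expG (s • u) * g) v

theorem dNabla₁_eq {Ω : ∀ x : Q.X, Tan x → L} {W : L →L[ℝ] L}
    (hΩ : ∀ (g : adjointGroup L) v, Ω (g : Q.X) (fund v (g : Q.X)) = g.1 (W (g.1.symm v)))
    {g : adjointGroup L} {x : Q.X} (hg : (g : Q.X) = x) (p q : Tan x) :
    dNabla₁ Ω x p q = -g.1 (W ⁅g.1.symm (mc x p), g.1.symm (mc x q)⁆) := by
  subst hg
  have hp : ∀ p : Tan (g : Q.X), Ω _ p = g.1 (W (g.1.symm (mc _ p))) := by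
    intro p
    conv_lhs => rw [← fund_mc _ p]
    exact hΩ _ _
  rw [dNabla₁, lieDer_oneForm hΩ, lieDer_oneForm hΩ, hΩ, hp p, hp q, ← lie_skew (mc _ p) (mc _ q), map_neg,
    map_neg, map_neg, ← symm_lie]
  rw [← lie_skew (mc _ p) (mc _ q), map_neg, map_neg, map_neg]
  abel

/-- The derivative of an invariant two-form along the infinitesimal action of `G`. -/
theorem lieDer_twoForm {Ω : ∀ x : Q.X, Tan x → Tan x → L} {B : L →L[ℝ] L →L[ℝ] L}
    (hΩ : ∀ (g : adjointGroup L) v w, Ω (g : Q.X) (fund v (g : Q.X)) (fund w (g : Q.X)) =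
      g.1 (B (g.1.symm v) (g.1.symm w))) (g : adjointGroup L) (u v w : L) :
    lieDer u (fun y => Ω y (fund v y) (fund w y)) (g : Q.X) =
      ⁅u, g.1 (B (g.1.symm v) (g.1.symm w))⁆ - g.1 (B (g.1.symm ⁅u, v⁆) (g.1.symm w))
        - g.1 (B (g.1.symm v) (g.1.symm ⁅u, w⁆)) := by
  have hc := (gop g).hasFDerivAt.comp_hasDerivAt 0
    ((B.hasFDerivAt.comp_hasDerivAt 0
      ((gop g⁻¹).hasFDerivAt.comp_hasDerivAt 0 (hasDerivAt_expAd_symm u v))).clm_apply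
      ((gop g⁻¹).hasFDerivAt.comp_hasDerivAt 0 (hasDerivAt_expAd_symm u w)))
  rw [lieDer_eq (fun s => ?_) hc]
  · simp only [Function.comp_apply, expAd_zero_symm, map_neg, neg_apply,
      map_add]
    simp only [gop_apply]
    rw [sub_sub, sub_eq_add_neg, neg_add]
    rfl
  · exact hΩ (expG (s • u) * g) v w

theorem dNabla₂_eq {Ω : ∀ x : Q.X, Tan x → Tan x → L} {B : L →L[ℝ] L →L[ℝ] L}
    (hΩ : ∀ (g : adjointGroup L) v w, Ω (g : Q.X) (fund v (g : Q.X)) (fund w (g : Q.X)) =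
      g.1 (B (g.1.symm v) (g.1.symm w))) (hB : ∀ a b, B a b = -B b a)
    {g : adjointGroup L} {x : Q.X} (hg : (g : Q.X) = x) (p q r : Tan x) {a b c : L}
    (ha : mc x p = g.1 a) (hb : mc x q = g.1 b) (hc : mc x r = g.1 c) :
    dNabla₂ Ω x p q r = g.1 (B ⁅a, c⁆ b - B ⁅a, b⁆ c - B ⁅b, c⁆ a) := by
  subst hg
  have hp : ∀ {p : Tan (g : Q.X)} {a : L}, mc _ p = g.1 a → p = fund (g.1 a) (g : Q.X) := by
    intro p a h
    rw [← h, fund_mc]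
  rw [dNabla₂]
  simp only [ha, hb, hc, lieDer_twoForm hΩ]
  rw [hp ha, hp hb, hp hc]
  simp only [hΩ, ← map_lie_adjointGroup, LinearEquiv.symm_apply_apply]
  simp only [← map_sub, ← map_add]
  congr 1
  rw [← lie_skew a b, ← lie_skew a c, ← lie_skew b c]
  simp only [map_neg, neg_apply]
  rw [hB a ⁅c, b⁆, hB b ⁅c, a⁆]
  abel

end HKQuadruple

/-! ### The tangent map in a frame -/

section Charts

variable {M : Type*} [TopologicalSpace M] [ChartedSpace (EuclideanSpace ℝ (Fin 2)) M]
  {V : Type*} [NormedAddCommGroup V] [NormedSpace ℝ V]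

/-- The derivative of a vector-valued map at a point, as a linear map on the model space. -/
noncomputable def derivAt (F : M → V) (m : M) : EuclideanSpace ℝ (Fin 2) →L[ℝ] V :=
  mfderiv (𝓡 2) 𝓘(ℝ, V) F m

/-- At the centre of a chart, the manifold derivative is the derivative in the chart. -/
theorem hasFDerivAt_comp_chart_center {F : M → V} {m : M}
    (h : MDifferentiableAt (𝓡 2) 𝓘(ℝ, V) F m) :
    HasFDerivAt (F ∘ (extChartAt (𝓡 2) m).symm)
      (derivAt F m) (extChartAt (𝓡 2) m m) := by
  have h1 := h.hasMFDerivAt.2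
  simp only [modelWithCornersSelf_coe, Set.range_id] at h1
  exact hasFDerivWithinAt_univ.mp h1

/-- The derivative of a parametrisation of the surface, as a linear map into the model space. -/
noncomputable def paramDeriv {E : Type*} [NormedAddCommGroup E] [NormedSpace ℝ E] (ψ : E → M)
    (y : E) : E →L[ℝ] EuclideanSpace ℝ (Fin 2) :=
  mfderiv 𝓘(ℝ, E) (𝓡 2) ψ y

theorem hasFDerivAt_comp_param {E : Type*} [NormedAddCommGroup E] [NormedSpace ℝ E]
    {F : M → V} {ψ : E → M} {y : E}
    (h : MDifferentiableAt (𝓡 2) 𝓘(ℝ, V) F (ψ y)) (hψ : MDifferentiableAt 𝓘(ℝ, E) (𝓡 2) ψ y) :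
    HasFDerivAt (fun y => F (ψ y)) (derivAt F (ψ y) ∘L paramDeriv ψ y) y :=
  (h.hasMFDerivAt.comp y hψ.hasMFDerivAt).hasFDerivAt

variable [IsManifold (𝓡 2) ∞ M]

theorem mdifferentiableAt_chart_symm (m : M) {y : EuclideanSpace ℝ (Fin 2)}
    (hy : y ∈ (extChartAt (𝓡 2) m).target) :
    MDifferentiableAt 𝓘(ℝ, EuclideanSpace ℝ (Fin 2)) (𝓡 2) (extChartAt (𝓡 2) m).symm y := by
  have : IsManifold (𝓡 2) 1 M := IsManifold.of_le (n := ∞) (by exact_mod_cast le_top)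
  exact (mdifferentiableOn_extChartAt_symm y hy).mdifferentiableAt
    ((isOpen_extChartAt_target m).mem_nhds hy)

end Charts

section Frames

variable {L : Type*} [LieRing L] [LieAlgebra ℂ L] [Module.Finite ℂ L]
  {E : Type*} [NormedAddCommGroup E] [NormedSpace ℝ E]

variable (L) in
theorem exists_gop_eq : ∃ R : (Fin (Module.finrank ℝ L) → L) →L[ℝ] (L →L[ℝ] L),
    ∀ g : adjointGroup L, gop g = R fun i => g.1 (Module.finBasis ℝ L i) := by
  let b := Module.finBasis ℝ L
  let R : (Fin (Module.finrank ℝ L) → L) →ₗ[ℝ] (L →L[ℝ] L) :=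
    { toFun := fun v => LinearMap.toContinuousLinearMap (b.constr ℝ v)
      map_add' := fun v w => by rw [map_add, map_add]
      map_smul' := fun c v => by rw [map_smul, map_smul]; rfl }
  refine ⟨LinearMap.toContinuousLinearMap R, fun g => ?_⟩
  apply ContinuousLinearMap.coe_injective
  refine b.ext fun i => ?_
  change g.1 (b i) = b.constr ℝ (fun i => g.1 (b i)) (b i)
  rw [Module.Basis.constr_basis]

theorem differentiableAt_gop {G : E → adjointGroup L} {y : E}
    (h : ∀ v, DifferentiableAt ℝ (fun y => (G y).1 v) y) :
    DifferentiableAt ℝ (fun y => gop (G y)) y := by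
  obtain ⟨R, hR⟩ := exists_gop_eq L
  simp only [hR]
  exact R.differentiableAt.comp y (differentiableAt_pi.mpr fun i => h _)

theorem contDiffAt_gop {G : E → adjointGroup L} {y : E} {n : ℕ∞ω}
    (h : ∀ v, ContDiffAt ℝ n (fun y => (G y).1 v) y) : ContDiffAt ℝ n (fun y => gop (G y)) y := by
  obtain ⟨R, hR⟩ := exists_gop_eq L
  simp only [hR]
  exact R.contDiff.contDiffAt.comp y (contDiffAt_pi.mpr fun i => h _)

end Frames

namespace HKQuadruple

open LieAlgebra

variable {L : Type*} [LieRing L] [LieAlgebra ℂ L] [Module.Finite ℂ L] [IsSimple ℂ L]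
  {Q : HKQuadruple L}
  {M : Type*} [TopologicalSpace M] [ChartedSpace (EuclideanSpace ℝ (Fin 2)) M]
  {E : Type*} [NormedAddCommGroup E] [NormedSpace ℝ E]

theorem reKilling_conj_left {σ : L →ₗ⋆[ℂ] L} (hσ : IsConjugation σ) (x y : L) :
    reKilling L (σ x) y = reKilling L x (σ y) := by
  conv_lhs => rw [← hσ.involutive y]
  rw [reKilling_apply, killingForm_conj hσ, Complex.star_def, Complex.conj_re, reKilling_apply]

variable (L) in
/-- The real part of the Killing form as a continuous bilinear map. -/
noncomputable def reK : L →L[ℝ] L →L[ℝ] ℝ := (reKilling L).toContinuousBilinearMap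

@[simp] theorem reK_apply (x y : L) : reK L x y = reKilling L x y := rfl

/-- The difference of the logarithmic derivatives of two frames, taken in the second one, is fixed
by a conjugation which commutes with the torus. -/
theorem conj_logDer_sub {G G' : E → adjointGroup L} {y : E}
    (hG : DifferentiableAt ℝ (fun y => gop (G y)) y)
    (hG' : DifferentiableAt ℝ (fun y => gop (G' y)) y)
    (h : ∀ᶠ y' in 𝓝 y, (G y' : Q.X) = (G' y' : Q.X)) {σ : L →ₗ⋆[ℂ] L} (hσ : IsConjugation σ)
    (hT : ∀ t ∈ Q.T, ∀ x, t.1 (σ x) = σ (t.1 x)) (w : E) {D : L}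
    (hD : D = (G' y).1.symm ((G y).1 (logDer G y w)) - logDer G' y w) : σ D = D := by
  obtain ⟨t, ht, hGt⟩ := exists_mem_T h.self_of_nhds.symm
  have hev : ∀ x z, (fun y' => reK L ((G y').1 (σ x)) ((G' y').1 z)) =ᶠ[𝓝 y]
      fun y' => reK L ((G y').1 x) ((G' y').1 (σ z)) := by
    intro x z
    filter_upwards [h] with y' hy'
    obtain ⟨s, hs, hGs⟩ := exists_mem_T hy'.symm
    rw [hGs]
    change reKilling L ((G' y').1 (s.1 (σ x))) ((G' y').1 z) =
      reKilling L ((G' y').1 (s.1 x)) ((G' y').1 (σ z))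
    rw [reKilling_adjointGroup, reKilling_adjointGroup, hT s hs, reKilling_conj_left hσ]
  have hd : ∀ x z, HasFDerivAt (fun y' => reK L ((G y').1 x) ((G' y').1 z)) _ y := fun x z =>
    ((reK L).hasFDerivAt.comp y (hasFDerivAt_frame_apply hG (hasFDerivAt_const x y))).clm_apply
      (hasFDerivAt_frame_apply hG' (hasFDerivAt_const z y))
  have key : ∀ x z, reKilling L ⁅D, σ (t.1 x)⁆ z = reKilling L (σ ⁅D, t.1 x⁆) z := by
    intro x z
    have h1 := DFunLike.congr_fun (((hd (σ x) z).congr_of_eventuallyEq (hev x z).symm).unique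
      (hd x (σ z))) w
    have hDt : D = t.1 (logDer G y w) - logDer G' y w := by
      rw [hD, hGt]
      change (G' y).1.symm ((G' y).1 (t.1 _)) - _ = _
      rw [LinearEquiv.symm_apply_apply]
    have hGt' : ∀ v, (G y).1 v = (G' y).1 (t.1 v) := fun v => by rw [hGt]; rfl
    simp only [ContinuousLinearMap.comp_apply, add_apply,
      ContinuousLinearMap.flip_apply, lieB_apply, gop_apply, Function.comp_apply,
      add_zero, reK_apply, hGt', reKilling_adjointGroup] at h1
    simp only [map_lie_adjointGroup] at h1
    rw [reKilling_conj_left hσ, hDt, sub_lie, sub_lie, map_sub, map_sub, LinearMap.sub_apply,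
      LinearMap.sub_apply, reKilling_lie' (logDer G' y w), reKilling_lie' (logDer G' y w), ← hT t ht]
    linarith
  have h2 : ∀ z : L, ⁅D - σ D, z⁆ = 0 := by
    intro z
    have e : z = σ (t.1 (t.1.symm (σ z))) := by
      rw [LinearEquiv.apply_symm_apply, hσ.involutive]
    refine Q.reKilling_eq_zero_of_forall fun z' => ?_
    rw [e, sub_lie, map_sub, LinearMap.sub_apply, key, hσ.map_lie, sub_self]
  exact (sub_eq_zero.mp (PositiveSystem.eq_zero_of_forall_lie h2)).symm

/-- Two frames along the same map have the same logarithmic derivative modulo `t`. -/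
theorem fund_logDer_eq {G G' : E → adjointGroup L} {y : E} {x : Q.X} (hx : (G' y : Q.X) = x)
    (hG : DifferentiableAt ℝ (fun y => gop (G y)) y)
    (hG' : DifferentiableAt ℝ (fun y => gop (G' y)) y)
    (h : ∀ᶠ y' in 𝓝 y, (G y' : Q.X) = (G' y' : Q.X)) (w : E) :
    fund ((G y).1 (logDer G y w)) x = fund ((G' y).1 (logDer G' y w)) x := by
  rw [fund_eq_fund_iff hx, map_sub, LinearEquiv.symm_apply_apply]
  refine ⟨?_, conj_logDer_sub hG hG' h Q.ρ_conj (fun t ht => ht.2.1) w rfl,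
    conj_logDer_sub hG hG' h Q.lam_conj (fun t ht => ht.2.2) w rfl⟩
  rw [Q.mem_h_iff]
  refine Q.mem_rootSpace_of_forall fun u => ?_
  rw [Pi.zero_apply, zero_smul, ← lie_skew, neg_eq_zero]
  obtain ⟨t, ht, hGt⟩ := exists_mem_T h.self_of_nhds.symm
  have hev : (fun y' => (G y').1 (u : L)) =ᶠ[𝓝 y] fun y' => (G' y').1 (u : L) := by
    filter_upwards [h] with y' hy'
    obtain ⟨s, hs, hGs⟩ := exists_mem_T hy'.symm
    rw [hGs]
    change (G' y').1 (s.1 u) = _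
    rw [hs.1 u u.2]
  have h1 := DFunLike.congr_fun
    (((hasFDerivAt_frame_apply hG (hasFDerivAt_const (u : L) y)).congr_of_eventuallyEq
      hev.symm).unique (hasFDerivAt_frame_apply hG' (hasFDerivAt_const (u : L) y))) w
  simp only [ContinuousLinearMap.comp_apply, ContinuousLinearMap.flip_apply, lieB_apply, gop_apply,
    add_zero] at h1
  have h2 := congrArg (fun z => (G' y).1.symm z) h1
  simp only [LinearEquiv.symm_apply_apply, map_lie_adjointGroup, symm_lie] at h2
  have h3 : (G y).1 (u : L) = (G' y).1 (u : L) := hev.self_of_nhds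
  rw [h3, LinearEquiv.symm_apply_apply] at h2
  rw [sub_lie, h2, sub_self]

theorem exists_isTangent {f : M → Q.X} (hf : SmoothMap f) (m : M) (u : TangentSpace (𝓡 2) m) :
    IsTangent f m u (tmap f m u) := by
  have hex : ∃ p, IsTangent f m u p := by
    obtain ⟨g, hg⟩ := hf m
    have hd : ∀ v : L, MDifferentiableAt (𝓡 2) 𝓘(ℝ, L) (fun m' => (g m').1 v) m := fun v =>
      (hg.2 v).mdifferentiableAt (by simp)
    have hG : DifferentiableAt ℝ (fun y => gop (g ((extChartAt (𝓡 2) m).symm y)))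
        (extChartAt (𝓡 2) m m) :=
      differentiableAt_gop fun v => (hasFDerivAt_comp_chart_center (hd v)).differentiableAt
    refine ⟨_, g, hg, (g m).1 (logDer (fun y => g ((extChartAt (𝓡 2) m).symm y))
      (extChartAt (𝓡 2) m m) u), rfl, fun v => ?_⟩
    · have h0 : ∀ u' : EuclideanSpace ℝ (Fin 2), _ := fun u' =>
        (fderiv_gop_apply hG u' v).symm.trans (logDer_spec hG u' v)
      have h1 := h0 u
      have h2 := (hasFDerivAt_comp_chart_center (hd v)).fderiv
      change fderiv ℝ (fun y => (g ((extChartAt (𝓡 2) m).symm y)).1 v) _ = _ at h2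
      rw [h2, extChartAt_to_inv, map_lie_adjointGroup] at h1
      exact h1
  exact Classical.epsilon_spec hex

/-- The tangent map is computed by any differentiable frame. -/
theorem tmap_eq {f : M → Q.X} (hf : SmoothMap f) {ψ : E → M} {y w : E} {m : M}
    {u : TangentSpace (𝓡 2) m} (hm : ψ y = m) (hψ : ContinuousAt ψ y)
    (hu : ∀ F : M → L, MDifferentiableAt (𝓡 2) 𝓘(ℝ, L) F m →
      DifferentiableAt ℝ (fun y => F (ψ y)) y ∧
        fderiv ℝ (fun y => F (ψ y)) y w = derivAt F m u) {G : E → adjointGroup L}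
    (hG : DifferentiableAt ℝ (fun y => gop (G y)) y)
    (hfG : ∀ᶠ y' in 𝓝 y, (G y' : Q.X) = f (ψ y')) :
    tmap f m u = fund ((G y).1 (logDer G y w)) (f m) := by
  obtain ⟨g, hg, a, hp, ha⟩ := exists_isTangent hf m u
  have hd : ∀ v : L, DifferentiableAt ℝ (fun y => (g (ψ y)).1 v) y ∧ _ := fun v =>
    hu _ ((hg.2 v).mdifferentiableAt (by simp))
  have hG' : DifferentiableAt ℝ (fun y => gop (g (ψ y))) y :=
    differentiableAt_gop fun v => (hd v).1
  have hev : ∀ᶠ y' in 𝓝 y, (g (ψ y') : Q.X) = f (ψ y') := by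
    rw [← hm] at hg
    exact hψ.eventually hg.1
  have h0 : (g (ψ y) : Q.X) = f m := by rw [← hm]; exact hev.self_of_nhds
  have h1 := fund_logDer_eq (G := G) (G' := fun y => g (ψ y)) (x := f m) h0 hG hG'
    (by filter_upwards [hev, hfG] with y' h1 h2; rw [h1, h2]) w
  rw [h1, hp]
  congr 1
  have h2 : logDer (fun y => g (ψ y)) y w = (g (ψ y)).1.symm a := by
    refine logDer_eq fun v => ?_
    rw [fderiv_gop_apply hG', (hd v).2, map_lie_adjointGroup, LinearEquiv.apply_symm_apply, hm]
    exact ha v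
  rw [h2, LinearEquiv.apply_symm_apply]

/-- The Maurer–Cartan form on the image of a tangent vector of a parametrised surface. -/
theorem mc_tmap_param {f : M → Q.X} (hf : SmoothMap f) {ψ : E → M} {y : E}
    (hψ : MDifferentiableAt 𝓘(ℝ, E) (𝓡 2) ψ y) {G : E → adjointGroup L}
    (hG : DifferentiableAt ℝ (fun y => gop (G y)) y)
    (hfG : ∀ᶠ y' in 𝓝 y, (G y' : Q.X) = f (ψ y')) (w : E) :
    mc (f (ψ y)) (tmap f (ψ y) (paramDeriv ψ y w)) =
      (G y).1 (Q.perp (logDer G y w)) := by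
  have h := tmap_eq (u := (paramDeriv ψ y w : EuclideanSpace ℝ (Fin 2))) hf rfl hψ.continuousAt
    (fun F hF => ⟨(hasFDerivAt_comp_param hF hψ).differentiableAt,
      DFunLike.congr_fun (hasFDerivAt_comp_param hF hψ).fderiv w⟩) hG hfG
  refine (congrArg (mc _) h).trans ?_
  rw [mc_fund hfG.self_of_nhds, LinearEquiv.symm_apply_apply]

/-- The Maurer–Cartan form on the image of a tangent vector at the centre of a chart. -/
theorem mc_tmap_center {f : M → Q.X} (hf : SmoothMap f) (m : M)
    {G : EuclideanSpace ℝ (Fin 2) → adjointGroup L}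
    (hG : DifferentiableAt ℝ (fun y => gop (G y)) (extChartAt (𝓡 2) m m))
    (hfG : ∀ᶠ y in 𝓝 (extChartAt (𝓡 2) m m), (G y : Q.X) = f ((extChartAt (𝓡 2) m).symm y))
    (u : EuclideanSpace ℝ (Fin 2)) :
    mc (f m) (tmap f m u) =
      (G (extChartAt (𝓡 2) m m)).1 (Q.perp (logDer G (extChartAt (𝓡 2) m m) u)) := by
  have h0 : (G (extChartAt (𝓡 2) m m) : Q.X) = f m := by
    have := hfG.self_of_nhds; rwa [extChartAt_to_inv] at this
  rw [tmap_eq hf (extChartAt_to_inv (I := 𝓡 2) m) (continuousAt_extChartAt_symm m)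
    (fun F hF => ⟨(hasFDerivAt_comp_chart_center hF).differentiableAt,
    DFunLike.congr_fun (hasFDerivAt_comp_chart_center hF).fderiv u⟩) hG hfG, mc_fund h0,
    LinearEquiv.symm_apply_apply]

/-- A smooth map has a smooth frame in the chart at a point. -/
theorem exists_frame {f : M → Q.X} (hf : SmoothMap f) (m : M) :
    ∃ G : EuclideanSpace ℝ (Fin 2) → adjointGroup L, ∀ᶠ y in 𝓝 (extChartAt (𝓡 2) m m),
      y ∈ (extChartAt (𝓡 2) m).target ∧ (G y : Q.X) = f ((extChartAt (𝓡 2) m).symm y) ∧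
        ContDiffAt ℝ 3 (fun y => gop (G y)) y := by
  obtain ⟨g, hg⟩ := hf m
  refine ⟨fun y => g ((extChartAt (𝓡 2) m).symm y), ?_⟩
  have h1 : ContDiffAt ℝ 3 (fun y => gop (g ((extChartAt (𝓡 2) m).symm y)))
      (extChartAt (𝓡 2) m m) := by
    refine contDiffAt_gop fun v => ?_
    have := (contMDiffAt_iff.mp (hg.2 v)).2
    simp only [modelWithCornersSelf_coe, Set.range_id, contDiffWithinAt_univ] at this
    exact this.of_le (WithTop.coe_le_coe.mpr (le_top : (3 : ℕ∞) ≤ ⊤))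
  have h2 := (continuousAt_extChartAt_symm (I := 𝓡 2) m)
  rw [ContinuousAt, extChartAt_to_inv] at h2
  filter_upwards [h1.eventually (by simp), extChartAt_target_mem_nhds (I := 𝓡 2) m,
    h2.eventually hg.1] with y hy1 hy2 hy3
  exact ⟨hy2, hy3, hy1⟩

end HKQuadruple

/-! ### The variation equations -/

theorem derivAt_eq {M : Type*} [TopologicalSpace M] [ChartedSpace (EuclideanSpace ℝ (Fin 2)) M]
    {V : Type*} [NormedAddCommGroup V] [NormedSpace ℝ V] {F : M → V} {m : M}
    {F' : EuclideanSpace ℝ (Fin 2) →L[ℝ] V}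
    (h : HasFDerivAt (F ∘ (extChartAt (𝓡 2) m).symm) F' (extChartAt (𝓡 2) m m)) :
    derivAt F m = F' := by
  have hc : ContinuousAt F m := by
    have h1 : ContinuousAt ((F ∘ (extChartAt (𝓡 2) m).symm) ∘ extChartAt (𝓡 2) m) m :=
      ContinuousAt.comp h.continuousAt (continuousAt_extChartAt m)
    refine h1.congr ?_
    filter_upwards [extChartAt_source_mem_nhds (I := 𝓡 2) m] with m' hm'
    simp only [Function.comp_apply, (extChartAt (𝓡 2) m).left_inv hm']
  have h2 : HasMFDerivAt (𝓡 2) 𝓘(ℝ, V) F m F' := by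
    refine ⟨hc, ?_⟩
    simp only [modelWithCornersSelf_coe, Set.range_id]
    exact hasFDerivWithinAt_univ.mpr h
  exact h2.mfderiv

theorem derivAt_extChartAt {M : Type*} [TopologicalSpace M]
    [ChartedSpace (EuclideanSpace ℝ (Fin 2)) M] (m : M) :
    derivAt (extChartAt (𝓡 2) m) m = ContinuousLinearMap.id ℝ (EuclideanSpace ℝ (Fin 2)) := by
  refine derivAt_eq ((hasFDerivAt_id _).congr_of_eventuallyEq ?_)
  filter_upwards [extChartAt_target_mem_nhds (I := 𝓡 2) m] with y hy
  exact (extChartAt (𝓡 2) m).right_inv hy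

namespace HKQuadruple

open LieAlgebra

variable {L : Type*} [LieRing L] [LieAlgebra ℂ L] [Module.Finite ℂ L] [IsSimple ℂ L]
  {Q : HKQuadruple L}
  {M : Type*} [TopologicalSpace M] [ChartedSpace (EuclideanSpace ℝ (Fin 2)) M]

/-- Elements of `t` commute with each other. -/
theorem lie_t_eq_zero {τ u : L} (hτ : τ ∈ Q.t) (hu : u ∈ Q.h) : ⁅τ, u⁆ = 0 := by
  have := Q.lie_eq_smul (Q.mem_h_iff.mp hu) ⟨τ, hτ.1⟩
  simpa using this

/-- For an invariant one-form `Ω` on `X`, the equation satisfied by an infinitesimal variation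
`ξ` says that `Ω` vanishes on the derivatives of the vector `ω(ξ)` of `L`. -/
theorem IsVariation₁.fund_eq_zero {f : M → Q.X} {ξ : ∀ m, Tan (f m)} {Ω : ∀ x : Q.X, Tan x → L}
    (hv : IsVariation₁ f ξ Ω) (hf : SmoothMap f)
    (hξ : ContMDiff (𝓡 2) 𝓘(ℝ, L) ∞ fun m => mc (f m) (ξ m)) {W : L →L[ℝ] L}
    (hΩ : ∀ (g : adjointGroup L) v, Ω (g : Q.X) (fund v (g : Q.X)) = g.1 (W (g.1.symm v)))
    (hWp : ∀ x, W (Q.perp x) = W x) (hW : ∀ τ ∈ Q.t, ∀ x, ⁅τ, W x⁆ = W ⁅τ, x⁆) (m : M)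
    (u : EuclideanSpace ℝ (Fin 2)) :
    Ω (f m) (fund (derivAt (fun m => mc (f m) (ξ m)) m u) (f m)) = 0 := by
  obtain ⟨G, hG⟩ := exists_frame hf m
  set y₀ := extChartAt (𝓡 2) m m with hy₀
  set s : M → L := fun m => mc (f m) (ξ m) with hs
  have hG0 := hG.self_of_nhds
  have hm : (G y₀ : Q.X) = f m := by rw [hG0.2.1, hy₀, extChartAt_to_inv]
  have hGd := hG0.2.2.differentiableAt (by simp)
  have htm := mc_tmap_center hf m hGd (hG.mono fun y hy => hy.2.1) u
  rw [← hy₀] at htm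
  have hsd : HasFDerivAt (s ∘ (extChartAt (𝓡 2) m).symm) (derivAt s m) y₀ :=
    hasFDerivAt_comp_chart_center ((hξ m).mdifferentiableAt (by simp))
  -- the value of `Ω` along the surface
  have hFs : ∀ {g : adjointGroup L} {m : M}, (g : Q.X) = f m → ∀ p : Tan (f m), Ω (f m) p =
      g.1 (W (g.1.symm (mc (f m) p))) := by
    intro g m h p
    generalize f m = x at h p
    subst h
    conv_lhs => rw [← fund_mc _ p]
    exact hΩ _ _
  have hd := hasFDerivAt_frame_apply hGd (W.hasFDerivAt.comp y₀
    (hasFDerivAt_frame_symm_apply (hG0.2.2.of_le (by norm_num)) hsd))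
  have hF : (fun m' => Ω (f m') (ξ m')) ∘ (extChartAt (𝓡 2) m).symm =ᶠ[𝓝 y₀]
      fun y => (G y).1 ((W ∘ fun y => (G y).1.symm ((s ∘ (extChartAt (𝓡 2) m).symm) y)) y) := by
    filter_upwards [hG] with y hy
    exact hFs hy.2.1 _
  have hder := derivAt_eq (hd.congr_of_eventuallyEq hF)
  have hvar := hv m u
  rw [dNabla₁_eq hΩ hm] at hvar
  change _ = -(derivAt (fun m' => Ω (f m') (ξ m')) m u - ⁅mc (f m) (tmap f m u),
    Ω (f m) (ξ m)⁆) at hvar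
  have hsm : s ((extChartAt (𝓡 2) m).symm y₀) = s m := by rw [hy₀, extChartAt_to_inv]
  rw [hder, htm, hFs hm] at hvar
  rw [hFs hm, mc_fund hm, LinearEquiv.symm_apply_apply, hWp]
  set ζ := (G y₀).1.symm (s m) with hζ
  set A := logDer G y₀ u with hA
  set e := (G y₀).1.symm (derivAt s m u) with he
  have h1 : W ⁅ζ, Q.perp A⁆ = ⁅A, W ζ⁆ + W (e - ⁅A, ζ⁆) - ⁅Q.perp A, W ζ⁆ := by
    apply (G y₀).1.injective
    rw [map_sub, map_lie_adjointGroup _ (Q.perp A)]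
    rw [LinearEquiv.symm_apply_apply] at hvar
    have h2 : (s ∘ (extChartAt (𝓡 2) m).symm) y₀ = s m := hsm
    simp only [ContinuousLinearMap.comp_apply, add_apply, sub_apply,
      ContinuousLinearMap.flip_apply, lieB_apply, gop_apply, Function.comp_apply, hsm] at hvar
    exact neg_injective hvar
  have h3 := hW _ (Q.sub_perp_mem A) ζ
  have h4 : W e = 0 := by
    rw [← lie_skew, map_neg, map_sub] at h1
    rw [sub_lie, sub_lie, map_sub] at h3
    have : W e = -W ⁅Q.perp A, ζ⁆ - (⁅A, W ζ⁆ - ⁅Q.perp A, W ζ⁆) + W ⁅A, ζ⁆ := by rw [h1]; abel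
    rw [this, h3]; abel
  rw [h4, map_zero]

/-- For an invariant two-form `Ω` on `X`, the equation satisfied by an infinitesimal variation,
expressed with the derivatives of the vector `ω(ξ)` of `L`. -/
theorem IsVariation₂.fund_eq [IsManifold (𝓡 2) ∞ M] {f : M → Q.X} {ξ : ∀ m, Tan (f m)}
    {Ω : ∀ x : Q.X, Tan x → Tan x → L} (hv : IsVariation₂ f ξ Ω) (hf : SmoothMap f)
    (hξ : ContMDiff (𝓡 2) 𝓘(ℝ, L) ∞ fun m => mc (f m) (ξ m)) {B : L →L[ℝ] L →L[ℝ] L}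
    (hΩ : ∀ (g : adjointGroup L) v w, Ω (g : Q.X) (fund v (g : Q.X)) (fund w (g : Q.X)) =
      g.1 (B (g.1.symm v) (g.1.symm w))) (hB : ∀ a b, B a b = -B b a)
    (hBp : ∀ x y, B x (Q.perp y) = B x y)
    (hBt : ∀ τ ∈ Q.t, ∀ x y, ⁅τ, B x y⁆ = B ⁅τ, x⁆ y + B x ⁅τ, y⁆) (m : M)
    (u v : EuclideanSpace ℝ (Fin 2)) :
    Ω (f m) (fund (derivAt (fun m => mc (f m) (ξ m)) m u) (f m)) (tmap f m v) =
      Ω (f m) (fund (derivAt (fun m => mc (f m) (ξ m)) m v) (f m)) (tmap f m u) := by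
  obtain ⟨G, hG⟩ := exists_frame hf m
  set y₀ := extChartAt (𝓡 2) m m with hy₀
  set s : M → L := fun m => mc (f m) (ξ m) with hs
  have hG0 := hG.self_of_nhds
  have hm : (G y₀ : Q.X) = f m := by rw [hG0.2.1, hy₀, extChartAt_to_inv]
  have hGd := hG0.2.2.differentiableAt (by simp)
  have htm : ∀ u : EuclideanSpace ℝ (Fin 2), mc (f m) (tmap f m u) = _ := fun u =>
    mc_tmap_center hf m hGd (hG.mono fun y hy => hy.2.1) u
  rw [← hy₀] at htm
  have hsd : HasFDerivAt (s ∘ (extChartAt (𝓡 2) m).symm) (derivAt s m) y₀ :=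
    hasFDerivAt_comp_chart_center ((hξ m).mdifferentiableAt (by simp))
  -- the values of `Ω` along the surface
  have hFs : ∀ {g : adjointGroup L} {m : M}, (g : Q.X) = f m → ∀ p q : Tan (f m), Ω (f m) p q =
      g.1 (B (g.1.symm (mc (f m) p)) (g.1.symm (mc (f m) q))) := by
    intro g m h p q
    generalize f m = x at h p q
    subst h
    conv_lhs => rw [← fund_mc _ p, ← fund_mc _ q]
    exact hΩ _ _ _
  have hA : DifferentiableAt ℝ (logDer G) y₀ :=
    (contDiffAt_logDer (n := 1) (hG0.2.2.of_le (by norm_num))).differentiableAt one_ne_zero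
  let θ : ∀ m : M, TangentSpace (𝓡 2) m → L := fun m' u' => Ω (f m') (ξ m') (tmap f m' u')
  let coeff : EuclideanSpace ℝ (Fin 2) → EuclideanSpace ℝ (Fin 2) → L := fun w y =>
    θ ((extChartAt (𝓡 2) m).symm y) (paramDeriv (extChartAt (𝓡 2) m).symm y w)
  set A := logDer G y₀ with hAdef
  set ζ := (G y₀).1.symm (s m) with hζ
  have hsζ : mc (f m) (ξ m) = (G y₀).1 ζ := ((G y₀).1.apply_symm_apply _).symm
  have h2 : s ((extChartAt (𝓡 2) m).symm y₀) = (G y₀).1 ζ := by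
    rw [hy₀, extChartAt_to_inv]; exact hsζ
  have hcoeff : ∀ w u, fderiv ℝ (coeff w) y₀ u = (G y₀).1 (⁅A u, B ζ (A w)⁆ +
      (B ((G y₀).1.symm (derivAt s m u) - ⁅A u, ζ⁆) (A w) +
        B ζ (fderiv ℝ (logDer G) y₀ u w))) := by
    intro w u
    have hd := hasFDerivAt_frame_apply hGd ((B.hasFDerivAt.comp y₀
      (hasFDerivAt_frame_symm_apply (hG0.2.2.of_le (by norm_num)) hsd)).clm_apply
        (hA.hasFDerivAt.clm_apply (hasFDerivAt_const w y₀)))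
    rw [HasFDerivAt.fderiv (hd.congr_of_eventuallyEq ?_)]
    · simp only [ContinuousLinearMap.comp_apply, add_apply, sub_apply,
        ContinuousLinearMap.flip_apply, lieB_apply, gop_apply, Function.comp_apply, h2,
        LinearEquiv.symm_apply_apply, zero_apply, map_zero, zero_add]
      congr 2
      rw [add_comm]; rfl
    filter_upwards [hG.eventually_nhds] with y hy
    have hy0 := hy.self_of_nhds
    change Ω _ _ _ = _
    rw [hFs hy0.2.1, mc_tmap_param hf (mdifferentiableAt_chart_symm m hy0.1)
      (hy0.2.2.differentiableAt (by simp)) (hy.mono fun y h => h.2.1), LinearEquiv.symm_apply_apply,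
      hBp]
    rfl
  have hvar := hv m u v
  have hdM : dM θ m u v = fderiv ℝ (coeff v) y₀ u - fderiv ℝ (coeff u) y₀ v := by
    change fderiv ℝ (coeff (derivAt (extChartAt (𝓡 2) m) m v)) y₀
      (derivAt (extChartAt (𝓡 2) m) m u) - fderiv ℝ (coeff (derivAt (extChartAt (𝓡 2) m) m u)) y₀
      (derivAt (extChartAt (𝓡 2) m) m v) = _
    rw [derivAt_extChartAt]; rfl
  rw [dNabla₂_eq hΩ hB hm (ξ m) (tmap f m u) (tmap f m v) hsζ (htm u) (htm v)] at hvar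
  change _ = -(dM θ m u v - (⁅mc (f m) (tmap f m u), Ω (f m) (ξ m) (tmap f m v)⁆ -
    ⁅mc (f m) (tmap f m v), Ω (f m) (ξ m) (tmap f m u)⁆)) at hvar
  rw [hdM, hcoeff, hcoeff, hFs hm, hFs hm, htm, htm, hsζ] at hvar
  rw [hFs hm, hFs hm, htm, htm, mc_fund hm, mc_fund hm]
  have hstr := structure_equation (hG0.2.2.of_le (by norm_num)) u v
  have hBp' : ∀ x y, B (Q.perp x) y = B x y := fun x y => by rw [hB, hBp, ← hB]
  simp only [LinearEquiv.symm_apply_apply, ← map_lie_adjointGroup, hBp, hBp', ← map_sub,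
    ← map_neg] at hvar ⊢
  have hvar := (G y₀).1.injective hvar
  congr 1
  -- decompose the logarithmic derivative along `t` and its orthogonal
  obtain ⟨a, ha⟩ : ∃ a, a = Q.perp (A u) := ⟨_, rfl⟩
  obtain ⟨b, hb⟩ : ∃ b, b = Q.perp (A v) := ⟨_, rfl⟩
  obtain ⟨τ, hτ⟩ : ∃ τ, τ = A u - Q.perp (A u) := ⟨_, rfl⟩
  obtain ⟨τ', hτ'⟩ : ∃ τ, τ = A v - Q.perp (A v) := ⟨_, rfl⟩
  have hτt : τ ∈ Q.t := hτ ▸ Q.sub_perp_mem _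
  have hτt' : τ' ∈ Q.t := hτ' ▸ Q.sub_perp_mem _
  have hAu : A u = τ + a := by rw [hτ, ha]; abel
  have hAv : A v = τ' + b := by rw [hτ', hb]; abel
  have hBτ : ∀ τ ∈ Q.t, ∀ x, B x τ = 0 := fun τ hτ x => by
    rw [← hBp, Q.perp_of_mem_t hτ, map_zero]
  rw [← ha, ← hb] at hvar
  have h4 : B ζ (fderiv ℝ (logDer G) y₀ u v) =
      B ζ (fderiv ℝ (logDer G) y₀ v u) - B ζ ⁅A u, A v⁆ := by
    rw [← map_sub]; congr 1; rw [← sub_eq_zero, ← hstr]; abel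
  rw [h4, hAu, hAv] at hvar
  rw [hAu, hAv]
  set c := B ζ (fderiv ℝ (logDer G) y₀ v u)
  set eu := (G y₀).1.symm (derivAt s m u)
  set ev := (G y₀).1.symm (derivAt s m v)
  simp only [add_lie, lie_add, map_add, map_sub, add_apply, sub_apply, hBτ τ hτt, hBτ τ' hτt',
    hBt τ hτt, hBt τ' hτt', lie_t_eq_zero hτt hτt'.1, add_zero,
    zero_add] at hvar ⊢
  rw [← lie_skew b ζ, ← lie_skew a ζ, ← lie_skew a τ', hB ⁅a, b⁆ ζ] at hvar
  simp only [map_neg, neg_apply] at hvar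
  rw [← sub_eq_zero] at hvar ⊢
  rw [← hvar]
  abel

end HKQuadruple

/-! ### Cyclic surfaces and their deformations at a point -/

namespace HKQuadruple

open LieAlgebra

variable {L : Type*} [LieRing L] [LieAlgebra ℂ L] [Module.Finite ℂ L] [IsSimple ℂ L]
  (Q : HKQuadruple L)

/-- The algebraic properties of the components `φ` along `Z` of the derivative of a cyclic surface
at a point, in a frame. -/
structure IsCyclicPoint (φ : EuclideanSpace ℝ (Fin 2) →L[ℝ] L) : Prop where
  mem : ∀ u, φ u ∈ Q.weightSum Q.Z
  ne : ∀ β, Q.IsSimpleRoot β → ∀ u, u ≠ 0 → Q.proj {-β} (φ u) ≠ 0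
  comm : ∀ u v, ⁅φ u, φ v⁆ = 0

/-- The algebraic properties of a deformation of a cyclic surface at a point: `ζ` is the value of
the deformation and `η` the component along `Z` of its derivative, in a frame. -/
structure IsDeformationPoint (φ η : EuclideanSpace ℝ (Fin 2) →L[ℝ] L) (ζ : L) : Prop where
  mem_tPerp : ζ ∈ Q.tPerp
  lam_eq : Q.lam ζ = ζ
  mem : ∀ u, η u ∈ Q.weightSum Q.Z
  lie_eq : ∀ u v, ⁅η u, φ v⁆ = ⁅η v, φ u⁆

/-- `ρ` as a continuous real linear map. -/
noncomputable def rhoL : L →L[ℝ] L :=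
  LinearMap.toContinuousLinearMap
    { toFun := Q.ρ, map_add' := map_add _, map_smul' := Q.rho_real_smul }

/-- The projection on a sum of weight spaces as a continuous real linear map. -/
noncomputable def projL (S : Set (Q.h → ℂ)) : L →L[ℝ] L :=
  (LinearMap.toContinuousLinearMap (Q.proj S)).restrictScalars ℝ

@[simp] theorem projL_apply (S : Set (Q.h → ℂ)) (x : L) : Q.projL S x = Q.proj S x := rfl

/-- The projection on `tPerp` as a continuous real linear map. -/
noncomputable def perpL : L →L[ℝ] L := LinearMap.toContinuousLinearMap Q.perp

@[simp] theorem perpL_apply (x : L) : Q.perpL x = Q.perp x := rfl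

theorem perp_perp (x : L) : Q.perp (Q.perp x) = Q.perp x := Q.perp_of_mem (Q.perp_mem x)

/-- No cyclic point has `ρ φ = -φ`: the values of `φ` lie on a complex line, and the condition
leaves only a real line of it, so that `φ` would not be injective. In rank one, where `Z = Zdag`,
the definition of cyclic surfaces forces this condition. -/
theorem false_of_isCyclicPoint_of_rho_eq_neg {φ : EuclideanSpace ℝ (Fin 2) →L[ℝ] L}
    (hφ : Q.IsCyclicPoint φ) {β : Q.h → ℂ} (hβ : Q.IsSimpleRoot β)
    (hρ : ∀ u, Q.ρ (φ u) = -φ u) : False := by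
  let u : EuclideanSpace ℝ (Fin 2) := EuclideanSpace.single 0 1
  let v : EuclideanSpace ℝ (Fin 2) := EuclideanSpace.single 1 1
  have hu : u ≠ 0 := fun h => by
    have := congrFun (congrArg WithLp.ofLp h) 0
    simp [u] at this
  obtain ⟨c, hc⟩ := Q.exists_eq_smul_of_lie_eq_zero (hφ.mem u) (hφ.mem v)
    (fun β hβ => hφ.ne β hβ u hu) (hφ.comm u v) hβ
  have hφu : φ u ≠ 0 := fun h => hφ.ne β hβ u hu (by rw [h, map_zero])
  have h1 := hρ v
  rw [hc, map_smulₛₗ, hρ u, smul_neg, neg_inj] at h1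
  have h2 := smul_left_injective ℂ hφu h1
  have h3 : φ (v - c.re • u) = 0 := by
    rw [map_sub, map_smul, hc, ← Complex.coe_smul, Complex.conj_eq_iff_re.mp h2, sub_self]
  have hv : v - c.re • u ≠ 0 := fun h => by
    have := congrFun (congrArg WithLp.ofLp h) 1
    simp [u, v] at this
  exact hφ.ne β hβ _ hv (by rw [h3, map_zero])

/-- A vector with no component along `h` and along the roots outside `Z ∪ Zdag` is the sum of its
components along `Z` and `Zdag`. In rank one these would be the same component. -/
theorem eq_proj_add_proj (hs : ∀ β, Q.IsSimpleRoot β → ¬Q.IsLongestRoot β) {x : L}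
    (h0 : Q.proj {0} x = 0) (h1 : Q.proj ({0} ∪ Q.Z ∪ Q.Zdag)ᶜ x = 0) :
    x = Q.proj Q.Z x + Q.proj Q.Zdag x := by
  have hd := Q.disjoint_Z_Zdag hs
  have hZ0 : Disjoint ({0} : Set (Q.h → ℂ)) Q.Z := by
    rw [Set.disjoint_singleton_left]
    intro h; exact (Q.z_subset_roots h).1 rfl
  have hZd0 : Disjoint (({0} : Set (Q.h → ℂ)) ∪ Q.Z) Q.Zdag := by
    rw [Set.disjoint_union_left, Set.disjoint_singleton_left]
    exact ⟨fun h => (Q.zdag_subset_roots h).1 rfl, hd⟩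
  have := Q.proj_add_compl ({0} ∪ Q.Z ∪ Q.Zdag) x
  rw [h1, add_zero, Q.proj_union hZd0, Q.proj_union hZ0, h0, zero_add] at this
  exact this.symm

variable {Q}
variable {M : Type*} [TopologicalSpace M] [ChartedSpace (EuclideanSpace ℝ (Fin 2)) M]

/-- The derivative of a smooth map at a point, in a frame. -/
theorem exists_derivative {f : M → Q.X} (hf : SmoothMap f) (m : M) (g : adjointGroup L) :
    ∃ b : EuclideanSpace ℝ (Fin 2) →L[ℝ] L,
      ∀ u : EuclideanSpace ℝ (Fin 2), mc (f m) (tmap f m u) = g.1 (b u) := by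
  obtain ⟨G, hG⟩ := exists_frame hf m
  have hG0 := hG.self_of_nhds
  refine ⟨gop g⁻¹ ∘L gop (G (extChartAt (𝓡 2) m m)) ∘L Q.perpL ∘L
    logDer G (extChartAt (𝓡 2) m m), fun u => ?_⟩
  rw [mc_tmap_center hf m (hG0.2.2.differentiableAt (by simp)) (hG.mono fun y hy => hy.2.1) u]
  exact (g.1.apply_symm_apply _).symm

variable {f : M → Q.X}

theorem IsCyclic.proj_zero (hf : IsCyclic f) {m : M} {g : adjointGroup L} (hg : (g : Q.X) = f m)
    (u : EuclideanSpace ℝ (Fin 2)) : Q.proj {0} (g.1.symm (mc (f m) (tmap f m u))) = 0 := by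
  have := hf.omega0_eq m u
  rw [omega0, mcPart_eq hg] at this
  exact (LinearEquiv.map_eq_zero_iff _).mp this

/-- In any frame, the component `φ` along `Z` of the derivative of a cyclic surface satisfies the
algebraic conditions of a cyclic point, and the component along `Zdag` is `-ρ φ`. -/
theorem IsCyclic.isCyclicPoint (hf : IsCyclic f) {m : M} {g : adjointGroup L}
    (hg : (g : Q.X) = f m) {φ : EuclideanSpace ℝ (Fin 2) →L[ℝ] L}
    (hφ : ∀ u : EuclideanSpace ℝ (Fin 2), φ u = Q.proj Q.Z (g.1.symm (mc (f m) (tmap f m u)))) :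
    Q.IsCyclicPoint φ ∧ ∀ u : EuclideanSpace ℝ (Fin 2),
      Q.ρ (φ u) = -Q.proj Q.Zdag (g.1.symm (mc (f m) (tmap f m u))) := by
  have hρ : ∀ u : EuclideanSpace ℝ (Fin 2),
      Q.ρ (φ u) = -Q.proj Q.Zdag (g.1.symm (mc (f m) (tmap f m u))) := by
    intro u
    have := hf.rho_phi m u
    rw [rhoAt_eq hg, phi, phiDag, mcPart_eq hg, mcPart_eq hg, LinearEquiv.symm_apply_apply,
      ← map_neg] at this
    rw [hφ]
    exact g.1.injective this
  refine ⟨⟨fun u => by rw [hφ]; exact Q.proj_mem _ _, fun β hβ u hu h => ?_, fun u v => ?_⟩, hρ⟩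
  · have h1 : Q.proj {β} (Q.ρ (φ u)) = 0 := by
      rw [← Q.rho_proj (S := {-β}) (fun χ => by simp [neg_eq_iff_eq_neg]), h, map_zero]
    have hsub : ({β} : Set (Q.h → ℂ)) ∩ Q.Zdag = {β} :=
      Set.inter_eq_left.mpr (Set.singleton_subset_iff.mpr (show β ∈ Q.Zdag from Or.inl hβ))
    rw [hρ, map_neg, neg_eq_zero, Q.proj_proj, hsub] at h1
    apply hf.omegaRoot_ne β hβ m u hu
    rw [omegaRoot, mcPart_eq hg, h1, map_zero]
  · have := hf.phiPhi_eq m u v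
    rw [phiPhi, phi, phi, mcPart_eq hg, mcPart_eq hg] at this
    have h1 := hφ u
    have h2 := hφ v
    rw [← h1, ← h2, ← map_lie_adjointGroup, ← map_lie_adjointGroup, ← map_sub,
      LinearEquiv.map_eq_zero_iff, ← lie_skew (φ u), ← neg_add', neg_eq_zero, ← two_smul ℂ,
      smul_eq_zero] at this
    rw [← lie_skew, this.resolve_left two_ne_zero, neg_zero]

/-- A Lie algebra with a cyclic surface has rank at least two. -/
theorem IsCyclic.not_isLongestRoot (hf : IsCyclic f) (m : M) (β : Q.h → ℂ)
    (hβ : Q.IsSimpleRoot β) : ¬Q.IsLongestRoot β := by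
  intro hl
  obtain ⟨g, hg, -⟩ := frame_spec (f m)
  obtain ⟨b, hb⟩ := exists_derivative hf.smooth m g
  have hZ : Q.Z = Q.Zdag := by
    have h1 : ∀ χ, Q.IsSimpleRoot χ ↔ χ = β := fun χ =>
      ⟨fun h => hβ.eq_of_isLongestRoot Q.toPositiveSystem hl h, fun h => h ▸ hβ⟩
    have h2 : ∀ χ, Q.IsLongestRoot χ ↔ χ = β := fun χ =>
      ⟨fun h => h.unique Q.toPositiveSystem hl, fun h => h ▸ hl⟩
    ext χ
    simp only [PositiveSystem.Z, PositiveSystem.Zdag, Set.mem_ofPred_eq, h1, h2, neg_neg]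
    exact or_comm
  have hφ : ∀ u : EuclideanSpace ℝ (Fin 2), (Q.projL Q.Z ∘L b) u =
      Q.proj Q.Z (g.1.symm (mc (f m) (tmap f m u))) := by
    intro u; rw [hb, LinearEquiv.symm_apply_apply]; rfl
  obtain ⟨h1, h2⟩ := hf.isCyclicPoint hg hφ
  refine Q.false_of_isCyclicPoint_of_rho_eq_neg h1 hβ fun u => ?_
  rw [h2, hφ, hZ]

/-- The derivative of a cyclic surface in a frame is `φ - ρ φ`. -/
theorem IsCyclic.mc_tmap_eq (hf : IsCyclic f) {m : M} {g : adjointGroup L}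
    (hg : (g : Q.X) = f m) {φ : EuclideanSpace ℝ (Fin 2) →L[ℝ] L}
    (hφ : ∀ u : EuclideanSpace ℝ (Fin 2), φ u = Q.proj Q.Z (g.1.symm (mc (f m) (tmap f m u))))
    (u : EuclideanSpace ℝ (Fin 2)) : g.1.symm (mc (f m) (tmap f m u)) = φ u - Q.ρ (φ u) := by
  have h1 := hf.omega1_eq m u
  rw [omega1, mcPart_eq hg, LinearEquiv.map_eq_zero_iff] at h1
  rw [(hf.isCyclicPoint hg hφ).2, hφ, sub_neg_eq_add]
  exact Q.eq_proj_add_proj (hf.not_isLongestRoot m) (hf.proj_zero hg u) h1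

variable {ξ : ∀ m, Tan (f m)}

theorem mcPart_fund {g : adjointGroup L} (S : Set (Q.h → ℂ)) (v : L) :
    mcPart S (g : Q.X) (fund v (g : Q.X)) =
      g.1 ((Q.projL S ∘L Q.perpL) (g.1.symm v)) := by
  rw [mcPart_eq rfl, mc_fund rfl, LinearEquiv.symm_apply_apply]; rfl

theorem lie_proj_perp {τ : L} (hτ : τ ∈ Q.t) (S : Set (Q.h → ℂ)) (x : L) :
    ⁅τ, (Q.projL S ∘L Q.perpL) x⁆ = (Q.projL S ∘L Q.perpL) ⁅τ, x⁆ := by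
  change ⁅τ, Q.proj S (Q.perp x)⁆ = Q.proj S (Q.perp ⁅τ, x⁆)
  rw [← Q.proj_lie_h hτ.1, lie_perp hτ]

/-- The variations of the four forms of the Pfaffian system, read in a frame: those of `ω₀`, `ω₁`
and `φ + ρ φ†` say that the derivative of the deformation is `η - ρ η` modulo `t`, and that of
`φ ∧ φ` that `η` satisfies the linearization of `⁅φ u, φ v⁆ = 0`. -/
theorem IsInfDeformation.isDeformationPoint [IsManifold (𝓡 2) ∞ M] (hξ : IsInfDeformation f ξ)
    (hf : IsCyclic f) {m : M} {g : adjointGroup L}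
    (hg : (g : Q.X) = f m) {φ η : EuclideanSpace ℝ (Fin 2) →L[ℝ] L}
    (hφ : ∀ u : EuclideanSpace ℝ (Fin 2), φ u = Q.proj Q.Z (g.1.symm (mc (f m) (tmap f m u))))
    (hη : ∀ u, η u =
      Q.proj Q.Z (Q.perp (g.1.symm (derivAt (fun m => mc (f m) (ξ m)) m u)))) :
    Q.IsDeformationPoint φ η (g.1.symm (mc (f m) (ξ m))) ∧
      ∀ u, g.1.symm (derivAt (fun m => mc (f m) (ξ m)) m u) - (η u - Q.ρ (η u)) ∈ Q.t := by
  refine ⟨⟨symm_mc_mem hg _, ?_, fun u => ?_, fun u v => ?_⟩, fun u => ?_⟩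
  · have := hξ.real m
    rw [lamAt_eq hg, ← LinearEquiv.eq_symm_apply] at this
    exact this
  · rw [hη]; exact Q.proj_mem _ _
  · let P : L →L[ℝ] L := Q.projL Q.Z ∘L Q.perpL
    let B₀ : L →L[ℝ] L →L[ℝ] L := ((lieB L) ∘L P).flip ∘L P
    have hP : ∀ x, P (Q.perp x) = P x := fun x => by simp [P, perp_perp]
    have hB : ∀ x y, (B₀.flip - B₀) x y = ⁅P x, P y⁆ - ⁅P y, P x⁆ := fun x y => rfl
    have h1 := hξ.phiPhi_var.fund_eq (B := B₀.flip - B₀) hf.smooth hξ.smooth (fun g v w => ?_)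
      (fun a b => ?_) (fun x y => ?_) (fun τ hτ x y => ?_) m u v
    · have h2 : ∀ (x : L) (w : EuclideanSpace ℝ (Fin 2)),
          Q.phiPhi (f m) (fund x (f m)) (tmap f m w) =
            g.1 (⁅P (g.1.symm x), φ w⁆ - ⁅φ w, P (g.1.symm x)⁆) := by
        intro x w
        rw [phiPhi, phi, phi, mcPart_eq hg, mcPart_eq hg, mc_fund hg,
          LinearEquiv.symm_apply_apply, map_sub, map_lie_adjointGroup, map_lie_adjointGroup]
        have := hφ w
        rw [this]; rfl
      have h4 : ∀ w, P (g.1.symm (derivAt (fun m => mc (f m) (ξ m)) m w)) = η w :=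
        fun w => (hη w).symm
      have h3 := ((h2 _ v).symm.trans h1).trans (h2 _ u)
      rw [h4, h4] at h3
      have h3 := g.1.injective h3
      rw [← lie_skew (η u) (φ v), ← lie_skew (η v) (φ u), ← neg_add', ← neg_add', neg_inj,
        ← two_smul ℂ, ← two_smul ℂ] at h3
      rw [← lie_skew, smul_right_injective L (two_ne_zero (α := ℂ)) h3, lie_skew]
    · rw [hB, phiPhi, phi, phi, mcPart_fund, mcPart_fund, map_sub, map_lie_adjointGroup,
        map_lie_adjointGroup]
    · rw [hB, hB]; abel
    · rw [hB, hB, hP]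
    · have ht : ∀ x, ⁅τ, P x⁆ = P ⁅τ, x⁆ := fun x => lie_proj_perp hτ _ x
      simp only [hB, lie_sub, ← ht]
      rw [leibniz_lie τ (P x), leibniz_lie τ (P y)]
      abel
  · set x := g.1.symm (derivAt (fun m => mc (f m) (ξ m)) m u) with hx
    have h0 := hξ.omega0_var.fund_eq_zero (W := Q.projL {0} ∘L Q.perpL) hf.smooth hξ.smooth
      (fun g v => mcPart_fund _ _) (fun x => by simp [perp_perp])
      (fun τ hτ x => lie_proj_perp hτ _ x) m u
    have h1 := hξ.omega1_var.fund_eq_zero (W := Q.projL ({0} ∪ Q.Z ∪ Q.Zdag)ᶜ ∘L Q.perpL)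
      hf.smooth hξ.smooth (fun g v => mcPart_fund _ _) (fun x => by simp [perp_perp])
      (fun τ hτ x => lie_proj_perp hτ _ x) m u
    have h2 := hξ.phiRho_var.fund_eq_zero
      (W := Q.projL Q.Z ∘L Q.perpL + Q.rhoL ∘L Q.projL Q.Zdag ∘L Q.perpL)
      hf.smooth hξ.smooth (fun g v => ?_) (fun x => by simp [perp_perp])
      (fun τ hτ x => ?_) m u
    · rw [omega0, mcPart_eq hg, LinearEquiv.map_eq_zero_iff, mc_fund hg,
        LinearEquiv.symm_apply_apply, ← hx] at h0
      rw [omega1, mcPart_eq hg, LinearEquiv.map_eq_zero_iff, mc_fund hg,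
        LinearEquiv.symm_apply_apply, ← hx] at h1
      rw [phiRho, phi, phiDag, rhoAt_eq hg, mcPart_eq hg, mcPart_eq hg, ← map_add,
        LinearEquiv.map_eq_zero_iff, mc_fund hg, LinearEquiv.symm_apply_apply,
        LinearEquiv.symm_apply_apply, ← hx, ← hη, add_eq_zero_iff_eq_neg] at h2
      have h3 := Q.eq_proj_add_proj (hf.not_isLongestRoot m) h0 h1
      rw [← hη] at h3
      have h4 : Q.proj Q.Zdag (Q.perp x) = -Q.ρ (η u) := by
        rw [h2, map_neg, neg_neg, Q.rho_rho]
      rw [h4, ← sub_eq_add_neg] at h3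
      rw [← h3]
      exact Q.sub_perp_mem x
    · rw [phiRho, phi, phiDag, mcPart_fund, mcPart_fund, rhoAt_eq rfl, LinearEquiv.symm_apply_apply,
        ← map_add]
      rfl
    · rw [add_apply, lie_add, lie_proj_perp hτ, add_apply]
      congr 1
      change ⁅τ, Q.ρ ((Q.projL Q.Zdag ∘L Q.perpL) x)⁆ = Q.ρ ((Q.projL Q.Zdag ∘L Q.perpL) ⁅τ, x⁆)
      rw [← lie_proj_perp hτ, Q.ρ_conj.map_lie, hτ.2.1]

end HKQuadruple

/-! ### The equations of a deformation in a moving frame -/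

namespace HKQuadruple

open LieAlgebra

variable {L : Type*} [LieRing L] [LieAlgebra ℂ L] [Module.Finite ℂ L] [IsSimple ℂ L]
  (Q : HKQuadruple L)

/-- The component along `Z` of the projection on `tPerp`. -/
noncomputable def perpZ : L →L[ℝ] L := Q.projL Q.Z ∘L Q.perpL

/-- The equations satisfied at `y` by a cyclic surface in a moving frame: `A` is the logarithmic
derivative of the frame, and `φ` is the component along `Z` of `A`. -/
structure IsCyclicModel (A φ : EuclideanSpace ℝ (Fin 2) → EuclideanSpace ℝ (Fin 2) →L[ℝ] L)
    (y : EuclideanSpace ℝ (Fin 2)) : Prop where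
  contDiffAt_φ : ContDiffAt ℝ 2 φ y
  cyclic : Q.IsCyclicPoint (φ y)
  sub_mem : ∀ u, A y u - (φ y u - Q.ρ (φ y u)) ∈ Q.t
  structure_eq : ∀ u v, fderiv ℝ φ y u v - fderiv ℝ φ y v u +
    ⁅A y u - (φ y u - Q.ρ (φ y u)), φ y v⁆ - ⁅A y v - (φ y v - Q.ρ (φ y v)), φ y u⁆ = 0

/-- The equations satisfied at `y` by a deformation `ζ` of a cyclic surface in a moving frame: `η`
is the component along `Z` of the derivative of `ζ`. -/
structure IsLocalModel (A φ η : EuclideanSpace ℝ (Fin 2) → EuclideanSpace ℝ (Fin 2) →L[ℝ] L)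
    (ζ : EuclideanSpace ℝ (Fin 2) → L) (y : EuclideanSpace ℝ (Fin 2)) : Prop
    extends Q.IsCyclicModel A φ y where
  contDiffAt_ζ : ContDiffAt ℝ 2 ζ y
  deform : Q.IsDeformationPoint (φ y) (η y) (ζ y)
  deriv_sub_mem : ∀ u, fderiv ℝ ζ y u + ⁅A y u, ζ y⁆ - (η y u - Q.ρ (η y u)) ∈ Q.t

variable {Q}
variable {M : Type*} [TopologicalSpace M] [ChartedSpace (EuclideanSpace ℝ (Fin 2)) M]
  [IsManifold (𝓡 2) ∞ M]

theorem paramDeriv_chart_symm_injective (m : M) {y : EuclideanSpace ℝ (Fin 2)}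
    (hy : y ∈ (extChartAt (𝓡 2) m).target) {u : EuclideanSpace ℝ (Fin 2)}
    (hu : paramDeriv (extChartAt (𝓡 2) m).symm y u = 0) : u = 0 := by
  have h1 : MDifferentiableAt (𝓡 2) 𝓘(ℝ, EuclideanSpace ℝ (Fin 2)) (extChartAt (𝓡 2) m)
      ((extChartAt (𝓡 2) m).symm y) :=
    ((contMDiffAt_extChartAt' (n := ∞) (by
      rw [← extChartAt_source (𝓡 2)]; exact (extChartAt (𝓡 2) m).map_target hy)).mdifferentiableAt
      (by simp))
  have h2 := hasFDerivAt_comp_param h1 (mdifferentiableAt_chart_symm m hy)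
  have h3 := h2.unique ((hasFDerivAt_id y).congr_of_eventuallyEq (by
    filter_upwards [(isOpen_extChartAt_target m).mem_nhds hy] with z hz
    exact (extChartAt (𝓡 2) m).right_inv hz))
  have h4 := DFunLike.congr_fun h3 u
  rw [ContinuousLinearMap.comp_apply, hu, map_zero] at h4
  exact h4.symm

theorem perpZ_mem_h {x : L} (hx : x ∈ Q.h) : Q.perpZ x = 0 := by
  have h1 : Q.perp x ∈ Q.h := by
    have := Q.h.sub_mem hx (Q.sub_perp_mem x).1
    simpa using this
  change Q.proj Q.Z (Q.perp x) = 0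
  rw [Q.mem_h_iff_weightSum] at h1
  exact Q.proj_of_disjoint (by
    rw [Set.disjoint_singleton_right]
    exact fun h => (Q.z_subset_roots h).1 rfl) h1

theorem lie_perpZ {τ : L} (hτ : τ ∈ Q.t) (x : L) : ⁅τ, Q.perpZ x⁆ = Q.perpZ ⁅τ, x⁆ :=
  lie_proj_perp hτ _ x

theorem rho_mem_Zdag {x : L} (hx : x ∈ Q.weightSum Q.Z) : Q.ρ x ∈ Q.weightSum Q.Zdag :=
  Q.rho_mem_weightSum (fun _ h => h) hx

theorem lie_rho_mem_h {x y : L} (hx : x ∈ Q.weightSum Q.Z) (hy : y ∈ Q.weightSum Q.Z) :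
    ⁅x, Q.ρ y⁆ ∈ Q.h :=
  Q.lie_mem_h_of_mem_Z_of_mem_Zdag hx (rho_mem_Zdag hy)

/-- Along a cyclic surface, the brackets of the derivatives lie in `h`. -/
theorem IsCyclicPoint.lie_mem_h {φ : EuclideanSpace ℝ (Fin 2) →L[ℝ] L} (hφ : Q.IsCyclicPoint φ)
    (u v : EuclideanSpace ℝ (Fin 2)) : ⁅φ u - Q.ρ (φ u), φ v - Q.ρ (φ v)⁆ ∈ Q.h := by
  have h1 := lie_rho_mem_h (hφ.mem u) (hφ.mem v)
  have h2 := lie_rho_mem_h (hφ.mem v) (hφ.mem u)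
  have h3 : ⁅φ u - Q.ρ (φ u), φ v - Q.ρ (φ v)⁆ = ⁅φ v, Q.ρ (φ u)⁆ - ⁅φ u, Q.ρ (φ v)⁆ := by
    rw [sub_lie, lie_sub, lie_sub, hφ.comm, ← Q.ρ_conj.map_lie, hφ.comm, map_zero,
      ← lie_skew (φ v)]
    abel
  rw [h3]
  exact Q.h.sub_mem h2 h1

variable {f : M → Q.X} {ξ : ∀ m, Tan (f m)}

/-- A cyclic surface satisfies the equations of the moving frame. -/
theorem exists_cyclicModel (hf : IsCyclic f) (m : M) :
    ∃ G : EuclideanSpace ℝ (Fin 2) → adjointGroup L, ∀ᶠ y in 𝓝 (extChartAt (𝓡 2) m m),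
      y ∈ (extChartAt (𝓡 2) m).target ∧ (G y : Q.X) = f ((extChartAt (𝓡 2) m).symm y) ∧
      ContDiffAt ℝ 3 (fun y => gop (G y)) y ∧
      (∀ w, mc (f ((extChartAt (𝓡 2) m).symm y)) (tmap f ((extChartAt (𝓡 2) m).symm y)
        (paramDeriv (extChartAt (𝓡 2) m).symm y w)) = (G y).1 (Q.perp (logDer G y w))) ∧
      (∀ w, Q.perp (logDer G y w) =
        Q.perpZ (logDer G y w) - Q.ρ (Q.perpZ (logDer G y w))) ∧
      Q.IsCyclicModel (logDer G) (fun y => Q.perpZ ∘L logDer G y) y := by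
  obtain ⟨G, hG⟩ := exists_frame hf.smooth m
  set c := extChartAt (𝓡 2) m with hc
  refine ⟨G, ?_⟩
  filter_upwards [hG.eventually_nhds] with y hy
  obtain ⟨hyt, hyG, hyd⟩ := hy.self_of_nhds
  have hmd : MDifferentiableAt 𝓘(ℝ, EuclideanSpace ℝ (Fin 2)) (𝓡 2) c.symm y :=
    mdifferentiableAt_chart_symm m hyt
  have hGd : DifferentiableAt ℝ (fun y => gop (G y)) y := hyd.differentiableAt (by simp)
  have hA : ContDiffAt ℝ 2 (logDer G) y := contDiffAt_logDer (n := 2) (by exact_mod_cast hyd)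
  have hmc : ∀ w, mc (f (c.symm y)) (tmap f (c.symm y) (paramDeriv c.symm y w)) =
      (G y).1 (Q.perp (logDer G y w)) := fun w =>
    mc_tmap_param hf.smooth hmd hGd (hy.mono fun y hy => hy.2.1) w
  obtain ⟨b, hb⟩ := exists_derivative hf.smooth (c.symm y) (G y)
  have hφ : ∀ u : EuclideanSpace ℝ (Fin 2), (Q.projL Q.Z ∘L b) u =
      Q.proj Q.Z ((G y).1.symm (mc (f (c.symm y)) (tmap f (c.symm y) u))) := fun u => by
    rw [hb, LinearEquiv.symm_apply_apply]; rfl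
  have hφ' : ∀ w, (Q.perpZ ∘L logDer G y) w = (Q.projL Q.Z ∘L b) (paramDeriv c.symm y w) := by
    intro w
    have h1 := (hb (paramDeriv c.symm y w)).symm.trans (hmc w)
    rw [ContinuousLinearMap.comp_apply (Q.projL Q.Z), (G y).1.injective h1]; rfl
  have hcyc := (hf.isCyclicPoint hyG hφ).1
  have hperp : ∀ w, Q.perp (logDer G y w) =
      (Q.perpZ ∘L logDer G y) w - Q.ρ ((Q.perpZ ∘L logDer G y) w) := by
    intro w
    rw [hφ', ← hf.mc_tmap_eq hyG hφ]
    have := hmc w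
    rw [← LinearEquiv.symm_apply_eq] at this
    exact this.symm
  have hcyc' : Q.IsCyclicPoint (Q.perpZ ∘L logDer G y) :=
    ⟨fun u => by rw [hφ']; exact hcyc.mem _,
      fun β hβ u hu => by
        rw [hφ']
        exact hcyc.ne β hβ _ fun h => hu (paramDeriv_chart_symm_injective m hyt h),
      fun u v => by rw [hφ', hφ']; exact hcyc.comm _ _⟩
  have hsub : ∀ u, logDer G y u - ((Q.perpZ ∘L logDer G y) u -
      Q.ρ ((Q.perpZ ∘L logDer G y) u)) ∈ Q.t := fun u => by
    rw [← hperp]; exact Q.sub_perp_mem _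
  refine ⟨hyt, hyG, hyd, hmc, hperp, contDiffAt_const.clm_comp hA, hcyc', hsub, fun u v => ?_⟩
  have hstr := congrArg Q.perpZ (structure_equation (hyd.of_le (by norm_num)) u v)
  have hfd : ∀ u v, fderiv ℝ (fun y => Q.perpZ ∘L logDer G y) y u v =
      Q.perpZ (fderiv ℝ (logDer G) y u v) := by
    intro u v
    have h1 := ((ContinuousLinearMap.compL ℝ (EuclideanSpace ℝ (Fin 2)) L L
      Q.perpZ).hasFDerivAt.comp y (hA.differentiableAt two_ne_zero).hasFDerivAt)
    exact congrArg (fun T => T u v) h1.fderiv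
  rw [hfd, hfd]
  rw [map_add, map_sub, map_zero] at hstr
  rw [add_sub_assoc, ← hstr]
  congr 1
  have hpp : ∀ w, Q.perpZ (logDer G y w) = Q.perpZ
      ((Q.perpZ ∘L logDer G y) w - Q.ρ ((Q.perpZ ∘L logDer G y) w)) := fun w => by
    rw [← hperp]; exact congrArg (Q.projL Q.Z) (Q.perp_perp _).symm
  have hτ : ∀ w, ∃ τ ∈ Q.t, logDer G y w - ((Q.perpZ ∘L logDer G y) w -
      Q.ρ ((Q.perpZ ∘L logDer G y) w)) = τ ∧ logDer G y w = τ + ((Q.perpZ ∘L logDer G y) w -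
      Q.ρ ((Q.perpZ ∘L logDer G y) w)) := fun w => ⟨_, hsub w, rfl, by abel⟩
  obtain ⟨τ, hτt, h1, h2⟩ := hτ u
  obtain ⟨τ', hτt', h1', h2'⟩ := hτ v
  have h3 := perpZ_mem_h (hcyc'.lie_mem_h u v)
  rw [h1, h1']
  change ⁅τ, Q.perpZ (logDer G y v)⁆ - ⁅τ', Q.perpZ (logDer G y u)⁆ = _
  rw [hpp u, hpp v, lie_perpZ hτt, lie_perpZ hτt', h2, h2', add_lie, lie_add, lie_add,
    lie_t_eq_zero hτt hτt'.1, map_add, map_add, map_add, h3, ← lie_skew _ τ', map_neg, map_zero]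
  abel

/-- A deformation of a cyclic surface satisfies the equations of the moving frame. -/
theorem exists_localModel (hf : IsCyclic f) (hξ : IsInfDeformation f ξ) (m : M) :
    ∃ (G : EuclideanSpace ℝ (Fin 2) → adjointGroup L)
      (φ η : EuclideanSpace ℝ (Fin 2) → EuclideanSpace ℝ (Fin 2) →L[ℝ] L),
      ∀ᶠ y in 𝓝 (extChartAt (𝓡 2) m m),
        y ∈ (extChartAt (𝓡 2) m).target ∧ (G y : Q.X) = f ((extChartAt (𝓡 2) m).symm y) ∧
        (∀ w, mc (f ((extChartAt (𝓡 2) m).symm y)) (tmap f ((extChartAt (𝓡 2) m).symm y)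
          (paramDeriv (extChartAt (𝓡 2) m).symm y w)) = (G y).1 (φ y w - Q.ρ (φ y w))) ∧
        Q.IsLocalModel (logDer G) φ η (fun y => (G y).1.symm
          (mc (f ((extChartAt (𝓡 2) m).symm y)) (ξ ((extChartAt (𝓡 2) m).symm y)))) y := by
  obtain ⟨G, hG⟩ := exists_cyclicModel hf m
  set c := extChartAt (𝓡 2) m with hc
  set s : M → L := fun m => mc (f m) (ξ m) with hs
  let e : EuclideanSpace ℝ (Fin 2) → EuclideanSpace ℝ (Fin 2) →L[ℝ] L := fun y =>
    fderiv ℝ (fun y => (G y).1.symm (s (c.symm y))) y +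
      (lieB L).flip ((G y).1.symm (s (c.symm y))) ∘L logDer G y
  refine ⟨G, fun y => Q.perpZ ∘L logDer G y, fun y => Q.perpZ ∘L e y, ?_⟩
  filter_upwards [hG] with y hy
  obtain ⟨hyt, hyG, hyd, hmc, hperp, hcycm⟩ := hy
  have hmd : MDifferentiableAt 𝓘(ℝ, EuclideanSpace ℝ (Fin 2)) (𝓡 2) c.symm y :=
    mdifferentiableAt_chart_symm m hyt
  have hsd : ContDiffAt ℝ 2 (fun y => s (c.symm y)) y := by
    have h1 : ContMDiffAt 𝓘(ℝ, EuclideanSpace ℝ (Fin 2)) (𝓡 2) ∞ c.symm y :=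
      (contMDiffOn_extChartAt_symm m y hyt).contMDiffAt ((isOpen_extChartAt_target m).mem_nhds hyt)
    exact (contMDiffAt_iff_contDiffAt.mp ((hξ.smooth _).comp y h1)).of_le
      (WithTop.coe_le_coe.mpr (le_top : (2 : ℕ∞) ≤ ⊤))
  have hζd : ContDiffAt ℝ 2 (fun y => (G y).1.symm (s (c.symm y))) y :=
    (contDiffAt_gop_inv (hyd.of_le (by norm_num))).clm_apply hsd
  -- the components `φ` and `η` on the tangent plane of the surface
  obtain ⟨b, hb⟩ := exists_derivative hf.smooth (c.symm y) (G y)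
  have hφ : ∀ u : EuclideanSpace ℝ (Fin 2), (Q.projL Q.Z ∘L b) u =
      Q.proj Q.Z ((G y).1.symm (mc (f (c.symm y)) (tmap f (c.symm y) u))) := fun u => by
    rw [hb, LinearEquiv.symm_apply_apply]; rfl
  have hφ' : ∀ w, (Q.perpZ ∘L logDer G y) w = (Q.projL Q.Z ∘L b) (paramDeriv c.symm y w) := by
    intro w
    have h1 := (hb (paramDeriv c.symm y w)).symm.trans (hmc w)
    rw [ContinuousLinearMap.comp_apply (Q.projL Q.Z), (G y).1.injective h1]; rfl
  have hdef := hξ.isDeformationPoint hf hyG (η := Q.perpZ ∘L gop (G y)⁻¹ ∘L derivAt s (c.symm y))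
    hφ (fun u => rfl)
  have he : ∀ w, e y w = (G y).1.symm (derivAt s (c.symm y) (paramDeriv c.symm y w)) := by
    intro w
    have h1 := hasFDerivAt_frame_symm_apply (hyd.of_le (by norm_num))
      (hasFDerivAt_comp_param ((hξ.smooth (c.symm y)).mdifferentiableAt (by simp)) hmd)
    change (fderiv ℝ (fun y => (G y).1.symm (s (c.symm y))) y + _) w = _
    rw [h1.fderiv, sub_add_cancel]; rfl
  refine ⟨hyt, hyG, fun w => by rw [hmc, hperp]; rfl, hcycm, hζd,
    ⟨hdef.1.mem_tPerp, hdef.1.lam_eq, fun u => ?_, fun u v => ?_⟩, fun u => ?_⟩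
  · exact Q.proj_mem _ _
  · change ⁅Q.perpZ (e y u), _⁆ = ⁅Q.perpZ (e y v), _⁆
    rw [he, he, hφ', hφ']
    exact hdef.1.lie_eq _ _
  · have := hdef.2 (paramDeriv c.symm y u)
    change e y u - (Q.perpZ (e y u) - Q.ρ (Q.perpZ (e y u))) ∈ Q.t
    rw [he]
    exact this

end HKQuadruple

/-! ### The strong maximum principle -/

section MaximumPrinciple

variable {E : Type*} [NormedAddCommGroup E] [InnerProductSpace ℝ E]

local notation "⟪" x ", " y "⟫" => inner ℝ x y

/-- The Hessian is nonpositive at a local maximum. -/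
theorem fderiv_fderiv_nonpos_of_isLocalMax {w : E → ℝ} {p : E} (hm : IsLocalMax w p)
    (hw : ContDiffAt ℝ 2 w p) (X : E) : fderiv ℝ (fderiv ℝ w) p X X ≤ 0 := by
  by_contra! hpos
  have hl : ∀ t : ℝ, HasDerivAt (fun t : ℝ => p + t • X) X t := fun t => by
    simpa using ((hasDerivAt_id t).smul_const X).const_add p
  have h0 : p + (0 : ℝ) • X = p := by simp
  have hlc : Filter.Tendsto (fun t : ℝ => p + t • X) (𝓝 0) (𝓝 p) := by
    have := (hl 0).continuousAt.tendsto
    rwa [h0] at this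
  have hd : deriv (fun t : ℝ => w (p + t • X)) =ᶠ[𝓝 0] fun t => fderiv ℝ w (p + t • X) X := by
    filter_upwards [hlc.eventually (hw.eventually (by simp))] with t ht
    exact ((ht.differentiableAt two_ne_zero).hasFDerivAt.comp_hasDerivAt t (hl t)).deriv
  have hdd : deriv (deriv fun t : ℝ => w (p + t • X)) 0 = fderiv ℝ (fderiv ℝ w) p X X := by
    rw [hd.deriv_eq]
    have h1 : HasFDerivAt (fderiv ℝ w) (fderiv ℝ (fderiv ℝ w) p) (p + (0 : ℝ) • X) := by
      rw [h0]
      exact ((hw.fderiv_right (m := 1) (by norm_num)).differentiableAt one_ne_zero).hasFDerivAt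
    have h2 : HasDerivAt (fun t : ℝ => fderiv ℝ w (p + t • X)) (fderiv ℝ (fderiv ℝ w) p X) 0 :=
      h1.comp_hasDerivAt 0 (hl 0)
    have h3 := h2.clm_apply (hasDerivAt_const (0 : ℝ) X)
    rw [h3.deriv, map_zero, add_zero]
  have hmax : IsLocalMax (fun t : ℝ => w (p + t • X)) 0 := by
    have := hlc.eventually hm
    simpa [IsLocalMax, IsMaxFilter, h0] using this
  have hmin : IsLocalMin (fun t : ℝ => w (p + t • X)) 0 := by
    refine isLocalMin_of_deriv_deriv_pos (hdd ▸ hpos) hmax.deriv_eq_zero ?_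
    exact ContinuousAt.comp (by rw [h0]; exact hw.continuousAt) (hl 0).continuousAt
  have hconst : (fun t : ℝ => w (p + t • X)) =ᶠ[𝓝 0] fun _ => w (p + (0 : ℝ) • X) := by
    filter_upwards [hmax, hmin] with t h1 h2
    exact le_antisymm h1 h2
  have : deriv (deriv fun t : ℝ => w (p + t • X)) 0 = 0 := by
    rw [hconst.deriv.deriv_eq]; simp
  linarith

theorem hasFDerivAt_exp_sq (a : ℝ) (y₁ y : E) :
    HasFDerivAt (fun y : E => Real.exp (-a * ‖y - y₁‖ ^ 2))
      ((-2 * a * Real.exp (-a * ‖y - y₁‖ ^ 2)) • innerSL ℝ (y - y₁)) y := by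
  have h1 := (((hasFDerivAt_id y).sub_const y₁).norm_sq.const_mul (-a)).exp
  refine h1.congr_fderiv ?_
  ext w
  simp
  ring

theorem fderiv_fderiv_exp_sq (a : ℝ) (y₁ y X : E) :
    fderiv ℝ (fderiv ℝ fun y : E => Real.exp (-a * ‖y - y₁‖ ^ 2)) y X X =
      (4 * a ^ 2 * ⟪y - y₁, X⟫ ^ 2 - 2 * a * ‖X‖ ^ 2) * Real.exp (-a * ‖y - y₁‖ ^ 2) := by
  have h1 : (fderiv ℝ fun y : E => Real.exp (-a * ‖y - y₁‖ ^ 2)) = fun y =>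
      (-2 * a * Real.exp (-a * ‖y - y₁‖ ^ 2)) • innerSL ℝ (y - y₁) :=
    funext fun y => (hasFDerivAt_exp_sq a y₁ y).fderiv
  have h2 : HasFDerivAt (fun y : E => innerSL ℝ (y - y₁)) (innerSL ℝ) y :=
    ((innerSL ℝ : E →L[ℝ] E →L[ℝ] ℝ).hasFDerivAt.comp y ((hasFDerivAt_id y).sub_const y₁))
  have h3 := ((hasFDerivAt_exp_sq a y₁ y).const_mul (-2 * a)).fun_smul h2
  rw [h1, h3.fderiv]
  simp only [add_apply, smul_apply, smul_eq_mul, ContinuousLinearMap.smulRight_apply,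
    innerSL_apply_apply]
  change -2 * a * Real.exp (-a * ‖y - y₁‖ ^ 2) * ⟪X, X⟫ + _ = _
  rw [real_inner_self_eq_norm_sq]
  ring

theorem contDiff_exp_sq (a : ℝ) (y₁ : E) :
    ContDiff ℝ 2 fun y : E => Real.exp (-a * ‖y - y₁‖ ^ 2) :=
  (contDiff_const.mul ((contDiff_id.sub contDiff_const).norm_sq ℝ)).exp

variable [FiniteDimensional ℝ E]

/-- Hopf's lemma: a subsolution cannot have a maximum on the boundary of a ball on which it is
smaller elsewhere. -/
theorem hopf_lemma {v : E → ℝ} {X Y B : E → E} {p₀ y₁ : E}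
    (hX : ContinuousAt X p₀) (hY : ContinuousAt Y p₀) (hB : ContinuousAt B p₀)
    (hv : ∀ᶠ y in 𝓝 p₀, ContDiffAt ℝ 2 v y)
    (hL : ∀ᶠ y in 𝓝 p₀, 0 ≤ fderiv ℝ (fderiv ℝ v) y (X y) (X y) +
      fderiv ℝ (fderiv ℝ v) y (Y y) (Y y) + fderiv ℝ v y (B y))
    (hmax : IsLocalMax v p₀)
    (hlt : ∀ᶠ y in 𝓝 p₀, ‖y - y₁‖ ≤ ‖p₀ - y₁‖ → y ≠ p₀ → v y < v p₀)
    (hXY : ⟪p₀ - y₁, X p₀⟫ ≠ 0 ∨ ⟪p₀ - y₁, Y p₀⟫ ≠ 0) : False := by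
  have hS : 0 < ⟪p₀ - y₁, X p₀⟫ ^ 2 + ⟪p₀ - y₁, Y p₀⟫ ^ 2 := by
    rcases hXY with h | h
    · have := pow_pos (abs_pos.mpr h) 2
      rw [sq_abs] at this; positivity
    · have := pow_pos (abs_pos.mpr h) 2
      rw [sq_abs] at this; positivity
  set S := ⟪p₀ - y₁, X p₀⟫ ^ 2 + ⟪p₀ - y₁, Y p₀⟫ ^ 2
  set N := ‖X p₀‖ ^ 2 + ‖Y p₀‖ ^ 2 + ⟪p₀ - y₁, B p₀⟫ with hN
  -- for this exponent the barrier is a strict subsolution at `p₀`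
  obtain ⟨a, ha, haS⟩ : ∃ a : ℝ, 0 < a ∧ 0 < 2 * a * S - N := by
    refine ⟨(|N| + 1) / (2 * S), by positivity, ?_⟩
    have : 2 * ((|N| + 1) / (2 * S)) * S = |N| + 1 := by field_simp
    rw [this]
    linarith [le_abs_self N]
  set h : E → ℝ := fun y => Real.exp (-a * ‖y - y₁‖ ^ 2) with hh
  have hbar : ∀ᶠ y in 𝓝 p₀, 0 < 2 * a * (⟪y - y₁, X y⟫ ^ 2 + ⟪y - y₁, Y y⟫ ^ 2) -
      (‖X y‖ ^ 2 + ‖Y y‖ ^ 2 + ⟪y - y₁, B y⟫) := by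
    refine ContinuousAt.eventually_lt continuousAt_const ?_ haS
    fun_prop
  obtain ⟨R, hR, hball⟩ := Metric.eventually_nhds_iff_ball.mp
    (hv.and (hL.and (hmax.and (hlt.and hbar))))
  set r := R / 2 with hr
  have hr0 : 0 < r := by positivity
  have hsub : Metric.closedBall p₀ r ⊆ Metric.ball p₀ R :=
    Metric.closedBall_subset_ball (by rw [hr]; linarith)
  have hvc : ContinuousOn v (Metric.closedBall p₀ r) := fun y hy =>
    (hball y (hsub hy)).1.continuousAt.continuousWithinAt
  have hhc : Continuous h := (contDiff_exp_sq a y₁).continuous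
  have hh1 : ∀ y, h y ≤ 1 := fun y => Real.exp_le_one_iff.mpr (by
    have : 0 ≤ a * ‖y - y₁‖ ^ 2 := by positivity
    linarith)
  have hh0 : ∀ y, 0 < h y := fun y => Real.exp_pos _
  -- the part of the small sphere lying in the ball
  obtain ⟨ε, hε, hεK⟩ : ∃ ε : ℝ, 0 < ε ∧ ∀ y ∈ Metric.sphere p₀ r, ‖y - y₁‖ ≤ ‖p₀ - y₁‖ →
      v y + ε < v p₀ := by
    set K := Metric.sphere p₀ r ∩ {y | ‖y - y₁‖ ≤ ‖p₀ - y₁‖} with hK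
    have hKc : IsCompact K := (isCompact_sphere p₀ r).inter_right
      (isClosed_le (by fun_prop) continuous_const)
    rcases K.eq_empty_or_nonempty with he | hne
    · refine ⟨1, one_pos, fun y hy hy' => ?_⟩
      have : y ∈ K := ⟨hy, hy'⟩
      rw [he] at this
      exact this.elim
    · obtain ⟨z, hz, hzmax⟩ := hKc.exists_isMaxOn hne
        (hvc.mono (Set.inter_subset_left.trans Metric.sphere_subset_closedBall))
      have hz1 : v z < v p₀ := by
        refine (hball z (hsub (Metric.sphere_subset_closedBall hz.1))).2.2.2.1 hz.2 ?_
        rintro rfl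
        have := hz.1
        simp at this
        linarith
      refine ⟨(v p₀ - v z) / 2, by linarith, fun y hy hy' => ?_⟩
      have : v y ≤ v z := hzmax ⟨hy, hy'⟩
      linarith
  obtain ⟨p, hp, hpmax⟩ := (isCompact_closedBall p₀ r).exists_isMaxOn
    ⟨p₀, Metric.mem_closedBall_self hr0.le⟩ (hvc.add (continuousOn_const.mul hhc.continuousOn) :
      ContinuousOn (fun y => v y + ε * h y) _)
  have hpp : v p₀ + ε * h p₀ ≤ v p + ε * h p := hpmax (Metric.mem_closedBall_self hr0.le)
  have hpb : p ∈ Metric.ball p₀ r := by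
    rcases (Metric.mem_closedBall.mp hp).lt_or_eq with h1 | h1
    · exact h1
    · exfalso
      by_cases h2 : ‖p - y₁‖ ≤ ‖p₀ - y₁‖
      · have h3 := hεK p h1 h2
        have h4 := mul_le_mul_of_nonneg_left (hh1 p) hε.le
        have h5 := mul_pos hε (hh0 p₀)
        linarith
      · have h3 : h p < h p₀ := by
          rw [hh]
          refine Real.exp_lt_exp.mpr ?_
          have : ‖p₀ - y₁‖ ^ 2 < ‖p - y₁‖ ^ 2 := by
            gcongr
            exact not_le.mp h2
          nlinarith
        have h4 := mul_lt_mul_of_pos_left h3 hε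
        have h5 : v p ≤ v p₀ := (hball p (hsub hp)).2.2.1
        linarith
  obtain ⟨hvp, hLp, -, -, hbp⟩ := hball p (hsub hp)
  have hw : IsLocalMax (fun y => v y + ε * h y) p :=
    (hpmax.on_subset Metric.ball_subset_closedBall).isLocalMax (Metric.isOpen_ball.mem_nhds hpb)
  have hhd : ContDiff ℝ 2 h := contDiff_exp_sq a y₁
  have hwd : ContDiffAt ℝ 2 (fun y => v y + ε * h y) p :=
    hvp.add (contDiffAt_const.mul hhd.contDiffAt)
  have hfd : ∀ᶠ y in 𝓝 p, fderiv ℝ (fun y => v y + ε * h y) y =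
      fderiv ℝ v y + ε • fderiv ℝ h y := by
    filter_upwards [hvp.eventually (by simp)] with y hy
    exact ((hy.differentiableAt two_ne_zero).hasFDerivAt.add
      ((hhd.differentiable two_ne_zero y).hasFDerivAt.const_mul ε)).fderiv
  have hfd2 : fderiv ℝ (fderiv ℝ fun y => v y + ε * h y) p =
      fderiv ℝ (fderiv ℝ v) p + ε • fderiv ℝ (fderiv ℝ h) p := by
    rw [Filter.EventuallyEq.fderiv_eq hfd]
    exact ((((hvp.fderiv_right (m := 1) (by norm_num)).differentiableAt one_ne_zero).hasFDerivAt).add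
      ((((hhd.contDiffAt (x := p)).fderiv_right (m := 1) (by norm_num)).differentiableAt
        one_ne_zero).hasFDerivAt.const_smul ε)).fderiv
  have h1 : fderiv ℝ v p + ε • fderiv ℝ h p = 0 := by
    rw [← hfd.self_of_nhds]; exact hw.fderiv_eq_zero
  have hX2 := fderiv_fderiv_nonpos_of_isLocalMax hw hwd (X p)
  have hY2 := fderiv_fderiv_nonpos_of_isLocalMax hw hwd (Y p)
  have hB2 := DFunLike.congr_fun h1 (B p)
  rw [hfd2] at hX2 hY2
  simp only [add_apply, smul_apply, smul_eq_mul, zero_apply, hh, fderiv_fderiv_exp_sq,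
    (hasFDerivAt_exp_sq a y₁ p).fderiv, innerSL_apply_apply] at hX2 hY2 hB2
  have key : 0 < ε * (2 * a) * Real.exp (-a * ‖p - y₁‖ ^ 2) *
    (2 * a * (⟪p - y₁, X p⟫ ^ 2 + ⟪p - y₁, Y p⟫ ^ 2) -
      (‖X p‖ ^ 2 + ‖Y p‖ ^ 2 + ⟪p - y₁, B p⟫)) := by
    have := Real.exp_pos (-a * ‖p - y₁‖ ^ 2)
    positivity
  have hfin : ε * (2 * a) * Real.exp (-a * ‖p - y₁‖ ^ 2) *
    (2 * a * (⟪p - y₁, X p⟫ ^ 2 + ⟪p - y₁, Y p⟫ ^ 2) -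
      (‖X p‖ ^ 2 + ‖Y p‖ ^ 2 + ⟪p - y₁, B p⟫)) ≤ 0 := by linarith
  exact absurd hfin (not_le.mpr key)

/-- The strong maximum principle: a subsolution of an elliptic equation with continuous
coefficients is constant near a local maximum. -/
theorem eventually_eq_of_isLocalMax {v : E → ℝ} {X Y B : E → E} {y₀ : E}
    (hX : ∀ᶠ y in 𝓝 y₀, ContinuousAt X y) (hY : ∀ᶠ y in 𝓝 y₀, ContinuousAt Y y)
    (hB : ∀ᶠ y in 𝓝 y₀, ContinuousAt B y) (hv : ∀ᶠ y in 𝓝 y₀, ContDiffAt ℝ 2 v y)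
    (hL : ∀ᶠ y in 𝓝 y₀, 0 ≤ fderiv ℝ (fderiv ℝ v) y (X y) (X y) +
      fderiv ℝ (fderiv ℝ v) y (Y y) (Y y) + fderiv ℝ v y (B y))
    (hXY : ∀ᶠ y in 𝓝 y₀, ∀ n, n ≠ 0 → ⟪n, X y⟫ ≠ 0 ∨ ⟪n, Y y⟫ ≠ 0)
    (hmax : IsLocalMax v y₀) : ∀ᶠ y in 𝓝 y₀, v y = v y₀ := by
  obtain ⟨R, hR, hball⟩ := Metric.eventually_nhds_iff_ball.mp
    (hX.and (hY.and (hB.and (hv.and (hL.and (hXY.and hmax))))))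
  rw [Metric.eventually_nhds_iff_ball]
  refine ⟨R / 4, by positivity, ?_⟩
  by_contra! hcon
  obtain ⟨y', hy', hvy'⟩ := hcon
  have hsub : Metric.closedBall y₀ (R / 2) ⊆ Metric.ball y₀ R :=
    Metric.closedBall_subset_ball (by linarith)
  set K := Metric.closedBall y₀ (R / 2) ∩ v ⁻¹' {v y₀} with hK
  have hvc : ContinuousOn v (Metric.closedBall y₀ (R / 2)) := fun y hy =>
    (hball y (hsub hy)).2.2.2.1.continuousAt.continuousWithinAt
  have hKc : IsCompact K := (isCompact_closedBall y₀ (R / 2)).of_isClosed_subset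
    (hvc.preimage_isClosed_of_isClosed Metric.isClosed_closedBall isClosed_singleton)
    Set.inter_subset_left
  have hy₀K : y₀ ∈ K := ⟨Metric.mem_closedBall_self (by positivity), rfl⟩
  -- the point of the level set nearest to `y'`
  obtain ⟨p₀, hp₀, hdist⟩ := hKc.exists_infDist_eq_dist ⟨y₀, hy₀K⟩ y'
  have hnear : ∀ y ∈ K, dist y' p₀ ≤ dist y' y := fun y hy => by
    rw [← hdist]; exact Metric.infDist_le_dist_of_mem hy
  have hd : dist y' p₀ < R / 4 := (hnear y₀ hy₀K).trans_lt (Metric.mem_ball.mp hy')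
  have hvp : v p₀ = v y₀ := hp₀.2
  have hpb : p₀ ∈ Metric.ball y₀ R := hsub hp₀.1
  obtain ⟨h1, h2, h3, -, -, h6, -⟩ := hball p₀ hpb
  have hne : p₀ - y' ≠ 0 := by
    intro h
    rw [sub_eq_zero] at h
    rw [h] at hvp
    exact hvy' hvp
  set n : E := (1 / 2 : ℝ) • (p₀ - y') with hn
  have hn0 : n ≠ 0 := smul_ne_zero (by norm_num) hne
  have hpn : p₀ - (p₀ - n) = n := by abel
  have hev := Metric.isOpen_ball.mem_nhds hpb
  have hball' : ∀ᶠ y in 𝓝 p₀, y ∈ Metric.ball y₀ R := hev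
  refine hopf_lemma (y₁ := p₀ - n) h1 h2 h3 (hball'.mono fun y hy => (hball y hy).2.2.2.1)
    (hball'.mono fun y hy => (hball y hy).2.2.2.2.1)
    (hball'.mono fun y hy => hvp ▸ (hball y hy).2.2.2.2.2.2) (hball'.mono fun y hy hle hyp => ?_)
    (by rw [hpn]; exact h6 n hn0)
  rw [hpn] at hle
  have hlt : dist y' y < dist y' p₀ := by
    have e1 : y - y' = (y - (p₀ - n)) + n := by
      have : y' = p₀ - (2 : ℝ) • n := by rw [hn, smul_smul]; norm_num
      rw [this, two_smul]; abel
    have e2 : p₀ - y' = (2 : ℝ) • n := by rw [hn, smul_smul]; norm_num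
    have e3 := parallelogram_law_with_norm ℝ (y - (p₀ - n)) n
    rw [← e1] at e3
    have e4 : 0 < ‖y - (p₀ - n) - n‖ := by
      rw [norm_pos_iff]
      have : y - (p₀ - n) - n = y - p₀ := by abel
      rw [this]; exact sub_ne_zero.mpr hyp
    rw [dist_comm, dist_eq_norm, dist_comm, dist_eq_norm, e2, norm_smul]
    refine lt_of_pow_lt_pow_left₀ 2 (by positivity) ?_
    have e5 : ‖y - (p₀ - n)‖ ^ 2 ≤ ‖n‖ ^ 2 := by gcongr
    simp only [Real.norm_ofNat]
    nlinarith
  have hyK : y ∉ K := fun h => absurd (hnear y h) (not_le.mpr hlt)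
  have hyb : y ∈ Metric.closedBall y₀ (R / 2) := by
    have := dist_triangle y y' y₀
    rw [Metric.mem_closedBall]
    rw [Metric.mem_ball] at hy'
    rw [dist_comm y' y] at hlt
    linarith
  rw [hvp]
  refine lt_of_le_of_ne (hball y (hsub hyb)).2.2.2.2.2.2 fun h => hyK ⟨hyb, h⟩

end MaximumPrinciple

/-! ### A Bochner formula for deformations -/

namespace HKQuadruple

open LieAlgebra

variable {L : Type*} [LieRing L] [LieAlgebra ℂ L] [Module.Finite ℂ L] [IsSimple ℂ L]
  {Q : HKQuadruple L}

theorem rho_sub_rho (a : L) : Q.ρ (a - Q.ρ a) = -(a - Q.ρ a) := by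
  rw [map_sub, Q.rho_rho]; abel

theorem rho_add_rho (a : L) : Q.ρ (a + Q.ρ a) = a + Q.ρ a := by
  rw [map_add, Q.rho_rho]; abel

variable (Q) in
/-- The map `a ↦ i (a + ρ a)`, which is `(i a) - ρ (i a)`: when `a = φ u`, so that the derivative of
the surface along `u` is `a - ρ a`, this is the derivative in the direction obtained from `u` by a
quarter turn. -/
noncomputable def rotL : L →L[ℝ] L :=
  (LinearMap.toContinuousLinearMap ((Complex.I • LinearMap.id : L →ₗ[ℂ] L).restrictScalars ℝ)) ∘L
    (ContinuousLinearMap.id ℝ L + Q.rhoL)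

theorem rotL_apply (a : L) : Q.rotL a = Complex.I • (a + Q.ρ a) := rfl

theorem sub_rho_eq {a b : L} {x y : ℝ} (h : b = (⟨x, y⟩ : ℂ) • a) :
    b - Q.ρ b = x • (a - Q.ρ a) + y • Q.rotL a := by
  have hz : (⟨x, y⟩ : ℂ) = x + y * Complex.I := Complex.mk_eq_add_mul_I x y
  rw [h, map_smulₛₗ, hz, rotL_apply]
  simp only [← Complex.coe_smul, map_add, map_mul, Complex.conj_ofReal, Complex.conj_I]
  module

theorem smul_rotL {a b : L} {x y : ℝ} (h : b = (⟨x, y⟩ : ℂ) • a) :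
    y • Q.rotL a = (b - Q.ρ b) - x • (a - Q.ρ a) := by
  rw [sub_rho_eq h]; abel

theorem smul_rotL' {a b : L} {x y : ℝ} (h : b = (⟨x, y⟩ : ℂ) • a) :
    y • Q.rotL b = x • (b - Q.ρ b) - (x ^ 2 + y ^ 2) • (a - Q.ρ a) := by
  have hz : (⟨x, y⟩ : ℂ) = x + y * Complex.I := Complex.mk_eq_add_mul_I x y
  have hI : Complex.I * Complex.I = -1 := Complex.I_mul_I
  rw [sub_rho_eq h, rotL_apply, rotL_apply, h, map_smulₛₗ, hz]
  simp only [← Complex.coe_smul, map_add, map_mul, Complex.conj_ofReal, Complex.conj_I]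
  match_scalars
  · linear_combination (y ^ 2 : ℂ) * hI
  · linear_combination (-y ^ 2 : ℂ) * hI

/-- The algebraic core of the Bochner formula. For `κ` the part of the deformation fixed by `ρ` and
`π` the other one, the left hand side is `y` times the curl of the conjugate derivative of the
energy, with `δ₁, δ₂` the covariant derivatives of `κ` in the directions `a, b` and with those of
`π` expanded. The right hand side is the quadratic form `q₂ - 2 x q₁₂ + (x² + y²) q₁₁` attached to
the complex structure in which `b` is `x + i y` times `a`, applied to `δ` and to the brackets
with `κ`. When `ρ` fixes `κ` both terms are nonpositive, as the Killing form is negative on the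
`δᵢ`, which `ρ` fixes, and positive on the brackets, of which `ρ` changes the sign. -/
theorem bochner_identity {a b η₁ η₂ κ π δ₁ δ₂ t₁ t₂ : L} {x y : ℝ}
    (ha : a ∈ Q.weightSum Q.Z) (hη₁ : η₁ ∈ Q.weightSum Q.Z) (hη₂ : η₂ ∈ Q.weightSum Q.Z)
    (hz : b = (⟨x, y⟩ : ℂ) • a) (hη : ⁅η₁, b⁆ = ⁅η₂, a⁆) (hκ : Q.proj {0} κ = 0)
    (ht₁ : t₁ ∈ Q.h) (ht₂ : t₂ ∈ Q.h) (hδ₁ : Q.proj {0} δ₁ = 0) (hδ₂ : Q.proj {0} δ₂ = 0)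
    (hδt₁ : δ₁ = -⁅a - Q.ρ a, π⁆ + t₁) (hδt₂ : δ₂ = -⁅b - Q.ρ b, π⁆ + t₂) :
    y * ((reKilling L ⁅Q.rotL b, -⁅a - Q.ρ a, κ⁆ + (2 : ℝ) • (η₁ - Q.ρ η₁)⁆ κ +
        reKilling L ⁅Q.rotL b, π⁆ δ₁) -
      (reKilling L ⁅Q.rotL a, -⁅b - Q.ρ b, κ⁆ + (2 : ℝ) • (η₂ - Q.ρ η₂)⁆ κ +
        reKilling L ⁅Q.rotL a, π⁆ δ₂)) =
    (reKilling L (δ₂ - x • δ₁) (δ₂ - x • δ₁) + y ^ 2 * reKilling L δ₁ δ₁) -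
      (reKilling L ⁅(b - Q.ρ b) - x • (a - Q.ρ a), κ⁆ ⁅(b - Q.ρ b) - x • (a - Q.ρ a), κ⁆ +
        y ^ 2 * reKilling L ⁅a - Q.ρ a, κ⁆ ⁅a - Q.ρ a, κ⁆) := by
  have hb : b ∈ Q.weightSum Q.Z := hz ▸ Submodule.smul_mem _ _ ha
  -- the second derivatives contribute nothing
  have hE : reKilling L (⁅Q.rotL b, η₁ - Q.ρ η₁⁆ - ⁅Q.rotL a, η₂ - Q.ρ η₂⁆) κ = 0 := by
    refine Q.reKilling_eq_zero_of_mem_h ?_ hκ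
    have h1 : ⁅b, η₁⁆ = ⁅a, η₂⁆ := by rw [← lie_skew, hη, lie_skew]
    have h2 : ⁅Q.ρ b, Q.ρ η₁⁆ = ⁅Q.ρ a, Q.ρ η₂⁆ := by
      rw [← Q.ρ_conj.map_lie, h1, Q.ρ_conj.map_lie]
    have h3 : ⁅Q.rotL b, η₁ - Q.ρ η₁⁆ - ⁅Q.rotL a, η₂ - Q.ρ η₂⁆ =
        Complex.I • (⁅a, Q.ρ η₂⁆ - ⁅b, Q.ρ η₁⁆ + (⁅η₂, Q.ρ a⁆ - ⁅η₁, Q.ρ b⁆)) := by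
      rw [rotL_apply, rotL_apply, smul_lie, smul_lie, ← smul_sub]
      congr 1
      rw [add_lie, add_lie, lie_sub, lie_sub, lie_sub, lie_sub, h1, h2, ← lie_skew η₂,
        ← lie_skew η₁]
      abel
    rw [h3]
    exact Q.h.smul_mem _ (Q.h.add_mem (Q.h.sub_mem (lie_rho_mem_h ha hη₂) (lie_rho_mem_h hb hη₁))
      (Q.h.sub_mem (lie_rho_mem_h hη₂ ha) (lie_rho_mem_h hη₁ hb)))
  have hab := smul_rotL (Q := Q) hz
  have hab' := smul_rotL' (Q := Q) hz
  generalize a - Q.ρ a = B₁ at *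
  generalize b - Q.ρ b = B₂ at *
  have e1 : y * reKilling L ⁅Q.rotL b, ⁅B₁, κ⁆⁆ κ =
      -(x * reKilling L ⁅B₁, κ⁆ ⁅B₂, κ⁆ - (x ^ 2 + y ^ 2) * reKilling L ⁅B₁, κ⁆ ⁅B₁, κ⁆) := by
    rw [reKilling_lie', mul_neg, ← smul_eq_mul, ← map_smul, ← real_smul_lie, hab', sub_lie,
      real_smul_lie, real_smul_lie, map_sub, map_smul, map_smul, smul_eq_mul, smul_eq_mul]
  have e2 : y * reKilling L ⁅Q.rotL a, ⁅B₂, κ⁆⁆ κ =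
      -(reKilling L ⁅B₂, κ⁆ ⁅B₂, κ⁆ - x * reKilling L ⁅B₁, κ⁆ ⁅B₂, κ⁆) := by
    rw [reKilling_lie', mul_neg, ← smul_eq_mul, ← map_smul, ← real_smul_lie, hab, sub_lie,
      real_smul_lie, map_sub, map_smul, smul_eq_mul, reKilling_comm ⁅B₂, κ⁆ ⁅B₁, κ⁆]
  have f1 : ⁅B₁, π⁆ = t₁ - δ₁ := by rw [hδt₁]; abel
  have f2 : ⁅B₂, π⁆ = t₂ - δ₂ := by rw [hδt₂]; abel
  have e3 : y * reKilling L ⁅Q.rotL b, π⁆ δ₁ =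
      -x * reKilling L δ₂ δ₁ + (x ^ 2 + y ^ 2) * reKilling L δ₁ δ₁ := by
    rw [← smul_eq_mul, ← LinearMap.smul_apply, ← map_smul, ← real_smul_lie, hab', sub_lie,
      real_smul_lie, real_smul_lie, f1, f2]
    simp only [map_sub, map_smul, LinearMap.sub_apply, LinearMap.smul_apply, smul_eq_mul,
      Q.reKilling_eq_zero_of_mem_h ht₁ hδ₁, Q.reKilling_eq_zero_of_mem_h ht₂ hδ₁]
    ring
  have e4 : y * reKilling L ⁅Q.rotL a, π⁆ δ₂ =
      -reKilling L δ₂ δ₂ + x * reKilling L δ₂ δ₁ := by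
    rw [← smul_eq_mul, ← LinearMap.smul_apply, ← map_smul, ← real_smul_lie, hab, sub_lie,
      real_smul_lie, f1, f2]
    simp only [map_sub, map_smul, LinearMap.sub_apply, LinearMap.smul_apply, smul_eq_mul,
      Q.reKilling_eq_zero_of_mem_h ht₁ hδ₂, Q.reKilling_eq_zero_of_mem_h ht₂ hδ₂,
      reKilling_comm δ₁ δ₂]
    ring
  simp only [lie_add, lie_neg, real_lie_smul, sub_lie, real_smul_lie, map_add, map_neg, map_sub,
    map_smul, LinearMap.add_apply, LinearMap.neg_apply, LinearMap.sub_apply, LinearMap.smul_apply,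
    smul_eq_mul] at hE e1 e2 e3 e4 ⊢
  rw [reKilling_comm ⁅B₂, κ⁆ ⁅B₁, κ⁆, reKilling_comm δ₁ δ₂]
  linear_combination (-1 : ℝ) * e1 + e2 + e3 - e4 + 2 * y * hE

end HKQuadruple

/-! ### The elliptic inequality for the compact part of a deformation -/

namespace HKQuadruple

open LieAlgebra

variable {L : Type*} [LieRing L] [LieAlgebra ℂ L] [Module.Finite ℂ L] [IsSimple ℂ L]
  {Q : HKQuadruple L}

variable (Q) in
/-- The square of the norm of the part of `ζ` which is fixed by `ρ`, up to a factor. -/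
noncomputable def energy (ζ : L) : ℝ :=
  -(1 / 2) * reK L (ζ + Q.ρ ζ) (ζ + Q.ρ ζ)

theorem add_rho_eq_zero_of_energy {ζ : L} (h : Q.energy ζ = 0) : ζ + Q.ρ ζ = 0 := by
  by_contra h0
  have := Q.reKilling_self_neg (rho_add_rho (Q := Q) ζ) h0
  rw [energy, reK_apply] at h; linarith

/-- The trilinear form `⟨⁅a, x⁆, y⟩` is invariant. -/
theorem reK_add_lie_rotations (τ a x y : L) :
    reKilling L ⁅⁅τ, a⁆, x⁆ y + reKilling L ⁅a, ⁅τ, x⁆⁆ y + reKilling L ⁅a, x⁆ ⁅τ, y⁆ = 0 := by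
  rw [← LinearMap.add_apply, ← map_add, ← leibniz_lie, reKilling_lie']
  ring

theorem rotL_lie {τ : L} (hτ : τ ∈ Q.t) (a : L) : Q.rotL ⁅τ, a⁆ = ⁅τ, Q.rotL a⁆ := by
  rw [rotL_apply, rotL_apply, Q.ρ_conj.map_lie, hτ.2.1, ← lie_add, lie_smul]

variable {A φ η : EuclideanSpace ℝ (Fin 2) → EuclideanSpace ℝ (Fin 2) →L[ℝ] L}
  {ζ : EuclideanSpace ℝ (Fin 2) → L} {y : EuclideanSpace ℝ (Fin 2)}

theorem IsLocalModel.hasFDerivAt_ζ (h : Q.IsLocalModel A φ η ζ y) :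
    HasFDerivAt ζ (fderiv ℝ ζ y) y := (h.contDiffAt_ζ.differentiableAt two_ne_zero).hasFDerivAt

theorem IsLocalModel.hasFDerivAt_add (h : Q.IsLocalModel A φ η ζ y) :
    HasFDerivAt (fun y => ζ y + Q.ρ (ζ y)) ((ContinuousLinearMap.id ℝ L + Q.rhoL) ∘L fderiv ℝ ζ y)
      y :=
  (ContinuousLinearMap.id ℝ L + Q.rhoL).hasFDerivAt.comp y h.hasFDerivAt_ζ

theorem IsLocalModel.hasFDerivAt_sub (h : Q.IsLocalModel A φ η ζ y) :
    HasFDerivAt (fun y => ζ y - Q.ρ (ζ y)) ((ContinuousLinearMap.id ℝ L - Q.rhoL) ∘L fderiv ℝ ζ y)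
      y :=
  (ContinuousLinearMap.id ℝ L - Q.rhoL).hasFDerivAt.comp y h.hasFDerivAt_ζ

/-- The derivative of `ζ` and of its parts `ζ + ρ ζ`, `ζ - ρ ζ`. Bracketing with the derivative of
the surface exchanges the two parts; the remaining
terms are an element of `t` for the first and `2 (η - ρ η)` for the second. -/
theorem IsLocalModel.exists_deriv_eq (h : Q.IsLocalModel A φ η ζ y)
    (w : EuclideanSpace ℝ (Fin 2)) : ∃ τ ∈ Q.t, ∃ t ∈ Q.t,
      A y w - (φ y w - Q.ρ (φ y w)) = τ ∧
      fderiv ℝ ζ y w = -⁅τ, ζ y⁆ - ⁅φ y w - Q.ρ (φ y w), ζ y⁆ + (η y w - Q.ρ (η y w)) + t ∧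
      ((ContinuousLinearMap.id ℝ L + Q.rhoL) ∘L fderiv ℝ ζ y) w = -⁅τ, ζ y + Q.ρ (ζ y)⁆ -
        ⁅φ y w - Q.ρ (φ y w), ζ y - Q.ρ (ζ y)⁆ + (2 : ℝ) • t ∧
      ((ContinuousLinearMap.id ℝ L - Q.rhoL) ∘L fderiv ℝ ζ y) w = -⁅τ, ζ y - Q.ρ (ζ y)⁆ -
        ⁅φ y w - Q.ρ (φ y w), ζ y + Q.ρ (ζ y)⁆ + (2 : ℝ) • (η y w - Q.ρ (η y w)) := by
  obtain ⟨τ, hτ⟩ : ∃ τ, A y w - (φ y w - Q.ρ (φ y w)) = τ := ⟨_, rfl⟩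
  obtain ⟨t, ht⟩ : ∃ t, fderiv ℝ ζ y w + ⁅A y w, ζ y⁆ - (η y w - Q.ρ (η y w)) = t := ⟨_, rfl⟩
  have hτt : τ ∈ Q.t := hτ ▸ h.sub_mem w
  have htt : t ∈ Q.t := ht ▸ h.deriv_sub_mem w
  have hA : A y w = τ + (φ y w - Q.ρ (φ y w)) := by rw [← hτ]; abel
  have hd : fderiv ℝ ζ y w =
      -⁅τ, ζ y⁆ - ⁅φ y w - Q.ρ (φ y w), ζ y⁆ + (η y w - Q.ρ (η y w)) + t := by
    rw [← ht, hA, add_lie]; abel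
  have hr : Q.ρ (fderiv ℝ ζ y w) = -⁅τ, Q.ρ (ζ y)⁆ + ⁅φ y w - Q.ρ (φ y w), Q.ρ (ζ y)⁆ -
      (η y w - Q.ρ (η y w)) + t := by
    rw [hd, map_add, map_add, map_sub, map_neg, Q.ρ_conj.map_lie, Q.ρ_conj.map_lie, hτt.2.1,
      htt.2.1, rho_sub_rho, rho_sub_rho, neg_lie]
    abel
  refine ⟨τ, hτt, t, htt, hτ, hd, ?_, ?_⟩
  · change fderiv ℝ ζ y w + Q.ρ (fderiv ℝ ζ y w) = _
    rw [hr, hd, lie_add, lie_sub _ (ζ y), two_smul]; abel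
  · change fderiv ℝ ζ y w - Q.ρ (fderiv ℝ ζ y w) = _
    rw [hr, hd, lie_sub, lie_add _ (ζ y), two_smul]; abel

theorem IsLocalModel.proj_zero_add (h : Q.IsLocalModel A φ η ζ y) :
    Q.proj {0} (ζ y + Q.ρ (ζ y)) = 0 := Q.proj_zero_add_rho h.deform.mem_tPerp h.deform.lam_eq

theorem IsLocalModel.contDiffAt_energy (h : Q.IsLocalModel A φ η ζ y) :
    ContDiffAt ℝ 2 (fun y => Q.energy (ζ y)) y := by
  have h1 : ContDiffAt ℝ 2 (fun y => ζ y + Q.ρ (ζ y)) y :=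
    (ContinuousLinearMap.id ℝ L + Q.rhoL).contDiff.contDiffAt.comp y h.contDiffAt_ζ
  exact contDiffAt_const.mul (((reK L).contDiff.contDiffAt.comp y h1).clm_apply h1)

theorem IsLocalModel.fderiv_energy (h : Q.IsLocalModel A φ η ζ y)
    (w : EuclideanSpace ℝ (Fin 2)) : fderiv ℝ (fun y => Q.energy (ζ y)) y w =
      reKilling L ⁅φ y w - Q.ρ (φ y w), ζ y - Q.ρ (ζ y)⁆ (ζ y + Q.ρ (ζ y)) := by
  have h1 := (((reK L).hasFDerivAt.comp y h.hasFDerivAt_add).clm_apply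
    h.hasFDerivAt_add).const_mul (-(1 / 2) : ℝ)
  have h2 : fderiv ℝ (fun y => Q.energy (ζ y)) y w = _ := congrArg (fun T => T w) h1.fderiv
  rw [h2]
  obtain ⟨τ, hτ, t, ht, -, -, h3, -⟩ := h.exists_deriv_eq w
  simp only [smul_apply, add_apply, ContinuousLinearMap.flip_apply, smul_eq_mul,
    ContinuousLinearMap.comp_apply (reK L)] at *
  simp only [ContinuousLinearMap.comp_apply, Function.comp_apply] at *
  rw [h3, reK_apply, reK_apply, reKilling_comm (ζ y + Q.ρ (ζ y))]
  have h4 := Q.reKilling_eq_zero_of_mem_h ht.1 h.proj_zero_add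
  have h5 : reKilling L ⁅τ, ζ y + Q.ρ (ζ y)⁆ (ζ y + Q.ρ (ζ y)) = 0 := by
    have := reKilling_lie' τ (ζ y + Q.ρ (ζ y)) (ζ y + Q.ρ (ζ y))
    rw [reKilling_comm (ζ y + Q.ρ (ζ y)) ⁅τ, _⁆] at this
    linarith
  simp only [map_add, map_sub, map_neg, map_smul, LinearMap.add_apply, LinearMap.sub_apply,
    LinearMap.neg_apply, LinearMap.smul_apply, smul_eq_mul] at h4 h5 ⊢
  linear_combination (1 : ℝ) * h5 - 2 * h4

variable (Q) in
/-- The derivative of the energy in the direction obtained from `w` by a quarter turn. -/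
noncomputable def conjDeriv (φ : EuclideanSpace ℝ (Fin 2) → EuclideanSpace ℝ (Fin 2) →L[ℝ] L)
    (ζ : EuclideanSpace ℝ (Fin 2) → L) (w y : EuclideanSpace ℝ (Fin 2)) : ℝ :=
  reK L ⁅Q.rotL (φ y w), ζ y - Q.ρ (ζ y)⁆ (ζ y + Q.ρ (ζ y))

theorem IsLocalModel.differentiableAt_conjDeriv (h : Q.IsLocalModel A φ η ζ y)
    (w : EuclideanSpace ℝ (Fin 2)) : DifferentiableAt ℝ (Q.conjDeriv φ ζ w) y ∧
    ∀ u, fderiv ℝ (Q.conjDeriv φ ζ w) y u =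
      reKilling L ⁅Q.rotL (fderiv ℝ φ y u w), ζ y - Q.ρ (ζ y)⁆ (ζ y + Q.ρ (ζ y)) +
      reKilling L ⁅Q.rotL (φ y w), ((ContinuousLinearMap.id ℝ L - Q.rhoL) ∘L fderiv ℝ ζ y) u⁆
        (ζ y + Q.ρ (ζ y)) +
      reKilling L ⁅Q.rotL (φ y w), ζ y - Q.ρ (ζ y)⁆
        (((ContinuousLinearMap.id ℝ L + Q.rhoL) ∘L fderiv ℝ ζ y) u) := by
  have hφ : HasFDerivAt (fun y => Q.rotL (φ y w)) (Q.rotL ∘L (fderiv ℝ φ y).flip w) y :=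
    Q.rotL.hasFDerivAt.comp y
      ((((h.contDiffAt_φ.differentiableAt two_ne_zero).hasFDerivAt).clm_apply
        (hasFDerivAt_const w y)).congr_fderiv (by ext; simp))
  have h1 := ((reK L).hasFDerivAt.comp y (((lieB L).hasFDerivAt.comp y hφ).clm_apply
    h.hasFDerivAt_sub)).clm_apply h.hasFDerivAt_add
  have h2 : HasFDerivAt (Q.conjDeriv φ ζ w) _ y := h1
  refine ⟨h2.differentiableAt, fun u => ?_⟩
  rw [h2.fderiv]
  change reKilling L ⁅Q.rotL (φ y w), ζ y - Q.ρ (ζ y)⁆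
        (((ContinuousLinearMap.id ℝ L + Q.rhoL) ∘L fderiv ℝ ζ y) u) +
    reKilling L (⁅Q.rotL (φ y w), ((ContinuousLinearMap.id ℝ L - Q.rhoL) ∘L fderiv ℝ ζ y) u⁆ +
      ⁅Q.rotL (fderiv ℝ φ y u w), ζ y - Q.ρ (ζ y)⁆) (ζ y + Q.ρ (ζ y)) = _
  rw [map_add (reKilling L), LinearMap.add_apply]
  ring

/-- The Bochner inequality. When `v` is `z₁ + i z₂` times `u` for the complex structure of the
surface, the left hand side is a negative multiple of the Laplacian of the energy, and the right
hand side is minus a nonnegative quadratic expression in `⁅φ - ρ φ, ζ + ρ ζ⁆`. Thus the energy is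
subharmonic, and where its Laplacian vanishes `ζ + ρ ζ` commutes with the derivative of the
surface. -/
theorem curl_conjDeriv_le (h : ∀ᶠ y in 𝓝 y, Q.IsLocalModel A φ η ζ y)
    {u v : EuclideanSpace ℝ (Fin 2)} {z₁ z₂ : ℝ} (hz : φ y v = (⟨z₁, z₂⟩ : ℂ) • φ y u) :
    z₂ * (fderiv ℝ (Q.conjDeriv φ ζ v) y u - fderiv ℝ (Q.conjDeriv φ ζ u) y v) ≤
      -(reKilling L ⁅(φ y v - Q.ρ (φ y v)) - z₁ • (φ y u - Q.ρ (φ y u)), ζ y + Q.ρ (ζ y)⁆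
        ⁅(φ y v - Q.ρ (φ y v)) - z₁ • (φ y u - Q.ρ (φ y u)), ζ y + Q.ρ (ζ y)⁆ +
        z₂ ^ 2 * reKilling L ⁅φ y u - Q.ρ (φ y u), ζ y + Q.ρ (ζ y)⁆
          ⁅φ y u - Q.ρ (φ y u), ζ y + Q.ρ (ζ y)⁆) := by
  have hy := h.self_of_nhds
  rw [(hy.differentiableAt_conjDeriv v).2, (hy.differentiableAt_conjDeriv u).2]
  have hstr := hy.structure_eq u v
  obtain ⟨τ, hτ, t, ht, hA, -, hκ, hπ⟩ := hy.exists_deriv_eq u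
  obtain ⟨τ', hτ', t', ht', hA', -, hκ', hπ'⟩ := hy.exists_deriv_eq v
  have hδ : ∀ w, Q.proj {0} (((ContinuousLinearMap.id ℝ L + Q.rhoL) ∘L fderiv ℝ ζ y) w) = 0 := by
    intro w
    have h1 := ((Q.projL {0}).hasFDerivAt.comp y hy.hasFDerivAt_add).unique
      ((hasFDerivAt_const (0 : L) y).congr_of_eventuallyEq (h.mono fun y hy => hy.proj_zero_add))
    exact DFunLike.congr_fun h1 w
  have hδu := hδ u
  have hδv := hδ v
  have h0 := hy.proj_zero_add
  have hρπ := rho_sub_rho (Q := Q) (ζ y)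
  have hpτ : ∀ σ ∈ Q.t, Q.proj {0} ⁅σ, ζ y + Q.ρ (ζ y)⁆ = 0 := fun σ hσ => by
    rw [Q.proj_lie_h hσ.1, h0, lie_zero]
  rw [hA, hA'] at hstr
  rw [hκ, sub_eq_add_neg, add_assoc, map_add, map_neg, hpτ τ hτ, neg_zero, zero_add] at hδu
  rw [hκ', sub_eq_add_neg, add_assoc, map_add, map_neg, hpτ τ' hτ', neg_zero, zero_add] at hδv
  rw [hκ, hπ, hκ', hπ']
  have hρb : ∀ w, Q.ρ (φ y w - Q.ρ (φ y w)) = -(φ y w - Q.ρ (φ y w)) := fun w => rho_sub_rho _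
  have key := bochner_identity (Q := Q) (κ := ζ y + Q.ρ (ζ y)) (π := ζ y - Q.ρ (ζ y))
    (δ₁ := -⁅φ y u - Q.ρ (φ y u), ζ y - Q.ρ (ζ y)⁆ + (2 : ℝ) • t)
    (δ₂ := -⁅φ y v - Q.ρ (φ y v), ζ y - Q.ρ (ζ y)⁆ + (2 : ℝ) • t')
    (hy.cyclic.mem u) (hy.deform.mem u) (hy.deform.mem v) hz (hy.deform.lie_eq u v) h0
    (Submodule.smul_mem Q.t (2 : ℝ) ht).1 (Submodule.smul_mem Q.t (2 : ℝ) ht').1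
    hδu
    hδv rfl rfl
  have hρδ : ∀ w, ∀ s ∈ Q.t, Q.ρ (-⁅φ y w - Q.ρ (φ y w), ζ y - Q.ρ (ζ y)⁆ + (2 : ℝ) • s) =
      -⁅φ y w - Q.ρ (φ y w), ζ y - Q.ρ (ζ y)⁆ + (2 : ℝ) • s := by
    intro w s hs
    rw [map_add, map_neg, Q.ρ_conj.map_lie, hρb, hρπ, neg_lie, lie_neg, neg_neg,
      Q.rho_real_smul, hs.2.1]
  have hneg₁ := Q.reKilling_self_nonpos (hρδ u t ht)
  have hneg₂ : reKilling L _ _ ≤ 0 := Q.reKilling_self_nonpos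
    (x := (-⁅φ y v - Q.ρ (φ y v), ζ y - Q.ρ (ζ y)⁆ + (2 : ℝ) • t') -
      z₁ • (-⁅φ y u - Q.ρ (φ y u), ζ y - Q.ρ (ζ y)⁆ + (2 : ℝ) • t))
    (by rw [map_sub, Q.rho_real_smul, hρδ u t ht, hρδ v t' ht'])
  have hneg₃ := mul_nonpos_of_nonneg_of_nonpos (sq_nonneg z₂) hneg₁
  refine le_trans (le_of_eq ?_) (sub_le_sub_right (add_nonpos hneg₂ hneg₃) _ |>.trans_eq
    (zero_sub _))
  rw [← key]
  congr 1
  -- replace the derivatives by covariant ones, using the invariance of the Killing form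
  have hrot : reKilling L ⁅Q.rotL (fderiv ℝ φ y u v), ζ y - Q.ρ (ζ y)⁆ (ζ y + Q.ρ (ζ y)) +
      reKilling L ⁅⁅τ, Q.rotL (φ y v)⁆, ζ y - Q.ρ (ζ y)⁆ (ζ y + Q.ρ (ζ y)) =
      reKilling L ⁅Q.rotL (fderiv ℝ φ y v u), ζ y - Q.ρ (ζ y)⁆ (ζ y + Q.ρ (ζ y)) +
      reKilling L ⁅⁅τ', Q.rotL (φ y u)⁆, ζ y - Q.ρ (ζ y)⁆ (ζ y + Q.ρ (ζ y)) := by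
    rw [← LinearMap.add_apply, ← map_add, ← add_lie, ← LinearMap.add_apply, ← map_add, ← add_lie,
      ← rotL_lie hτ, ← rotL_lie hτ', ← map_add, ← map_add]
    have : fderiv ℝ φ y u v + ⁅τ, φ y v⁆ = fderiv ℝ φ y v u + ⁅τ', φ y u⁆ := by
      rw [← sub_eq_zero, ← hstr]; abel
    rw [this]
  have i1 := reK_add_lie_rotations τ (Q.rotL (φ y v)) (ζ y - Q.ρ (ζ y)) (ζ y + Q.ρ (ζ y))
  have i2 := reK_add_lie_rotations τ' (Q.rotL (φ y u)) (ζ y - Q.ρ (ζ y)) (ζ y + Q.ρ (ζ y))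
  clear key hρδ hneg₁ hneg₂ hneg₃ hκ hπ hκ' hπ' hδ hδu hδv hρπ h0 hstr
  generalize Q.rotL (φ y u) = R₁ at *
  generalize Q.rotL (φ y v) = R₂ at *
  generalize Q.rotL (fderiv ℝ φ y u v) = R₃ at *
  generalize Q.rotL (fderiv ℝ φ y v u) = R₄ at *
  generalize φ y u - Q.ρ (φ y u) = b₁ at *
  generalize φ y v - Q.ρ (φ y v) = b₂ at *
  generalize ζ y - Q.ρ (ζ y) = π at *
  generalize ζ y + Q.ρ (ζ y) = κ at *
  generalize η y u - Q.ρ (η y u) = e₁ at *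
  generalize η y v - Q.ρ (η y v) = e₂ at *
  simp only [lie_add, lie_sub, lie_neg, map_add, map_sub, map_neg, LinearMap.add_apply,
    LinearMap.sub_apply, LinearMap.neg_apply] at i1 i2 hrot ⊢
  linear_combination hrot - i1 + i2

end HKQuadruple

/-! ### The energy of a deformation is constant near a maximum -/

namespace HKQuadruple

open LieAlgebra

variable {L : Type*} [LieRing L] [LieAlgebra ℂ L] [Module.Finite ℂ L] [IsSimple ℂ L]
  {Q : HKQuadruple L}

theorem single_zero_ne : EuclideanSpace.single (0 : Fin 2) (1 : ℝ) ≠ 0 := fun h => by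
  have := congrFun (congrArg WithLp.ofLp h) 0
  simp at this

/-- At a cyclic point, two independent vectors have images which differ by a non-real factor. -/
theorem IsCyclicPoint.exists_eq_smul {φ : EuclideanSpace ℝ (Fin 2) →L[ℝ] L}
    (hφ : Q.IsCyclicPoint φ) {β : Q.h → ℂ} (hβ : Q.IsSimpleRoot β)
    {u v : EuclideanSpace ℝ (Fin 2)} (huv : ∀ r : ℝ, v ≠ r • u) (hu : u ≠ 0) :
    ∃ c : ℂ, φ v = c • φ u ∧ c.im ≠ 0 ∧ φ u ≠ 0 := by
  obtain ⟨c, hc⟩ := Q.exists_eq_smul_of_lie_eq_zero (hφ.mem u) (hφ.mem v)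
    (fun β hβ => hφ.ne β hβ u hu) (hφ.comm u v) hβ
  refine ⟨c, hc, fun h => ?_, fun h => hφ.ne β hβ u hu (by rw [h, map_zero])⟩
  refine hφ.ne β hβ (v - c.re • u) (sub_ne_zero.mpr (huv _)) ?_
  have h1 : (c.re : ℂ) = c := Complex.ext rfl (by simp [h])
  rw [map_sub, map_smul, hc, ← Complex.coe_smul, h1, sub_self, map_zero]

theorem single_one_ne (r : ℝ) :
    EuclideanSpace.single (1 : Fin 2) (1 : ℝ) ≠ r • EuclideanSpace.single (0 : Fin 2) (1 : ℝ) :=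
  fun h => by
  have := congrFun (congrArg WithLp.ofLp h) 1
  simp at this

variable {A φ η : EuclideanSpace ℝ (Fin 2) → EuclideanSpace ℝ (Fin 2) →L[ℝ] L}
  {ζ : EuclideanSpace ℝ (Fin 2) → L} {y₀ : EuclideanSpace ℝ (Fin 2)}

/-- The complex structure of a cyclic surface: the two partial derivatives differ by a smooth
complex factor. -/
theorem exists_ratio (h : ∀ᶠ y in 𝓝 y₀, Q.IsCyclicModel A φ y) {β : Q.h → ℂ}
    (hβ : Q.IsSimpleRoot β) : ∃ z : EuclideanSpace ℝ (Fin 2) → ℂ, ∀ᶠ y in 𝓝 y₀,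
      ContDiffAt ℝ 2 z y ∧ (z y).im ≠ 0 ∧
        φ y (EuclideanSpace.single 1 1) = z y • φ y (EuclideanSpace.single 0 1) := by
  obtain ⟨-, -, -, h0⟩ := h.self_of_nhds.cyclic.exists_eq_smul hβ single_one_ne single_zero_ne
  obtain ⟨l, hl⟩ := SeparatingDual.exists_ne_zero (R := ℂ) h0
  have hφd : ∀ y, Q.IsCyclicModel A φ y → ∀ w, ContDiffAt ℝ 2 (fun y => l (φ y w)) y :=
    fun y hy w => (l.restrictScalars ℝ).contDiff.contDiffAt.comp y
      (hy.contDiffAt_φ.clm_apply contDiffAt_const)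
  refine ⟨fun y => l (φ y (EuclideanSpace.single 1 1)) *
    (l (φ y (EuclideanSpace.single 0 1)))⁻¹, ?_⟩
  filter_upwards [h, (hφd y₀ h.self_of_nhds _).continuousAt.eventually_ne hl] with y hy hly
  obtain ⟨c, hc, him, -⟩ := hy.cyclic.exists_eq_smul hβ single_one_ne single_zero_ne
  have hz : l (φ y (EuclideanSpace.single 1 1)) *
      (l (φ y (EuclideanSpace.single 0 1)))⁻¹ = c := by
    rw [hc, map_smul, smul_eq_mul, mul_assoc, mul_inv_cancel₀ hly, mul_one]
  refine ⟨(hφd y hy _).mul ((hφd y hy _).inv hly), by rw [hz]; exact him, by rw [hz]; exact hc⟩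

/-- The energy is a subsolution of an elliptic equation without term of order zero, and at the
points where equality holds the part of the deformation fixed by `ρ` commutes with `φ` and `ρ φ`. -/
theorem exists_elliptic (h : ∀ᶠ y in 𝓝 y₀, Q.IsLocalModel A φ η ζ y) {β : Q.h → ℂ}
    (hβ : Q.IsSimpleRoot β) :
    ∃ X Y B : EuclideanSpace ℝ (Fin 2) → EuclideanSpace ℝ (Fin 2), ∀ᶠ y in 𝓝 y₀,
      ContinuousAt X y ∧ ContinuousAt Y y ∧ ContinuousAt B y ∧
      (∀ n, n ≠ 0 → inner ℝ n (X y) ≠ 0 ∨ inner ℝ n (Y y) ≠ 0) ∧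
      (0 ≤ fderiv ℝ (fderiv ℝ fun y => Q.energy (ζ y)) y (X y) (X y) +
        fderiv ℝ (fderiv ℝ fun y => Q.energy (ζ y)) y (Y y) (Y y) +
        fderiv ℝ (fun y => Q.energy (ζ y)) y (B y)) ∧
      (fderiv ℝ (fderiv ℝ fun y => Q.energy (ζ y)) y (X y) (X y) +
        fderiv ℝ (fderiv ℝ fun y => Q.energy (ζ y)) y (Y y) (Y y) +
        fderiv ℝ (fun y => Q.energy (ζ y)) y (B y) = 0 →
        ⁅φ y (EuclideanSpace.single 0 1), ζ y + Q.ρ (ζ y)⁆ = 0 ∧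
        ⁅Q.ρ (φ y (EuclideanSpace.single 0 1)), ζ y + Q.ρ (ζ y)⁆ = 0) := by
  obtain ⟨z, hz⟩ := exists_ratio (h.mono fun _ hy => hy.toIsCyclicModel) hβ
  set u : EuclideanSpace ℝ (Fin 2) := EuclideanSpace.single 0 1 with hu
  set v : EuclideanSpace ℝ (Fin 2) := EuclideanSpace.single 1 1 with hv
  set V : EuclideanSpace ℝ (Fin 2) → ℝ := fun y => Q.energy (ζ y) with hV
  set p : EuclideanSpace ℝ (Fin 2) → ℝ := fun y => (z y).re with hp
  set q : EuclideanSpace ℝ (Fin 2) → ℝ := fun y => (z y).im with hq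
  let s : EuclideanSpace ℝ (Fin 2) → ℝ := fun y => p y ^ 2 + q y ^ 2
  let B₁ : EuclideanSpace ℝ (Fin 2) → ℝ := fun y => fderiv ℝ s y u - fderiv ℝ p y v -
    fderiv ℝ q y u * s y * (q y)⁻¹ + fderiv ℝ q y v * p y * (q y)⁻¹
  let B₂ : EuclideanSpace ℝ (Fin 2) → ℝ := fun y => -fderiv ℝ p y u +
    fderiv ℝ q y u * p y * (q y)⁻¹ - fderiv ℝ q y v * (q y)⁻¹
  -- for the complex structure in which `v` is `z = p + i q` times `u`, a multiple of the Laplacian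
  -- has principal part `X² + Y²`; the derivatives of `z` contribute the first order term `B`
  refine ⟨fun y => p y • u - v, fun y => q y • u, fun y => B₁ y • u + B₂ y • v, ?_⟩
  filter_upwards [h.eventually_nhds, hz.eventually_nhds] with y hy hzy
  obtain ⟨hzd, hq0, hφz⟩ := hzy.self_of_nhds
  have hmod := hy.self_of_nhds
  have hpd : ContDiffAt ℝ 2 p y := Complex.reCLM.contDiff.contDiffAt.comp y hzd
  have hqd : ContDiffAt ℝ 2 q y := Complex.imCLM.contDiff.contDiffAt.comp y hzd
  have hsd : ContDiffAt ℝ 2 s y := (hpd.pow 2).add (hqd.pow 2)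
  have hc : ∀ {F : EuclideanSpace ℝ (Fin 2) → ℝ}, ContDiffAt ℝ 2 F y →
      ∀ w, ContinuousAt (fun y => fderiv ℝ F y w) y := fun {F} hF w =>
    ((hF.fderiv_right (m := 1) (by norm_num)).clm_apply contDiffAt_const).continuousAt
  have hcp := hpd.continuousAt
  have hcq := hqd.continuousAt
  have hcs := hsd.continuousAt
  have hcq' := hcq.inv₀ hq0
  have hcB₁ : ContinuousAt B₁ y := (((hc hsd u).sub (hc hpd v)).sub
    (((hc hqd u).mul hcs).mul hcq')).add (((hc hqd v).mul hcp).mul hcq')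
  have hcB₂ : ContinuousAt B₂ y := ((hc hpd u).neg.add
    (((hc hqd u).mul hcp).mul hcq')).sub ((hc hqd v).mul hcq')
  -- the Bochner inequality in terms of the energy
  have hVd : ContDiffAt ℝ 2 V y := hmod.contDiffAt_energy
  have hD : HasFDerivAt (fderiv ℝ V) (fderiv ℝ (fderiv ℝ V) y) y :=
    ((hVd.fderiv_right (m := 1) (by norm_num)).differentiableAt one_ne_zero).hasFDerivAt
  have hDw : ∀ w, HasFDerivAt (fun y => fderiv ℝ V y w) ((fderiv ℝ (fderiv ℝ V) y).flip w) y :=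
    fun w => (hD.clm_apply (hasFDerivAt_const w y)).congr_fderiv (by ext; simp)
  have hsymm : fderiv ℝ (fderiv ℝ V) y u v = fderiv ℝ (fderiv ℝ V) y v u :=
    (hVd.isSymmSndFDerivAt (by simp)) u v
  have hratio : ∀ᶠ y in 𝓝 y, q y * Q.conjDeriv φ ζ u y = fderiv ℝ V y v - p y * fderiv ℝ V y u ∧
      q y * Q.conjDeriv φ ζ v y = p y * fderiv ℝ V y v - s y * fderiv ℝ V y u := by
    filter_upwards [hy, hzy] with y hy hzy
    rw [hy.fderiv_energy, hy.fderiv_energy, conjDeriv, conjDeriv, reK_apply, reK_apply,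
      ← smul_eq_mul, ← LinearMap.smul_apply, ← map_smul, ← real_smul_lie, smul_rotL hzy.2.2,
      ← smul_eq_mul (a := q y), ← LinearMap.smul_apply, ← map_smul, ← real_smul_lie,
      smul_rotL' hzy.2.2]
    simp only [sub_lie, real_smul_lie, map_sub, map_smul, LinearMap.sub_apply,
      LinearMap.smul_apply, smul_eq_mul]
    exact ⟨rfl, rfl⟩
  have hth := fun w => (hmod.differentiableAt_conjDeriv w).1.hasFDerivAt
  have hpd' := (hpd.differentiableAt two_ne_zero).hasFDerivAt
  have hqd' := (hqd.differentiableAt two_ne_zero).hasFDerivAt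
  have hsd' := (hsd.differentiableAt two_ne_zero).hasFDerivAt
  have hder₁ := DFunLike.congr_fun ((hqd'.mul (hth u)).unique
    (((hDw v).sub (hpd'.mul (hDw u))).congr_of_eventuallyEq (hratio.mono fun y h => h.1))) v
  have hder₂ := DFunLike.congr_fun ((hqd'.mul (hth v)).unique
    (((hpd'.mul (hDw v)).sub (hsd'.mul (hDw u))).congr_of_eventuallyEq
      (hratio.mono fun y h => h.2))) u
  simp only [add_apply, sub_apply, smul_apply, smul_eq_mul, ContinuousLinearMap.flip_apply]
    at hder₁ hder₂
  obtain ⟨hr₁, hr₂⟩ := hratio.self_of_nhds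
  have hboch := curl_conjDeriv_le hy (z₁ := p y) (z₂ := q y) hφz
  have hLV : fderiv ℝ (fderiv ℝ V) y (p y • u - v) (p y • u - v) +
      fderiv ℝ (fderiv ℝ V) y (q y • u) (q y • u) + fderiv ℝ V y (B₁ y • u + B₂ y • v) =
      -(q y * (fderiv ℝ (Q.conjDeriv φ ζ v) y u - fderiv ℝ (Q.conjDeriv φ ζ u) y v)) := by
    have hr₁' : Q.conjDeriv φ ζ u y = (fderiv ℝ V y v - p y * fderiv ℝ V y u) * (q y)⁻¹ := by
      rw [← hr₁, mul_comm (q y), mul_assoc, mul_inv_cancel₀ hq0, mul_one]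
    have hr₂' : Q.conjDeriv φ ζ v y = (p y * fderiv ℝ V y v - s y * fderiv ℝ V y u) * (q y)⁻¹ := by
      rw [← hr₂, mul_comm (q y), mul_assoc, mul_inv_cancel₀ hq0, mul_one]
    rw [hr₁'] at hder₁
    rw [hr₂'] at hder₂
    simp only [map_sub, map_add, map_smul, sub_apply, smul_apply, smul_eq_mul, B₁, B₂]
    have hs : s y = p y ^ 2 + q y ^ 2 := rfl
    rw [hs] at hder₂ ⊢
    linear_combination hder₂ - hder₁
  rw [hLV]
  have hρφ : ∀ w, Q.ρ (φ y w - Q.ρ (φ y w)) = -(φ y w - Q.ρ (φ y w)) := fun w => rho_sub_rho _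
  have hβ₁ : Q.ρ ⁅φ y u - Q.ρ (φ y u), ζ y + Q.ρ (ζ y)⁆ =
      -⁅φ y u - Q.ρ (φ y u), ζ y + Q.ρ (ζ y)⁆ := by
    rw [Q.ρ_conj.map_lie, hρφ, rho_add_rho, neg_lie]
  have hβ₂ : Q.ρ ⁅(φ y v - Q.ρ (φ y v)) - p y • (φ y u - Q.ρ (φ y u)), ζ y + Q.ρ (ζ y)⁆ =
      -⁅(φ y v - Q.ρ (φ y v)) - p y • (φ y u - Q.ρ (φ y u)), ζ y + Q.ρ (ζ y)⁆ := by
    rw [Q.ρ_conj.map_lie, map_sub, Q.rho_real_smul, hρφ, hρφ, rho_add_rho, ← neg_lie]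
    congr 1; module
  have hpos₁ := mul_nonneg (sq_nonneg (q y)) (Q.reKilling_self_nonneg hβ₁)
  have hpos₂ := Q.reKilling_self_nonneg hβ₂
  refine ⟨(hcp.smul continuousAt_const).sub continuousAt_const, hcq.smul continuousAt_const,
    (hcB₁.smul continuousAt_const).add (hcB₂.smul continuousAt_const), fun n hn => ?_,
    by linarith, fun h0 => ?_⟩
  · by_contra! hcon
    obtain ⟨h1, h2⟩ := hcon
    have e0 : inner ℝ n u = n 0 := by simp [hu, EuclideanSpace.inner_single_right]
    have e1 : inner ℝ n v = n 1 := by simp [hv, EuclideanSpace.inner_single_right]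
    rw [inner_sub_right, inner_smul_right, e0, e1] at h1
    rw [inner_smul_right, e0] at h2
    have h3 : n 0 = 0 := (mul_eq_zero.mp h2).resolve_left hq0
    rw [h3, mul_zero, zero_sub, neg_eq_zero] at h1
    apply hn
    ext i
    fin_cases i
    · exact h3
    · exact h1
  · have hz₁ : ⁅φ y u - Q.ρ (φ y u), ζ y + Q.ρ (ζ y)⁆ = 0 := by
      by_contra hne
      have := mul_pos (pow_pos (abs_pos.mpr hq0) 2) (Q.reKilling_self_pos hβ₁ hne)
      rw [sq_abs] at this
      linarith
    have hz₂ : ⁅(φ y v - Q.ρ (φ y v)) - p y • (φ y u - Q.ρ (φ y u)), ζ y + Q.ρ (ζ y)⁆ = 0 := by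
      by_contra hne
      have := Q.reKilling_self_pos hβ₂ hne
      linarith
    rw [← smul_rotL (y := q y) hφz, real_smul_lie, smul_eq_zero, rotL_apply, smul_lie,
      smul_eq_zero] at hz₂
    have hz₃ := (hz₂.resolve_left hq0).resolve_left Complex.I_ne_zero
    rw [sub_lie] at hz₁
    rw [add_lie] at hz₃
    have h2 : (2 : ℂ) • ⁅φ y u, ζ y + Q.ρ (ζ y)⁆ = 0 := by
      rw [two_smul]
      calc _ = (⁅φ y u, ζ y + Q.ρ (ζ y)⁆ - ⁅Q.ρ (φ y u), ζ y + Q.ρ (ζ y)⁆) +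
            (⁅φ y u, ζ y + Q.ρ (ζ y)⁆ + ⁅Q.ρ (φ y u), ζ y + Q.ρ (ζ y)⁆) := by abel
        _ = 0 := by rw [hz₁, hz₃, add_zero]
    have h3 := (smul_eq_zero.mp h2).resolve_left two_ne_zero
    refine ⟨h3, ?_⟩
    rwa [h3, zero_add] at hz₃

/-- By the strong maximum principle, the energy is constant near a local maximum. -/
theorem energy_eventually_eq (h : ∀ᶠ y in 𝓝 y₀, Q.IsLocalModel A φ η ζ y) {β : Q.h → ℂ}
    (hβ : Q.IsSimpleRoot β) (hmax : IsLocalMax (fun y => Q.energy (ζ y)) y₀) :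
    ∀ᶠ y in 𝓝 y₀, Q.energy (ζ y) = Q.energy (ζ y₀) := by
  obtain ⟨X, Y, B, hXYB⟩ := exists_elliptic h hβ
  exact eventually_eq_of_isLocalMax (hXYB.mono fun y h => h.1) (hXYB.mono fun y h => h.2.1)
    (hXYB.mono fun y h => h.2.2.1) (h.mono fun y h => h.contDiffAt_energy)
    (hXYB.mono fun y h => h.2.2.2.2.1) (hXYB.mono fun y h => h.2.2.2.1) hmax

/-- If the energy is constant, then the compact part of the deformation commutes with the
derivative of the surface. -/
theorem lie_eq_zero_of_energy_const (h : ∀ᶠ y in 𝓝 y₀, Q.IsLocalModel A φ η ζ y) {β : Q.h → ℂ}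
    (hβ : Q.IsSimpleRoot β) {C : ℝ} (hC : ∀ᶠ y in 𝓝 y₀, Q.energy (ζ y) = C) :
    ⁅φ y₀ (EuclideanSpace.single 0 1), ζ y₀ + Q.ρ (ζ y₀)⁆ = 0 ∧
      ⁅Q.ρ (φ y₀ (EuclideanSpace.single 0 1)), ζ y₀ + Q.ρ (ζ y₀)⁆ = 0 := by
  obtain ⟨X, Y, B, hXYB⟩ := exists_elliptic h hβ
  refine hXYB.self_of_nhds.2.2.2.2.2 ?_
  have h1 : (fun y => Q.energy (ζ y)) =ᶠ[𝓝 y₀] fun _ => C := hC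
  have h2 : fderiv ℝ (fun y => Q.energy (ζ y)) =ᶠ[𝓝 y₀]
      fun _ => (0 : EuclideanSpace ℝ (Fin 2) →L[ℝ] ℝ) := by
    filter_upwards [h1.fderiv (𝕜 := ℝ)] with y hy
    rw [hy]; simp
  rw [h2.fderiv_eq, h2.self_of_nhds]
  simp

end HKQuadruple

/-! ### Deformations of closed cyclic surfaces -/

namespace HKQuadruple

open LieAlgebra

variable {L : Type*} [LieRing L] [LieAlgebra ℂ L] [Module.Finite ℂ L] [IsSimple ℂ L]
  {Q : HKQuadruple L}

/-- A function on `L` which is invariant under the torus can be evaluated in any frame. -/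
theorem apply_frame_symm {F : L → ℝ} (hF : ∀ t ∈ Q.T, ∀ v, F (t.1 v) = F v) {x : Q.X}
    {g : adjointGroup L} (hg : (g : Q.X) = x) (s : L) : F ((frame x).symm s) = F (g.1.symm s) := by
  obtain ⟨g', hg', hf⟩ := frame_spec x
  obtain ⟨t, ht, rfl⟩ := exists_mem_T (hg.trans hg'.symm)
  rw [hf]
  change F (t.1.symm (g.1.symm s)) = _
  rw [← hF t ht, LinearEquiv.apply_symm_apply]

theorem energy_torus {t : adjointGroup L} (ht : t ∈ Q.T) (v : L) :
    Q.energy (t.1 v) = Q.energy v := by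
  rw [energy, energy, ← ht.2.1, ← map_add, reK_apply, reK_apply, reKilling_adjointGroup]

variable {M : Type*} [TopologicalSpace M] [ChartedSpace (EuclideanSpace ℝ (Fin 2)) M]
variable {f : M → Q.X}

/-- The vector field `ξ` along `f`, in a frame at each point. -/
noncomputable def inFrame (f : M → Q.X) (ξ : ∀ m, Tan (f m)) (m : M) : L :=
  (frame (f m)).symm (mc (f m) (ξ m))

variable {ξ : ∀ m, Tan (f m)}

/-- Torus invariant functions of an equivariant vector field are invariant. -/
theorem apply_inFrame_smul {Γ : Type*} [Group Γ] [MulAction Γ M] {δ : Γ →* adjointGroup L}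
    (hfδ : ∀ (γ : Γ) (m : M), f (γ • m) = δ γ • f m)
    (hξδ : ∀ (γ : Γ) (m : M), mc (f (γ • m)) (ξ (γ • m)) = (δ γ).1 (mc (f m) (ξ m)))
    {F : L → ℝ} (hF : ∀ t ∈ Q.T, ∀ v, F (t.1 v) = F v) (γ : Γ) (m : M) :
    F (inFrame f ξ (γ • m)) = F (inFrame f ξ m) := by
  obtain ⟨g, hg, -⟩ := frame_spec (f m)
  have hg' : ((δ γ * g : adjointGroup L) : Q.X) = f (γ • m) := by
    rw [hfδ, ← hg]; rfl
  rw [inFrame, inFrame, apply_frame_symm hF hg, apply_frame_symm hF hg', hξδ]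
  congr 1
  change g.1.symm ((δ γ).1.symm ((δ γ).1 _)) = _
  rw [LinearEquiv.symm_apply_apply]

/-- A property which holds near the centre of a chart holds near the corresponding point. -/
theorem eventually_of_chart {p : M → Prop} {m : M}
    (h : ∀ᶠ y in 𝓝 (extChartAt (𝓡 2) m m), p ((extChartAt (𝓡 2) m).symm y)) :
    ∀ᶠ m' in 𝓝 m, p m' := by
  filter_upwards [(continuousAt_extChartAt (I := 𝓡 2) m).eventually h,
    extChartAt_source_mem_nhds (I := 𝓡 2) m] with m' h1 h2
  rwa [(extChartAt (𝓡 2) m).left_inv h2] at h1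

/-- A function on `ℝ²` whose derivative vanishes near a point is constant near that point. -/
theorem eventually_eq_of_fderiv_eq_zero {F : EuclideanSpace ℝ (Fin 2) → ℝ}
    {y₀ : EuclideanSpace ℝ (Fin 2)}
    (h : ∀ᶠ y in 𝓝 y₀, HasFDerivAt F (0 : EuclideanSpace ℝ (Fin 2) →L[ℝ] ℝ) y) :
    ∀ᶠ y in 𝓝 y₀, F y = F y₀ := by
  obtain ⟨r, hr, hball⟩ := Metric.eventually_nhds_iff_ball.mp h
  rw [Metric.eventually_nhds_iff_ball]
  refine ⟨r, hr, fun y hy => ?_⟩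
  exact Metric.isOpen_ball.is_const_of_fderiv_eq_zero (convex_ball y₀ r).isPreconnected
    (fun z hz => (hball z hz).differentiableAt.differentiableWithinAt)
    (fun z hz => (hball z hz).fderiv) hy (Metric.mem_ball_self hr)

variable [IsManifold (𝓡 2) ∞ M]

/-- The energy of a deformation of a closed cyclic surface is constant. -/
theorem exists_energy_eq [ConnectedSpace M] {Γ : Type*} [Group Γ] [MulAction Γ M]
    (hΓ : IsDeckGroup Γ M) {δ : Γ →* adjointGroup L} (hf : IsCyclic f)
    (hfδ : ∀ (γ : Γ) (m : M), f (γ • m) = δ γ • f m) (hξ : IsInfDeformation f ξ)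
    (hξδ : ∀ (γ : Γ) (m : M), mc (f (γ • m)) (ξ (γ • m)) = (δ γ).1 (mc (f m) (ξ m)))
    {β : Q.h → ℂ} (hβ : Q.IsSimpleRoot β) : ∃ C, ∀ m, Q.energy (inFrame f ξ m) = C := by
  set e : M → ℝ := fun m => Q.energy (inFrame f ξ m) with he
  have hloc := fun m => exists_localModel hf hξ m
  have heF : ∀ (m : M) (g : adjointGroup L), (g : Q.X) = f m →
      e m = Q.energy (g.1.symm (mc (f m) (ξ m))) := fun m g hg =>
    apply_frame_symm (fun t ht v => energy_torus ht v) hg _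
  have hcont : Continuous e := by
    rw [continuous_iff_continuousAt]
    intro m
    obtain ⟨G, φ, η, h⟩ := hloc m
    have h1 : ContinuousAt (fun y => e ((extChartAt (𝓡 2) m).symm y)) (extChartAt (𝓡 2) m m) :=
      (h.self_of_nhds.2.2.2.contDiffAt_energy.continuousAt).congr
        (h.mono fun y hy => (heF _ _ hy.2.1).symm)
    have h2 : ContinuousAt (fun m' => e ((extChartAt (𝓡 2) m).symm (extChartAt (𝓡 2) m m'))) m :=
      ContinuousAt.comp (f := extChartAt (𝓡 2) m) h1 (continuousAt_extChartAt m)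
    refine h2.congr ?_
    filter_upwards [extChartAt_source_mem_nhds (I := 𝓡 2) m] with m' hm'
    rw [(extChartAt (𝓡 2) m).left_inv hm']
  obtain ⟨K, hK, hKΓ⟩ := hΓ.cocompact
  have hKne : K.Nonempty := by
    obtain ⟨m⟩ := (inferInstance : Nonempty M)
    obtain ⟨γ, hγ⟩ := hKΓ m
    exact ⟨_, hγ⟩
  obtain ⟨m₀, -, hm₀⟩ := hK.exists_isMaxOn hKne hcont.continuousOn
  have hmax : ∀ m, e m ≤ e m₀ := fun m => by
    obtain ⟨γ, hγ⟩ := hKΓ m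
    have h1 : e (γ • m) = e m := apply_inFrame_smul hfδ hξδ (fun t ht v => energy_torus ht v) γ m
    rw [← h1]
    exact hm₀ hγ
  have hopen : IsOpen {m | e m = e m₀} := by
    rw [isOpen_iff_mem_nhds]
    intro m hm
    obtain ⟨G, φ, η, h⟩ := hloc m
    refine eventually_of_chart (p := fun m' => e m' = e m₀) ?_
    have hc : (extChartAt (𝓡 2) m).symm (extChartAt (𝓡 2) m m) = m := extChartAt_to_inv m
    have h0 : Q.energy ((G (extChartAt (𝓡 2) m m)).1.symm
        (mc (f ((extChartAt (𝓡 2) m).symm (extChartAt (𝓡 2) m m)))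
          (ξ ((extChartAt (𝓡 2) m).symm (extChartAt (𝓡 2) m m))))) = e m₀ := by
      rw [← heF _ _ h.self_of_nhds.2.1, hc]
      exact hm
    filter_upwards [h, energy_eventually_eq (h.mono fun y hy => hy.2.2.2) hβ (by
      filter_upwards [h] with y hy
      rw [h0, ← heF _ _ hy.2.1]
      exact hmax _)] with y hy hy'
    rw [heF _ _ hy.2.1, hy', h0]
  have huniv := IsClopen.eq_univ ⟨isClosed_eq hcont continuous_const, hopen⟩ ⟨m₀, rfl⟩
  refine ⟨e m₀, fun m => ?_⟩
  have : m ∈ {m | e m = e m₀} := by rw [huniv]; trivial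
  exact this

/-- Where the component of the surface along the longest root vanishes, `φ` is a sum of root vectors
for the negatives of the simple roots. -/
theorem mem_weightSum_simple {φ : EuclideanSpace ℝ (Fin 2) →L[ℝ] L}
    (hφ : Q.IsCyclicPoint φ) (hs : ∀ β, Q.IsSimpleRoot β → ¬Q.IsLongestRoot β)
    {w : EuclideanSpace ℝ (Fin 2)}
    (h : ∀ η, Q.IsLongestRoot η → Q.proj {η} (φ w - Q.ρ (φ w)) = 0) :
    φ w ∈ Q.weightSum {χ | Q.IsSimpleRoot (-χ)} := by
  refine Q.mem_weightSum_of_proj_compl (Q.eq_zero_of_forall_proj fun χ => ?_)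
  rw [Q.proj_proj]
  by_cases hχ : χ ∈ Q.Z ∧ ¬Q.IsSimpleRoot (-χ)
  · have h1 : ({χ} : Set (Q.h → ℂ)) ∩ {χ | Q.IsSimpleRoot (-χ)}ᶜ = {χ} :=
      Set.inter_eq_left.mpr (Set.singleton_subset_iff.mpr hχ.2)
    rw [h1]
    rcases hχ.1 with h2 | h2
    · exact absurd h2 hχ.2
    · rw [neg_neg] at h2
      have h3 := h χ h2
      rwa [map_sub, Q.proj_of_disjoint (Set.disjoint_singleton_left.mpr
        (Set.disjoint_left.mp (Q.disjoint_Z_Zdag hs) hχ.1)) (rho_mem_Zdag (hφ.mem w)),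
        sub_zero] at h3
  · refine Q.proj_of_disjoint (Set.disjoint_left.mpr ?_) (hφ.mem w)
    rintro χ' ⟨h1, h2⟩ h3
    rw [Set.mem_singleton_iff] at h1
    subst h1
    exact hχ ⟨h3, h2⟩

/-- If the part of a deformation `ζ` which is fixed by `ρ` vanishes near a point, the bracket of `ζ`
with the derivative of the surface lies in `h`, and the components of `ζ` outside `Z` and `Zdag` are
parallel for the connection given by `t`. -/
theorem IsLocalModel.lie_mem_h
    {A φ η : EuclideanSpace ℝ (Fin 2) → EuclideanSpace ℝ (Fin 2) →L[ℝ] L}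
    {ζ : EuclideanSpace ℝ (Fin 2) → L} {y : EuclideanSpace ℝ (Fin 2)}
    (h : Q.IsLocalModel A φ η ζ y) (hκ : ∀ᶠ y in 𝓝 y, Q.ρ (ζ y) = -ζ y)
    (w : EuclideanSpace ℝ (Fin 2)) :
    ⁅φ y w - Q.ρ (φ y w), ζ y⁆ ∈ Q.h ∧ ∃ τ ∈ Q.t,
      fderiv ℝ ζ y w = -⁅τ, ζ y⁆ + (η y w - Q.ρ (η y w)) := by
  have hd0 : ((ContinuousLinearMap.id ℝ L + Q.rhoL) ∘L fderiv ℝ ζ y) = 0 :=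
    h.hasFDerivAt_add.unique ((hasFDerivAt_const (0 : L) y).congr_of_eventuallyEq
      (hκ.mono fun y hy => by
        change ζ y + Q.ρ (ζ y) = 0
        rw [hy, add_neg_cancel]))
  obtain ⟨τ, hτ, t, ht, -, h1, h2, -⟩ := h.exists_deriv_eq w
  rw [hd0, hκ.self_of_nhds, add_neg_cancel, lie_zero, neg_zero, sub_neg_eq_add, ← two_smul ℝ,
    real_lie_smul, zero_apply, zero_sub, eq_comm, neg_add_eq_zero] at h2
  have h3 := smul_right_injective L (two_ne_zero (α := ℝ)) h2
  refine ⟨h3 ▸ ht.1, τ, hτ, ?_⟩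
  rw [h1, h3]
  abel

/-- The set of the weights outside `Z` and `Zdag`, which contains zero, is symmetric. -/
theorem neg_mem_compl_iff (χ : Q.h → ℂ) : -χ ∈ (Q.Z ∪ Q.Zdag)ᶜ ↔ χ ∈ (Q.Z ∪ Q.Zdag)ᶜ := by
  have h1 : -χ ∈ Q.Z ↔ χ ∈ Q.Zdag := by
    change - -χ ∈ Q.Zdag ↔ _
    rw [neg_neg]
  have h2 : -χ ∈ Q.Zdag ↔ χ ∈ Q.Z := Iff.rfl
  simp only [Set.mem_compl_iff, Set.mem_union, h1, h2, or_comm]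

/-- If the brackets of `ζ` with all the values of `φ - ρ φ` lie in `h`, so do those with `φ u` and
`ρ (φ u)`: the values of `φ` in two directions differ by a complex number which is not real, and `ρ`
is antilinear. -/
theorem IsCyclicPoint.lie_mem_h_of_sub {φ : EuclideanSpace ℝ (Fin 2) →L[ℝ] L}
    (hφ : Q.IsCyclicPoint φ) {β : Q.h → ℂ} (hβ : Q.IsSimpleRoot β) {ζ : L}
    (h : ∀ w, ⁅φ w - Q.ρ (φ w), ζ⁆ ∈ Q.h) :
    ⁅φ (EuclideanSpace.single 0 1), ζ⁆ ∈ Q.h ∧ ⁅Q.ρ (φ (EuclideanSpace.single 0 1)), ζ⁆ ∈ Q.h := by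
  obtain ⟨c, hc, him, -⟩ := hφ.exists_eq_smul hβ single_one_ne single_zero_ne
  have h1 := h (EuclideanSpace.single 0 1)
  have h2 := h (EuclideanSpace.single 1 1)
  rw [hc, map_smulₛₗ, sub_lie, smul_lie, smul_lie] at h2
  rw [sub_lie] at h1
  set a := ⁅φ (EuclideanSpace.single 0 1), ζ⁆
  set b := ⁅Q.ρ (φ (EuclideanSpace.single 0 1)), ζ⁆
  have hne : c - (starRingEnd ℂ) c ≠ 0 := by
    rw [Complex.sub_conj]
    simpa using him
  have h3 : (c - (starRingEnd ℂ) c) • a ∈ Q.h := by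
    have := Q.h.sub_mem h2 (Q.h.smul_mem ((starRingEnd ℂ) c) h1)
    convert this using 1
    module
  have h4 : a ∈ Q.h := by
    have := Q.h.smul_mem (c - (starRingEnd ℂ) c)⁻¹ h3
    rwa [smul_smul, inv_mul_cancel₀ hne, one_smul] at this
  refine ⟨h4, ?_⟩
  have := Q.h.sub_mem h4 h1
  rwa [sub_sub_cancel] at this

/-- A vector without components outside `Z` and `Zdag` which is fixed by `-ρ`, and whose bracket
with the derivative of a cyclic surface lies in `h`, is determined by any of its components along
the simple roots. -/
theorem IsCyclicPoint.eq_zero {φ : EuclideanSpace ℝ (Fin 2) →L[ℝ] L} (hφ : Q.IsCyclicPoint φ)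
    (hs : ∀ β, Q.IsSimpleRoot β → ¬Q.IsLongestRoot β) {α : Q.h → ℂ} (hα : Q.IsSimpleRoot α) {ζ : L}
    (h : ⁅φ (EuclideanSpace.single 0 1), ζ⁆ ∈ Q.h) (hρ : Q.ρ ζ = -ζ)
    (h0 : Q.proj (Q.Z ∪ Q.Zdag)ᶜ ζ = 0) (hαζ : Q.proj {α} ζ = 0) : ζ = 0 := by
  set a := φ (EuclideanSpace.single 0 1)
  have ha : a ∈ Q.weightSum Q.Z := hφ.mem _
  have hd := Q.disjoint_Z_Zdag hs
  have hζ : Q.proj Q.Z ζ + Q.proj Q.Zdag ζ = ζ := by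
    have := Q.proj_add_compl (Q.Z ∪ Q.Zdag) ζ
    rwa [h0, add_zero, Q.proj_union hd] at this
  have hρZ : Q.proj Q.Zdag ζ = -Q.ρ (Q.proj Q.Z ζ) := by
    rw [Q.rho_proj (S := Q.Z) (T := Q.Zdag) (fun χ => Iff.rfl), hρ, map_neg, neg_neg]
  have h1 : ⁅a, Q.proj Q.Z ζ⁆ ∈ Q.h := by
    have h2 := Q.lie_mem_h_of_mem_Z_of_mem_Zdag ha (Q.proj_mem Q.Zdag ζ)
    rw [← hζ, lie_add] at h
    simpa using Q.h.sub_mem h h2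
  have h2 : ⁅a, Q.proj Q.Z ζ⁆ ∈ Q.weightSum {0}ᶜ := by
    refine Q.lie_mem_weightSum (fun χ hχ χ' hχ' _ => ?_) ha (Q.proj_mem _ _)
    intro h3
    rw [Set.mem_singleton_iff, add_eq_zero_iff_eq_neg] at h3
    rw [h3] at hχ
    have h4 : χ' ∈ Q.Zdag := by
      have : - -χ' ∈ Q.Zdag := hχ
      rwa [neg_neg] at this
    exact Set.disjoint_left.mp hd hχ' h4
  have h3 : ⁅a, Q.proj Q.Z ζ⁆ = 0 := by
    rw [← Q.proj_of_mem (Q.mem_h_iff_weightSum.mp h1)]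
    exact Q.proj_of_disjoint disjoint_compl_right h2
  obtain ⟨c, hc⟩ := Q.exists_eq_smul_of_lie_eq_zero ha (Q.proj_mem _ _)
    (fun β hβ => hφ.ne β hβ _ single_zero_ne) h3 hα
  have h4 : Q.proj {-α} ζ = 0 := by
    rw [← Q.rho_rho ζ, ← Q.rho_proj (S := {α}) (fun χ => by simp), hρ, map_neg, hαζ, neg_zero,
      map_zero]
  have h5 : Q.proj {-α} (Q.proj Q.Z ζ) = Q.proj {-α} ζ := by
    have hαZ : -α ∈ Q.Z := by
      change - -α ∈ Q.Zdag
      rw [neg_neg]; exact Or.inl hα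
    rw [Q.proj_proj, Set.inter_eq_left.mpr (Set.singleton_subset_iff.mpr hαZ)]
  rw [h4, hc, map_smul, smul_eq_zero] at h5
  rw [h5.resolve_right (hφ.ne α hα _ single_zero_ne), zero_smul] at hc
  rw [← hζ, hρZ, hc, map_zero, neg_zero, add_zero]

/-- The Killing square of the part of `ζ` outside `Z` and `Zdag`: it is the square of a norm where
`ρ ζ = -ζ`. -/
noncomputable def restNorm (Q : HKQuadruple L) (ζ : L) : ℝ :=
  reKilling L (Q.proj (Q.Z ∪ Q.Zdag)ᶜ ζ) (Q.proj (Q.Z ∪ Q.Zdag)ᶜ ζ)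

theorem reKilling_add_lie_eq_zero (τ x : L) :
    reKilling L x (-⁅τ, x⁆) + reKilling L (-⁅τ, x⁆) x = 0 := by
  rw [map_neg, map_neg, LinearMap.neg_apply, reKilling_lie', neg_neg, neg_add_cancel]

/-- A deformation vanishes if the component of the surface along the longest root vanishes at some
point. -/
theorem eq_zero_of_exists_zero [ConnectedSpace M] {Γ : Type*} [Group Γ] [MulAction Γ M]
    (hΓ : IsDeckGroup Γ M) {δ : Γ →* adjointGroup L} (hf : IsCyclic f)
    (hfδ : ∀ (γ : Γ) (m : M), f (γ • m) = δ γ • f m) (hξ : IsInfDeformation f ξ)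
    (hξδ : ∀ (γ : Γ) (m : M), mc (f (γ • m)) (ξ (γ • m)) = (δ γ).1 (mc (f m) (ξ m)))
    {α : Q.h → ℂ} (hα : Q.IsSimpleRoot α) (hξα : ∀ m, Q.omegaRoot α (f m) (ξ m) = 0) {p : M}
    (hp : ∀ η, Q.IsLongestRoot η → ∀ u, Q.omegaRoot η (f p) (tmap f p u) = 0) (m : M) :
    ξ m = 0 := by
  have hs := hf.not_isLongestRoot p
  obtain ⟨C, hC⟩ := exists_energy_eq hΓ hf hfδ hξ hξδ hα
  have heF : ∀ {m : M} {g : adjointGroup L}, (g : Q.X) = f m →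
      Q.energy (g.1.symm (mc (f m) (ξ m))) = C := fun {m g} hg => by
    rw [← hC m, inFrame, apply_frame_symm (fun t ht v => energy_torus ht v) hg]
  have hc : (extChartAt (𝓡 2) p).symm (extChartAt (𝓡 2) p p) = p := extChartAt_to_inv p
  have hlocal := fun m => exists_localModel hf hξ m
  -- at the given point the derivative is principal nilpotent
  have hsimple : ∀ {G : EuclideanSpace ℝ (Fin 2) → adjointGroup L}
      {φ : EuclideanSpace ℝ (Fin 2) → EuclideanSpace ℝ (Fin 2) →L[ℝ] L}
      {y : EuclideanSpace ℝ (Fin 2)}, Q.IsCyclicPoint (φ y) →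
      (extChartAt (𝓡 2) p).symm y = p → (G y : Q.X) = f ((extChartAt (𝓡 2) p).symm y) →
      (∀ w, mc (f ((extChartAt (𝓡 2) p).symm y)) (tmap f ((extChartAt (𝓡 2) p).symm y)
          (paramDeriv (extChartAt (𝓡 2) p).symm y w)) = (G y).1 (φ y w - Q.ρ (φ y w))) →
      ∀ w, φ y w ∈ Q.weightSum {χ | Q.IsSimpleRoot (-χ)} := by
    intro G φ y hcyc hy hG hmc w
    refine mem_weightSum_simple hcyc hs fun η hη => ?_
    have h1 : ∀ u, Q.omegaRoot η (f ((extChartAt (𝓡 2) p).symm y))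
        (tmap f ((extChartAt (𝓡 2) p).symm y) u) = 0 := by rw [hy]; exact hp η hη
    have h2 := h1 (paramDeriv (extChartAt (𝓡 2) p).symm y w)
    rw [omegaRoot, mcPart_eq hG, LinearEquiv.map_eq_zero_iff] at h2
    have h3 := hmc w
    rw [← LinearEquiv.symm_apply_eq] at h3
    rw [← h3]
    exact h2
  have hC0 : C = 0 := by
    obtain ⟨G, φ, η, h⟩ := hlocal p
    obtain ⟨-, hG, hmc, hmod⟩ := h.self_of_nhds
    have h1 := lie_eq_zero_of_energy_const (h.mono fun y hy => hy.2.2.2) hα (C := C)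
      (h.mono fun y hy => heF hy.2.1)
    have h2 := Q.eq_zero_of_commute (hsimple hmod.cyclic hc hG hmc _)
      (fun β hβ => hmod.cyclic.ne β hβ _ single_zero_ne) hα h1.1 h1.2
    rw [← heF hG, energy, h2, map_zero, mul_zero]
  have hρ : ∀ {m : M} {g : adjointGroup L}, (g : Q.X) = f m →
      Q.ρ (g.1.symm (mc (f m) (ξ m))) = -g.1.symm (mc (f m) (ξ m)) := fun {m g} hg =>
    (neg_eq_of_add_eq_zero_right (add_rho_eq_zero_of_energy ((heF hg).trans hC0))).symm
  have hrestT : ∀ t ∈ Q.T, ∀ v, Q.restNorm (t.1 v) = Q.restNorm v := fun t ht v => by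
    rw [restNorm, ← mem_T_proj ht, reKilling_adjointGroup, restNorm]
  have hrF : ∀ {m : M} {g : adjointGroup L}, (g : Q.X) = f m →
      Q.restNorm (inFrame f ξ m) = Q.restNorm (g.1.symm (mc (f m) (ξ m))) := fun {m g} hg =>
    apply_frame_symm hrestT hg _
  -- the remaining part of the deformation is parallel
  have hconst : IsLocallyConstant fun m => Q.restNorm (inFrame f ξ m) := by
    rw [IsLocallyConstant.iff_eventually_eq]
    intro m
    obtain ⟨G, φ, η, h⟩ := hlocal m
    have hc : (extChartAt (𝓡 2) m).symm (extChartAt (𝓡 2) m m) = m := extChartAt_to_inv m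
    refine eventually_of_chart (p := fun m' => Q.restNorm (inFrame f ξ m') =
      Q.restNorm (inFrame f ξ m)) ?_
    have h0 : Q.restNorm (inFrame f ξ m) = Q.restNorm ((G (extChartAt (𝓡 2) m m)).1.symm
        (mc (f ((extChartAt (𝓡 2) m).symm (extChartAt (𝓡 2) m m)))
          (ξ ((extChartAt (𝓡 2) m).symm (extChartAt (𝓡 2) m m))))) := by
      rw [← hrF h.self_of_nhds.2.1, hc]
    filter_upwards [h, eventually_eq_of_fderiv_eq_zero (F := fun y => Q.restNorm ((G y).1.symm
        (mc (f ((extChartAt (𝓡 2) m).symm y)) (ξ ((extChartAt (𝓡 2) m).symm y))))) (by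
      filter_upwards [h.eventually_nhds] with y hy
      have hmod := hy.self_of_nhds.2.2.2
      have hd := (Q.projL (Q.Z ∪ Q.Zdag)ᶜ).hasFDerivAt.comp y hmod.hasFDerivAt_ζ
      have hd2 := ((reK L).hasFDerivAt.comp y hd).clm_apply hd
      refine hd2.congr_fderiv ?_
      ext w
      obtain ⟨-, τ, hτ, hw⟩ := hmod.lie_mem_h (hy.mono fun y hy => hρ hy.2.1) w
      have hP : (Q.projL (Q.Z ∪ Q.Zdag)ᶜ ∘L fderiv ℝ _ y) w = _ :=
        congrArg (Q.projL (Q.Z ∪ Q.Zdag)ᶜ) hw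
      have hηm := hmod.deform.mem w
      rw [map_add, map_sub, map_neg, projL_apply, projL_apply, projL_apply,
        Q.proj_of_disjoint (disjoint_compl_left.mono_right Set.subset_union_left) hηm,
        Q.proj_of_disjoint (disjoint_compl_left.mono_right Set.subset_union_right)
          (rho_mem_Zdag hηm), sub_zero, add_zero, Q.proj_lie_h hτ.1] at hP
      simp only [add_apply, ContinuousLinearMap.comp_apply (reK L), zero_apply,
        ContinuousLinearMap.flip_apply]
      rw [ContinuousLinearMap.comp_apply (M₂ := L)]
      simp only [hP, Function.comp_apply, projL_apply, reK_apply]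
      exact reKilling_add_lie_eq_zero τ _)] with y hy hy'
    rw [hrF hy.2.1, h0]
    exact hy'
  have hrest0 : ∀ m, Q.restNorm (inFrame f ξ m) = 0 := by
    intro m
    rw [hconst.apply_eq_of_preconnectedSpace m p]
    obtain ⟨G, φ, η, h⟩ := hlocal p
    obtain ⟨-, hG, hmc, hmod⟩ := h.self_of_nhds
    have h1 := hmod.cyclic.lie_mem_h_of_sub hα fun w =>
      (hmod.lie_mem_h (h.mono fun y hy => hρ hy.2.1) w).1
    have h2 : Q.proj (Q.Z ∪ Q.Zdag)ᶜ ((G (extChartAt (𝓡 2) p p)).1.symm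
        (mc (f ((extChartAt (𝓡 2) p).symm (extChartAt (𝓡 2) p p)))
          (ξ ((extChartAt (𝓡 2) p).symm (extChartAt (𝓡 2) p p))))) = 0 := by
      refine Q.eq_zero_of_forall_proj fun χ => ?_
      rw [Q.proj_proj]
      by_cases hχ : χ ∈ (Q.Z ∪ Q.Zdag)ᶜ
      · rw [Set.inter_eq_left.mpr (Set.singleton_subset_iff.mpr hχ)]
        refine Q.proj_eq_zero_of_lie_mem_h (hsimple hmod.cyclic hc hG hmc _)
          (fun β hβ => hmod.cyclic.ne β hβ _ single_zero_ne) hα h1.1 h1.2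
          (fun h => hχ (Or.inr (Or.inl h))) (fun h => hχ (Or.inl (Or.inl h)))
      · rw [Set.singleton_inter_eq_empty.mpr hχ]
        have h3 := Q.proj_mem ∅ ((G (extChartAt (𝓡 2) p p)).1.symm
          (mc (f ((extChartAt (𝓡 2) p).symm (extChartAt (𝓡 2) p p)))
            (ξ ((extChartAt (𝓡 2) p).symm (extChartAt (𝓡 2) p p)))))
        simpa [PositiveSystem.weightSum] using h3
    rw [← hc, hrF hG, restNorm, h2, map_zero]
  obtain ⟨G, φ, η, h⟩ := hlocal m
  obtain ⟨-, hG, hmc, hmod⟩ := h.self_of_nhds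
  have hcm : (extChartAt (𝓡 2) m).symm (extChartAt (𝓡 2) m m) = m := extChartAt_to_inv m
  have h1 := hmod.cyclic.lie_mem_h_of_sub hα fun w =>
    (hmod.lie_mem_h (h.mono fun y hy => hρ hy.2.1) w).1
  have h2 := hmod.cyclic.eq_zero hs hα h1.1 (hρ hG) (by
    by_contra hne
    refine (Q.reKilling_self_pos ?_ hne).ne' ((hrF hG).symm.trans (hrest0 _))
    rw [Q.rho_proj neg_mem_compl_iff, hρ hG, map_neg]) (by
    have := hξα ((extChartAt (𝓡 2) m).symm (extChartAt (𝓡 2) m m))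
    rwa [omegaRoot, mcPart_eq hG, LinearEquiv.map_eq_zero_iff] at this)
  have h3 := eq_zero_of_mc_eq_zero ((LinearEquiv.map_eq_zero_iff _).mp h2)
  rwa [hcm] at h3

end HKQuadruple

/-! ### Flat structures -/

/-- A flat structure on `M` which is invariant under `Γ`: a class of germs of maps from `ℂ` to `M`,
the inverses of the flat charts, which are unique up to rotations. -/
structure IsFlatStructure (Γ : Type*) {M : Type*} [TopologicalSpace M] [Group Γ] [MulAction Γ M]
    (flat : (ℂ → M) → ℂ → Prop) : Prop where
  congr : ∀ {g g' : ℂ → M} {y : ℂ}, flat g y → g =ᶠ[𝓝 y] g' → flat g' y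
  eventually : ∀ {g : ℂ → M} {y : ℂ}, flat g y → ∀ᶠ y' in 𝓝 y, flat g y'
  comp : ∀ {g : ℂ → M} {a b y : ℂ}, ‖a‖ = 1 → flat g (a * y + b) → flat (fun y => g (a * y + b)) y
  smul : ∀ {g : ℂ → M} {y : ℂ} (γ : Γ), flat g y → flat (fun y => γ • g y) y
  continuousAt : ∀ {g : ℂ → M} {y : ℂ}, flat g y → ContinuousAt g y
  nhds_le : ∀ {g : ℂ → M} {y : ℂ}, flat g y → 𝓝 (g y) ≤ Filter.map g (𝓝 y)
  injOn : ∀ {g : ℂ → M} {y : ℂ}, flat g y → ∃ U ∈ 𝓝 y, Set.InjOn g U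
  unique : ∀ {g g' : ℂ → M} {y : ℂ}, flat g y → flat g' y → g y = g' y →
    ∃ a : ℂ, ‖a‖ = 1 ∧ ∀ᶠ y' in 𝓝 y, g y' = g' (y + a * (y' - y))
  exists_flat : ∀ p : M, ∃ g : ℂ → M, g 0 = p ∧ flat g 0

namespace IsFlatStructure

variable {Γ M : Type*} [TopologicalSpace M] [Group Γ] [MulAction Γ M] {flat : (ℂ → M) → ℂ → Prop}

theorem comp_add (h : IsFlatStructure Γ flat) {g : ℂ → M} {a b c y : ℂ} (ha : ‖a‖ = 1)
    (hg : flat g (b + a * (y - c))) : flat (fun y => g (b + a * (y - c))) y := by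
  have e : ∀ y, b + a * (y - c) = a * y + (b - a * c) := fun y => by ring
  simp only [e] at hg ⊢
  exact h.comp ha hg

/-- The identity principle. -/
theorem eqOn (h : IsFlatStructure Γ flat) [T2Space M] {S : Set ℂ}
    (hSc : IsPreconnected S) {g g' : ℂ → M} (hg : ∀ y ∈ S, flat g y) (hg' : ∀ y ∈ S, flat g' y)
    {u : ℂ} (hu : u ∈ S) (he : g =ᶠ[𝓝 u] g') : Set.EqOn g g' S := by
  have hsub : S ⊆ {y | g =ᶠ[𝓝 y] g'} := by
    refine hSc.subset_of_closure_inter_subset ?_ ⟨u, hu, he⟩ ?_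
    · rw [isOpen_iff_mem_nhds]
      intro y hy
      exact hy.eventually_nhds
    · rintro y ⟨hy, hyS⟩
      have hfr : ∃ᶠ y' in 𝓝 y, g =ᶠ[𝓝 y'] g' := mem_closure_iff_frequently.mp hy
      have hyy : g y = g' y := by
        have hc : ContinuousAt (fun y => (g y, g' y)) y :=
          (h.continuousAt (hg y hyS)).prodMk (h.continuousAt (hg' y hyS))
        by_contra hne
        have h1 : ∀ᶠ y' in 𝓝 y, (g y', g' y') ∈ (Set.diagonal M)ᶜ :=
          hc.eventually (isClosed_diagonal.isOpen_compl.mem_nhds hne)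
        obtain ⟨y', h2, h3⟩ := (hfr.and_eventually h1).exists
        exact h3 h2.self_of_nhds
      obtain ⟨a, -, ha⟩ := h.unique (hg y hyS) (hg' y hyS) hyy
      obtain ⟨U, hU, hinj⟩ := h.injOn (hg' y hyS)
      -- the rotation fixes an open set, hence it is the identity
      have hlim : Filter.Tendsto (fun y' => y + a * (y' - y)) (𝓝 y) (𝓝 y) := by
        have : ContinuousAt (fun y' => y + a * (y' - y)) y := by fun_prop
        simpa [ContinuousAt] using this
      obtain ⟨y', h1, h2⟩ := (hfr.and_eventually (ha.eventually_nhds.and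
        ((Filter.eventually_mem_set.mpr hU).eventually_nhds.and
          (hlim.eventually (Filter.eventually_mem_set.mpr hU)).eventually_nhds))).exists
      have h3 : ∀ᶠ y'' in 𝓝 y', y'' = y + a * (y'' - y) := by
        filter_upwards [h1, h2.1, h2.2.1, h2.2.2] with y'' e1 e2 e3 e4
        exact hinj e3 e4 (e1.symm.trans e2)
      have h4 : ∃ y'', y'' ≠ y ∧ y'' = y + a * (y'' - y) := by
        by_cases hy' : y' = y
        · have h5 : ∀ᶠ y'' in 𝓝[≠] y', y'' = y + a * (y'' - y) := h3.filter_mono nhdsWithin_le_nhds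
          obtain ⟨y'', h6, h7⟩ := (h5.and self_mem_nhdsWithin).exists
          exact ⟨y'', hy' ▸ h7, h6⟩
        · exact ⟨y', hy', h3.self_of_nhds⟩
      obtain ⟨y'', h5, h6⟩ := h4
      have ha1 : a = 1 := by
        have : (a - 1) * (y'' - y) = 0 := by linear_combination -h6
        exact sub_eq_zero.mp ((mul_eq_zero.mp this).resolve_right (sub_ne_zero.mpr h5))
      filter_upwards [ha] with z hz
      rw [hz, ha1]; congr 1; ring
  exact fun y hy => (hsub hy).self_of_nhds

/-- By compactness, there are flat discs of a given radius at every point. -/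
theorem exists_radius (h : IsFlatStructure Γ flat)
    (hK : ∃ K : Set M, IsCompact K ∧ ∀ m : M, ∃ γ : Γ, γ • m ∈ K) :
    ∃ ε > 0, ∀ p : M, ∃ g : ℂ → M, g 0 = p ∧ ∀ y ∈ Metric.ball (0 : ℂ) ε, flat g y := by
  obtain ⟨K, hK, hΓ⟩ := hK
  have key : ∃ ε > 0, ∀ p ∈ K, ∃ g : ℂ → M, g 0 = p ∧ ∀ y ∈ Metric.ball (0 : ℂ) ε, flat g y := by
    refine hK.induction_on (p := fun S => ∃ ε > 0, ∀ p ∈ S, ∃ g : ℂ → M, g 0 = p ∧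
      ∀ y ∈ Metric.ball (0 : ℂ) ε, flat g y) ⟨1, one_pos, fun p hp => hp.elim⟩ ?_ ?_ ?_
    · rintro S T hST ⟨ε, hε, hT⟩
      exact ⟨ε, hε, fun p hp => hT p (hST hp)⟩
    · rintro S T ⟨ε, hε, hS⟩ ⟨ε', hε', hT⟩
      refine ⟨min ε ε', lt_min hε hε', fun p hp => ?_⟩
      rcases hp with hp | hp
      · obtain ⟨g, h1, h2⟩ := hS p hp
        exact ⟨g, h1, fun y hy => h2 y (Metric.ball_subset_ball (min_le_left _ _) hy)⟩
      · obtain ⟨g, h1, h2⟩ := hT p hp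
        exact ⟨g, h1, fun y hy => h2 y (Metric.ball_subset_ball (min_le_right _ _) hy)⟩
    · intro p _
      obtain ⟨g, h1, h2⟩ := h.exists_flat p
      obtain ⟨r, hr, hball⟩ := Metric.eventually_nhds_iff_ball.mp (h.eventually h2)
      refine ⟨g '' Metric.ball 0 (r / 2), mem_nhdsWithin_of_mem_nhds ?_, r / 2, by positivity, ?_⟩
      · rw [← h1]
        exact h.nhds_le h2 (Filter.image_mem_map (Metric.ball_mem_nhds _ (by positivity)))
      · rintro q ⟨y, hy, rfl⟩
        refine ⟨fun v => g (1 * v + y), by simp, fun v hv => h.comp (by simp) (hball _ ?_)⟩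
        rw [mem_ball_zero_iff] at hy hv ⊢
        calc ‖1 * v + y‖ ≤ ‖v‖ + ‖y‖ := by rw [one_mul]; exact norm_add_le _ _
          _ < r := by linarith
  obtain ⟨ε, hε, hdisc⟩ := key
  refine ⟨ε, hε, fun p => ?_⟩
  obtain ⟨γ, hγ⟩ := hΓ p
  obtain ⟨g, h1, h2⟩ := hdisc _ hγ
  exact ⟨fun y => γ⁻¹ • g y, by simp [h1], fun y hy => h.smul _ (h2 y hy)⟩

/-- The germ of a flat map extends to a disc of a given radius. -/
theorem exists_disc (h : IsFlatStructure Γ flat) {ε : ℝ}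
    (hε : ∀ p : M, ∃ g : ℂ → M, g 0 = p ∧ ∀ y ∈ Metric.ball (0 : ℂ) ε, flat g y) (hε0 : 0 < ε)
    {g : ℂ → M} {u : ℂ} (hg : flat g u) :
    ∃ d : ℂ → M, (∀ y ∈ Metric.ball u ε, flat d y) ∧ g =ᶠ[𝓝 u] d := by
  obtain ⟨d, h1, h2⟩ := hε (g u)
  have h3 : flat (fun y => d (0 + 1 * (y - u))) u := by
    refine h.comp_add (by simp) (h2 _ ?_)
    simpa using hε0
  obtain ⟨a, ha, h4⟩ := h.unique hg h3 (by simp [h1])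
  refine ⟨fun y => d (0 + a * (y - u)), fun y hy => h.comp_add ha (h2 _ ?_), ?_⟩
  · rw [Metric.mem_ball, dist_eq_norm] at hy
    simpa [ha] using hy
  · filter_upwards [h4] with y hy
    rw [hy]; simp

/-- A flat map on a disc extends to a larger disc. -/
theorem exists_extension (h : IsFlatStructure Γ flat) [T2Space M] {ε : ℝ}
    (hε : ∀ p : M, ∃ g : ℂ → M, g 0 = p ∧ ∀ y ∈ Metric.ball (0 : ℂ) ε, flat g y) (hε0 : 0 < ε)
    {r : ℝ} (hr : 0 < r) {g : ℂ → M} (hg : ∀ y ∈ Metric.ball (0 : ℂ) r, flat g y) :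
    ∃ g' : ℂ → M, (∀ y ∈ Metric.ball (0 : ℂ) (r + ε / 4), flat g' y) ∧
      Set.EqOn g g' (Metric.ball 0 r) := by
  have : Nonempty M := ⟨g 0⟩
  choose! d hd hgd using fun u (hu : u ∈ Metric.ball (0 : ℂ) r) => h.exists_disc hε hε0 (hg u hu)
  have hball : ∀ {x y : ℂ} {s t : ℝ}, IsPreconnected (Metric.ball x s ∩ Metric.ball y t) :=
    fun {x y s t} => ((convex_ball x s).inter (convex_ball y t)).isPreconnected
  have heq : ∀ u ∈ Metric.ball (0 : ℂ) r,
      Set.EqOn g (d u) (Metric.ball 0 r ∩ Metric.ball u ε) := fun u hu =>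
    h.eqOn hball (fun y hy => hg y hy.1)
      (fun y hy => hd u hu y hy.2) ⟨hu, Metric.mem_ball_self hε0⟩ (hgd u hu)
  -- the discs around two nearby points agree
  have hdd : ∀ u ∈ Metric.ball (0 : ℂ) r, ∀ u' ∈ Metric.ball (0 : ℂ) r, dist u u' < ε →
      Set.EqOn (d u) (d u') (Metric.ball u ε ∩ Metric.ball u' ε) := by
    intro u hu u' hu' huu'
    refine h.eqOn hball (fun y hy => hd u hu y hy.1)
      (fun y hy => hd u' hu' y hy.2) (u := u) ⟨Metric.mem_ball_self hε0, huu'⟩ ?_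
    filter_upwards [(Metric.isOpen_ball.inter (Metric.isOpen_ball.inter
      Metric.isOpen_ball)).mem_nhds (⟨hu, Metric.mem_ball_self hε0, huu'⟩ :
        u ∈ Metric.ball 0 r ∩ (Metric.ball u ε ∩ Metric.ball u' ε))] with y hy
    rw [← heq u hu ⟨hy.1, hy.2.1⟩, ← heq u' hu' ⟨hy.1, hy.2.2⟩]
  set κ : ℝ := r / (r + ε / 4) with hκ
  have hκ0 : 0 < κ := by positivity
  have hκr : κ * (r + ε / 4) = r := by rw [hκ]; field_simp
  have hκ1 : κ < 1 := by rw [hκ, div_lt_one (by positivity)]; linarith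
  have hnorm : ∀ y : ℂ, ‖(κ : ℂ) * y‖ = κ * ‖y‖ := fun y => by
    rw [norm_mul, Complex.norm_real, Real.norm_of_nonneg hκ0.le]
  have hin : ∀ y ∈ Metric.ball (0 : ℂ) (r + ε / 4), (κ : ℂ) * y ∈ Metric.ball (0 : ℂ) r := by
    intro y hy
    rw [mem_ball_zero_iff] at hy ⊢
    rw [hnorm, ← hκr]
    exact mul_lt_mul_of_pos_left hy hκ0
  have hclose : ∀ y ∈ Metric.ball (0 : ℂ) (r + ε / 4), y ∈ Metric.ball ((κ : ℂ) * y) ε := by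
    intro y hy
    rw [mem_ball_zero_iff] at hy
    rw [Metric.mem_ball, dist_eq_norm]
    have : y - (κ : ℂ) * y = ((1 - κ : ℝ) : ℂ) * y := by push_cast; ring
    rw [this, norm_mul, Complex.norm_real, Real.norm_of_nonneg (by linarith)]
    have : (1 - κ) * ‖y‖ ≤ (1 - κ) * (r + ε / 4) :=
      mul_le_mul_of_nonneg_left hy.le (by linarith)
    nlinarith
  refine ⟨fun y => d (κ * y) y, fun y hy => ?_, fun y hy => ?_⟩
  · refine h.congr (hd (κ * y) (hin y hy) y (hclose y hy)) ?_
    have hc : ContinuousAt (fun z : ℂ => (κ : ℂ) * z) y := by fun_prop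
    filter_upwards [Metric.isOpen_ball.mem_nhds hy,
      Metric.isOpen_ball.mem_nhds (hclose y hy),
      hc.eventually (Metric.ball_mem_nhds _ hε0)] with z hz hz' hz''
    exact hdd _ (hin y hy) _ (hin z hz) (by rw [dist_comm]; exact hz'') ⟨hz', hclose z hz⟩
  · have hy' : y ∈ Metric.ball (0 : ℂ) (r + ε / 4) :=
      Metric.ball_subset_ball (by linarith) hy
    exact heq _ (hin y hy') ⟨hy, hclose y hy'⟩

/-- A flat disc extends to a flat map on the whole plane. -/
theorem exists_entire (h : IsFlatStructure Γ flat) [T2Space M] {ε : ℝ}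
    (hε : ∀ p : M, ∃ g : ℂ → M, g 0 = p ∧ ∀ y ∈ Metric.ball (0 : ℂ) ε, flat g y) (hε0 : 0 < ε)
    (p : M) : ∃ E : ℂ → M, E 0 = p ∧ ∀ y, flat E y := by
  obtain ⟨g₀, hg₀, hflat₀⟩ := hε p
  have hr : ∀ n : ℕ, 0 < ε + n * (ε / 4) := fun n => by positivity
  have : Nonempty M := ⟨p⟩
  choose! next hnext heq using fun (n : ℕ) (g : ℂ → M)
    (hg : ∀ y ∈ Metric.ball (0 : ℂ) (ε + n * (ε / 4)), flat g y) =>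
      h.exists_extension hε hε0 (hr n) hg
  let G : ℕ → ℂ → M := fun n => Nat.rec g₀ (fun n g => next n g) n
  have hG : ∀ n : ℕ, ∀ y ∈ Metric.ball (0 : ℂ) (ε + n * (ε / 4)), flat (G n) y := by
    intro n
    induction n with
    | zero => exact fun y hy => hflat₀ y (by simpa using hy)
    | succ n ih =>
      have := hnext n (G n) ih
      intro y hy
      refine this y ?_
      push_cast at hy
      have e : ε + (n + 1 : ℝ) * (ε / 4) = ε + n * (ε / 4) + ε / 4 := by ring
      rwa [e] at hy
  have hGs : ∀ n k : ℕ, Set.EqOn (G n) (G (n + k)) (Metric.ball 0 (ε + n * (ε / 4))) := by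
    intro n k
    induction k with
    | zero => exact fun _ _ => rfl
    | succ k ih =>
      intro y hy
      rw [ih hy]
      refine heq (n + k) (G (n + k)) (hG _) ?_
      refine Metric.ball_subset_ball ?_ hy
      have : (0 : ℝ) ≤ k * (ε / 4) := by positivity
      push_cast
      linarith
  have hex : ∀ y : ℂ, ∃ n : ℕ, y ∈ Metric.ball (0 : ℂ) (ε + n * (ε / 4)) := by
    intro y
    obtain ⟨n, hn⟩ := exists_nat_gt (‖y‖ / (ε / 4))
    refine ⟨n, ?_⟩
    rw [mem_ball_zero_iff]
    rw [div_lt_iff₀ (by positivity)] at hn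
    linarith
  choose N hN using hex
  have hEG : ∀ n : ℕ, ∀ y ∈ Metric.ball (0 : ℂ) (ε + n * (ε / 4)), G (N y) y = G n y := by
    intro n y hy
    rw [hGs (N y) n (hN y), hGs n (N y) hy, add_comm]
  refine ⟨fun y => G (N y) y, ?_, fun y => ?_⟩
  · change G (N 0) 0 = p
    rw [hEG 0 0 (by simpa using hε0)]
    exact hg₀
  · refine h.congr (hG (N y) y (hN y)) ?_
    filter_upwards [Metric.isOpen_ball.mem_nhds (hN y)] with z hz
    exact (hEG _ z hz).symm

/-- Two flat maps on the plane with a common value differ by an isometry. -/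
theorem entire_unique (h : IsFlatStructure Γ flat) [T2Space M] {E E' : ℂ → M}
    (hE : ∀ y, flat E y) (hE' : ∀ y, flat E' y) {u v : ℂ} (huv : E u = E' v) :
    ∃ a : ℂ, ‖a‖ = 1 ∧ ∀ y, E y = E' (v + a * (y - u)) := by
  have h1 : ∀ y, flat (fun y => E' (v + 1 * (y - u))) y := fun y => h.comp_add (by simp) (hE' _)
  obtain ⟨a, ha, hev⟩ := h.unique (hE u) (h1 u) (by simp [huv])
  refine ⟨a, ha, fun y => ?_⟩
  refine h.eqOn isPreconnected_univ (fun y _ => hE y)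
    (fun y _ => h.comp_add ha (hE' _)) (Set.mem_univ u) ?_ (Set.mem_univ y)
  filter_upwards [hev] with z hz
  rw [hz]; congr 1; ring

theorem entire_surjective (h : IsFlatStructure Γ flat) [T2Space M] [PreconnectedSpace M]
    {ε : ℝ} (hε : ∀ p : M, ∃ g : ℂ → M, g 0 = p ∧ ∀ y ∈ Metric.ball (0 : ℂ) ε, flat g y)
    (hε0 : 0 < ε) {E : ℂ → M} (hE : ∀ y, flat E y) : Function.Surjective E := by
  rw [← Set.range_eq_univ]
  refine IsClopen.eq_univ ⟨?_, ?_⟩ ⟨E 0, 0, rfl⟩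
  · rw [← isOpen_compl_iff, isOpen_iff_mem_nhds]
    intro p hp
    obtain ⟨E', hp', hE'⟩ := h.exists_entire hε hε0 p
    have h1 : Set.range E' ∈ 𝓝 p := by
      rw [← hp']
      exact h.nhds_le (hE' 0) Filter.range_mem_map
    filter_upwards [h1] with q hq
    rintro ⟨u, rfl⟩
    obtain ⟨v, hv⟩ := hq
    obtain ⟨a, -, ha⟩ := h.entire_unique hE' hE hv
    exact hp ⟨u + a * (0 - v), by rw [← ha, hp']⟩
  · rw [isOpen_iff_mem_nhds]
    rintro _ ⟨u, rfl⟩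
    exact h.nhds_le (hE u) Filter.range_mem_map

end IsFlatStructure

/-! ### Flat structures and the first homology group -/

/-- A separated family of points of a disc of radius `r` has at most quadratic size in `r`. -/
theorem card_le_of_separated {ι : Type*} [Fintype ι] {r ε : ℝ} (hε : 0 < ε) (v : ι → ℂ)
    (hr : ∀ i, ‖v i‖ ≤ r) (hs : ∀ i j, ‖v i - v j‖ < ε → i = j) :
    (Fintype.card ι : ℝ) ≤ (4 * r / ε + 3) ^ 2 := by
  classical
  rcases isEmpty_or_nonempty ι with h | ⟨⟨i₀⟩⟩
  · rw [Fintype.card_eq_zero]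
    simpa using sq_nonneg _
  have hr0 : 0 ≤ r := (norm_nonneg _).trans (hr i₀)
  set K : ℤ := ⌊2 * r / ε⌋ + 1 with hK
  have hK0 : 0 ≤ K := by
    have : 0 ≤ ⌊2 * r / ε⌋ := Int.floor_nonneg.mpr (by positivity)
    omega
  have hbound : ∀ x : ℝ, |x| ≤ r → ⌊2 * x / ε⌋ ∈ Finset.Icc (-K) K := by
    intro x hx
    obtain ⟨h1, h2⟩ := abs_le.mp hx
    have h4 : 2 * r / ε < K := by rw [hK]; push_cast; exact Int.lt_floor_add_one _
    rw [Finset.mem_Icc]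
    constructor
    · rw [Int.le_floor]
      push_cast
      have : -(2 * r / ε) ≤ 2 * x / ε := by
        rw [← neg_div]; gcongr; linarith
      linarith
    · have h3 : (⌊2 * x / ε⌋ : ℝ) ≤ 2 * x / ε := Int.floor_le _
      have : 2 * x / ε ≤ 2 * r / ε := by gcongr
      have : (⌊2 * x / ε⌋ : ℝ) < K := by linarith
      exact_mod_cast this.le
  have hclose : ∀ x y : ℝ, ⌊2 * x / ε⌋ = ⌊2 * y / ε⌋ → |x - y| < ε / 2 := by
    intro x y hxy
    have h1 := Int.abs_sub_lt_one_of_floor_eq_floor hxy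
    have h2 : 2 * x / ε - 2 * y / ε = (2 / ε) * (x - y) := by ring
    rw [h2, abs_mul, abs_of_pos (by positivity)] at h1
    rw [div_mul_eq_mul_div, div_lt_one hε] at h1
    linarith
  have hcard : Fintype.card ι ≤ (Finset.Icc (-K) K ×ˢ Finset.Icc (-K) K).card := by
    rw [← Finset.card_univ]
    refine Finset.card_le_card_of_injOn
      (fun i => (⌊2 * (v i).re / ε⌋, ⌊2 * (v i).im / ε⌋)) ?_ ?_
    · intro i _
      exact Finset.mem_coe.mpr (Finset.mem_product.mpr
        ⟨hbound _ ((Complex.abs_re_le_norm _).trans (hr i)),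
          hbound _ ((Complex.abs_im_le_norm _).trans (hr i))⟩)
    · intro i _ j _ hij
      obtain ⟨h1, h2⟩ := Prod.mk.inj hij
      refine hs i j ((Complex.norm_le_abs_re_add_abs_im _).trans_lt ?_)
      have h3 := hclose _ _ h1
      have h4 := hclose _ _ h2
      rw [Complex.sub_re, Complex.sub_im]
      linarith
  rw [Finset.card_product, Int.card_Icc] at hcard
  have hcast : (((K + 1 - -K).toNat : ℕ) : ℝ) = 2 * K + 1 := by
    have : (((K + 1 - -K).toNat : ℕ) : ℤ) = 2 * K + 1 := by omega
    exact_mod_cast this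
  have h5 : (Fintype.card ι : ℝ) ≤ (2 * K + 1) * (2 * K + 1) := by
    rw [← hcast]; exact_mod_cast hcard
  have h6 : (K : ℝ) ≤ 2 * r / ε + 1 := by
    rw [hK]; push_cast; linarith [Int.floor_le (2 * r / ε)]
  have h7 : (0 : ℝ) ≤ K := by exact_mod_cast hK0
  have h8 : (2 * K + 1 : ℝ) ≤ 4 * r / ε + 3 := by
    have : 4 * r / ε = 2 * (2 * r / ε) := by ring
    linarith
  nlinarith

namespace IsFlatStructure

variable {Γ M : Type*} [TopologicalSpace M] [Group Γ] [MulAction Γ M] {flat : (ℂ → M) → ℂ → Prop}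

/-- A properly discontinuous free cocompact group which preserves a flat structure has first Betti
number at most two: the developing map identifies an orbit with a separated set of points of the
plane, on which the words of length `n` in three independent elements would give `n ^ 3` points
of a disc of radius proportional to `n`. -/
theorem finrank_abelianization_le (h : IsFlatStructure Γ flat) [T2Space M] [ConnectedSpace M]
    (hfree : ∀ (γ : Γ) (m : M), γ • m = m → γ = 1) [hp : ProperlyDiscontinuousSMul Γ M]
    (hK : ∃ K : Set M, IsCompact K ∧ ∀ m : M, ∃ γ : Γ, γ • m ∈ K) :
    Module.finrank ℤ (Additive (Abelianization Γ)) ≤ 2 := by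
  by_contra! hrank
  obtain ⟨ε, hε0, hε⟩ := h.exists_radius hK
  obtain ⟨p⟩ := (inferInstance : Nonempty M)
  obtain ⟨E, hEp, hE⟩ := h.exists_entire hε hε0 p
  have hsurj := h.entire_surjective hε hε0 hE
  have hEc : Continuous E := continuous_iff_continuousAt.mpr fun y => h.continuousAt (hE y)
  -- left translations act on the developing map by isometries
  have hiso : ∀ (γ : Γ) (v : ℂ), E v = γ • p →
      ∃ a : ℂ, ‖a‖ = 1 ∧ ∀ y, E y = γ • E (a * (y - v)) := by
    intro γ v hv
    obtain ⟨a, ha, h1⟩ := h.entire_unique (fun y => h.smul γ⁻¹ (hE y)) hE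
      (show γ⁻¹ • E v = E 0 by rw [hv, inv_smul_smul, hEp])
    refine ⟨a, ha, fun y => ?_⟩
    have h2 := h1 y
    rw [zero_add] at h2
    rw [← h2, smul_inv_smul]
  obtain ⟨r, hr0, hr⟩ : ∃ r > 0, ∀ (γ : Γ) (v : ℂ), ‖v‖ < r → E v = γ • p → γ = 1 := by
    have hfin := hp.finite_disjoint_inter_image (K := {p}) (L := E '' Metric.closedBall 0 1)
      isCompact_singleton ((isCompact_closedBall 0 1).image hEc)
    have hev : ∀ᶠ v in 𝓝 (0 : ℂ), ∀ γ ∈ {γ : Γ | (((γ • ·) '' {p}) ∩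
        E '' Metric.closedBall 0 1).Nonempty}, γ ≠ 1 → E v ≠ γ • p := by
      rw [Filter.eventually_all_finite hfin]
      intro γ _
      by_cases hγ : γ = 1
      · exact Filter.Eventually.of_forall fun v h => absurd hγ h
      · have : E 0 ≠ γ • p := fun h => hγ (hfree γ p (by rw [← h, hEp]))
        filter_upwards [hEc.continuousAt.eventually_ne this] with v hv _ using hv
    obtain ⟨r, hr0, hr⟩ := Metric.eventually_nhds_iff_ball.mp hev
    refine ⟨min r 1, lt_min hr0 one_pos, fun γ v hv hvγ => ?_⟩
    by_contra hγ
    refine hr v (mem_ball_zero_iff.mpr (hv.trans_le (min_le_left _ _))) γ ?_ hγ hvγ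
    refine ⟨γ • p, ⟨p, rfl, rfl⟩, v, ?_, hvγ⟩
    exact mem_closedBall_zero_iff.mpr (hv.le.trans (min_le_right _ _))
  have hsep : ∀ (γ γ' : Γ) (v v' : ℂ), E v = γ • p → E v' = γ' • p → ‖v - v'‖ < r → γ = γ' := by
    intro γ γ' v v' hv hv' hvv
    obtain ⟨a, ha, h1⟩ := hiso γ v hv
    have h2 : γ⁻¹ * γ' = 1 := by
      refine hr _ (a * (v' - v)) ?_ ?_
      · rwa [norm_mul, ha, one_mul, norm_sub_rev]
      · rw [mul_smul, ← hv', h1 v', inv_smul_smul]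
    exact (inv_mul_eq_one.mp h2)
  obtain ⟨b, hb⟩ := exists_linearIndependent_of_le_finrank (R := ℤ)
    (M := Additive (Abelianization Γ)) (n := 3) hrank
  have hlift : ∀ i, ∃ γ : Γ, Additive.ofMul (Abelianization.of γ) = b i := fun i =>
    QuotientGroup.mk_surjective (b i).toMul
  choose γ hγ using hlift
  choose w hw using fun i => hsurj (γ i • p)
  obtain ⟨C, hC⟩ : ∃ C : ℝ, ∀ i, ‖w i‖ ≤ C :=
    ⟨∑ i, ‖w i‖, fun i => Finset.single_le_sum (f := fun i => ‖w i‖)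
      (fun _ _ => norm_nonneg _) (Finset.mem_univ i)⟩
  have hC0 : 0 ≤ C := (norm_nonneg _).trans (hC 0)
  have hstep : ∀ (i : Fin 3) (k : ℕ) (σ : Γ) (s : ℝ), (∃ v : ℂ, ‖v‖ ≤ s ∧ E v = σ • p) →
      ∃ v : ℂ, ‖v‖ ≤ s + k * C ∧ E v = (σ * γ i ^ k) • p := by
    intro i k σ s hs
    induction k with
    | zero => simpa using hs
    | succ k ih =>
      obtain ⟨v, hv, hvσ⟩ := ih
      obtain ⟨a, ha, h1⟩ := hiso _ v hvσ
      have ha0 : a ≠ 0 := norm_ne_zero_iff.mp (by rw [ha]; exact one_ne_zero)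
      refine ⟨v + a⁻¹ * w i, ?_, ?_⟩
      · refine (norm_add_le _ _).trans ?_
        rw [norm_mul, norm_inv, ha, inv_one, one_mul]
        push_cast
        linarith [hC i]
      · rw [h1, add_sub_cancel_left, mul_inv_cancel_left₀ ha0, hw, smul_smul, pow_succ, mul_assoc]
  have hword : ∀ (n : ℕ) (k : Fin 3 → Fin n), ∃ v : ℂ, ‖v‖ ≤ 3 * n * C ∧
      E v = (γ 0 ^ (k 0 : ℕ) * γ 1 ^ (k 1 : ℕ) * γ 2 ^ (k 2 : ℕ)) • p := by
    intro n k
    obtain ⟨v, hv, hvk⟩ := hstep 2 (k 2) _ _ (hstep 1 (k 1) _ _ (hstep 0 (k 0) 1 0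
      ⟨0, by simp, by simp [hEp]⟩))
    rw [one_mul] at hvk
    refine ⟨v, hv.trans ?_, hvk⟩
    have : ∀ i, ((k i : ℕ) : ℝ) * C ≤ n * C := fun i =>
      mul_le_mul_of_nonneg_right (by exact_mod_cast (k i).isLt.le) hC0
    linarith [this 0, this 1, this 2]
  have hinj : ∀ (n : ℕ) (k k' : Fin 3 → Fin n),
      γ 0 ^ (k 0 : ℕ) * γ 1 ^ (k 1 : ℕ) * γ 2 ^ (k 2 : ℕ) =
        γ 0 ^ (k' 0 : ℕ) * γ 1 ^ (k' 1 : ℕ) * γ 2 ^ (k' 2 : ℕ) → k = k' := by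
    intro n k k' hkk
    have h1 : ∀ k : Fin 3 → Fin n, Additive.ofMul (Abelianization.of
        (γ 0 ^ (k 0 : ℕ) * γ 1 ^ (k 1 : ℕ) * γ 2 ^ (k 2 : ℕ))) =
        ∑ i, ((k i : ℕ) : ℤ) • b i := by
      intro k
      rw [Fin.sum_univ_three, ← hγ, ← hγ, ← hγ]
      simp only [map_mul, map_pow, ofMul_mul, ofMul_pow, natCast_zsmul]
    have h2 : ∑ i, (((k i : ℕ) : ℤ) - ((k' i : ℕ) : ℤ)) • b i = 0 := by
      simp only [sub_smul, Finset.sum_sub_distrib]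
      rw [← h1, ← h1, hkk, sub_self]
    have h3 := Fintype.linearIndependent_iff.mp hb _ h2
    funext i
    have := h3 i
    exact Fin.ext (by omega)
  have hcount : ∀ n : ℕ, (n : ℝ) ^ 3 ≤ (4 * (3 * n * C) / r + 3) ^ 2 := by
    intro n
    choose v hv hvE using hword n
    have := card_le_of_separated hr0 v hv
      (fun k k' hkk => hinj n k k' (hsep _ _ _ _ (hvE k) (hvE k') hkk))
    simpa using this
  set B : ℝ := 12 * C / r + 3 with hB
  obtain ⟨n, hn⟩ := exists_nat_gt (B ^ 2 + 1)
  have hn1 : (1 : ℝ) ≤ n := by nlinarith [sq_nonneg B]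
  have h1 : 4 * (3 * n * C) / r + 3 ≤ B * n := by
    have : 4 * (3 * n * C) / r = 12 * C / r * n := by ring
    rw [this, hB]
    nlinarith
  have h2 : 0 ≤ 4 * (3 * n * C) / r + 3 := by positivity
  have h3 : (n : ℝ) ^ 3 ≤ (B * n) ^ 2 := (hcount n).trans (pow_le_pow_left₀ h2 h1 2)
  have h4 : (n : ℝ) ^ 2 * (n - B ^ 2) ≤ 0 := by nlinarith
  have h5 : (0 : ℝ) < n ^ 2 := by positivity
  have h6 : (0 : ℝ) < n - B ^ 2 := by linarith
  exact absurd h4 (not_le.mpr (mul_pos h5 h6))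

end IsFlatStructure

/-! ### Flat atlases -/

/-- The isometry `y ↦ a * y + b` of the plane. -/
noncomputable def affineHomeo {a : ℂ} (ha : a ≠ 0) (b : ℂ) : ℂ ≃ₜ ℂ where
  toFun y := a * y + b
  invFun y := a⁻¹ * (y - b)
  left_inv y := by simp [inv_mul_cancel_left₀ ha]
  right_inv y := by simp [mul_inv_cancel_left₀ ha]
  continuous_toFun := by fun_prop
  continuous_invFun := by fun_prop

/-- The inverses of the charts of an atlas with values in the plane form a flat structure if the
changes of charts are rotations and translations. -/
theorem isFlatStructure_of_atlas {Γ M : Type*} [TopologicalSpace M] [Group Γ] [MulAction Γ M]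
    [ContinuousConstSMul Γ M] {A : Set (OpenPartialHomeomorph M ℂ)}
    (hcov : ∀ p, ∃ e ∈ A, p ∈ e.source)
    (haff : ∀ e ∈ A, ∀ (a b : ℂ) (ha : a ≠ 0), ‖a‖ = 1 →
      e.transHomeomorph (affineHomeo ha b).symm ∈ A)
    (hsmul : ∀ e ∈ A, ∀ γ : Γ, (Homeomorph.smul γ⁻¹).transOpenPartialHomeomorph e ∈ A)
    (huniq : ∀ e ∈ A, ∀ e' ∈ A, ∀ m ∈ e.source, m ∈ e'.source →
      ∃ a : ℂ, ‖a‖ = 1 ∧ ∀ᶠ m' in 𝓝 m, e' m' = e' m + a * (e m' - e m)) :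
    IsFlatStructure Γ fun (g : ℂ → M) y => ∃ e ∈ A, y ∈ e.target ∧ g =ᶠ[𝓝 y] e.symm where
  congr := by
    rintro g g' y ⟨e, he, hy, hg⟩ h
    exact ⟨e, he, hy, h.symm.trans hg⟩
  eventually := by
    rintro g y ⟨e, he, hy, hg⟩
    filter_upwards [e.open_target.mem_nhds hy, hg.eventually_nhds] with y' h1 h2
    exact ⟨e, he, h1, h2⟩
  comp := by
    rintro g a b y ha ⟨e, he, hy, hg⟩
    have ha0 : a ≠ 0 := norm_ne_zero_iff.mp (by rw [ha]; exact one_ne_zero)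
    refine ⟨_, haff e he a b ha0 ha, hy, ?_⟩
    have hc : ContinuousAt (fun y : ℂ => a * y + b) y := by fun_prop
    filter_upwards [hc.eventually hg] with y' h
    exact h
  smul := by
    rintro g y γ ⟨e, he, hy, hg⟩
    refine ⟨_, hsmul e he γ, hy, ?_⟩
    filter_upwards [hg] with y' h
    change γ • g y' = (γ⁻¹)⁻¹ • e.symm y'
    rw [h, inv_inv]
  continuousAt := by
    rintro g y ⟨e, he, hy, hg⟩
    exact (e.continuousAt_symm hy).congr hg.symm
  nhds_le := by
    rintro g y ⟨e, he, hy, hg⟩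
    rw [Filter.map_congr hg, hg.self_of_nhds, e.symm.map_nhds_eq hy]
  injOn := by
    rintro g y ⟨e, he, hy, hg⟩
    refine ⟨e.target ∩ {y' | g y' = e.symm y'},
      Filter.inter_mem (e.open_target.mem_nhds hy) hg, ?_⟩
    rintro y₁ ⟨h1, h1'⟩ y₂ ⟨h2, h2'⟩ h
    exact e.symm.injOn h1 h2 (h1'.symm.trans (h.trans h2'))
  unique := by
    rintro g g' y ⟨e, he, hy, hg⟩ ⟨e', he', hy', hg'⟩ hgg
    have hm : e.symm y = e'.symm y := by rw [← hg.self_of_nhds, ← hg'.self_of_nhds, hgg]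
    have hs' : e.symm y ∈ e'.source := by rw [hm]; exact e'.map_target hy'
    obtain ⟨a, ha, h⟩ := huniq e he e' he' (e.symm y) (e.map_target hy) hs'
    refine ⟨a, ha, ?_⟩
    rw [e.right_inv hy, hm, e'.right_inv hy', ← hm] at h
    have hc := e.continuousAt_symm hy
    have hlim : Filter.Tendsto (fun y' => y + a * (y' - y)) (𝓝 y) (𝓝 y) := by
      have : ContinuousAt (fun y' => y + a * (y' - y)) y := by fun_prop
      simpa [ContinuousAt] using this
    filter_upwards [hg, hlim.eventually hg', hc.eventually h, e.open_target.mem_nhds hy,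
      hc.eventually (e'.open_source.mem_nhds hs')] with y' h1 h2 h3 h4 h5
    rw [e.right_inv h4] at h3
    rw [h1, h2, ← h3, e'.left_inv h5]
  exists_flat := by
    intro p
    obtain ⟨e, he, hp⟩ := hcov p
    refine ⟨fun y => e.symm (1 * y + e p), ?_, _, haff e he 1 (e p) one_ne_zero (by simp), ?_, ?_⟩
    · simp [e.left_inv hp]
    · change 1 * 0 + e p ∈ e.target
      simpa using e.map_source hp
    · exact Filter.EventuallyEq.rfl

/-- A germ of homeomorphism of the plane whose derivative is complex linear of modulus one is the
germ of an isometry. -/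
theorem eventually_eq_of_norm_deriv_eq_one {h : ℂ → ℂ} {y : ℂ}
    (hh : ∀ᶠ y' in 𝓝 y, ∃ a : ℂ, ‖a‖ = 1 ∧ HasDerivAt h a y') :
    ∃ a : ℂ, ‖a‖ = 1 ∧ ∀ᶠ y' in 𝓝 y, h y' = h y + a * (y' - y) := by
  obtain ⟨r, hr, hball⟩ := Metric.eventually_nhds_iff_ball.mp hh
  have hnorm : ∀ y' ∈ Metric.ball y r, ‖deriv h y'‖ = 1 := fun y' hy' => by
    obtain ⟨a, ha, hd⟩ := hball y' hy'
    rw [hd.deriv, ha]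
  have hdiff : DifferentiableOn ℂ h (Metric.ball y r) := fun y' hy' => by
    obtain ⟨a, -, hd⟩ := hball y' hy'
    exact hd.differentiableAt.differentiableWithinAt
  have hy := Metric.mem_ball_self (x := y) hr
  have hconst : Set.EqOn (deriv h) (Function.const ℂ (deriv h y)) (Metric.ball y r) :=
    Complex.eqOn_of_isPreconnected_of_isMaxOn_norm (convex_ball y r).isPreconnected
      Metric.isOpen_ball (hdiff.deriv Metric.isOpen_ball) hy
      fun y' hy' => by simp only [Set.mem_ofPred_eq, Function.comp_apply, hnorm y' hy', hnorm y hy,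
        le_refl]
  refine ⟨deriv h y, hnorm y hy, ?_⟩
  filter_upwards [Metric.ball_mem_nhds y hr] with y' hy'
  have h1 : ∀ z ∈ Metric.ball y r,
      HasDerivAt (fun z => h z - deriv h y * z) 0 z := by
    intro z hz
    have h2 := (hdiff.differentiableAt (Metric.isOpen_ball.mem_nhds hz)).hasDerivAt
    rw [hconst hz] at h2
    exact (h2.sub ((hasDerivAt_id z).const_mul (deriv h y))).congr_deriv (by
      rw [mul_one]; exact sub_self _)
  have h2 := Metric.isOpen_ball.is_const_of_deriv_eq_zero (convex_ball y r).isPreconnected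
    (fun z hz => (h1 z hz).differentiableAt.differentiableWithinAt)
    (fun z hz => (h1 z hz).deriv) hy' hy
  linear_combination h2

/-! ### Flat functions on a cyclic surface -/

namespace HKQuadruple

open LieAlgebra

variable {L : Type*} [LieRing L] [LieAlgebra ℂ L] [Module.Finite ℂ L] [IsSimple ℂ L]
  (Q : HKQuadruple L)

/-- The square of the norm of the component of `x` along the root `χ`, for the Hermitian form
defined by `ρ`. -/
noncomputable def rootNormSq (χ : Q.h → ℂ) (x : L) : ℝ :=
  -reKilling L (Q.proj {χ} x) (Q.ρ (Q.proj {χ} x))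

variable {Q}

theorem rootNormSq_smul (χ : Q.h → ℂ) (c : ℂ) (x : L) :
    Q.rootNormSq χ (c • x) = ‖c‖ ^ 2 * Q.rootNormSq χ x := by
  rw [rootNormSq, rootNormSq, (Q.proj {χ}).map_smul, Q.ρ.map_smulₛₗ, reKilling_apply,
    reKilling_apply, map_smul, map_smul, LinearMap.smul_apply, smul_eq_mul, smul_eq_mul,
    ← mul_assoc, Complex.conj_mul', ← Complex.ofReal_pow, Complex.re_ofReal_mul, mul_neg]

theorem rootNormSq_pos {χ : Q.h → ℂ} {x : L} (hx : Q.proj {χ} x ≠ 0) : 0 < Q.rootNormSq χ x :=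
  neg_pos.mpr (Q.ρ_cartan _ hx)

theorem rootNormSq_torus {t : adjointGroup L} (ht : t ∈ Q.T) (χ : Q.h → ℂ) (x : L) :
    Q.rootNormSq χ (t.1 x) = Q.rootNormSq χ x := by
  rw [rootNormSq, rootNormSq, ← mem_T_proj ht, ← ht.2.1, reKilling_adjointGroup]

variable {M : Type*} [TopologicalSpace M] [ChartedSpace (EuclideanSpace ℝ (Fin 2)) M]

/-- `F` is a flat function at `m`: the component `φ` of the derivative of `f` is `dF • Ψ` for a
vector `Ψ` normalised by `N Ψ = 1`. -/
def IsFlatAt (f : M → Q.X) (N : L → ℝ) (F : M → ℂ) (m : M) : Prop :=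
  MDifferentiableAt (𝓡 2) 𝓘(ℝ, ℂ) F m ∧ ∃ Ψ : L, N Ψ = 1 ∧ ∀ u : EuclideanSpace ℝ (Fin 2),
    Q.proj Q.Z ((frame (f m)).symm (mc (f m) (tmap f m u))) = derivAt F m u • Ψ

variable {f : M → Q.X} {N : L → ℝ} {F F' : M → ℂ} {m : M}

/-- Flatness can be tested in any frame. -/
theorem isFlatAt_iff_of_frame (hN : ∀ t ∈ Q.T, ∀ v, N (t.1 v) = N v) {g : adjointGroup L}
    (hg : (g : Q.X) = f m) : IsFlatAt f N F m ↔
      MDifferentiableAt (𝓡 2) 𝓘(ℝ, ℂ) F m ∧ ∃ Ψ : L, N Ψ = 1 ∧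
        ∀ u : EuclideanSpace ℝ (Fin 2),
          Q.proj Q.Z (g.1.symm (mc (f m) (tmap f m u))) = derivAt F m u • Ψ := by
  refine and_congr_right fun _ => ?_
  obtain ⟨g', hg', hf⟩ := frame_spec (f m)
  obtain ⟨t, ht, rfl⟩ := exists_mem_T (hg.trans hg'.symm)
  have hsymm : ∀ v, g.1.symm v = t.1 ((g * t).1.symm v) := fun v =>
    (LinearEquiv.apply_symm_apply t.1 _).symm
  have hproj : ∀ v, Q.proj Q.Z (g.1.symm v) = t.1 (Q.proj Q.Z ((frame (f m)).symm v)) :=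
    fun v => by rw [hsymm, hf, mem_T_proj ht]
  constructor
  · rintro ⟨Ψ, h1, h2⟩
    exact ⟨t.1 Ψ, by rw [hN t ht, h1], fun u => by rw [hproj, h2, map_smul]⟩
  · rintro ⟨Ψ, h1, h2⟩
    refine ⟨t.1.symm Ψ, ?_, fun u => ?_⟩
    · rw [← hN t ht, LinearEquiv.apply_symm_apply, h1]
    · rw [← map_smul, ← h2, hproj, LinearEquiv.symm_apply_apply]

/-- Flatness in a moving frame along a parametrisation of the surface. -/
theorem isFlatAt_iff_param (hf : SmoothMap f) (hN : ∀ t ∈ Q.T, ∀ v, N (t.1 v) = N v)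
    {ψ : EuclideanSpace ℝ (Fin 2) → M} {y : EuclideanSpace ℝ (Fin 2)}
    (hψ : MDifferentiableAt 𝓘(ℝ, EuclideanSpace ℝ (Fin 2)) (𝓡 2) ψ y)
    (hinj : ∀ u, paramDeriv ψ y u = 0 → u = 0) {G : EuclideanSpace ℝ (Fin 2) → adjointGroup L}
    (hG : DifferentiableAt ℝ (fun y => gop (G y)) y)
    (hfG : ∀ᶠ y' in 𝓝 y, (G y' : Q.X) = f (ψ y'))
    (hF : MDifferentiableAt (𝓡 2) 𝓘(ℝ, ℂ) F (ψ y)) :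
    IsFlatAt f N F (ψ y) ↔ ∃ Ψ : L, N Ψ = 1 ∧
      ∀ w, Q.perpZ (logDer G y w) = fderiv ℝ (fun y => F (ψ y)) y w • Ψ := by
  rw [isFlatAt_iff_of_frame hN hfG.self_of_nhds, and_iff_right hF]
  refine exists_congr fun Ψ => and_congr_right fun _ => ?_
  have hmc := mc_tmap_param hf hψ hG hfG
  have hd := (hasFDerivAt_comp_param hF hψ).fderiv
  have hsurj : Function.Surjective (paramDeriv ψ y) :=
    LinearMap.surjective_of_injective (f := (paramDeriv ψ y).toLinearMap)
      ((injective_iff_map_eq_zero _).mpr hinj)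
  have hw : ∀ w, Q.proj Q.Z ((G y).1.symm (mc (f (ψ y)) (tmap f (ψ y) (paramDeriv ψ y w)))) =
      Q.perpZ (logDer G y w) := fun w => by
    rw [hmc, LinearEquiv.symm_apply_apply]; rfl
  constructor
  · intro h w
    rw [← hw, hd]
    exact h _
  · intro h u
    obtain ⟨w, rfl⟩ := hsurj u
    have h1 := h w
    rw [← hw, hd] at h1
    exact h1

theorem IsFlatAt.affine {k : ℕ} (hN : ∀ (c : ℂ) v, N (c • v) = ‖c‖ ^ k * N v)
    (hF : IsFlatAt f N F m) {a : ℂ} (ha : ‖a‖ = 1) (b : ℂ) :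
    IsFlatAt f N (fun m => a⁻¹ * (F m - b)) m := by
  obtain ⟨h1, Ψ, h2, h3⟩ := hF
  have ha0 : a ≠ 0 := norm_ne_zero_iff.mp (by rw [ha]; exact one_ne_zero)
  have hcomp : HasMFDerivAt (𝓡 2) 𝓘(ℝ, ℂ) (fun m => a⁻¹ * (F m - b)) m _ :=
    (((((hasFDerivAt_id (F m)).sub_const b).const_mul a⁻¹).hasMFDerivAt).comp m h1.hasMFDerivAt :)
  refine ⟨hcomp.mdifferentiableAt, a • Ψ, by rw [hN, ha, one_pow, one_mul, h2], fun u => ?_⟩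
  have h4 : derivAt (fun m => a⁻¹ * (F m - b)) m u = a⁻¹ * derivAt F m u :=
    congrArg (fun T : EuclideanSpace ℝ (Fin 2) →L[ℝ] ℂ => T u) hcomp.mfderiv
  rw [h4, h3, smul_smul, mul_right_comm, inv_mul_cancel₀ ha0, one_mul]

theorem IsFlatAt.injective (hf : IsCyclic f) {β : Q.h → ℂ} (hβ : Q.IsSimpleRoot β)
    (hF : IsFlatAt f N F m) {u : EuclideanSpace ℝ (Fin 2)} (hu : derivAt F m u = 0) : u = 0 := by
  obtain ⟨-, Ψ, -, h⟩ := hF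
  obtain ⟨g, hg, hfr⟩ := frame_spec (f m)
  obtain ⟨b, hb⟩ := exists_derivative hf.smooth m g
  have hφ : ∀ u : EuclideanSpace ℝ (Fin 2), (Q.projL Q.Z ∘L b) u =
      Q.proj Q.Z (g.1.symm (mc (f m) (tmap f m u))) := fun u => by
    rw [hb, LinearEquiv.symm_apply_apply]; rfl
  by_contra h0
  refine (hf.isCyclicPoint hg hφ).1.ne β hβ u h0 ?_
  rw [hφ, ← hfr, h, hu, zero_smul, map_zero]

/-- The derivatives of two flat functions differ by a rotation. -/
theorem IsFlatAt.exists_mul (hf : IsCyclic f) {β : Q.h → ℂ} (hβ : Q.IsSimpleRoot β) {k : ℕ}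
    (hk : k ≠ 0) (hN : ∀ (c : ℂ) v, N (c • v) = ‖c‖ ^ k * N v) (hF : IsFlatAt f N F m)
    (hF' : IsFlatAt f N F' m) : ∃ a : ℂ, ‖a‖ = 1 ∧ ∀ u, derivAt F' m u = a * derivAt F m u := by
  have hinj := hF.injective hf hβ (u := EuclideanSpace.single 0 1)
  obtain ⟨-, Ψ, h1, h2⟩ := hF
  obtain ⟨-, Ψ', h1', h2'⟩ := hF'
  have h3 : ∀ u, derivAt F m u • Ψ = derivAt F' m u • Ψ' := fun u => by rw [← h2, ← h2']
  have h0 : derivAt F m (EuclideanSpace.single 0 1) ≠ 0 := fun h => single_zero_ne (hinj h)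
  have hΨ' : Ψ' ≠ 0 := by
    rintro rfl
    have := hN 0 0
    rw [smul_zero, h1', norm_zero, zero_pow hk, zero_mul] at this
    exact one_ne_zero this
  obtain ⟨a, ha⟩ : ∃ a : ℂ, Ψ = a • Ψ' := by
    refine ⟨(derivAt F m (EuclideanSpace.single 0 1))⁻¹ *
      derivAt F' m (EuclideanSpace.single 0 1), ?_⟩
    rw [mul_smul, ← h3, inv_smul_smul₀ h0]
  refine ⟨a, ?_, fun u => ?_⟩
  · rw [ha, hN, h1', mul_one] at h1
    exact (pow_eq_one_iff_of_nonneg (norm_nonneg a) hk).mp h1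
  · have := h3 u
    rw [ha, smul_smul] at this
    rw [mul_comm]
    exact (smul_left_injective ℂ hΨ' this).symm

variable [IsManifold (𝓡 2) ∞ M]

theorem IsFlatAt.smul {Γ : Type*} [Group Γ] [MulAction Γ M] (hΓ : IsDeckGroup Γ M)
    {δ : Γ →* adjointGroup L} (hf : IsCyclic f) (hfδ : ∀ (γ : Γ) (m : M), f (γ • m) = δ γ • f m)
    (hN : ∀ t ∈ Q.T, ∀ v, N (t.1 v) = N v) (γ : Γ) (hF : IsFlatAt f N F m) :
    IsFlatAt f N (fun m => F (γ⁻¹ • m)) (γ • m) := by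
  obtain ⟨G, hG⟩ := exists_frame hf.smooth m
  set c := extChartAt (𝓡 2) m with hc
  set y := c m with hy
  have hcy : c.symm y = m := extChartAt_to_inv m
  obtain ⟨hyt, -, hyd⟩ := hG.self_of_nhds
  have hGd : DifferentiableAt ℝ (fun y => gop (G y)) y := hyd.differentiableAt (by simp)
  have hmd : MDifferentiableAt 𝓘(ℝ, EuclideanSpace ℝ (Fin 2)) (𝓡 2) c.symm y :=
    mdifferentiableAt_chart_symm m hyt
  have hsm : ∀ (γ : Γ) (m : M), MDifferentiableAt (𝓡 2) (𝓡 2) (fun m : M => γ • m) m :=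
    fun γ m => (hΓ.smooth γ m).mdifferentiableAt (by simp)
  have hψ : MDifferentiableAt 𝓘(ℝ, EuclideanSpace ℝ (Fin 2)) (𝓡 2)
      (fun y => γ • c.symm y) y := (hsm γ _).comp y hmd
  have hFm : MDifferentiableAt (𝓡 2) 𝓘(ℝ, ℂ) F (c.symm y) := by rw [hcy]; exact hF.1
  have h1 := (isFlatAt_iff_param hf.smooth hN hmd
    (fun u hu => paramDeriv_chart_symm_injective m hyt hu) hGd (hG.mono fun y hy => hy.2.1)
    hFm).mp (by rw [hcy]; exact hF)
  have hcomp : (fun y => F (γ⁻¹ • γ • c.symm y)) = fun y => F (c.symm y) := by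
    funext y; rw [inv_smul_smul]
  have hFγ : MDifferentiableAt (𝓡 2) 𝓘(ℝ, ℂ) (fun m => F (γ⁻¹ • m)) (γ • c.symm y) := by
    refine MDifferentiableAt.comp (g := F) (γ • c.symm y) ?_ (hsm γ⁻¹ _)
    rw [inv_smul_smul]; exact hFm
  have hgop : (fun y => gop (δ γ * G y)) = fun y => gop (δ γ) ∘L gop (G y) := rfl
  have hGd' : DifferentiableAt ℝ (fun y => gop (δ γ * G y)) y := by
    rw [hgop]
    exact (differentiableAt_const _).clm_comp hGd
  have hlog : logDer (fun y => δ γ * G y) y = logDer G y := by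
    ext w
    refine logDer_eq fun v => ?_
    rw [fderiv_gop_apply hGd']
    have h2 : HasFDerivAt (fun y => (δ γ * G y).1 v)
        (gop (δ γ) ∘L fderiv ℝ (fun y => (G y).1 v) y) y := by
      have h3 : DifferentiableAt ℝ (fun y => (G y).1 v) y :=
        hGd.clm_apply (differentiableAt_const v)
      exact (gop (δ γ)).hasFDerivAt.comp y h3.hasFDerivAt
    rw [h2.fderiv]
    change (δ γ).1 (fderiv ℝ (fun y => (G y).1 v) y w) = (δ γ).1 ((G y).1 _)
    rw [← fderiv_gop_apply hGd, logDer_spec hGd]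
  rw [← hcy]
  refine (isFlatAt_iff_param hf.smooth hN (ψ := fun y => γ • c.symm y) hψ (fun u hu => ?_) hGd' ?_
    hFγ).mpr ?_
  · refine paramDeriv_chart_symm_injective m hyt ?_
    have h3 : HasMFDerivAt 𝓘(ℝ, EuclideanSpace ℝ (Fin 2)) (𝓡 2)
      (fun y => γ⁻¹ • γ • c.symm y) y _ := ((hsm γ⁻¹ _).hasMFDerivAt.comp y hψ.hasMFDerivAt :)
    have h4 : (fun y => γ⁻¹ • γ • c.symm y) = c.symm := by funext y; rw [inv_smul_smul]
    rw [h4] at h3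
    have h5 := congrArg (fun T : EuclideanSpace ℝ (Fin 2) →L[ℝ] EuclideanSpace ℝ (Fin 2) => T u)
      h3.mfderiv
    have h6 : ∀ T : EuclideanSpace ℝ (Fin 2) →L[ℝ] EuclideanSpace ℝ (Fin 2),
        T (paramDeriv (fun y => γ • c.symm y) y u) = 0 := fun T => by rw [hu, map_zero]
    exact h5.trans (h6 _)
  · filter_upwards [hG] with y' hy'
    rw [hfδ, ← hy'.2.1]; rfl
  · rw [hlog, hcomp]
    exact h1

end HKQuadruple

/-! ### Complex valued forms on the plane -/

/-- The form `θ (dx + z dy)`. -/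
noncomputable def conformalForm (θ z : ℂ) : EuclideanSpace ℝ (Fin 2) →L[ℝ] ℂ :=
  ((EuclideanSpace.proj 0 : EuclideanSpace ℝ (Fin 2) →L[ℝ] ℝ).smulRight θ) +
    (EuclideanSpace.proj 1 : EuclideanSpace ℝ (Fin 2) →L[ℝ] ℝ).smulRight (z * θ)

theorem conformalForm_apply (θ z : ℂ) (w : EuclideanSpace ℝ (Fin 2)) :
    conformalForm θ z w = w 0 • θ + w 1 • (z * θ) := rfl

theorem eq_smul_single (w : EuclideanSpace ℝ (Fin 2)) :
    w = w 0 • EuclideanSpace.single 0 1 + w 1 • EuclideanSpace.single 1 1 := by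
  ext i; fin_cases i <;> simp

theorem conformalForm_eq_zero {θ z : ℂ} (hθ : θ ≠ 0) (hz : z.im ≠ 0)
    {w : EuclideanSpace ℝ (Fin 2)} (h : conformalForm θ z w = 0) : w = 0 := by
  have h1 : ((w 0 : ℂ) + w 1 * z) * θ = 0 := by
    rw [conformalForm_apply, Complex.real_smul, Complex.real_smul] at h
    linear_combination h
  have h2 := (mul_eq_zero.mp h1).resolve_right hθ
  have h3 : w 1 = 0 := by
    have := congrArg Complex.im h2
    simpa [hz] using this
  have h4 : w 0 = 0 := by
    rw [h3] at h2
    simpa using h2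
  ext i; fin_cases i <;> simp [h3, h4]

/-- An injective real linear map from `ℝ²` to `ℂ` is an isomorphism. -/
theorem exists_equiv_of_injective {T : EuclideanSpace ℝ (Fin 2) →L[ℝ] ℂ}
    (h : ∀ u, T u = 0 → u = 0) :
    ∃ e : EuclideanSpace ℝ (Fin 2) ≃L[ℝ] ℂ, (e : EuclideanSpace ℝ (Fin 2) →L[ℝ] ℂ) = T := by
  have hfr : Module.finrank ℝ (EuclideanSpace ℝ (Fin 2)) = Module.finrank ℝ ℂ := by
    rw [finrank_euclideanSpace_fin, Complex.finrank_real_complex]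
  refine ⟨(LinearEquiv.ofInjectiveOfFinrankEq T.toLinearMap
    ((injective_iff_map_eq_zero _).mpr h) hfr).toContinuousLinearEquiv, ?_⟩
  ext1 u
  rfl

/-- A closed form `θ (dx + z dy)` is locally the differential of a local diffeomorphism. -/
theorem exists_primitive {θ z : EuclideanSpace ℝ (Fin 2) → ℂ} {y₀ : EuclideanSpace ℝ (Fin 2)}
    (h : ∀ᶠ y in 𝓝 y₀, DifferentiableAt ℝ θ y ∧ DifferentiableAt ℝ z y ∧
      fderiv ℝ (fun y => z y * θ y) y (EuclideanSpace.single 0 1) =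
        fderiv ℝ θ y (EuclideanSpace.single 1 1)) (hθ : θ y₀ ≠ 0) (hz : (z y₀).im ≠ 0) :
    ∃ F : OpenPartialHomeomorph (EuclideanSpace ℝ (Fin 2)) ℂ, y₀ ∈ F.source ∧
      ∀ᶠ y in 𝓝 y₀, HasFDerivAt F (conformalForm (θ y) (z y)) y := by
  set W : EuclideanSpace ℝ (Fin 2) → EuclideanSpace ℝ (Fin 2) →L[ℝ] ℂ :=
    fun y => conformalForm (θ y) (z y) with hW
  have hWd : ∀ {y}, DifferentiableAt ℝ θ y → DifferentiableAt ℝ z y →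
      HasFDerivAt W ((ContinuousLinearMap.smulRightL ℝ _ ℂ
          (EuclideanSpace.proj 0 : EuclideanSpace ℝ (Fin 2) →L[ℝ] ℝ)) ∘L fderiv ℝ θ y +
        (ContinuousLinearMap.smulRightL ℝ _ ℂ
          (EuclideanSpace.proj 1 : EuclideanSpace ℝ (Fin 2) →L[ℝ] ℝ)) ∘L
            fderiv ℝ (fun y => z y * θ y) y) y := fun {y} h1 h2 =>
    (((ContinuousLinearMap.smulRightL ℝ _ ℂ
        (EuclideanSpace.proj 0 : EuclideanSpace ℝ (Fin 2) →L[ℝ] ℝ)).hasFDerivAt.comp y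
          h1.hasFDerivAt).add
      ((ContinuousLinearMap.smulRightL ℝ _ ℂ
        (EuclideanSpace.proj 1 : EuclideanSpace ℝ (Fin 2) →L[ℝ] ℝ)).hasFDerivAt.comp y
          (h2.mul h1).hasFDerivAt) :)
  obtain ⟨r, hr, hball⟩ := Metric.eventually_nhds_iff_ball.mp h
  obtain ⟨F, hF⟩ := (convex_ball y₀ r).exists_forall_hasFDerivAt_of_fderiv_symmetric
    Metric.isOpen_ball
    (show DifferentiableOn ℝ W _ from fun y hy =>
      (hWd (hball y hy).1 (hball y hy).2.1).differentiableAt.differentiableWithinAt)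
    (fun y hy u v => by
      obtain ⟨h1, h2, h3⟩ := hball y hy
      rw [(hWd h1 h2).fderiv]
      have h4 : ∀ (T : EuclideanSpace ℝ (Fin 2) →L[ℝ] ℂ) (u : EuclideanSpace ℝ (Fin 2)),
          T u = u 0 * T (EuclideanSpace.single 0 1) + u 1 * T (EuclideanSpace.single 1 1) := by
        intro T u
        conv_lhs => rw [eq_smul_single u]
        rw [map_add, map_smul, map_smul, Complex.real_smul, Complex.real_smul]
      have h5 : ∀ u v : EuclideanSpace ℝ (Fin 2), v 0 • fderiv ℝ θ y u +
          v 1 • fderiv ℝ (fun y => z y * θ y) y u = u 0 • fderiv ℝ θ y v +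
          u 1 • fderiv ℝ (fun y => z y * θ y) y v := by
        intro u v
        rw [h4 (fderiv ℝ θ y) u, h4 (fderiv ℝ θ y) v, h4 (fderiv ℝ (fun y => z y * θ y) y) u,
          h4 (fderiv ℝ (fun y => z y * θ y) y) v, h3]
        simp only [Complex.real_smul]
        ring
      exact h5 u v)
  have hcont : ContinuousAt W y₀ :=
    (hWd h.self_of_nhds.1 h.self_of_nhds.2.1).continuousAt
  obtain ⟨e, he⟩ := exists_equiv_of_injective fun u hu => conformalForm_eq_zero hθ hz hu
  have hstrict : HasStrictFDerivAt F (e : EuclideanSpace ℝ (Fin 2) →L[ℝ] ℂ) y₀ := by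
    rw [he]
    exact hasStrictFDerivAt_of_hasFDerivAt_of_continuousAt
      (Metric.eventually_nhds_iff_ball.mpr ⟨r, hr, hF⟩) hcont
  exact ⟨hstrict.toOpenPartialHomeomorph F, hstrict.mem_toOpenPartialHomeomorph_source,
    Metric.eventually_nhds_iff_ball.mpr ⟨r, hr, hF⟩⟩

namespace HKQuadruple

open LieAlgebra

variable {L : Type*} [LieRing L] [LieAlgebra ℂ L] [Module.Finite ℂ L] [IsSimple ℂ L]
  {Q : HKQuadruple L}

/-! ### Transition functions of flat charts -/

section Transition

variable {M : Type*} [TopologicalSpace M] [ChartedSpace (EuclideanSpace ℝ (Fin 2)) M]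
  {f : M → Q.X} {N : L → ℝ}

/-- The changes of flat charts are isometries: their derivatives are complex linear of modulus
one. -/
theorem eventually_eq_of_isFlatAt (hf : IsCyclic f) {β : Q.h → ℂ} (hβ : Q.IsSimpleRoot β) {k : ℕ}
    (hk : k ≠ 0) (hN : ∀ (c : ℂ) v, N (c • v) = ‖c‖ ^ k * N v)
    {e e' : OpenPartialHomeomorph M ℂ} (he : ∀ m ∈ e.source, IsFlatAt f N e m)
    (he' : ∀ m ∈ e'.source, IsFlatAt f N e' m) {m : M} (hm : m ∈ e.source) (hm' : m ∈ e'.source) :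
    ∃ a : ℂ, ‖a‖ = 1 ∧ ∀ᶠ m' in 𝓝 m, e' m' = e' m + a * (e m' - e m) := by
  have key : ∀ p ∈ e.source, p ∈ e'.source →
      ∃ a : ℂ, ‖a‖ = 1 ∧ HasDerivAt (fun y => e' (e.symm y)) a (e p) := by
    intro p hp hp'
    obtain ⟨a, ha, hmul⟩ := (he p hp).exists_mul hf hβ hk hN (he' p hp')
    refine ⟨a, ha, ?_⟩
    set c := extChartAt (𝓡 2) p with hc
    obtain ⟨T, hT⟩ := exists_equiv_of_injective fun u hu => (he p hp).injective hf hβ hu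
    have hsymm : e.symm (e p) = p := e.left_inv hp
    have hcs : ContinuousAt e.symm (e p) := e.continuousAt_symm (e.map_source hp)
    have hcont : ContinuousAt (fun y => c (e.symm y)) (e p) :=
      ContinuousAt.comp (g := c) (by rw [hsymm]; exact continuousAt_extChartAt p) hcs
    have hsrc : ∀ᶠ y in 𝓝 (e p), c.symm (c (e.symm y)) = e.symm y := by
      have h1 : c.source ∈ 𝓝 (e.symm (e p)) := by
        rw [hsymm]; exact extChartAt_source_mem_nhds p
      filter_upwards [hcs.eventually h1] with y hy using c.left_inv hy
    have h1 : HasFDerivAt (fun y => c (e.symm y)) (T.symm : ℂ →L[ℝ] EuclideanSpace ℝ (Fin 2))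
        (e p) := by
      refine HasFDerivAt.of_local_left_inverse (f := e ∘ c.symm) hcont ?_ ?_
      · rw [hT]
        change HasFDerivAt _ _ (c (e.symm (e p)))
        rw [hsymm]
        exact hasFDerivAt_comp_chart_center (he p hp).1
      · filter_upwards [hsrc, e.open_target.mem_nhds (e.map_source hp)] with y h2 h3
        rw [Function.comp_apply, h2, e.right_inv h3]
    have h2 : HasFDerivAt (e' ∘ c.symm) (derivAt e' p) (c (e.symm (e p))) := by
      rw [hsymm]
      exact hasFDerivAt_comp_chart_center (he' p hp').1
    have h3 : HasFDerivAt (fun y => e' (e.symm y))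
        (derivAt e' p ∘L (T.symm : ℂ →L[ℝ] EuclideanSpace ℝ (Fin 2))) (e p) := by
      refine (h2.comp (e p) h1).congr_of_eventuallyEq ?_
      filter_upwards [hsrc] with y hy
      change _ = e' (c.symm (c (e.symm y)))
      rw [hy]
    rw [hasDerivAt_iff_hasFDerivAt]
    refine hasFDerivAt_of_restrictScalars ℝ h3 ?_
    ext1 v
    change v * a = derivAt e' p (T.symm v)
    rw [hmul, ← hT, mul_comm]
    congr 1
    exact (T.apply_symm_apply v).symm
  have hsymm : e.symm (e m) = m := e.left_inv hm
  obtain ⟨a, ha, h⟩ := eventually_eq_of_norm_deriv_eq_one (h := fun y => e' (e.symm y))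
    (y := e m) (by
      have hcs : ContinuousAt e.symm (e m) := e.continuousAt_symm (e.map_source hm)
      filter_upwards [e.open_target.mem_nhds (e.map_source hm), hcs.eventually
        (e'.open_source.mem_nhds (by rw [hsymm]; exact hm'))] with y h1 h2
      have := key (e.symm y) (e.map_target h1) h2
      rwa [e.right_inv h1] at this)
  refine ⟨a, ha, ?_⟩
  filter_upwards [(e.continuousAt hm).eventually h, e.open_source.mem_nhds hm] with m' h1 h2
  rwa [e.left_inv h2, hsymm] at h1

end Transition

/-! ### Components of a cyclic surface along the roots of `Z` -/

variable {A φ : EuclideanSpace ℝ (Fin 2) → EuclideanSpace ℝ (Fin 2) →L[ℝ] L}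
  {y₀ : EuclideanSpace ℝ (Fin 2)}

/-- The equation satisfied by the component of `φ` along a root of `Z`, written as the multiple
`c` of its value at a point. -/
theorem exists_component (h : ∀ᶠ y in 𝓝 y₀, Q.IsCyclicModel A φ y)
    {z : EuclideanSpace ℝ (Fin 2) → ℂ} (hz : ∀ᶠ y in 𝓝 y₀,
      φ y (EuclideanSpace.single 1 1) = z y • φ y (EuclideanSpace.single 0 1)) {χ : Q.h → ℂ}
    (hχ : χ ∈ Q.Z) (h0 : Q.proj {χ} (φ y₀ (EuclideanSpace.single 0 1)) ≠ 0) :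
    ∃ c : EuclideanSpace ℝ (Fin 2) → ℂ, c y₀ = 1 ∧ ∀ᶠ y in 𝓝 y₀, DifferentiableAt ℝ c y ∧
      Q.rootNormSq χ (φ y (EuclideanSpace.single 0 1)) =
        ‖c y‖ ^ 2 * Q.rootNormSq χ (φ y₀ (EuclideanSpace.single 0 1)) ∧
      ∀ a₁ a₂ : Q.h,
        (a₁ : L) = A y (EuclideanSpace.single 0 1) - (φ y (EuclideanSpace.single 0 1) -
          Q.ρ (φ y (EuclideanSpace.single 0 1))) →
        (a₂ : L) = A y (EuclideanSpace.single 1 1) - (φ y (EuclideanSpace.single 1 1) -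
          Q.ρ (φ y (EuclideanSpace.single 1 1))) →
        fderiv ℝ (fun y => z y * c y) y (EuclideanSpace.single 0 1) -
          fderiv ℝ c y (EuclideanSpace.single 1 1) + χ a₁ * (z y * c y) - χ a₂ * c y = 0 := by
  set e₁ : EuclideanSpace ℝ (Fin 2) := EuclideanSpace.single 0 1 with he₁
  set e₂ : EuclideanSpace ℝ (Fin 2) := EuclideanSpace.single 1 1 with he₂
  set x := Q.proj {χ} (φ y₀ e₁) with hx
  have hxm : x ∈ rootSpace Q.h χ := Q.mem_weightSum_singleton.mp (Q.proj_mem _ _)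
  obtain ⟨l', hl'⟩ := SeparatingDual.exists_ne_zero (R := ℂ) h0
  set l : L →L[ℂ] ℂ := (l' x)⁻¹ • l' with hl
  have hlx : l x = 1 := inv_mul_cancel₀ hl'
  let P : L →L[ℝ] ℂ := (l.restrictScalars ℝ) ∘L Q.projL {χ}
  have hP : ∀ v, Q.proj {χ} v = P v • x := by
    intro v
    obtain ⟨c, hc⟩ := Q.exists_smul_eq (Q.z_subset_roots hχ) hxm h0
      (Q.mem_weightSum_singleton.mp (Q.proj_mem {χ} v))
    have : P v = c := by
      change l (Q.proj {χ} v) = c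
      rw [← hc, map_smul, hlx, smul_eq_mul, mul_one]
    rw [this, hc]
  have hPl : ∀ (a : Q.h) (v : L), P ⁅(a : L), v⁆ = χ a * P v := by
    intro a v
    change l (Q.proj {χ} _) = χ a * l (Q.proj {χ} v)
    rw [Q.proj_lie_h a.2, Q.lie_eq_smul (Q.mem_weightSum_singleton.mp (Q.proj_mem {χ} v)),
      map_smul, smul_eq_mul]
  have hPs : ∀ (a : ℂ) (v : L), P (a • v) = a * P v := by
    intro a v
    change l (Q.proj {χ} _) = a * l (Q.proj {χ} v)
    rw [map_smul, map_smul, smul_eq_mul]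
  have hd : ∀ {y}, Q.IsCyclicModel A φ y → ∀ w, HasFDerivAt (fun y => P (φ y w))
      (P ∘L (fderiv ℝ φ y).flip w) y := by
    intro y hy w
    have h1 := (hy.contDiffAt_φ.differentiableAt two_ne_zero).hasFDerivAt
    have h2 := h1.clm_apply (hasFDerivAt_const w y)
    refine (P.hasFDerivAt.comp y h2).congr_fderiv ?_
    ext1 v
    simp
  refine ⟨fun y => P (φ y e₁), hlx, ?_⟩
  filter_upwards [h, hz.eventually_nhds] with y hy hzy
  refine ⟨(hd hy e₁).differentiableAt, ?_, fun a₁ a₂ h1 h2 => ?_⟩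
  · have h3 : Q.proj {χ} (φ y e₁) = Q.proj {χ} (P (φ y e₁) • φ y₀ e₁) := by
      rw [hP, map_smul]
    rw [← rootNormSq_smul, rootNormSq, h3, rootNormSq]
  · have h3 : fderiv ℝ (fun y => z y * P (φ y e₁)) y = P ∘L (fderiv ℝ φ y).flip e₂ := by
      refine ((hd hy e₂).congr_of_eventuallyEq ?_).fderiv
      filter_upwards [hzy] with y' hy'
      rw [hy', hPs]
    have h4 := congrArg P (hy.structure_eq e₁ e₂)
    rw [← h1, ← h2, map_sub, map_add, map_sub, hPl, hPl, map_zero, hzy.self_of_nhds, hPs] at h4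
    rw [h3, (hd hy e₁).fderiv]
    exact h4

end HKQuadruple

namespace HKQuadruple

open LieAlgebra

variable {L : Type*} [LieRing L] [LieAlgebra ℂ L] [Module.Finite ℂ L] [IsSimple ℂ L]
  {Q : HKQuadruple L}

/-! ### The flat structure of a cyclic surface -/

/-- The relation between the roots of `Z`: the longest root is a sum of simple roots. -/
theorem exists_sum_eq_zero (Q : HKQuadruple L) {η : Q.h → ℂ} (hη : Q.IsLongestRoot η) :
    ∃ (n : ℕ) (χ : Fin n → (Q.h → ℂ)), n ≠ 0 ∧
      (∀ i, χ i = η ∨ Q.IsSimpleRoot (-χ i)) ∧ ∑ i, χ i = 0 := by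
  obtain ⟨k, hk⟩ := Q.exists_eq_sum_nat hη.1
  let ι := Option (Σ i : Q.base.support, Fin (k i))
  let χ : ι → (Q.h → ℂ) := fun j => j.elim η fun p =>
    -⇑((p.1 : Q.h.root) : LieModule.Weight ℂ Q.h L)
  refine ⟨Fintype.card ι, χ ∘ (Fintype.equivFin ι).symm, Fintype.card_ne_zero, fun i => ?_, ?_⟩
  · change χ ((Fintype.equivFin ι).symm i) = η ∨ Q.IsSimpleRoot (-χ ((Fintype.equivFin ι).symm i))
    rcases (Fintype.equivFin ι).symm i with _ | p
    · exact Or.inl rfl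
    · right
      change Q.IsSimpleRoot (- -⇑((p.1 : Q.h.root) : LieModule.Weight ℂ Q.h L))
      rw [neg_neg]
      exact Q.mem_base_iff.mp p.1.2
  · refine (Equiv.sum_comp (Fintype.equivFin ι).symm χ).trans ?_
    rw [Fintype.sum_option, Fintype.sum_sigma]
    change η + ∑ i : Q.base.support, ∑ _j : Fin (k i),
      -⇑((i : Q.h.root) : LieModule.Weight ℂ Q.h L) = 0
    simp only [Finset.sum_const, Finset.card_univ, Fintype.card_fin, smul_neg,
      Finset.sum_neg_distrib]
    rw [← hk, add_neg_cancel]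

/-- The product of the squares of the norms of the components along a family of roots. -/
noncomputable def prodNormSq {n : ℕ} (χ : Fin n → (Q.h → ℂ)) (x : L) : ℝ :=
  ∏ i, Q.rootNormSq (χ i) x

theorem prodNormSq_smul {n : ℕ} (χ : Fin n → (Q.h → ℂ)) (c : ℂ) (x : L) :
    prodNormSq χ (c • x) = ‖c‖ ^ (2 * n) * prodNormSq χ x := by
  simp only [prodNormSq, rootNormSq_smul, Finset.prod_mul_distrib, Finset.prod_const,
    Finset.card_univ, Fintype.card_fin, pow_mul]

theorem prodNormSq_torus {n : ℕ} (χ : Fin n → (Q.h → ℂ)) {t : adjointGroup L} (ht : t ∈ Q.T)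
    (x : L) : prodNormSq χ (t.1 x) = prodNormSq χ x := by
  simp only [prodNormSq, rootNormSq_torus ht]

variable {A φ : EuclideanSpace ℝ (Fin 2) → EuclideanSpace ℝ (Fin 2) →L[ℝ] L}
  {y₀ : EuclideanSpace ℝ (Fin 2)}

/-- The closed form which defines the flat structure: a root of the product of the components of
`φ` along roots with sum zero. The connection does not contribute, because of the relation between
the roots. -/
theorem exists_closed_form (h : ∀ᶠ y in 𝓝 y₀, Q.IsCyclicModel A φ y)
    {z : EuclideanSpace ℝ (Fin 2) → ℂ} (hz : ∀ᶠ y in 𝓝 y₀, DifferentiableAt ℝ z y ∧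
      φ y (EuclideanSpace.single 1 1) = z y • φ y (EuclideanSpace.single 0 1)) {n : ℕ}
    (hn : n ≠ 0) {χ : Fin n → (Q.h → ℂ)} (hχ : ∀ i, χ i ∈ Q.Z) (hsum : ∑ i, χ i = 0)
    (h0 : ∀ i, Q.proj {χ i} (φ y₀ (EuclideanSpace.single 0 1)) ≠ 0) :
    ∃ θ : EuclideanSpace ℝ (Fin 2) → ℂ, ∀ᶠ y in 𝓝 y₀, θ y ≠ 0 ∧ DifferentiableAt ℝ θ y ∧
      fderiv ℝ (fun y => z y * θ y) y (EuclideanSpace.single 0 1) =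
        fderiv ℝ θ y (EuclideanSpace.single 1 1) ∧
      prodNormSq χ (φ y (EuclideanSpace.single 0 1)) = ‖θ y‖ ^ (2 * n) := by
  set e₁ : EuclideanSpace ℝ (Fin 2) := EuclideanSpace.single 0 1 with he₁
  set e₂ : EuclideanSpace ℝ (Fin 2) := EuclideanSpace.single 1 1 with he₂
  have hnC : (n : ℂ) ≠ 0 := by exact_mod_cast hn
  choose c hc1 hc using fun i => exists_component h (hz.mono fun y hy => hy.2) (hχ i) (h0 i)
  set N₀ := prodNormSq χ (φ y₀ e₁) with hN₀
  have hN₀pos : 0 < N₀ := Finset.prod_pos fun i _ => rootNormSq_pos (h0 i)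
  obtain ⟨C, hC0, hC⟩ : ∃ C : ℝ, 0 < C ∧ C ^ (2 * n) = N₀ :=
    ⟨N₀ ^ (((2 * n : ℕ) : ℝ)⁻¹), by positivity,
      Real.rpow_inv_natCast_pow hN₀pos.le (by omega)⟩
  let Λ : EuclideanSpace ℝ (Fin 2) → ℂ := fun y => ∑ i, Complex.log (c i y)
  refine ⟨fun y => C * Complex.exp ((n : ℂ)⁻¹ * Λ y), ?_⟩
  have hslit : ∀ᶠ y in 𝓝 y₀, ∀ i, c i y ∈ Complex.slitPlane := by
    rw [Filter.eventually_all]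
    intro i
    refine (hc i).self_of_nhds.1.continuousAt.eventually
      (Complex.isOpen_slitPlane.mem_nhds ?_)
    rw [hc1]
    exact Complex.one_mem_slitPlane
  filter_upwards [h, hz, hslit, Filter.eventually_all.mpr hc] with y hy ⟨hzd, _⟩ hys hyc
  have hne : ∀ i, c i y ≠ 0 := fun i => Complex.slitPlane_ne_zero (hys i)
  have hΛ : HasFDerivAt Λ (∑ i, (c i y)⁻¹ • fderiv ℝ (c i) y) y := by
    have : HasFDerivAt (fun y => ∑ i, Complex.log (c i y))
        (∑ i, (c i y)⁻¹ • fderiv ℝ (c i) y) y :=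
      HasFDerivAt.fun_sum fun i _ =>
        (Complex.hasDerivAt_log (hys i)).comp_hasFDerivAt y (hyc i).1.hasFDerivAt
    exact this
  have hθ : HasFDerivAt (fun y => (C : ℂ) * Complex.exp ((n : ℂ)⁻¹ * Λ y))
      (((C : ℂ) * Complex.exp ((n : ℂ)⁻¹ * Λ y)) • ((n : ℂ)⁻¹ •
        ∑ i, (c i y)⁻¹ • fderiv ℝ (c i) y)) y := by
    have := ((hΛ.const_mul (n : ℂ)⁻¹).cexp).const_mul (C : ℂ)
    rwa [smul_smul] at this
  set θ := (C : ℂ) * Complex.exp ((n : ℂ)⁻¹ * Λ y) with hθy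
  have hθ0 : θ ≠ 0 := mul_ne_zero (by exact_mod_cast hC0.ne') (Complex.exp_ne_zero _)
  refine ⟨hθ0, hθ.differentiableAt, ?_, ?_⟩
  · have hzθ : HasFDerivAt (fun y => z y * ((C : ℂ) * Complex.exp ((n : ℂ)⁻¹ * Λ y)))
        (z y • (θ • ((n : ℂ)⁻¹ • ∑ i, (c i y)⁻¹ • fderiv ℝ (c i) y)) + θ • fderiv ℝ z y) y :=
      hzd.hasFDerivAt.mul hθ
    rw [hθ.fderiv, hzθ.fderiv]
    -- the equations of the components, divided by the components and summed
    obtain ⟨a₁, ha₁⟩ : ∃ a : Q.h, (a : L) = A y e₁ - (φ y e₁ - Q.ρ (φ y e₁)) :=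
      ⟨⟨_, (hy.sub_mem e₁).1⟩, rfl⟩
    obtain ⟨a₂, ha₂⟩ : ∃ a : Q.h, (a : L) = A y e₂ - (φ y e₂ - Q.ρ (φ y e₂)) :=
      ⟨⟨_, (hy.sub_mem e₂).1⟩, rfl⟩
    have h1 : ∀ i, fderiv ℝ z y e₁ + z y * ((c i y)⁻¹ * fderiv ℝ (c i) y e₁) -
        (c i y)⁻¹ * fderiv ℝ (c i) y e₂ + χ i a₁ * z y - χ i a₂ = 0 := by
      intro i
      have h2 := (hyc i).2.2 a₁ a₂ ha₁ ha₂
      rw [(hzd.hasFDerivAt.fun_mul (hyc i).1.hasFDerivAt).fderiv] at h2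
      simp only [add_apply, smul_apply, smul_eq_mul] at h2
      have h3 := hne i
      field_simp
      linear_combination h2
    have h2 : ∑ i, (fderiv ℝ z y e₁ + z y * ((c i y)⁻¹ * fderiv ℝ (c i) y e₁) -
        (c i y)⁻¹ * fderiv ℝ (c i) y e₂ + χ i a₁ * z y - χ i a₂) = 0 :=
      Finset.sum_eq_zero fun i _ => h1 i
    have hs : ∀ a : Q.h, ∑ i, χ i a = 0 := fun a => by
      rw [← Finset.sum_apply, hsum, Pi.zero_apply]
    rw [Finset.sum_sub_distrib, Finset.sum_add_distrib, Finset.sum_sub_distrib,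
      Finset.sum_add_distrib, ← Finset.sum_mul, hs, hs, ← Finset.mul_sum, Finset.sum_const,
      Finset.card_univ, Fintype.card_fin, nsmul_eq_mul] at h2
    simp only [add_apply, smul_apply, smul_eq_mul, sum_apply]
    generalize ∑ i, (c i y)⁻¹ * fderiv ℝ (c i) y e₁ = S₁ at h2 ⊢
    generalize ∑ i, (c i y)⁻¹ * fderiv ℝ (c i) y e₂ = S₂ at h2 ⊢
    field_simp
    linear_combination h2
  · have h1 : Complex.exp ((n : ℂ)⁻¹ * Λ y) ^ n = ∏ i, c i y := by
      rw [← Complex.exp_nat_mul, mul_inv_cancel_left₀ hnC, Complex.exp_sum]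
      exact Finset.prod_congr rfl fun i _ => Complex.exp_log (hne i)
    have h2 : ‖θ‖ ^ (2 * n) = N₀ * ‖∏ i, c i y‖ ^ 2 := by
      rw [hθy, norm_mul, mul_pow, Complex.norm_real, Real.norm_of_nonneg hC0.le, hC, mul_comm 2 n,
        pow_mul, ← norm_pow, h1]
    rw [h2, norm_prod, ← Finset.prod_pow, hN₀, prodNormSq, prodNormSq, ← Finset.prod_mul_distrib]
    exact Finset.prod_congr rfl fun i _ => by rw [(hyc i).2.1, mul_comm]

variable {M : Type*} [TopologicalSpace M] [ChartedSpace (EuclideanSpace ℝ (Fin 2)) M]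
  [IsManifold (𝓡 2) ∞ M] {f : M → Q.X}

/-- There are flat charts near every point where the components of `φ` along the family of roots do
not vanish. -/
theorem exists_isFlatAt (hf : IsCyclic f) {β : Q.h → ℂ} (hβ : Q.IsSimpleRoot β) {n : ℕ}
    (hn : n ≠ 0) {χ : Fin n → (Q.h → ℂ)} (hχ : ∀ i, χ i ∈ Q.Z) (hsum : ∑ i, χ i = 0) (m : M)
    (h0 : ∀ i, ∃ u, Q.omegaRoot (χ i) (f m) (tmap f m u) ≠ 0) :
    ∃ e : OpenPartialHomeomorph M ℂ, m ∈ e.source ∧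
      ∀ m' ∈ e.source, IsFlatAt f (prodNormSq χ) e m' := by
  obtain ⟨G, hG⟩ := exists_cyclicModel hf m
  set y₀ := extChartAt (𝓡 2) m m with hy₀
  have hcy : (extChartAt (𝓡 2) m).symm y₀ = m := extChartAt_to_inv m
  set φ : EuclideanSpace ℝ (Fin 2) → EuclideanSpace ℝ (Fin 2) →L[ℝ] L :=
    fun y => Q.perpZ ∘L logDer G y with hφ
  have hmodel : ∀ᶠ y in 𝓝 y₀, Q.IsCyclicModel (logDer G) φ y :=
    hG.mono fun y hy => hy.2.2.2.2.2
  obtain ⟨z, hz⟩ := exists_ratio hmodel hβ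
  have hz0 := hz.self_of_nhds
  have hne : ∀ i, Q.proj {χ i} (φ y₀ (EuclideanSpace.single 0 1)) ≠ 0 := by
    intro i h
    obtain ⟨u, hu⟩ := h0 i
    obtain ⟨hyt, hyG, hyd, hmc, hperp, -⟩ := hG.self_of_nhds
    obtain ⟨w, rfl⟩ : ∃ w, paramDeriv (extChartAt (𝓡 2) m).symm y₀ w = u :=
      LinearMap.surjective_of_injective
        (f := (paramDeriv (extChartAt (𝓡 2) m).symm y₀).toLinearMap)
        ((injective_iff_map_eq_zero _).mpr fun v hv =>
          paramDeriv_chart_symm_injective m hyt hv) u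
    refine hu ?_
    have hmc' := hmc w
    rw [hcy] at hmc' hyG
    rw [omegaRoot, mcPart_eq hyG, hmc', LinearEquiv.symm_apply_apply,
      LinearEquiv.map_eq_zero_iff]
    have h1 : Q.proj {χ i} (Q.perp (logDer G y₀ w)) = Q.proj {χ i} (φ y₀ w) := by
      change _ = Q.proj {χ i} (Q.proj Q.Z (Q.perp (logDer G y₀ w)))
      rw [Q.proj_proj, Set.inter_eq_left.mpr (Set.singleton_subset_iff.mpr (hχ i))]
    rw [h1, eq_smul_single w, map_add, map_smul, map_smul, hz0.2.2, ← Complex.coe_smul,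
      ← Complex.coe_smul, map_add, map_smul, map_smul, map_smul, h, smul_zero, smul_zero,
      smul_zero, add_zero]
  obtain ⟨θ, hθ⟩ := exists_closed_form hmodel (hz.mono fun y hy =>
    ⟨hy.1.differentiableAt two_ne_zero, hy.2.2⟩) hn hχ hsum hne
  obtain ⟨F, hF, hFd⟩ := exists_primitive (θ := θ) (z := z) (by
    filter_upwards [hz, hθ] with y h1 h2
    exact ⟨h2.2.1, h1.1.differentiableAt two_ne_zero, h2.2.2.1⟩) hθ.self_of_nhds.1 hz0.2.1
  have hflat : ∀ᶠ y in 𝓝 y₀, IsFlatAt f (prodNormSq χ) (fun m' => F (extChartAt (𝓡 2) m m'))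
      ((extChartAt (𝓡 2) m).symm y) := by
    filter_upwards [hG.eventually_nhds, hz, hθ, hFd] with y hy hyz hyθ hyF
    obtain ⟨hyt, hyG, hyd, hmc, hperp, hmod⟩ := hy.self_of_nhds
    have hcc : extChartAt (𝓡 2) m ((extChartAt (𝓡 2) m).symm y) = y :=
      (extChartAt (𝓡 2) m).right_inv hyt
    have hcd : MDifferentiableAt (𝓡 2) 𝓘(ℝ, EuclideanSpace ℝ (Fin 2)) (extChartAt (𝓡 2) m)
        ((extChartAt (𝓡 2) m).symm y) :=
      (contMDiffAt_extChartAt' (n := ∞) (by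
        rw [← extChartAt_source (𝓡 2)]
        exact (extChartAt (𝓡 2) m).map_target hyt)).mdifferentiableAt (by simp)
    have hFm : MDifferentiableAt (𝓡 2) 𝓘(ℝ, ℂ) (fun m' => F (extChartAt (𝓡 2) m m'))
        ((extChartAt (𝓡 2) m).symm y) := by
      refine MDifferentiableAt.comp (g := F) _ ?_ hcd
      rw [hcc]
      exact hyF.differentiableAt.mdifferentiableAt
    refine (isFlatAt_iff_param hf.smooth (fun t ht v => prodNormSq_torus χ ht v)
      (mdifferentiableAt_chart_symm m hyt)
      (fun u hu => paramDeriv_chart_symm_injective m hyt hu) (hyd.differentiableAt (by simp))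
      (hy.mono fun y hy => hy.2.1) hFm).mpr ?_
    have hd : fderiv ℝ (fun y => F (extChartAt (𝓡 2) m ((extChartAt (𝓡 2) m).symm y))) y =
        conformalForm (θ y) (z y) := by
      refine (hyF.congr_of_eventuallyEq ?_).fderiv
      filter_upwards [hy] with y' hy'
      rw [(extChartAt (𝓡 2) m).right_inv hy'.1]
    refine ⟨(θ y)⁻¹ • φ y (EuclideanSpace.single 0 1), ?_, fun w => ?_⟩
    · rw [prodNormSq_smul, hyθ.2.2.2, norm_inv, ← mul_pow,
        inv_mul_cancel₀ (norm_ne_zero_iff.mpr hyθ.1), one_pow]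
    · rw [hd, conformalForm_apply]
      change φ y w = _
      conv_lhs => rw [eq_smul_single w]
      rw [map_add, map_smul, map_smul, hyz.2.2, smul_smul, add_mul, Complex.real_smul,
        Complex.real_smul, mul_assoc, mul_assoc, mul_assoc, mul_inv_cancel₀ hyθ.1, add_smul,
        mul_one, mul_one, mul_smul, Complex.coe_smul, Complex.coe_smul]
  have hflat' : ∀ᶠ m' in 𝓝 m,
      IsFlatAt f (prodNormSq χ) (fun m' => F (extChartAt (𝓡 2) m m')) m' :=
    eventually_of_chart hflat
  obtain ⟨S, hS, hSo, hmS⟩ := mem_nhds_iff.mp hflat'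
  refine ⟨((chartAt (EuclideanSpace ℝ (Fin 2)) m).trans F).restrOpen S hSo,
    ⟨⟨mem_chart_source _ m, ?_⟩, hmS⟩, fun m' hm' => hS hm'.2⟩
  exact hF

/-- The component of a closed cyclic surface of genus greater than one along the longest root
vanishes at some point; otherwise the surface would be flat. -/
theorem exists_longest_eq_zero [T2Space M] [ConnectedSpace M] {Γ : Type*} [Group Γ]
    [MulAction Γ M] (hΓ : IsDeckGroup Γ M) (hgenus : 1 < genus Γ) {δ : Γ →* adjointGroup L}
    (hf : IsCyclic f) (hfδ : ∀ (γ : Γ) (m : M), f (γ • m) = δ γ • f m) {β : Q.h → ℂ}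
    (hβ : Q.IsSimpleRoot β) :
    ∃ p, ∀ η, Q.IsLongestRoot η → ∀ u, Q.omegaRoot η (f p) (tmap f p u) = 0 := by
  by_contra! hcon
  obtain ⟨p₀⟩ := (inferInstance : Nonempty M)
  obtain ⟨η, hη, -⟩ := hcon p₀
  obtain ⟨n, χ, hn, hχ, hsum⟩ := Q.exists_sum_eq_zero hη
  have hχZ : ∀ i, χ i ∈ Q.Z := fun i => by
    rcases hχ i with h | h
    · rw [h]
      change -η ∈ Q.Zdag
      exact Or.inr (by rw [neg_neg]; exact hη)
    · exact Or.inl h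
  have h0 : ∀ (m : M) (i : Fin n), ∃ u, Q.omegaRoot (χ i) (f m) (tmap f m u) ≠ 0 := by
    intro m i
    rcases hχ i with h | h
    · obtain ⟨η', hη', u, hu⟩ := hcon m
      exact ⟨u, by rw [h, PositiveSystem.IsLongestRoot.unique Q.toPositiveSystem hη hη']; exact hu⟩
    · obtain ⟨g, hg, -⟩ := frame_spec (f m)
      obtain ⟨b, hb⟩ := exists_derivative hf.smooth m g
      have hφ : ∀ u : EuclideanSpace ℝ (Fin 2), (Q.projL Q.Z ∘L b) u =
          Q.proj Q.Z (g.1.symm (mc (f m) (tmap f m u))) := fun u => by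
        rw [hb, LinearEquiv.symm_apply_apply]; rfl
      refine ⟨(EuclideanSpace.single 0 1 : EuclideanSpace ℝ (Fin 2)), fun h1 => ?_⟩
      rw [omegaRoot, mcPart_eq hg, LinearEquiv.map_eq_zero_iff] at h1
      refine (hf.isCyclicPoint hg hφ).1.ne _ h _ single_zero_ne ?_
      rw [hφ, neg_neg, Q.proj_proj,
        Set.inter_eq_left.mpr (Set.singleton_subset_iff.mpr (hχZ i)), h1]
  have hk : 2 * n ≠ 0 := by omega
  have hNs := prodNormSq_smul χ
  have hcs : ContinuousConstSMul Γ M := ⟨fun γ => (hΓ.smooth γ).continuous⟩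
  have hflat := isFlatStructure_of_atlas (Γ := Γ)
    (A := {e : OpenPartialHomeomorph M ℂ | ∀ m ∈ e.source, IsFlatAt f (prodNormSq χ) e m})
    (fun p => by
      obtain ⟨e, h1, h2⟩ := exists_isFlatAt hf hβ hn hχZ hsum p (h0 p)
      exact ⟨e, h2, h1⟩)
    (fun e he a b _ ha m hm => (he m hm).affine hNs ha b)
    (fun e he γ m hm => by
      have h1 := (he (γ⁻¹ • m) hm).smul hΓ hf hfδ (fun t ht v => prodNormSq_torus χ ht v) γ
      rwa [smul_inv_smul] at h1)
    (fun e he e' he' m hm hm' => eventually_eq_of_isFlatAt hf hβ hk hNs he he' hm hm')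
  have := hΓ.proper
  have hrank := hflat.finrank_abelianization_le hΓ.free hΓ.cocompact
  rw [genus] at hgenus
  omega

end HKQuadruple

end CyclicSurface

theorem mainTheorem8
    {L : Type*} [LieRing L] [LieAlgebra ℂ L] [Module.Finite ℂ L] [LieAlgebra.IsSimple ℂ L]
    (Q : CyclicSurface.HKQuadruple L)
    {M : Type*} [TopologicalSpace M] [T2Space M] [SecondCountableTopology M]
    [ChartedSpace (EuclideanSpace ℝ (Fin 2)) M] [IsManifold (𝓡 2) ∞ M] [SimplyConnectedSpace M]
    {Γ : Type*} [Group Γ] [MulAction Γ M]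
    (hΓ : CyclicSurface.IsDeckGroup Γ M) (hgenus : 1 < CyclicSurface.genus Γ)
    (δ : Γ →* CyclicSurface.adjointGroup L)
    (f : M → Q.X) (hf : CyclicSurface.HKQuadruple.IsCyclic f)
    (hfδ : ∀ (γ : Γ) (m : M), f (γ • m) = δ γ • f m)
    (ξ : ∀ m, CyclicSurface.HKQuadruple.Tan (f m))
    (hξ : CyclicSurface.HKQuadruple.IsInfDeformation f ξ)
    (hξδ : ∀ (γ : Γ) (m : M), CyclicSurface.HKQuadruple.mc (f (γ • m)) (ξ (γ • m)) =
      (δ γ).1 (CyclicSurface.HKQuadruple.mc (f m) (ξ m)))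
    (α : Q.h → ℂ) (hα : Q.IsSimpleRoot α) (hξα : ∀ m, Q.omegaRoot α (f m) (ξ m) = 0) :
    ∀ m, ξ m = 0 := by
  intro m
  have : ConnectedSpace M := inferInstance
  obtain ⟨p, hp⟩ := CyclicSurface.HKQuadruple.exists_longest_eq_zero hΓ hgenus hf hfδ hα
  exact CyclicSurface.HKQuadruple.eq_zero_of_exists_zero hΓ hf hfδ hξ hξδ hα hξα hp m
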